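/- **Definitions.** A *simple orthogonal polygon* $P$ with $n$ vertices is the closed bounded region of the plane whose boundary is a simple closed polygonal chain with $n$ axis-parallel edges that are alternately horizontal and vertical (so every interior angle is $90^\circ$ or $270^\circ$); it is given by the coordinates of its vertices in boundary order. Two points $p,q$ *see each other* in $P$ if the segment $pq$ is contained in $P$. A *hidden set* is a set of points of $P$ no two distinct ones of which see each other, and $hs(P)$ is the largest cardinality of a hidden set. A *convex cover* of $P$ is a set of convex polygons whose union is $P$, and $cc(P)$ is the smallest cardinality of a convex cover. The *extension* of a horizontal edge is the maximal horizontal segment in $P$ that contains it; two horizontal edges have the same extension if and only if they are collinear and see each other, i.e. the segment joining them lies in $P$. A horizontal edge is a *top edge* (a *bottom edge*) if it bounds $P$ from above (from below). **Theorem.** (1) There is an algorithm on the real RAM (unit-cost exact arithmetic and comparisons on real numbers) which, for every simple orthogonal polygon $P$ with $n$ vertices, finds in time $O(n\log n)$ both a convex cover $\mathcal C$ of $P$ consisting of axis-parallel rectangles with $|\mathcal C|\le 2\,cc(P)$ and a hidden set $H$ of $P$ with $|H|\ge \tfrac12\,hs(P)$. (2) Let $P$ be a simple orthogonal polygon. The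 extensions of all horizontal edges partition $P$ into axis-parallel rectangles (with union $P$ and pairwise disjoint interiors). Let $p$ be the number of these rectangles. Then $p\le g-1$, where $g$ is the number of horizontal edges when edges that are collinear and see each other are counted once; also $p\le e-1$, where $e$ is the number of top edges plus the number of bottom edges, where within the top edges, and within the bottom edges, edges that are collinear and see each other are counted once; and $p\le 2\,hs(P)-1$. (3) Let $P$ be a simple orthogonal polygon. If $T$ is a set of top edges of $P$ no two of which are collinear and see each other, then the midpoints of the edges in $T$ form a hidden set of $P$. The same holds for bottom edges. -/

import Mathlib

open Set Filter Topology

/-! ## Visibility, hidden sets, convex covers -/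

/-- Points of the coordinate plane; the first coordinate is horizontal, the second one vertical. -/
abbrev Plane : Type := ℝ × ℝ

/-- Two points see each other in `P` if the segment that joins them is contained in `P`. -/
def Sees (P : Set Plane) (p q : Plane) : Prop := segment ℝ p q ⊆ P

/-- A hidden set: points of `P`, no two distinct ones of which see each other. -/
def IsHiddenSet (P H : Set Plane) : Prop :=
  H ⊆ P ∧ H.Pairwise fun p q => ¬ Sees P p q

/-- The hidden set number `hs(P)`: the largest cardinality of a hidden set. -/
noncomputable def hiddenSetNumber (P : Set Plane) : ℕ∞ :=
  ⨆ (H : Set Plane) (_ : IsHiddenSet P H), H.encard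

/-- A convex polygon (as a region): the convex hull of finitely many points,
with nonempty interior. -/
def IsConvexPolygon (K : Set Plane) : Prop :=
  (∃ S : Set Plane, S.Finite ∧ K = convexHull ℝ S) ∧ (interior K).Nonempty

/-- A convex cover of `P`: a set of convex polygons whose union is equal to `P`. -/
def IsConvexCover (P : Set Plane) (C : Set (Set Plane)) : Prop :=
  (∀ K ∈ C, IsConvexPolygon K) ∧ ⋃₀ C = P

/-- The convex cover number `cc(P)`: the smallest cardinality of a convex cover. -/
noncomputable def convexCoverNumber (P : Set Plane) : ℕ∞ :=
  ⨅ (C : Set (Set Plane)) (_ : IsConvexCover P C), C.encard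

/-- A 2-approximate (minimum) convex cover. -/
def IsTwoApproxConvexCover (P : Set Plane) (C : Set (Set Plane)) : Prop :=
  IsConvexCover P C ∧ C.encard ≤ 2 * convexCoverNumber P

/-- A 1/2-approximate (maximum) hidden set. -/
def IsHalfApproxHiddenSet (P H : Set Plane) : Prop :=
  IsHiddenSet P H ∧ hiddenSetNumber P ≤ 2 * H.encard

/-- A nondegenerate closed axis-parallel rectangle `[x₁, x₂] × [y₁, y₂]`. -/
def IsAxisRectangle (K : Set Plane) : Prop :=
  ∃ x₁ x₂ y₁ y₂ : ℝ, x₁ < x₂ ∧ y₁ < y₂ ∧ K = Icc x₁ x₂ ×ˢ Icc y₁ y₂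

/-! ## Simple orthogonal polygons -/

/-- The closed polygonal chain `v` is simple: the vertices are distinct, two consecutive edges
share only their common vertex, and any two other edges are disjoint. -/
structure IsSimpleChain {n : ℕ} (v : Polygon Plane n) : Prop where
  three_le : 3 ≤ n
  injective : Function.Injective v.vertices
  consecutive : ∀ i, v.edgeSet ℝ i ∩ v.edgeSet ℝ (finRotate n i) = {v (finRotate n i)}
  disjoint : ∀ i j, i ≠ j → j ≠ finRotate n i → i ≠ finRotate n j →
    Disjoint (v.edgeSet ℝ i) (v.edgeSet ℝ j)

/-- The edge from vertex `i` to the next vertex is horizontal. -/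
def IsHorizontalEdge {n : ℕ} (v : Polygon Plane n) (i : Fin n) : Prop :=
  (v i).2 = (v (finRotate n i)).2

/-- The edge from vertex `i` to the next vertex is vertical. -/
def IsVerticalEdge {n : ℕ} (v : Polygon Plane n) (i : Fin n) : Prop :=
  (v i).1 = (v (finRotate n i)).1

/-- `P` is the simple orthogonal polygon with the vertices `v`, listed along its boundary (in either
direction, from any starting vertex): `P` is the closed bounded region whose boundary is the simple
closed chain `v`, and of any two consecutive edges one is horizontal and the other vertical,
so that every interior angle is `90°` or `270°`. -/
structure IsSimpleOrthogonalPolygon {n : ℕ} (v : Polygon Plane n) (P : Set Plane) : Prop where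
  simple : IsSimpleChain v
  orthogonal : ∀ i, IsHorizontalEdge v i ∧ IsVerticalEdge v (finRotate n i) ∨
    IsVerticalEdge v i ∧ IsHorizontalEdge v (finRotate n i)
  isCompact : IsCompact P
  closure_interior : closure (interior P) = P
  frontier_eq : frontier P = v.boundary ℝ

/-- The midpoint of an edge. -/
noncomputable def edgeMidpoint {n : ℕ} (v : Polygon Plane n) (i : Fin n) : Plane :=
  midpoint ℝ (v i) (v (finRotate n i))

/-- A top edge bounds `P` from above: it is horizontal and the points just above its midpoint
are outside of `P`. -/
def IsTopEdge {n : ℕ} (v : Polygon Plane n) (P : Set Plane) (i : Fin n) : Prop :=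
  IsHorizontalEdge v i ∧ ∀ᶠ ε : ℝ in 𝓝[>] 0, edgeMidpoint v i + (0, ε) ∉ P

/-- A bottom edge bounds `P` from below: it is horizontal and the points just below its midpoint
are outside of `P`. -/
def IsBottomEdge {n : ℕ} (v : Polygon Plane n) (P : Set Plane) (i : Fin n) : Prop :=
  IsHorizontalEdge v i ∧ ∀ᶠ ε : ℝ in 𝓝[>] 0, edgeMidpoint v i - (0, ε) ∉ P

/-- The extension of a horizontal edge: the maximal horizontal segment of `P` that contains it,
i.e. all points at the height of the edge that see some point of the edge.
Two horizontal edges have the same extension iff they are collinear and see each other. -/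
def edgeExtension {n : ℕ} (v : Polygon Plane n) (P : Set Plane) (i : Fin n) : Set Plane :=
  {x | x.2 = (v i).2 ∧ ∃ q ∈ v.edgeSet ℝ i, Sees P x q}

/-- The number of edges in `E` when collinear edges that see each other are counted once. -/
noncomputable def noncollinearCount {n : ℕ} (v : Polygon Plane n) (P : Set Plane)
    (E : Set (Fin n)) : ℕ :=
  (edgeExtension v P '' E).ncard

/-- The interior of `P` without the extensions of all horizontal edges. -/
def cutInterior {n : ℕ} (v : Polygon Plane n) (P : Set Plane) : Set Plane :=
  interior P \ ⋃ i ∈ {i | IsHorizontalEdge v i}, edgeExtension v P i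

/-- The pieces into which `P` is cut by the extensions of all horizontal edges: the closures of the
connected components of what remains of the interior. -/
def horizontalPieces {n : ℕ} (v : Polygon Plane n) (P : Set Plane) : Set (Set Plane) :=
  (fun x => closure (connectedComponentIn (cutInterior v P) x)) '' cutInterior v P

/-- `C` is a partition of `P` into axis-parallel rectangles: they have union `P` and
pairwise disjoint interiors. -/
def IsRectanglePartition (P : Set Plane) (C : Set (Set Plane)) : Prop :=
  (∀ K ∈ C, IsAxisRectangle K) ∧ ⋃₀ C = P ∧
    C.Pairwise fun K L => Disjoint (interior K) (interior L)

/-! ## The real RAM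

A program works on finitely many arrays of natural numbers (used for indices, counters, pointers)
and finitely many arrays of real numbers. Arrays are named by numbers that are fixed in the program,
their entries are addressed by computed natural numbers. Exact arithmetic and comparison of reals,
addition, truncated subtraction and halving of natural numbers, and memory access take unit time.
There is no conversion from reals to natural numbers. -/

namespace RealRAM

/-- Memory contents: `s.nat a i` and `s.real a i` are the entries of index `i` of the array of
natural numbers, respectively real numbers, with name `a`. -/
structure Store where
  nat : ℕ → ℕ → ℕ
  real : ℕ → ℕ → ℝ

/-- Expressions for natural numbers. -/
inductive NatExpr where
  | const (k : ℕ)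
  | read (a : ℕ) (i : NatExpr)
  | add (e f : NatExpr)
  | sub (e f : NatExpr)
  | half (e : NatExpr)

namespace NatExpr

/-- The value of an expression. -/
def eval (s : Store) : NatExpr → ℕ
  | const k => k
  | read a i => s.nat a (i.eval s)
  | add e f => e.eval s + f.eval s
  | sub e f => e.eval s - f.eval s
  | half e => e.eval s / 2

/-- The time for evaluating an expression: one unit per operation. -/
def cost : NatExpr → ℕ
  | const _ => 1
  | read _ i => i.cost + 1
  | add e f => e.cost + f.cost + 1
  | sub e f => e.cost + f.cost + 1
  | half e => e.cost + 1

end NatExpr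

/-- Expressions for real numbers. -/
inductive RealExpr where
  | const (k : ℕ)
  | read (a : ℕ) (i : NatExpr)
  | add (e f : RealExpr)
  | sub (e f : RealExpr)
  | mul (e f : RealExpr)
  | div (e f : RealExpr)

namespace RealExpr

/-- The value of an expression. -/
noncomputable def eval (s : Store) : RealExpr → ℝ
  | const k => k
  | read a i => s.real a (i.eval s)
  | add e f => e.eval s + f.eval s
  | sub e f => e.eval s - f.eval s
  | mul e f => e.eval s * f.eval s
  | div e f => e.eval s / f.eval s

/-- The time for evaluating an expression: one unit per operation. -/
def cost : RealExpr → ℕ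
  | const _ => 1
  | read _ i => i.cost + 1
  | add e f => e.cost + f.cost + 1
  | sub e f => e.cost + f.cost + 1
  | mul e f => e.cost + f.cost + 1
  | div e f => e.cost + f.cost + 1

end RealExpr

/-- Tests. -/
inductive Test where
  | natLt (e f : NatExpr)
  | natEq (e f : NatExpr)
  | realLt (e f : RealExpr)
  | realEq (e f : RealExpr)
  | not (b : Test)
  | and (b c : Test)

namespace Test

/-- Whether a test succeeds. -/
def Holds (s : Store) : Test → Prop
  | natLt e f => e.eval s < f.eval s
  | natEq e f => e.eval s = f.eval s
  | realLt e f => e.eval s < f.eval s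
  | realEq e f => e.eval s = f.eval s
  | not b => ¬ b.Holds s
  | and b c => b.Holds s ∧ c.Holds s

/-- The time for a test: one unit per operation. -/
def cost : Test → ℕ
  | natLt e f => e.cost + f.cost + 1
  | natEq e f => e.cost + f.cost + 1
  | realLt e f => e.cost + f.cost + 1
  | realEq e f => e.cost + f.cost + 1
  | not b => b.cost + 1
  | and b c => b.cost + c.cost + 1

end Test

namespace Store

/-- Overwrite one entry of an array of natural numbers. -/
def setNat (s : Store) (a i k : ℕ) : Store :=
  { s with nat := Function.update s.nat a (Function.update (s.nat a) i k) }

/-- Overwrite one entry of an array of real numbers. -/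
noncomputable def setReal (s : Store) (a i : ℕ) (x : ℝ) : Store :=
  { s with real := Function.update s.real a (Function.update (s.real a) i x) }

end Store

/-- Programs. -/
inductive Program where
  | skip
  | writeNat (a : ℕ) (i e : NatExpr)
  | writeReal (a : ℕ) (i : NatExpr) (e : RealExpr)
  | seq (p q : Program)
  | ite (b : Test) (p q : Program)
  | while (b : Test) (p : Program)

/-- `Runs p s t s'`: started with memory `s`, the program `p` halts after `t` time units
with memory `s'`. -/
inductive Runs : Program → Store → ℕ → Store → Prop where
  | skip (s : Store) : Runs .skip s 1 s
  | writeNat (s : Store) (a : ℕ) (i e : NatExpr) :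
      Runs (.writeNat a i e) s (i.cost + e.cost + 1) (s.setNat a (i.eval s) (e.eval s))
  | writeReal (s : Store) (a : ℕ) (i : NatExpr) (e : RealExpr) :
      Runs (.writeReal a i e) s (i.cost + e.cost + 1) (s.setReal a (i.eval s) (e.eval s))
  | seq {p q : Program} {s₁ s₂ s₃ : Store} {t u : ℕ} :
      Runs p s₁ t s₂ → Runs q s₂ u s₃ → Runs (.seq p q) s₁ (t + u) s₃
  | iteTrue {b : Test} {p : Program} (q : Program) {s₁ s₂ : Store} {t : ℕ} :
      b.Holds s₁ → Runs p s₁ t s₂ → Runs (.ite b p q) s₁ (b.cost + t + 1) s₂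
  | iteFalse {b : Test} (p : Program) {q : Program} {s₁ s₂ : Store} {t : ℕ} :
      ¬ b.Holds s₁ → Runs q s₁ t s₂ → Runs (.ite b p q) s₁ (b.cost + t + 1) s₂
  | whileTrue {b : Test} {p : Program} {s₁ s₂ s₃ : Store} {t u : ℕ} :
      b.Holds s₁ → Runs p s₁ t s₂ → Runs (.while b p) s₂ u s₃ →
      Runs (.while b p) s₁ (b.cost + t + u + 1) s₃
  | whileFalse {b : Test} (p : Program) {s : Store} :
      ¬ b.Holds s → Runs (.while b p) s (b.cost + 1) s

/-- The input: `n` is the entry of index `0` of the natural-number array `0`, the coordinates of the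
vertices are in the real arrays `0` and `1`, and all other memory is `0`. -/
noncomputable def input {n : ℕ} (v : Polygon Plane n) : Store where
  nat a i := if a = 0 ∧ i = 0 then n else 0
  real a i := if h : i < n then
      if a = 0 then (v ⟨i, h⟩).1 else if a = 1 then (v ⟨i, h⟩).2 else 0
    else 0

/-- The list of rectangles that a halting program leaves in memory: their number is the entry of
index `0` of the natural-number array `1`, and rectangle `j` is `[x₁, x₂] × [y₁, y₂]` with `x₁`,
`x₂`, `y₁`, `y₂` the entries of index `j` of the real arrays `2`, `3`, `4`, `5`. -/
def outputRectangles (s : Store) : Set (Set Plane) :=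
  (fun j => Icc (s.real 2 j) (s.real 3 j) ×ˢ Icc (s.real 4 j) (s.real 5 j)) '' Iio (s.nat 1 0)

/-- The list of points that a halting program leaves in memory: their number is the entry of
index `1` of the natural-number array `1`, and the coordinates of point `j` are the entries of
index `j` of the real arrays `6` and `7`. -/
def outputPoints (s : Store) : Set Plane :=
  (fun j => (s.real 6 j, s.real 7 j)) '' Iio (s.nat 1 1)

end RealRAM

set_option linter.unusedSectionVars false

/-! ## Orthogonal polygons given by two cyclic sequences of coordinates -/

/-! Everything rests on one inequality: the rectangles cut out by the extensions of horizontal edges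
are fewer than the extensions. Take the extensions as the vertices of a graph in which every
rectangle joins the extension along its bottom to the extension along its top. This graph has no
cycle. Indeed, a horizontal chord at half the height of a rectangle joins two vertical edges. A
boundary arc between these edges and the chord form a closed chain, and the parity of the crossings
of an upward ray with this chain (`chainParity`) is locally constant in `P` off the chord but
changes across it. So each rectangle has a potential with values in `ZMod 2` on the extensions that
differs at the two ends of this rectangle and agrees at the two ends of every other one
(`exists_potential`). The linear map that sends a function on the extensions to its differences
along the rectangles is therefore onto, and it kills the constants; comparing dimensions gives the
inequality (`ncard_pieces_lt`). The topology needed is modest: a connected set that avoids the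
boundary is inside or outside (`subset_interior_or_disjoint`), and near a boundary point exactly one
of the two local sides is inside (`local_dichotomy`).

The midpoint of a top edge sees nothing above it, and two midpoints at the same height that see each
other belong to edges with equal extensions. So one top edge per extension yields a hidden set, and
likewise for bottom edges. Since every horizontal edge is a top or a bottom edge, the number p of
rectangles satisfies p + 1 ≤ #top + #bottom ≤ 2 hs(P). A convex polygon inside `P` contains at most
one point of a hidden set, so hs(P) ≤ cc(P). This makes the rectangles a 2-approximate cover.
Conversely hs(P) ≤ cc(P) ≤ p < #top + #bottom, so the larger of the two families of midpoints has at
least half of the maximal size.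

The algorithm sweeps upwards over the horizontal edges, from left to right at equal heights. A
vertical edge is active while exactly one of its ends has been processed. The active edges form a
linked list ordered by abscissa; each gap to the right of an active edge stores whether it is inside
`P` (the parity of the active edges up to there) and the greatest height of a processed edge
touching it. An event affects only the gaps at three positions: those of the two neighbours of the
edge, and that of the active predecessor of the left neighbour. This is `SweepInv.step`. A gap that
is inside and whose stored height is below the event is a rectangle (`SweepInv.isPiece`), and each
rectangle is found at the first event on its top side (`SweepInv.reports`). The same data decide
whether the edge is a top edge (`SweepInv.isTopH_iff`) and whether it shares its extension with the
preceding edge (`SweepInv.linked_iff`); edges with a common extension are consecutive in the sweep,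
so this comparison suffices to select one midpoint per extension.

Sorting uses a tournament tree and predecessors are found in a tree of maxima. Both trees have depth
logarithmic in the number of edges, so each operation takes logarithmic time and the total is O(n
log n). -/

/-- The horizontal edge `k`. -/
def hEdge {m : ℕ} (X Y : ZMod m → ℝ) (k : ZMod m) : Set Plane :=
  uIcc (X (k - 1)) (X k) ×ˢ {Y k}

/-- The vertical edge `k`. -/
def vEdge {m : ℕ} (X Y : ZMod m → ℝ) (k : ZMod m) : Set Plane :=
  {X k} ×ˢ uIcc (Y k) (Y (k + 1))

/-- The boundary of the orthogonal polygon with coordinate sequences `X` and `Y`. -/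
def edgeUnion {m : ℕ} (X Y : ZMod m → ℝ) : Set Plane :=
  (⋃ k, hEdge X Y k) ∪ ⋃ k, vEdge X Y k

/-- `P` is the simple orthogonal polygon whose vertical edges have the `x`-coordinates `X k`, and
whose horizontal edges have the `y`-coordinates `Y k`, in the cyclic order
`Y 0, X 0, Y 1, X 1, …`. -/
structure IsCyclicPolygon {m : ℕ} (X Y : ZMod m → ℝ) (P : Set Plane) : Prop where
  two_le : 2 ≤ m
  X_ne : ∀ k, X (k - 1) ≠ X k
  Y_ne : ∀ k, Y k ≠ Y (k + 1)
  h_disjoint : ∀ k l, k ≠ l → Disjoint (hEdge X Y k) (hEdge X Y l)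
  v_disjoint : ∀ k l, k ≠ l → Disjoint (vEdge X Y k) (vEdge X Y l)
  hv_disjoint : ∀ k l, l ≠ k → l ≠ k - 1 → Disjoint (hEdge X Y k) (vEdge X Y l)
  isCompact : IsCompact P
  closure_interior : closure (interior P) = P
  frontier_eq : frontier P = edgeUnion X Y

theorem mem_hEdge {m : ℕ} {X Y : ZMod m → ℝ} {k : ZMod m} {x y : ℝ} :
    (x, y) ∈ hEdge X Y k ↔ x ∈ uIcc (X (k - 1)) (X k) ∧ y = Y k := by
  simp [hEdge]

theorem mem_vEdge {m : ℕ} {X Y : ZMod m → ℝ} {k : ZMod m} {x y : ℝ} :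
    (x, y) ∈ vEdge X Y k ↔ x = X k ∧ y ∈ uIcc (Y k) (Y (k + 1)) := by
  simp [vEdge]

theorem mem_edgeUnion {m : ℕ} {X Y : ZMod m → ℝ} {z : Plane} :
    z ∈ edgeUnion X Y ↔ (∃ k, z ∈ hEdge X Y k) ∨ ∃ k, z ∈ vEdge X Y k := by
  simp [edgeUnion]

theorem isClosed_hEdge {m : ℕ} (X Y : ZMod m → ℝ) (k : ZMod m) : IsClosed (hEdge X Y k) :=
  isCompact_uIcc.isClosed.prod isClosed_singleton

theorem isClosed_vEdge {m : ℕ} (X Y : ZMod m → ℝ) (k : ZMod m) : IsClosed (vEdge X Y k) :=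
  isClosed_singleton.prod isCompact_uIcc.isClosed

theorem hEdge_swap {m : ℕ} (X Y : ZMod m → ℝ) (k : ZMod m) :
    hEdge (fun k => Y (k + 1)) X k = Prod.swap ⁻¹' vEdge X Y k := by
  ext ⟨x, y⟩
  simp [hEdge, vEdge]

theorem vEdge_swap {m : ℕ} (X Y : ZMod m → ℝ) (k : ZMod m) :
    vEdge (fun k => Y (k + 1)) X k = Prod.swap ⁻¹' hEdge X Y (k + 1) := by
  ext ⟨x, y⟩
  simp [hEdge, vEdge]

theorem exists_box_subset {W : Set Plane} (hW : IsOpen W) {x₀ y₀ : ℝ} (h : (x₀, y₀) ∈ W) :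
    ∃ ε > 0, ∀ x y, |x - x₀| < ε → |y - y₀| < ε → (x, y) ∈ W := by
  obtain ⟨ε, hε, hb⟩ := Metric.isOpen_iff.1 hW _ h
  refine ⟨ε, hε, fun x y hx hy => hb ?_⟩
  simp [Metric.mem_ball, Prod.dist_eq, Real.dist_eq, hx, hy]

/-! ### Symmetry, and the local structure of `P` at its boundary -/

namespace IsCyclicPolygon

/-- Reading the cyclic order from `X 0` on, as `X 0, Y 1, X 1, …`, exchanges the roles of the
coordinates; hence the shift of `Y` by one. Facts on vertical edges carry over to horizontal edges
in this way. -/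
theorem swap {m : ℕ} {X Y : ZMod m → ℝ} {P : Set Plane} (hP : IsCyclicPolygon X Y P) :
    IsCyclicPolygon (fun k => Y (k + 1)) X (Prod.swap ⁻¹' P) := by
  have hinj : Function.Surjective (Prod.swap : Plane → Plane) := Prod.swap_surjective
  have e : ∀ S : Set Plane, Prod.swap ⁻¹' S = (Homeomorph.prodComm ℝ ℝ) ⁻¹' S := fun S => rfl
  refine ⟨hP.two_le, ?_, ?_, ?_, ?_, ?_, ?_, ?_, ?_⟩
  · intro k; simpa using hP.Y_ne k
  · intro k; simpa using hP.X_ne (k + 1)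
  · intro k l hkl
    rw [hEdge_swap, hEdge_swap]
    exact (hP.v_disjoint k l hkl).preimage _
  · intro k l hkl
    rw [vEdge_swap, vEdge_swap]
    exact (hP.h_disjoint _ _ (by simpa using hkl)).preimage _
  · intro k l h1 h2
    rw [hEdge_swap, vEdge_swap]
    refine ((hP.hv_disjoint (l + 1) k ?_ ?_).preimage _).symm
    · rintro rfl; simp at h2
    · rintro rfl; simp at h1
  · rw [e]; exact (Homeomorph.prodComm ℝ ℝ).isCompact_preimage.2 hP.isCompact
  · rw [e, ← Homeomorph.preimage_interior, ← Homeomorph.preimage_closure, hP.closure_interior]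
  · rw [e, ← Homeomorph.preimage_frontier, hP.frontier_eq]
    ext ⟨x, y⟩
    have h1 : ∀ k, hEdge X Y k = hEdge X Y ((k - 1) + 1) := fun k => by simp
    simp only [mem_preimage, mem_edgeUnion, hEdge_swap, vEdge_swap]
    rw [or_comm]
    refine or_congr Iff.rfl ⟨fun ⟨k, hk⟩ => ⟨k - 1, ?_⟩, fun ⟨k, hk⟩ => ⟨k + 1, hk⟩⟩
    rw [← h1]; exact hk

variable {m : ℕ} {X Y : ZMod m → ℝ} {P : Set Plane}

theorem isClosed (hP : IsCyclicPolygon X Y P) : IsClosed P := hP.isCompact.isClosed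

theorem edgeUnion_subset (hP : IsCyclicPolygon X Y P) : edgeUnion X Y ⊆ P :=
  hP.frontier_eq ▸ hP.isClosed.frontier_subset

theorem hEdge_subset (hP : IsCyclicPolygon X Y P) (k : ZMod m) : hEdge X Y k ⊆ P :=
  fun _ h => hP.edgeUnion_subset (mem_edgeUnion.2 (Or.inl ⟨k, h⟩))

theorem vEdge_subset (hP : IsCyclicPolygon X Y P) (k : ZMod m) : vEdge X Y k ⊆ P :=
  fun _ h => hP.edgeUnion_subset (mem_edgeUnion.2 (Or.inr ⟨k, h⟩))

theorem mem_interior (hP : IsCyclicPolygon X Y P) {z : Plane} :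
    z ∈ interior P ↔ z ∈ P ∧ z ∉ edgeUnion X Y := by
  rw [← hP.frontier_eq, hP.isClosed.frontier_eq]
  constructor
  · intro h; exact ⟨interior_subset h, fun h' => h'.2 h⟩
  · rintro ⟨h1, h2⟩; by_contra h; exact h2 ⟨h1, h⟩

/-- The trace of `P` on a set avoiding the frontier is both relatively open and relatively closed.
All decisions between inside and outside go through this lemma. -/
theorem subset_interior_or_disjoint (hP : IsCyclicPolygon X Y P) {S : Set Plane}
    (hS : IsPreconnected S) (hd : Disjoint S (edgeUnion X Y)) :
    S ⊆ interior P ∨ Disjoint S P := by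
  by_cases h : (S ∩ P).Nonempty
  · left
    have h1 : S ∩ closure P ⊆ interior P := fun z hz =>
      hP.mem_interior.2 ⟨hP.isClosed.closure_eq ▸ hz.2, disjoint_left.1 hd hz.1⟩
    obtain ⟨z, hz⟩ := h
    refine hS.subset_of_closure_inter_subset isOpen_interior
      ⟨z, hz.1, h1 ⟨hz.1, subset_closure hz.2⟩⟩ fun w hw => ?_
    exact h1 ⟨hw.2, closure_mono interior_subset hw.1⟩
  · right
    exact disjoint_iff_inter_eq_empty.2 (not_nonempty_iff_eq_empty.1 h)

/-- If both sides were inside, `U` would lie in `P` because the frontier has empty interior, and the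
boundary point `z` would be interior. If both were outside, `z` would not be a limit of interior
points, although `P` is the closure of its interior. -/
theorem local_dichotomy (hP : IsCyclicPolygon X Y P) {U C₁ C₂ : Set Plane} {z : Plane}
    (hU : IsOpen U) (hz : z ∈ U) (hzE : z ∈ edgeUnion X Y)
    (h₁ : IsPreconnected C₁) (h₂ : IsPreconnected C₂)
    (d₁ : Disjoint C₁ (edgeUnion X Y)) (d₂ : Disjoint C₂ (edgeUnion X Y))
    (hc : U \ edgeUnion X Y ⊆ C₁ ∪ C₂) :
    (C₁ ⊆ interior P ∧ Disjoint C₂ P) ∨ (Disjoint C₁ P ∧ C₂ ⊆ interior P) := by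
  rcases hP.subset_interior_or_disjoint h₁ d₁ with a | a <;>
    rcases hP.subset_interior_or_disjoint h₂ d₂ with b | b
  · exfalso
    have hd : Dense (edgeUnion X Y)ᶜ := by
      rw [← interior_eq_empty_iff_dense_compl, ← hP.frontier_eq]
      exact interior_frontier hP.isClosed
    have h3 : U ⊆ P := by
      refine (hd.open_subset_closure_inter hU).trans ?_
      refine closure_minimal ?_ hP.isClosed
      intro w hw
      rcases hc hw with h | h
      · exact interior_subset (a h)
      · exact interior_subset (b h)
    have h4 : z ∈ interior P := interior_maximal h3 hU hz
    exact (hP.mem_interior.1 h4).2 hzE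
  · exact Or.inl ⟨a, b⟩
  · exact Or.inr ⟨a, b⟩
  · exfalso
    have h3 : z ∈ closure (interior P) := by
      rw [hP.closure_interior]; exact hP.edgeUnion_subset hzE
    obtain ⟨w, hw, hw'⟩ := mem_closure_iff.1 h3 U hU hz
    rcases hc ⟨hw, (hP.mem_interior.1 hw').2⟩ with h | h
    · exact disjoint_left.1 a h (interior_subset hw')
    · exact disjoint_left.1 b h (interior_subset hw')

theorem isClosed_iUnion_hEdge (_ : IsCyclicPolygon X Y P) [NeZero m] (s : Set (ZMod m)) :
    IsClosed (⋃ k ∈ s, hEdge X Y k) :=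
  s.toFinite.isClosed_biUnion fun k _ => isClosed_hEdge X Y k

theorem isClosed_iUnion_vEdge (_ : IsCyclicPolygon X Y P) [NeZero m] (s : Set (ZMod m)) :
    IsClosed (⋃ k ∈ s, vEdge X Y k) :=
  s.toFinite.isClosed_biUnion fun k _ => isClosed_vEdge X Y k

/-- Near a point only those edges matter that contain it. -/
theorem exists_box_avoiding (hP : IsCyclicPolygon X Y P) [NeZero m] {x₀ y₀ : ℝ}
    {W : Set Plane} (hW : IsOpen W) (h : (x₀, y₀) ∈ W) :
    ∃ ε > 0, ∀ x y, |x - x₀| < ε → |y - y₀| < ε → (x, y) ∈ W ∧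
      (∀ k, (x, y) ∈ hEdge X Y k → (x₀, y₀) ∈ hEdge X Y k) ∧
      (∀ k, (x, y) ∈ vEdge X Y k → (x₀, y₀) ∈ vEdge X Y k) := by
  have c1 := hP.isClosed_iUnion_hEdge {k | (x₀, y₀) ∉ hEdge X Y k}
  have c2 := hP.isClosed_iUnion_vEdge {k | (x₀, y₀) ∉ vEdge X Y k}
  obtain ⟨ε, hε, hb⟩ := exists_box_subset (hW.inter (c1.union c2).isOpen_compl)
    (x₀ := x₀) (y₀ := y₀) ⟨h, by simp⟩
  refine ⟨ε, hε, fun x y hx hy => ?_⟩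
  obtain ⟨h1, h2⟩ := hb x y hx hy
  simp only [mem_compl_iff, mem_union, mem_iUnion, not_or, not_exists] at h2
  refine ⟨h1, fun k hk => ?_, fun k hk => ?_⟩
  · by_contra h; exact h2.1 k h hk
  · by_contra h; exact h2.2 k h hk

theorem not_mem_hEdge_of_mem_vEdge (hP : IsCyclicPolygon X Y P) {k : ZMod m} {x y : ℝ}
    (h : (x, y) ∈ vEdge X Y k) (h1 : y ≠ Y k) (h2 : y ≠ Y (k + 1)) (l : ZMod m) :
    (x, y) ∉ hEdge X Y l := by
  intro hl
  have hy := (mem_hEdge.1 hl).2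
  refine disjoint_left.1 (hP.hv_disjoint l k ?_ ?_) hl h
  · rintro rfl; exact h1 hy
  · rintro rfl; rw [sub_add_cancel] at h2; exact h2 hy

theorem eq_of_mem_vEdge (hP : IsCyclicPolygon X Y P) {k l : ZMod m} {z : Plane}
    (h : z ∈ vEdge X Y k) (h' : z ∈ vEdge X Y l) : k = l := by
  by_contra hkl; exact disjoint_left.1 (hP.v_disjoint k l hkl) h h'

theorem eq_of_mem_hEdge (hP : IsCyclicPolygon X Y P) {k l : ZMod m} {z : Plane}
    (h : z ∈ hEdge X Y k) (h' : z ∈ hEdge X Y l) : k = l := by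
  by_contra hkl; exact disjoint_left.1 (hP.h_disjoint k l hkl) h h'

theorem convex_box (x₀ y₀ ε : ℝ) : Convex ℝ {z : Plane | |z.1 - x₀| < ε ∧ |z.2 - y₀| < ε} := by
  have : {z : Plane | |z.1 - x₀| < ε ∧ |z.2 - y₀| < ε} =
      Ioo (x₀ - ε) (x₀ + ε) ×ˢ Ioo (y₀ - ε) (y₀ + ε) := by
    ext z; simp only [mem_ofPred_eq, abs_lt, mem_prod, mem_Ioo]
    constructor <;> rintro ⟨⟨_, _⟩, _, _⟩ <;> refine ⟨⟨?_, ?_⟩, ?_, ?_⟩ <;> linarith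
  rw [this]; exact (convex_Ioo _ _).prod (convex_Ioo _ _)

theorem isOpen_box (x₀ y₀ ε : ℝ) : IsOpen {z : Plane | |z.1 - x₀| < ε ∧ |z.2 - y₀| < ε} := by
  have h1 : Continuous fun z : Plane => |z.1 - x₀| := by fun_prop
  have h2 : Continuous fun z : Plane => |z.2 - y₀| := by fun_prop
  exact (isOpen_lt h1 continuous_const).inter (isOpen_lt h2 continuous_const)

/-- Locally, `P` lies on exactly one side of a vertical edge. -/
theorem vEdge_side (hP : IsCyclicPolygon X Y P) [NeZero m] {k : ZMod m} {y₀ : ℝ}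
    (hy : min (Y k) (Y (k + 1)) < y₀) (hy' : y₀ < max (Y k) (Y (k + 1)))
    {W : Set Plane} (hW : IsOpen W) (hzW : (X k, y₀) ∈ W) :
    ∃ ε > 0, (∀ x y, |x - X k| < ε → |y - y₀| < ε → (x, y) ∈ W) ∧
      (∀ y, |y - y₀| < ε → (X k, y) ∈ vEdge X Y k) ∧
      (((∀ x y, |x - X k| < ε → |y - y₀| < ε → x < X k → (x, y) ∈ interior P) ∧
        (∀ x y, |x - X k| < ε → |y - y₀| < ε → X k < x → (x, y) ∉ P)) ∨
      ((∀ x y, |x - X k| < ε → |y - y₀| < ε → x < X k → (x, y) ∉ P) ∧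
        (∀ x y, |x - X k| < ε → |y - y₀| < ε → X k < x → (x, y) ∈ interior P))) := by
  have hz : (X k, y₀) ∈ vEdge X Y k := mem_vEdge.2 ⟨rfl, hy.le, hy'.le⟩
  have n1 : y₀ ≠ Y k ∧ y₀ ≠ Y (k + 1) := by
    constructor <;> rintro rfl <;> rcases le_total (Y k) (Y (k + 1)) with h | h <;> simp [h] at hy hy'
  obtain ⟨ε, hε, hb⟩ := hP.exists_box_avoiding
    (hW.inter ((isOpen_lt continuous_const continuous_snd).inter
      (isOpen_lt continuous_snd continuous_const)))
    (x₀ := X k) (y₀ := y₀) ⟨hzW, hy, hy'⟩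
  refine ⟨ε, hε, fun x y hx hy => (hb x y hx hy).1.1, fun y hy => ?_, ?_⟩
  · obtain ⟨⟨-, h1, h2⟩, -⟩ := hb (X k) y (by simpa using hε) hy
    exact mem_vEdge.2 ⟨rfl, h1.le, h2.le⟩
  -- In the small box only edges through the centre matter. The centre is not an end of edge `k`, so
  -- this is the only edge through it.
  have key : ∀ x y, |x - X k| < ε → |y - y₀| < ε → ((x, y) ∈ edgeUnion X Y ↔ x = X k) := by
    intro x y hx hy
    obtain ⟨⟨_, h1, h2⟩, h3, h4⟩ := hb x y hx hy
    constructor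
    · intro h
      rcases mem_edgeUnion.1 h with ⟨l, hl⟩ | ⟨l, hl⟩
      · exact absurd (h3 l hl) (hP.not_mem_hEdge_of_mem_vEdge hz n1.1 n1.2 l)
      · rw [hP.eq_of_mem_vEdge hz (h4 l hl)]
        exact (mem_vEdge.1 hl).1
    · rintro rfl
      exact mem_edgeUnion.2 (Or.inr ⟨k, mem_vEdge.2 ⟨rfl, h1.le, h2.le⟩⟩)
  have d := hP.local_dichotomy (U := {z : Plane | |z.1 - X k| < ε ∧ |z.2 - y₀| < ε})
    (C₁ := {z : Plane | |z.1 - X k| < ε ∧ |z.2 - y₀| < ε} ∩ {z | z.1 < X k})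
    (C₂ := {z : Plane | |z.1 - X k| < ε ∧ |z.2 - y₀| < ε} ∩ {z | X k < z.1})
    (z := (X k, y₀)) (isOpen_box _ _ _) (by simpa using hε)
    (mem_edgeUnion.2 (Or.inr ⟨k, hz⟩))
    ((convex_box _ _ _).inter (convex_halfSpace_lt (f := Prod.fst) (LinearMap.fst ℝ ℝ ℝ).isLinear _)).isPreconnected
    ((convex_box _ _ _).inter (convex_halfSpace_gt (f := Prod.fst) (LinearMap.fst ℝ ℝ ℝ).isLinear _)).isPreconnected
    (disjoint_left.2 fun z hz hz' => by
      have := (key z.1 z.2 hz.1.1 hz.1.2).1 hz'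
      exact absurd hz.2 (by simp [this]))
    (disjoint_left.2 fun z hz hz' => by
      have := (key z.1 z.2 hz.1.1 hz.1.2).1 hz'
      exact absurd hz.2 (by simp [this]))
    (by
      rintro z ⟨hz, hz'⟩
      rcases lt_trichotomy z.1 (X k) with h | h | h
      · exact Or.inl ⟨hz, h⟩
      · exact absurd ((key z.1 z.2 hz.1 hz.2).2 h) hz'
      · exact Or.inr ⟨hz, h⟩)
  refine d.imp ?_ ?_
  · rintro ⟨a, b⟩
    exact ⟨fun x y hx hy h => a ⟨⟨hx, hy⟩, h⟩,
      fun x y hx hy h => disjoint_left.1 b ⟨⟨hx, hy⟩, h⟩⟩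
  · rintro ⟨a, b⟩
    exact ⟨fun x y hx hy h => disjoint_left.1 a ⟨⟨hx, hy⟩, h⟩,
      fun x y hx hy h => b ⟨⟨hx, hy⟩, h⟩⟩

/-- Locally, `P` lies on exactly one side of a horizontal edge. -/
theorem hEdge_side (hP : IsCyclicPolygon X Y P) [NeZero m] {k : ZMod m} {x₀ : ℝ}
    (hx : min (X (k - 1)) (X k) < x₀) (hx' : x₀ < max (X (k - 1)) (X k))
    {W : Set Plane} (hW : IsOpen W) (hzW : (x₀, Y k) ∈ W) :
    ∃ ε > 0, (∀ x y, |x - x₀| < ε → |y - Y k| < ε → (x, y) ∈ W) ∧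
      (∀ x, |x - x₀| < ε → (x, Y k) ∈ hEdge X Y k) ∧
      (((∀ x y, |x - x₀| < ε → |y - Y k| < ε → y < Y k → (x, y) ∈ interior P) ∧
        (∀ x y, |x - x₀| < ε → |y - Y k| < ε → Y k < y → (x, y) ∉ P)) ∨
      ((∀ x y, |x - x₀| < ε → |y - Y k| < ε → y < Y k → (x, y) ∉ P) ∧
        (∀ x y, |x - x₀| < ε → |y - Y k| < ε → Y k < y → (x, y) ∈ interior P))) := by
  have e : interior (Prod.swap ⁻¹' P) = Prod.swap ⁻¹' interior P :=
    ((Homeomorph.prodComm ℝ ℝ).preimage_interior P).symm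
  -- The transposed polygon has the horizontal edge `k` as its vertical edge `k - 1`.
  have := hP.swap.vEdge_side (k := k - 1) (y₀ := x₀) (W := Prod.swap ⁻¹' W)
    (by simpa using hx) (by simpa using hx') (hW.preimage continuous_swap) (by simpa using hzW)
  simp only [sub_add_cancel, e, mem_preimage, Prod.swap_prod_mk, vEdge_swap] at this
  obtain ⟨ε, hε, h1, h0, h2⟩ := this
  refine ⟨ε, hε, fun x y a b => h1 y x b a, h0, h2.imp ?_ ?_⟩ <;> rintro ⟨a, b⟩ <;>
    exact ⟨fun x y h1 h2 => a y x h2 h1, fun x y h1 h2 => b y x h2 h1⟩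

end IsCyclicPolygon

/-! ## The pieces of the horizontal decomposition -/

/-- The horizontal edge `k` meets the vertical strip between the vertical edges `l` and `r`. -/
def Touches {m : ℕ} (X : ZMod m → ℝ) (l r k : ZMod m) : Prop :=
  min (X (k - 1)) (X k) ≤ X r ∧ X l ≤ max (X (k - 1)) (X k)

/-- The extension of the horizontal edge `k`. -/
def hExtension {m : ℕ} (X Y : ZMod m → ℝ) (P : Set Plane) (k : ZMod m) : Set Plane :=
  {z | z.2 = Y k ∧ ∃ q ∈ hEdge X Y k, Sees P z q}

/-- The interior of `P` without the extensions of the horizontal edges. -/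
def hCut {m : ℕ} (X Y : ZMod m → ℝ) (P : Set Plane) : Set Plane :=
  interior P \ ⋃ k, hExtension X Y P k

/-- The rectangle between the vertical edges `l`, `r` and the heights `b`, `t` is a piece of the
decomposition of `P` by the extensions of the horizontal edges. -/
structure IsPiece {m : ℕ} (X Y : ZMod m → ℝ) (P : Set Plane) (l r : ZMod m) (b t : ℝ) : Prop where
  lt_x : X l < X r
  lt_y : b < t
  lo_l : min (Y l) (Y (l + 1)) ≤ b
  hi_l : t ≤ max (Y l) (Y (l + 1))
  lo_r : min (Y r) (Y (r + 1)) ≤ b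
  hi_r : t ≤ max (Y r) (Y (r + 1))
  v_between : ∀ k, X l < X k → X k < X r → min (Y k) (Y (k + 1)) < t →
    max (Y k) (Y (k + 1)) ≤ b
  h_between : ∀ k, Touches X l r k → Y k ≤ b ∨ t ≤ Y k
  bottom : ∃ k, Touches X l r k ∧ Y k = b
  top : ∃ k, Touches X l r k ∧ Y k = t
  inside : ((Ioo (X l) (X r) ×ˢ Ioo b t) ∩ P).Nonempty

theorem sees_horizontal {P : Set Plane} {x x' y : ℝ} :
    Sees P (x, y) (x', y) ↔ ∀ s ∈ uIcc x x', (s, y) ∈ P := by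
  rw [Sees, ← Prod.image_mk_segment_left, segment_eq_uIcc]
  simp [subset_def]

theorem mem_hExtension {m : ℕ} {X Y : ZMod m → ℝ} {P : Set Plane} {k : ZMod m} {x y : ℝ} :
    (x, y) ∈ hExtension X Y P k ↔
      y = Y k ∧ ∃ q ∈ uIcc (X (k - 1)) (X k), ∀ s ∈ uIcc x q, (s, y) ∈ P := by
  constructor
  · rintro ⟨h1, ⟨q, y'⟩, h2, h3⟩
    simp only at h1
    obtain ⟨h5, h4⟩ := mem_hEdge.1 h2
    subst h1 h4
    exact ⟨rfl, q, h5, sees_horizontal.1 h3⟩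
  · rintro ⟨h1, q, h2, h3⟩
    exact ⟨h1, (q, y), mem_hEdge.2 ⟨h2, h1⟩, sees_horizontal.2 h3⟩

theorem isPreconnected_horizontal {I : Set ℝ} (hI : IsPreconnected I) (y : ℝ) :
    IsPreconnected (I ×ˢ {y} : Set Plane) :=
  hI.prod isPreconnected_singleton

theorem isPreconnected_vertical {I : Set ℝ} (hI : IsPreconnected I) (x : ℝ) :
    IsPreconnected ({x} ×ˢ I : Set Plane) :=
  isPreconnected_singleton.prod hI

namespace IsCyclicPolygon

variable {m : ℕ} {X Y : ZMod m → ℝ} {P : Set Plane}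

theorem exists_bound (hP : IsCyclicPolygon X Y P) :
    ∃ M, ∀ x y, (x, y) ∈ P → |x| < M ∧ |y| < M := by
  obtain ⟨M, hM⟩ := hP.isCompact.isBounded.exists_norm_le
  refine ⟨M + 1, fun x y h => ?_⟩
  have := hM _ h
  simp only [Prod.norm_def, Real.norm_eq_abs, sup_le_iff] at this
  exact ⟨by linarith, by linarith⟩

/-- Otherwise the ray to the left would avoid the boundary: a horizontal edge on the ray misses the
starting point, so it lies wholly to the left of it, and the vertical edge at its end would count.
The ray would then be an unbounded subset of `P`. -/
theorem exists_vEdge_left (hP : IsCyclicPolygon X Y P) {x y : ℝ} (hz : (x, y) ∈ interior P) :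
    ∃ k, X k < x ∧ y ∈ uIcc (Y k) (Y (k + 1)) := by
  by_contra! hcon
  obtain ⟨hzP, hzE⟩ := hP.mem_interior.1 hz
  rw [mem_edgeUnion, not_or, not_exists, not_exists] at hzE
  have hd : Disjoint (Iic x ×ˢ {y} : Set Plane) (edgeUnion X Y) := by
    rw [disjoint_left]
    rintro ⟨s, y'⟩ ⟨hs, hy⟩ hE
    simp only [mem_singleton_iff, mem_Iic] at hs hy
    subst hy
    rcases mem_edgeUnion.1 hE with ⟨k, hk⟩ | ⟨k, hk⟩
    · obtain ⟨h1, h2⟩ := mem_hEdge.1 hk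
      have h3 : ¬ x ∈ uIcc (X (k - 1)) (X k) := fun h => hzE.1 k (mem_hEdge.2 ⟨h, h2⟩)
      have h4 : X k < x := by
        by_contra h
        apply h3
        rw [mem_uIcc] at h1 ⊢
        rcases h1 with h1 | h1
        · left; constructor <;> linarith
        · exact absurd (by linarith : X k ≤ x) (by
            intro h5
            exact h3 (by rw [mem_uIcc]; right; constructor <;> linarith))
      exact hcon k h4 (by rw [h2]; exact left_mem_uIcc)
    · obtain ⟨h1, h2⟩ := mem_vEdge.1 hk
      rcases hs.lt_or_eq with h3 | h3
      · exact hcon k (h1 ▸ h3) h2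
      · exact hzE.2 k (h3 ▸ hk)
  obtain ⟨M, hM⟩ := hP.exists_bound
  rcases hP.subset_interior_or_disjoint (isPreconnected_horizontal isPreconnected_Iic y) hd with h | h
  · have h1 := (hM (min x (-M)) y (interior_subset (h ⟨mem_Iic.2 (min_le_left _ _), rfl⟩))).1
    have h2 := (abs_lt.1 h1).1
    have := min_le_right x (-M)
    linarith
  · exact disjoint_left.1 h (mk_mem_prod (mem_Iic.2 (le_refl x)) (mem_singleton y)) hzP

theorem exists_vEdge_right (hP : IsCyclicPolygon X Y P) {x y : ℝ} (hz : (x, y) ∈ interior P) :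
    ∃ k, x < X k ∧ y ∈ uIcc (Y k) (Y (k + 1)) := by
  by_contra! hcon
  obtain ⟨hzP, hzE⟩ := hP.mem_interior.1 hz
  rw [mem_edgeUnion, not_or, not_exists, not_exists] at hzE
  have hd : Disjoint (Ici x ×ˢ {y} : Set Plane) (edgeUnion X Y) := by
    rw [disjoint_left]
    rintro ⟨s, y'⟩ ⟨hs, hy⟩ hE
    simp only [mem_singleton_iff, mem_Ici] at hs hy
    subst hy
    rcases mem_edgeUnion.1 hE with ⟨k, hk⟩ | ⟨k, hk⟩
    · obtain ⟨h1, h2⟩ := mem_hEdge.1 hk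
      have h3 : ¬ x ∈ uIcc (X (k - 1)) (X k) := fun h => hzE.1 k (mem_hEdge.2 ⟨h, h2⟩)
      have h4 : x < X k := by
        by_contra h
        apply h3
        rw [mem_uIcc] at h1 ⊢
        rcases h1 with h1 | h1
        · exact absurd (by linarith : x ≤ X k) (by
            intro h5
            exact h3 (by rw [mem_uIcc]; left; constructor <;> linarith))
        · right; constructor <;> linarith
      exact hcon k h4 (by rw [h2]; exact left_mem_uIcc)
    · obtain ⟨h1, h2⟩ := mem_vEdge.1 hk
      rcases hs.lt_or_eq with h3 | h3
      · exact hcon k (h1 ▸ h3) h2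
      · exact hzE.2 k (h3 ▸ hk)
  obtain ⟨M, hM⟩ := hP.exists_bound
  rcases hP.subset_interior_or_disjoint (isPreconnected_horizontal isPreconnected_Ici y) hd with h | h
  · have h1 := (hM (max x M) y (interior_subset (h ⟨mem_Ici.2 (le_max_left _ _), rfl⟩))).1
    have h2 := (abs_lt.1 h1).2
    have := le_max_right x M
    linarith
  · exact disjoint_left.1 h (mk_mem_prod (mem_Ici.2 (le_refl x)) (mem_singleton y)) hzP

/-- Every point off the extensions lies in the interior of a piece. -/
theorem exists_isPiece (hP : IsCyclicPolygon X Y P) [NeZero m] {x y : ℝ}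
    (hz : (x, y) ∈ hCut X Y P) :
    ∃ l r b t, IsPiece X Y P l r b t ∧ (x, y) ∈ Ioo (X l) (X r) ×ˢ Ioo b t := by
  classical
  obtain ⟨hzi, hze⟩ := hz
  obtain ⟨hzP, hzE⟩ := hP.mem_interior.1 hzi
  rw [mem_edgeUnion, not_or, not_exists, not_exists] at hzE
  obtain ⟨k₁, hk₁⟩ := hP.exists_vEdge_left hzi
  obtain ⟨k₂, hk₂⟩ := hP.exists_vEdge_right hzi
  -- The sides of the piece are the nearest vertical edges at height `y` on either side of `x`.
  obtain ⟨l, hl, hlmax⟩ := Finset.exists_max_image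
    (Finset.univ.filter fun k => X k < x ∧ y ∈ uIcc (Y k) (Y (k + 1))) X ⟨k₁, by simp [hk₁]⟩
  obtain ⟨r, hr, hrmin⟩ := Finset.exists_min_image
    (Finset.univ.filter fun k => x < X k ∧ y ∈ uIcc (Y k) (Y (k + 1))) X ⟨k₂, by simp [hk₂]⟩
  simp only [Finset.mem_filter, Finset.mem_univ, true_and] at hl hr hlmax hrmin
  have hno : ∀ k, X l < X k → X k < X r → y ∉ uIcc (Y k) (Y (k + 1)) := by
    intro k h1 h2 h3
    rcases lt_trichotomy (X k) x with h | h | h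
    · linarith [hlmax k ⟨h, h3⟩]
    · exact hzE.2 k (mem_vEdge.2 ⟨h.symm, h3⟩)
    · linarith [hrmin k ⟨h, h3⟩]
  -- A horizontal edge through `(s, y)` cannot reach `x`, so it ends between `s` and `x`, and a
  -- vertical edge at this end contradicts the choice of `l` and `r`.
  have hnoH : ∀ k s, X l < s → s < X r → (s, y) ∉ hEdge X Y k := by
    intro k s h1 h2 h3
    obtain ⟨h4, h5⟩ := mem_hEdge.1 h3
    have h6 : ¬ x ∈ uIcc (X (k - 1)) (X k) := fun h => hzE.1 k (mem_hEdge.2 ⟨h, h5⟩)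
    have c1 : y ∈ uIcc (Y k) (Y (k + 1)) := by rw [h5]; exact left_mem_uIcc
    have c2 : y ∈ uIcc (Y (k - 1)) (Y (k - 1 + 1)) := by
      rw [h5, sub_add_cancel]; exact right_mem_uIcc
    have n1 := fun a b => hno k a b c1
    have n2 := fun a b => hno (k - 1) a b c2
    rw [mem_uIcc] at h4 h6
    rcases lt_or_ge s x with hs | hs
    · rcases h4 with h4 | h4
      · refine n1 (by linarith) ?_
        by_contra h; exact h6 (Or.inl ⟨by linarith, by linarith⟩)
      · refine n2 (by linarith) ?_
        by_contra h; exact h6 (Or.inr ⟨by linarith, by linarith⟩)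
    · rcases h4 with h4 | h4
      · refine n2 ?_ (by linarith)
        by_contra h; exact h6 (Or.inl ⟨by linarith, by linarith⟩)
      · refine n1 ?_ (by linarith)
        by_contra h; exact h6 (Or.inr ⟨by linarith, by linarith⟩)
  have hseg : ∀ s, X l ≤ s → s ≤ X r → (s, y) ∈ P := by
    have hd : Disjoint (Ioo (X l) (X r) ×ˢ {y} : Set Plane) (edgeUnion X Y) := by
      rw [disjoint_left]
      rintro ⟨s, y'⟩ ⟨hs, hy⟩ hE
      simp only [mem_singleton_iff, mem_Ioo] at hs hy
      subst hy
      rcases mem_edgeUnion.1 hE with ⟨k, hk⟩ | ⟨k, hk⟩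
      · exact hnoH k s hs.1 hs.2 hk
      · obtain ⟨h1, h2⟩ := mem_vEdge.1 hk
        exact hno k (h1 ▸ hs.1) (h1 ▸ hs.2) h2
    rcases hP.subset_interior_or_disjoint
      (isPreconnected_horizontal isPreconnected_Ioo y) hd with h | h
    · intro s h1 h2
      rcases h1.lt_or_eq with h1 | rfl
      · rcases h2.lt_or_eq with h2 | rfl
        · exact interior_subset (h ⟨⟨h1, h2⟩, rfl⟩)
        · exact hP.vEdge_subset r (mem_vEdge.2 ⟨rfl, hr.2⟩)
      · exact hP.vEdge_subset l (mem_vEdge.2 ⟨rfl, hl.2⟩)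
    · exact absurd hzP (disjoint_left.1 h ⟨⟨hl.1, hr.1⟩, rfl⟩)
  have hne : ∀ k, Touches X l r k → Y k ≠ y := by
    rintro k ⟨h1, h2⟩ rfl
    -- The leftmost common abscissa of the edge and the strip gives a point of the edge that `(x,
    -- y)` sees along the open row between `l` and `r`.
    refine hze (mem_iUnion.2 ⟨k, mem_hExtension.2 ⟨rfl, max (min (X (k - 1)) (X k)) (X l), ?_, ?_⟩⟩)
    · exact ⟨le_max_left _ _, max_le min_le_max h2⟩
    · intro s hs
      have h3 : max (min (X (k - 1)) (X k)) (X l) ≤ X r := max_le h1 (by linarith)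
      have h4 : X l ≤ max (min (X (k - 1)) (X k)) (X l) := le_max_right _ _
      rw [mem_uIcc] at hs
      apply hseg <;> rcases hs with hs | hs <;> linarith [hl.1, hr.1]
  have tl : ∀ u, X l ≤ X u → X u ≤ X r → Touches X l r u ∧ Touches X l r (u + 1) := by
    intro u h1 h2
    refine ⟨⟨(min_le_right _ _).trans h2, h1.trans (le_max_right _ _)⟩, ?_, ?_⟩
    · rw [add_sub_cancel_right]; exact (min_le_left _ _).trans h2
    · rw [add_sub_cancel_right]; exact h1.trans (le_max_left _ _)
  have hlr : X l < X r := hl.1.trans hr.1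
  have span : ∀ u, X l ≤ X u → X u ≤ X r → y ∈ uIcc (Y u) (Y (u + 1)) →
      (Y u < y ∧ y < Y (u + 1)) ∨ (Y (u + 1) < y ∧ y < Y u) := by
    intro u h1 h2 h3
    have a := hne u (tl u h1 h2).1
    have b := hne _ (tl u h1 h2).2
    rw [mem_uIcc] at h3
    rcases h3 with h3 | h3
    · exact Or.inl ⟨lt_of_le_of_ne h3.1 a, lt_of_le_of_ne h3.2 b.symm⟩
    · exact Or.inr ⟨lt_of_le_of_ne h3.1 b, lt_of_le_of_ne h3.2 a.symm⟩
  have exlo : ∃ k, Touches X l r k ∧ Y k < y := by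
    rcases span l le_rfl hlr.le hl.2 with h | h
    · exact ⟨l, (tl l le_rfl hlr.le).1, h.1⟩
    · exact ⟨l + 1, (tl l le_rfl hlr.le).2, h.1⟩
  have exhi : ∃ k, Touches X l r k ∧ y < Y k := by
    rcases span l le_rfl hlr.le hl.2 with h | h
    · exact ⟨l + 1, (tl l le_rfl hlr.le).2, h.2⟩
    · exact ⟨l, (tl l le_rfl hlr.le).1, h.2⟩
  obtain ⟨k₃, hk₃⟩ := exlo
  obtain ⟨k₄, hk₄⟩ := exhi
  -- Bottom and top are the nearest heights, below and above `y`, of horizontal edges that touch the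
  -- strip.
  obtain ⟨kb, hb, hbmax⟩ := Finset.exists_max_image
    (Finset.univ.filter fun k => Touches X l r k ∧ Y k < y) Y ⟨k₃, by simp [hk₃]⟩
  obtain ⟨kt, ht, htmin⟩ := Finset.exists_min_image
    (Finset.univ.filter fun k => Touches X l r k ∧ y < Y k) Y ⟨k₄, by simp [hk₄]⟩
  simp only [Finset.mem_filter, Finset.mem_univ, true_and] at hb ht hbmax htmin
  have lohi : ∀ u, X l ≤ X u → X u ≤ X r → y ∈ uIcc (Y u) (Y (u + 1)) →
      min (Y u) (Y (u + 1)) ≤ Y kb ∧ Y kt ≤ max (Y u) (Y (u + 1)) := by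
    intro u h1 h2 h3
    rcases span u h1 h2 h3 with h | h
    · exact ⟨(min_le_left _ _).trans (hbmax u ⟨(tl u h1 h2).1, h.1⟩),
        (htmin _ ⟨(tl u h1 h2).2, h.2⟩).trans (le_max_right _ _)⟩
    · exact ⟨(min_le_right _ _).trans (hbmax _ ⟨(tl u h1 h2).2, h.1⟩),
        (htmin _ ⟨(tl u h1 h2).1, h.2⟩).trans (le_max_left _ _)⟩
  have hbt : ∀ k, Touches X l r k → Y k ≤ Y kb ∨ Y kt ≤ Y k := by
    intro k hk
    rcases lt_or_gt_of_ne (hne k hk) with h | h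
    · exact Or.inl (hbmax k ⟨hk, h⟩)
    · exact Or.inr (htmin k ⟨hk, h⟩)
  refine ⟨l, r, Y kb, Y kt, ⟨hlr, hb.2.trans ht.2, (lohi l le_rfl hlr.le hl.2).1,
    (lohi l le_rfl hlr.le hl.2).2, (lohi r hlr.le le_rfl hr.2).1,
    (lohi r hlr.le le_rfl hr.2).2, ?_, hbt, ⟨kb, hb.1, rfl⟩, ⟨kt, ht.1, rfl⟩,
    ⟨(x, y), ⟨⟨hl.1, hr.1⟩, hb.2, ht.2⟩, hzP⟩⟩, ⟨hl.1, hr.1⟩, hb.2, ht.2⟩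
  -- Both horizontal neighbours of such a vertical edge touch the strip, so their heights avoid the
  -- range between bottom and top. They are on the same side of it because the edge does not meet
  -- height `y`.
  intro k h1 h2 h3
  have t1 := hbt k (tl k h1.le h2.le).1
  have t2 := hbt _ (tl k h1.le h2.le).2
  have hn := hno k h1 h2
  rw [mem_uIcc, not_or] at hn
  have b1 := hb.2
  have b2 := ht.2
  rcases min_lt_iff.1 h3 with h3 | h3
  · have t1 : Y k ≤ Y kb := t1.resolve_right (by linarith)
    refine max_le t1 (t2.resolve_right fun h => hn.1 ⟨by linarith, by linarith⟩)
  · have t2 : Y (k + 1) ≤ Y kb := t2.resolve_right (by linarith)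
    refine max_le (t1.resolve_right fun h => hn.2 ⟨by linarith, by linarith⟩) t2

end IsCyclicPolygon

/-! ### Pieces are the connected components of the cut interior -/

namespace IsPiece

variable {m : ℕ} {X Y : ZMod m → ℝ} {P : Set Plane} {l r : ZMod m} {b t : ℝ}

/-- `h_between` excludes horizontal edges. `v_between` excludes vertical ones: an edge with its
lower end below `t` ends at or below `b`. -/
theorem disjoint_edgeUnion (h : IsPiece X Y P l r b t) :
    Disjoint (Ioo (X l) (X r) ×ˢ Ioo b t) (edgeUnion X Y) := by
  rw [disjoint_left]
  rintro ⟨x, y⟩ ⟨⟨h1, h2⟩, h3, h4⟩ hE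
  simp only at h1 h2 h3 h4
  rcases mem_edgeUnion.1 hE with ⟨k, hk⟩ | ⟨k, hk⟩
  · obtain ⟨a, b⟩ := mem_hEdge.1 hk
    rcases h.h_between k ⟨a.1.trans h2.le, h1.le.trans a.2⟩ with c | c <;> linarith
  · obtain ⟨rfl, b⟩ := mem_vEdge.1 hk
    have := h.v_between k h1 h2 (b.1.trans_lt h4)
    linarith [b.2, (show y ≤ max (Y k) (Y (k + 1)) from b.2)]

theorem isPreconnected_Ioo (l r : ZMod m) (X : ZMod m → ℝ) (b t : ℝ) :
    IsPreconnected (Ioo (X l) (X r) ×ˢ Ioo b t) :=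
  _root_.isPreconnected_Ioo.prod _root_.isPreconnected_Ioo

theorem subset_interior (h : IsPiece X Y P l r b t) (hP : IsCyclicPolygon X Y P) :
    Ioo (X l) (X r) ×ˢ Ioo b t ⊆ interior P := by
  refine (hP.subset_interior_or_disjoint (isPreconnected_Ioo l r X b t)
    h.disjoint_edgeUnion).resolve_right fun hd => ?_
  obtain ⟨z, hz, hzP⟩ := h.inside
  exact disjoint_left.1 hd hz hzP

theorem closure_eq (h : IsPiece X Y P l r b t) :
    closure (Ioo (X l) (X r) ×ˢ Ioo b t) = Icc (X l) (X r) ×ˢ Icc b t := by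
  rw [closure_prod_eq, closure_Ioo h.lt_x.ne, closure_Ioo h.lt_y.ne]

theorem Icc_subset (h : IsPiece X Y P l r b t) (hP : IsCyclicPolygon X Y P) :
    Icc (X l) (X r) ×ˢ Icc b t ⊆ P := by
  rw [← h.closure_eq]
  exact closure_minimal ((h.subset_interior hP).trans interior_subset) hP.isClosed

theorem left_subset (h : IsPiece X Y P l r b t) {y : ℝ} (hy : y ∈ Icc b t) :
    (X l, y) ∈ vEdge X Y l :=
  mem_vEdge.2 ⟨rfl, h.lo_l.trans hy.1, hy.2.trans h.hi_l⟩

theorem right_subset (h : IsPiece X Y P l r b t) {y : ℝ} (hy : y ∈ Icc b t) :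
    (X r, y) ∈ vEdge X Y r :=
  mem_vEdge.2 ⟨rfl, h.lo_r.trans hy.1, hy.2.trans h.hi_r⟩

theorem mem_hExtension_of_touches (h : IsPiece X Y P l r b t) (hP : IsCyclicPolygon X Y P)
    {k : ZMod m} (hk : Touches X l r k) (hy : Y k ∈ Icc b t) {x : ℝ} (hx : x ∈ Icc (X l) (X r)) :
    (x, Y k) ∈ hExtension X Y P k := by
  refine mem_hExtension.2 ⟨rfl, max (min (X (k - 1)) (X k)) (X l), ?_, ?_⟩
  · exact ⟨le_max_left _ _, max_le min_le_max hk.2⟩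
  · intro s hs
    have h3 : max (min (X (k - 1)) (X k)) (X l) ≤ X r := max_le hk.1 h.lt_x.le
    have h4 : X l ≤ max (min (X (k - 1)) (X k)) (X l) := le_max_right _ _
    rw [mem_uIcc] at hs
    exact h.Icc_subset hP ⟨⟨by rcases hs with hs | hs <;> linarith [hx.1, hx.2],
      by rcases hs with hs | hs <;> linarith [hx.1, hx.2]⟩, hy⟩

/-- An extension does not enter the part of the strip strictly between bottom and top. -/
theorem not_mem_hExtension (h : IsPiece X Y P l r b t) (hP : IsCyclicPolygon X Y P) [NeZero m]
    {x y : ℝ} (hx : x ∈ Icc (X l) (X r)) (hy : y ∈ Ioo b t) (k : ZMod m) :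
    (x, y) ∉ hExtension X Y P k := by
  intro hk
  obtain ⟨rfl, q, hq, hs⟩ := mem_hExtension.1 hk
  have hnt : ¬ Touches X l r k := fun ht => by
    rcases h.h_between k ht with c | c <;> linarith [hy.1, hy.2]
  have hq' : q < X l ∨ X r < q := by
    by_contra! hc
    exact hnt ⟨hq.1.trans hc.2, hc.1.trans hq.2⟩
  have hlt := h.lt_x
  -- The visible segment would leave the strip through an interior point of the vertical edge `l` or
  -- `r`. There `P` lies on one side only, yet the piece occupies the inner side and the segment the
  -- outer side.
  rcases hq' with hq' | hq'
  · obtain ⟨ε, hε, -, -, hside⟩ := hP.vEdge_side (k := l) (y₀ := Y k) (h.lo_l.trans_lt hy.1)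
      (hy.2.trans_le h.hi_l) isOpen_univ (mem_univ _)
    have e1 : 0 < min (ε / 2) (min (X l - q) ((X r - X l) / 2)) := by
      refine lt_min (by linarith) (lt_min (by linarith) (by linarith))
    set δ := min (ε / 2) (min (X l - q) ((X r - X l) / 2)) with hδ
    have e2 : δ ≤ ε / 2 := min_le_left _ _
    have e3 : δ ≤ X l - q := (min_le_right _ _).trans (min_le_left _ _)
    have e4 : δ ≤ (X r - X l) / 2 := (min_le_right _ _).trans (min_le_right _ _)
    rcases hside with hside | hside
    · refine hside.2 (X l + δ) (Y k) (by rw [abs_lt]; constructor <;> linarith)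
        (by simpa using hε) (by linarith) (h.Icc_subset hP ⟨⟨?_, ?_⟩, hy.1.le, hy.2.le⟩)
      all_goals simp only; linarith
    · refine hside.1 (X l - δ) (Y k) (by rw [abs_lt]; constructor <;> linarith)
        (by simpa using hε) (by linarith) (hs _ ?_)
      rw [mem_uIcc]; right; constructor <;> linarith [hx.1]
  · obtain ⟨ε, hε, -, -, hside⟩ := hP.vEdge_side (k := r) (y₀ := Y k) (h.lo_r.trans_lt hy.1)
      (hy.2.trans_le h.hi_r) isOpen_univ (mem_univ _)
    have e1 : 0 < min (ε / 2) (min (q - X r) ((X r - X l) / 2)) := by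
      refine lt_min (by linarith) (lt_min (by linarith) (by linarith))
    set δ := min (ε / 2) (min (q - X r) ((X r - X l) / 2)) with hδ
    have e2 : δ ≤ ε / 2 := min_le_left _ _
    have e3 : δ ≤ q - X r := (min_le_right _ _).trans (min_le_left _ _)
    have e4 : δ ≤ (X r - X l) / 2 := (min_le_right _ _).trans (min_le_right _ _)
    rcases hside with hside | hside
    · refine hside.2 (X r + δ) (Y k) (by rw [abs_lt]; constructor <;> linarith)
        (by simpa using hε) (by linarith) (hs _ ?_)
      rw [mem_uIcc]; left; constructor <;> linarith [hx.2]
    · refine hside.1 (X r - δ) (Y k) (by rw [abs_lt]; constructor <;> linarith)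
        (by simpa using hε) (by linarith) (h.Icc_subset hP ⟨⟨?_, ?_⟩, hy.1.le, hy.2.le⟩)
      all_goals simp only; linarith

theorem subset_hCut (h : IsPiece X Y P l r b t) (hP : IsCyclicPolygon X Y P) [NeZero m] :
    Ioo (X l) (X r) ×ˢ Ioo b t ⊆ hCut X Y P := by
  rintro ⟨x, y⟩ hz
  refine ⟨h.subset_interior hP hz, fun hE => ?_⟩
  obtain ⟨k, hk⟩ := mem_iUnion.1 hE
  exact h.not_mem_hExtension hP ⟨hz.1.1.le, hz.1.2.le⟩ hz.2 k hk

/-- The sides of the closed rectangle lie on vertical edges, and its bottom and top lie on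
extensions. So the cut interior meets the closed rectangle only in the open one, and a connected set
cannot leave it. -/
theorem connectedComponentIn_eq (h : IsPiece X Y P l r b t) (hP : IsCyclicPolygon X Y P)
    [NeZero m] {z : Plane} (hz : z ∈ Ioo (X l) (X r) ×ˢ Ioo b t) :
    connectedComponentIn (hCut X Y P) z = Ioo (X l) (X r) ×ˢ Ioo b t := by
  refine subset_antisymm ?_ ((isPreconnected_Ioo l r X b t).subset_connectedComponentIn hz
    (h.subset_hCut hP))
  refine isPreconnected_connectedComponentIn.subset_of_closure_inter_subset
    (isOpen_Ioo.prod isOpen_Ioo)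
    ⟨z, mem_connectedComponentIn (h.subset_hCut hP hz), hz⟩ ?_
  rintro ⟨x, y⟩ ⟨hw, hw'⟩
  rw [h.closure_eq] at hw
  obtain ⟨hc, hc'⟩ := connectedComponentIn_subset _ _ hw'
  have hE := (hP.mem_interior.1 hc).2
  obtain ⟨⟨h1, h2⟩, h3, h4⟩ := hw
  simp only at h1 h2 h3 h4
  have tb : ∀ k, Touches X l r k → y = Y k → False := by
    rintro k hk rfl
    exact hc' (mem_iUnion.2 ⟨k, h.mem_hExtension_of_touches hP hk ⟨h3, h4⟩ ⟨h1, h2⟩⟩)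
  refine ⟨⟨lt_of_le_of_ne h1 ?_, lt_of_le_of_ne h2 ?_⟩, lt_of_le_of_ne h3 ?_, lt_of_le_of_ne h4 ?_⟩
  · rintro rfl; exact hE (mem_edgeUnion.2 (Or.inr ⟨l, h.left_subset ⟨h3, h4⟩⟩))
  · rintro rfl; exact hE (mem_edgeUnion.2 (Or.inr ⟨r, h.right_subset ⟨h3, h4⟩⟩))
  · rintro rfl
    obtain ⟨k, hk, e⟩ := h.bottom
    exact tb k hk e.symm
  · rintro rfl
    obtain ⟨k, hk, e⟩ := h.top
    exact tb k hk e.symm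

end IsPiece

/-- The closed rectangles that are pieces of the horizontal decomposition. -/
def pieces {m : ℕ} (X Y : ZMod m → ℝ) (P : Set Plane) : Set (Set Plane) :=
  {K | ∃ l r b t, IsPiece X Y P l r b t ∧ K = Icc (X l) (X r) ×ˢ Icc b t}

namespace IsCyclicPolygon

variable {m : ℕ} {X Y : ZMod m → ℝ} {P : Set Plane}

theorem pieces_eq (hP : IsCyclicPolygon X Y P) [NeZero m] :
    pieces X Y P = (fun z => closure (connectedComponentIn (hCut X Y P) z)) '' hCut X Y P := by
  ext K
  constructor
  · rintro ⟨l, r, b, t, h, rfl⟩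
    obtain ⟨z, hz, -⟩ := h.inside
    exact ⟨z, h.subset_hCut hP hz, by simp only [h.connectedComponentIn_eq hP hz, h.closure_eq]⟩
  · rintro ⟨⟨x, y⟩, hz, rfl⟩
    obtain ⟨l, r, b, t, h, hz'⟩ := hP.exists_isPiece hz
    exact ⟨l, r, b, t, h, by simp only [h.connectedComponentIn_eq hP hz', h.closure_eq]⟩

theorem finite_pieces (_ : IsCyclicPolygon X Y P) [NeZero m] : (pieces X Y P).Finite := by
  refine (Set.finite_range fun a : ZMod m × ZMod m × ZMod m × ZMod m =>
    (Icc (X a.1) (X a.2.1) ×ˢ Icc (Y a.2.2.1) (Y a.2.2.2) : Set Plane)).subset ?_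
  rintro K ⟨l, r, b, t, h, rfl⟩
  obtain ⟨k, -, rfl⟩ := h.bottom
  obtain ⟨k', -, rfl⟩ := h.top
  exact ⟨(l, r, k, k'), rfl⟩

theorem interior_rect (x₁ x₂ y₁ y₂ : ℝ) :
    interior (Icc x₁ x₂ ×ˢ Icc y₁ y₂ : Set Plane) = Ioo x₁ x₂ ×ˢ Ioo y₁ y₂ := by
  rw [interior_prod_eq, interior_Icc, interior_Icc]

theorem isPiece_unique (hP : IsCyclicPolygon X Y P) [NeZero m] {l r l' r' : ZMod m}
    {b t b' t' : ℝ} (h : IsPiece X Y P l r b t) (h' : IsPiece X Y P l' r' b' t')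
    (hn : ((Ioo (X l) (X r) ×ˢ Ioo b t) ∩ (Ioo (X l') (X r') ×ˢ Ioo b' t')).Nonempty) :
    (Icc (X l) (X r) ×ˢ Icc b t : Set Plane) = Icc (X l') (X r') ×ˢ Icc b' t' := by
  obtain ⟨z, hz, hz'⟩ := hn
  rw [← h.closure_eq, ← h'.closure_eq, ← h.connectedComponentIn_eq hP hz,
    ← h'.connectedComponentIn_eq hP hz']

theorem isRectanglePartition_pieces (hP : IsCyclicPolygon X Y P) [NeZero m] :
    IsRectanglePartition P (pieces X Y P) := by
  refine ⟨?_, subset_antisymm ?_ ?_, ?_⟩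
  · rintro K ⟨l, r, b, t, h, rfl⟩
    exact ⟨_, _, _, _, h.lt_x, h.lt_y, rfl⟩
  · rintro z ⟨K, ⟨l, r, b, t, h, rfl⟩, hz⟩
    exact h.Icc_subset hP hz
  · have hcl : IsClosed (⋃₀ pieces X Y P) := by
      rw [sUnion_eq_biUnion]
      refine hP.finite_pieces.isClosed_biUnion ?_
      rintro K ⟨l, r, b, t, h, rfl⟩
      exact isClosed_Icc.prod isClosed_Icc
    have hcut : hCut X Y P ⊆ ⋃₀ pieces X Y P := by
      rintro ⟨x, y⟩ hz
      obtain ⟨l, r, b, t, h, hz'⟩ := hP.exists_isPiece hz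
      exact ⟨_, ⟨l, r, b, t, h, rfl⟩, ⟨hz'.1.1.le, hz'.1.2.le⟩, ⟨hz'.2.1.le, hz'.2.2.le⟩⟩
    -- Interior points whose height differs from the finitely many edge heights lie on no extension.
    -- They are dense in the interior, and a finite union of closed pieces is closed.
    have hd : Dense {z : Plane | z.2 ∈ (range Y)ᶜ} := by
      have h1 : Dense ((range Y)ᶜ : Set ℝ) := (finite_range Y).countable.dense_compl ℝ
      have h2 := (dense_univ (X := ℝ)).prod h1
      convert h2 using 1
      ext z; simp
    refine hP.closure_interior.symm.subset.trans (closure_minimal ?_ hcl)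
    refine (hd.open_subset_closure_inter isOpen_interior).trans (closure_minimal ?_ hcl)
    rintro z ⟨hz, hz'⟩
    refine hcut ⟨hz, fun hE => ?_⟩
    obtain ⟨k, hk⟩ := mem_iUnion.1 hE
    exact hz' ⟨k, hk.1.symm⟩
  · rintro K ⟨l, r, b, t, h, rfl⟩ K' ⟨l', r', b', t', h', rfl⟩ hne
    rw [interior_rect, interior_rect]
    by_contra hd
    exact hne (hP.isPiece_unique h h' (not_disjoint_iff_nonempty_inter.1 hd))

end IsCyclicPolygon

/-! ## Chords separate: the number of pieces -/

theorem IsPreconnected.eq_of_locally_eq {α β : Type*} [TopologicalSpace α] {S : Set α}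
    (hS : IsPreconnected S) {F : α → β}
    (hF : ∀ z ∈ S, ∃ U, IsOpen U ∧ z ∈ U ∧ ∀ w ∈ U ∩ S, F w = F z) {z w : α}
    (hz : z ∈ S) (hw : w ∈ S) : F z = F w := by
  let _ : TopologicalSpace β := ⊥
  have _ : DiscreteTopology β := ⟨rfl⟩
  refine hS.constant (f := F) ?_ hz hw
  intro u hu
  obtain ⟨U, hU, huU, hc⟩ := hF u hu
  refine (continuousWithinAt_const (b := F u)).congr_of_eventuallyEq ?_ rfl
  filter_upwards [inter_mem_nhdsWithin S (hU.mem_nhds huU)] with v hv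
  exact hc v ⟨hv.2, hv.1⟩

namespace IsCyclicPolygon

variable {m : ℕ} {X Y : ZMod m → ℝ} {P : Set Plane}

/-- Near a vertex the boundary is a pair of perpendicular half-lines with directions given by the
signs of `A` and `B`, which treats all four orientations at once. The complement consists of an open
quadrant and the union of two half-boxes, both connected; exactly one of them is inside. -/
theorem vertex_dichotomy (hP : IsCyclicPolygon X Y P) [NeZero m] {k u : ZMod m} {x₀ x₁ y₀ y₁ : ℝ}
    (hx : x₁ ≠ x₀) (hy : y₁ ≠ y₀) (hk : hEdge X Y k = uIcc x₀ x₁ ×ˢ {y₀})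
    (hu : vEdge X Y u = {x₀} ×ˢ uIcc y₀ y₁) {W : Set Plane} (hW : IsOpen W)
    (hzW : (x₀, y₀) ∈ W) :
    ∃ U, IsOpen U ∧ (x₀, y₀) ∈ U ∧ U ⊆ W ∧ IsPreconnected (U ∩ interior P) := by
  have hzk : (x₀, y₀) ∈ hEdge X Y k := by rw [hk]; simp
  have hzu : (x₀, y₀) ∈ vEdge X Y u := by rw [hu]; simp
  obtain ⟨ε', hε', hb⟩ := hP.exists_box_avoiding hW hzW
  set A := x₁ - x₀ with hA
  set B := y₁ - y₀ with hB
  have hA0 : A ≠ 0 := sub_ne_zero.2 hx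
  have hB0 : B ≠ 0 := sub_ne_zero.2 hy
  obtain ⟨ε, hε, e1, e2, e3⟩ : ∃ ε > 0, ε ≤ ε' ∧ ε ≤ |A| ∧ ε ≤ |B| :=
    ⟨min ε' (min |A| |B|), lt_min hε' (lt_min (abs_pos.2 hA0) (abs_pos.2 hB0)), min_le_left _ _,
      (min_le_right _ _).trans (min_le_left _ _), (min_le_right _ _).trans (min_le_right _ _)⟩
  set U := {z : Plane | |z.1 - x₀| < ε ∧ |z.2 - y₀| < ε} with hU
  -- Closer to `a₀` than the length `|d|`, the interval cannot be told from a half-line, so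
  -- membership becomes a sign condition.
  have arm : ∀ (a₀ a₁ d a : ℝ), d = a₁ - a₀ → d ≠ 0 → ε ≤ |d| → |a - a₀| < ε →
      (a ∈ uIcc a₀ a₁ ↔ 0 ≤ d * (a - a₀)) := by
    intro a₀ a₁ d a hd hd0 hε' ha
    rw [mem_uIcc]
    rw [abs_lt] at ha
    rcases lt_or_gt_of_ne hd0 with h | h
    · rw [abs_of_neg h] at hε'
      constructor
      · rintro (h' | h')
        · linarith
        · exact mul_nonneg_of_nonpos_of_nonpos h.le (by linarith)
      · intro h'
        have : a - a₀ ≤ 0 := by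
          by_contra hc
          have := mul_neg_of_neg_of_pos h (not_le.1 hc)
          linarith
        right; constructor <;> linarith
    · rw [abs_of_pos h] at hε'
      constructor
      · rintro (h' | h')
        · exact mul_nonneg h.le (by linarith)
        · linarith
      · intro h'
        have := nonneg_of_mul_nonneg_right h' h
        left; constructor <;> linarith
  have key : ∀ z ∈ U, (z ∈ edgeUnion X Y ↔
      (z.2 = y₀ ∧ 0 ≤ A * (z.1 - x₀)) ∨ (z.1 = x₀ ∧ 0 ≤ B * (z.2 - y₀))) := by
    rintro ⟨x, y⟩ ⟨h1, h2⟩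
    obtain ⟨-, h3, h4⟩ := hb x y (h1.trans_le e1) (h2.trans_le e1)
    have a1 := arm x₀ x₁ A x hA hA0 e2 h1
    have a2 := arm y₀ y₁ B y hB hB0 e3 h2
    simp only
    rw [← a1, ← a2]
    constructor
    · intro h
      rcases mem_edgeUnion.1 h with ⟨j, hj⟩ | ⟨j, hj⟩
      · have := hP.eq_of_mem_hEdge hzk (h3 j hj)
        rw [← this, hk] at hj
        exact Or.inl ⟨hj.2, hj.1⟩
      · have := hP.eq_of_mem_vEdge hzu (h4 j hj)
        rw [← this, hu] at hj
        exact Or.inr ⟨hj.1, hj.2⟩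
    · rintro (⟨rfl, h⟩ | ⟨rfl, h⟩)
      · exact mem_edgeUnion.2 (Or.inl ⟨k, by rw [hk]; exact ⟨h, rfl⟩⟩)
      · exact mem_edgeUnion.2 (Or.inr ⟨u, by rw [hu]; exact ⟨rfl, h⟩⟩)
  have cv : Convex ℝ U := convex_box _ _ _
  have lA : IsLinearMap ℝ fun z : Plane => A * z.1 :=
    ⟨fun a b => by simp; ring, fun c a => by simp; ring⟩
  have lB : IsLinearMap ℝ fun z : Plane => B * z.2 :=
    ⟨fun a b => by simp; ring, fun c a => by simp; ring⟩
  have sA1 : Convex ℝ {z : Plane | 0 < A * (z.1 - x₀)} := by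
    have e : {z : Plane | 0 < A * (z.1 - x₀)} = {z : Plane | A * x₀ < A * z.1} := by
      ext z; simp only [mem_ofPred_eq, mul_sub, sub_pos]
    rw [e]; exact convex_halfSpace_gt lA (A * x₀)
  have sB1 : Convex ℝ {z : Plane | 0 < B * (z.2 - y₀)} := by
    have e : {z : Plane | 0 < B * (z.2 - y₀)} = {z : Plane | B * y₀ < B * z.2} := by
      ext z; simp only [mem_ofPred_eq, mul_sub, sub_pos]
    rw [e]; exact convex_halfSpace_gt lB (B * y₀)
  have sA2 : Convex ℝ {z : Plane | A * (z.1 - x₀) < 0} := by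
    have e : {z : Plane | A * (z.1 - x₀) < 0} = {z : Plane | A * z.1 < A * x₀} := by
      ext z; simp only [mem_ofPred_eq, mul_sub, sub_neg]
    rw [e]; exact convex_halfSpace_lt lA (A * x₀)
  have sB2 : Convex ℝ {z : Plane | B * (z.2 - y₀) < 0} := by
    have e : {z : Plane | B * (z.2 - y₀) < 0} = {z : Plane | B * z.2 < B * y₀} := by
      ext z; simp only [mem_ofPred_eq, mul_sub, sub_neg]
    rw [e]; exact convex_halfSpace_lt lB (B * y₀)
  set C₁ := U ∩ ({z : Plane | 0 < A * (z.1 - x₀)} ∩ {z : Plane | 0 < B * (z.2 - y₀)}) with hC₁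
  set C₂ := (U ∩ {z : Plane | A * (z.1 - x₀) < 0}) ∪ (U ∩ {z : Plane | B * (z.2 - y₀) < 0}) with hC₂
  have p1 : IsPreconnected C₁ := (cv.inter (sA1.inter sB1)).isPreconnected
  have p2 : IsPreconnected C₂ := by
    have hs : 0 < |A| + |B| := by positivity
    -- The point opposite to the quadrant lies in both half-boxes; `c` is small enough to keep it in
    -- the box.
    set c := ε / (2 * (|A| + |B|)) with hc
    have hcp : 0 < c := by positivity
    have hc1 : c * (|A| + |B|) = ε / 2 := by rw [hc]; field_simp
    have m1 : (x₀ - c * A, y₀ - c * B) ∈ U := by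
      constructor
      · simp only [sub_sub_cancel_left, abs_neg, abs_mul, abs_of_pos hcp]
        nlinarith [abs_nonneg B, abs_nonneg A]
      · simp only [sub_sub_cancel_left, abs_neg, abs_mul, abs_of_pos hcp]
        nlinarith [abs_nonneg B, abs_nonneg A]
    refine IsPreconnected.union (x₀ - c * A, y₀ - c * B) ⟨m1, ?_⟩ ⟨m1, ?_⟩
      (cv.inter sA2).isPreconnected (cv.inter sB2).isPreconnected
    · simp only [mem_ofPred_eq]
      have : 0 < c * (A * A) := mul_pos hcp (mul_self_pos.2 hA0)
      linarith
    · simp only [mem_ofPred_eq]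
      have : 0 < c * (B * B) := mul_pos hcp (mul_self_pos.2 hB0)
      linarith
  have d1 : Disjoint C₁ (edgeUnion X Y) := by
    rw [disjoint_left]
    rintro z ⟨hz, h1, h2⟩ hE
    simp only [mem_ofPred_eq] at h1 h2
    rcases (key z hz).1 hE with ⟨h, -⟩ | ⟨h, -⟩
    · rw [h] at h2; simp at h2
    · rw [h] at h1; simp at h1
  have d2 : Disjoint C₂ (edgeUnion X Y) := by
    rw [disjoint_left]
    rintro z (⟨hz, h1⟩ | ⟨hz, h1⟩) hE <;> simp only [mem_ofPred_eq] at h1 <;>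
    · rcases (key z hz).1 hE with ⟨h, h'⟩ | ⟨h, h'⟩
      · first | linarith | (rw [h] at h1; simp at h1)
      · first | linarith | (rw [h] at h1; simp at h1)
  have hc : U \ edgeUnion X Y ⊆ C₁ ∪ C₂ := by
    rintro z ⟨hz, hzE⟩
    rw [key z hz] at hzE
    rcases lt_trichotomy (A * (z.1 - x₀)) 0 with h | h | h
    · exact Or.inr (Or.inl ⟨hz, h⟩)
    · rcases lt_or_ge (B * (z.2 - y₀)) 0 with h' | h'
      · exact Or.inr (Or.inr ⟨hz, h'⟩)
      · refine absurd (Or.inr ⟨?_, h'⟩) hzE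
        rcases mul_eq_zero.1 h with h | h
        · exact absurd h hA0
        · linarith
    · rcases lt_trichotomy (B * (z.2 - y₀)) 0 with h' | h' | h'
      · exact Or.inr (Or.inr ⟨hz, h'⟩)
      · refine absurd (Or.inl ⟨?_, h.le⟩) hzE
        rcases mul_eq_zero.1 h' with h' | h'
        · exact absurd h' hB0
        · linarith
      · exact Or.inl ⟨hz, h, h'⟩
  have hzU : (x₀, y₀) ∈ U := by simpa [hU] using hε
  have d := hP.local_dichotomy (isOpen_box _ _ _) hzU (mem_edgeUnion.2 (Or.inl ⟨k, hzk⟩)) p1 p2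
    d1 d2 hc
  refine ⟨U, isOpen_box _ _ _, hzU, fun z hz => (hb z.1 z.2 (hz.1.trans_le e1) (hz.2.trans_le e1)).1, ?_⟩
  have c1 : C₁ ⊆ U := inter_subset_left
  have c2 : C₂ ⊆ U := union_subset inter_subset_left inter_subset_left
  rcases d with ⟨a, b⟩ | ⟨a, b⟩
  · convert p1 using 1
    refine subset_antisymm ?_ (subset_inter c1 a)
    rintro z ⟨hz, hzi⟩
    exact (hc ⟨hz, (hP.mem_interior.1 hzi).2⟩).resolve_right
      fun h => disjoint_left.1 b h (interior_subset hzi)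
  · convert p2 using 1
    refine subset_antisymm ?_ (subset_inter c2 b)
    rintro z ⟨hz, hzi⟩
    exact (hc ⟨hz, (hP.mem_interior.1 hzi).2⟩).resolve_left
      fun h => disjoint_left.1 a h (interior_subset hzi)

/-- The interior of `P` is locally connected at every point of `P`. -/
theorem exists_preconnected (hP : IsCyclicPolygon X Y P) [NeZero m] {z : Plane} (hz : z ∈ P)
    {W : Set Plane} (hW : IsOpen W) (hzW : z ∈ W) :
    ∃ U, IsOpen U ∧ z ∈ U ∧ U ⊆ W ∧ IsPreconnected (U ∩ interior P) := by
  obtain ⟨x₀, y₀⟩ := z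
  have hv : ∀ k, (x₀, y₀) ∈ vEdge X Y k →
      ∃ U, IsOpen U ∧ (x₀, y₀) ∈ U ∧ U ⊆ W ∧ IsPreconnected (U ∩ interior P) := by
    intro k hk
    obtain ⟨rfl, h1⟩ := mem_vEdge.1 hk
    rcases eq_or_ne y₀ (Y k) with rfl | n1
    · exact hP.vertex_dichotomy (k := k) (u := k) (hP.X_ne k) (hP.Y_ne k).symm
        (by rw [hEdge, uIcc_comm]) rfl hW hzW
    rcases eq_or_ne y₀ (Y (k + 1)) with rfl | n2
    · have := hP.X_ne (k + 1)
      rw [add_sub_cancel_right] at this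
      exact hP.vertex_dichotomy (k := k + 1) (u := k) this.symm (hP.Y_ne k)
        (by rw [hEdge, add_sub_cancel_right]) (by rw [vEdge, uIcc_comm]) hW hzW
    have h2 : min (Y k) (Y (k + 1)) < y₀ := by
      refine lt_of_le_of_ne h1.1 fun h => ?_
      rcases min_choice (Y k) (Y (k + 1)) with h' | h'
      · exact n1 (h.symm.trans h')
      · exact n2 (h.symm.trans h')
    have h3 : y₀ < max (Y k) (Y (k + 1)) := by
      refine lt_of_le_of_ne h1.2 fun h => ?_
      rcases max_choice (Y k) (Y (k + 1)) with h' | h'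
      · exact n1 (h.trans h')
      · exact n2 (h.trans h')
    obtain ⟨ε, hε, hbW, hbE, hside⟩ := hP.vEdge_side h2 h3 hW hzW
    -- Away from the ends of the edge, the interior meets the box in one open half-box.
    refine ⟨_, isOpen_box (X k) y₀ ε, by simpa using hε, fun z hz => hbW z.1 z.2 hz.1 hz.2, ?_⟩
    have hE : ∀ z ∈ {z : Plane | |z.1 - X k| < ε ∧ |z.2 - y₀| < ε}, z ∈ interior P →
        z.1 ≠ X k := fun z hz hi h => (hP.mem_interior.1 hi).2
      (mem_edgeUnion.2 (Or.inr ⟨k, by have := hbE z.2 hz.2; rwa [← h] at this⟩))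
    rcases hside with ⟨a, b⟩ | ⟨a, b⟩
    · have e : {z : Plane | |z.1 - X k| < ε ∧ |z.2 - y₀| < ε} ∩ interior P =
          {z : Plane | |z.1 - X k| < ε ∧ |z.2 - y₀| < ε} ∩ {z | z.1 < X k} := by
        ext z
        refine and_congr_right fun hz => ⟨fun h => ?_, fun h => a z.1 z.2 hz.1 hz.2 h⟩
        exact lt_of_le_of_ne (not_lt.1 fun h' => b z.1 z.2 hz.1 hz.2 h' (interior_subset h))
          (hE z hz h)
      rw [e]
      exact ((convex_box (X k) y₀ ε).inter (convex_halfSpace_lt (f := Prod.fst)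
        (LinearMap.fst ℝ ℝ ℝ).isLinear (X k))).isPreconnected
    · have e : {z : Plane | |z.1 - X k| < ε ∧ |z.2 - y₀| < ε} ∩ interior P =
          {z : Plane | |z.1 - X k| < ε ∧ |z.2 - y₀| < ε} ∩ {z | X k < z.1} := by
        ext z
        refine and_congr_right fun hz => ⟨fun h => ?_, fun h => b z.1 z.2 hz.1 hz.2 h⟩
        exact lt_of_le_of_ne (not_lt.1 fun h' => a z.1 z.2 hz.1 hz.2 h' (interior_subset h))
          (hE z hz h).symm
      rw [e]
      exact ((convex_box (X k) y₀ ε).inter (convex_halfSpace_gt (f := Prod.fst)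
        (LinearMap.fst ℝ ℝ ℝ).isLinear (X k))).isPreconnected
  by_cases hzi : (x₀, y₀) ∈ interior P
  · obtain ⟨ε, hε, hb⟩ := exists_box_subset (hW.inter isOpen_interior) ⟨hzW, hzi⟩
    refine ⟨_, isOpen_box x₀ y₀ ε, by simpa using hε,
      fun z hz => (hb z.1 z.2 hz.1 hz.2).1, ?_⟩
    rw [inter_eq_left.2 fun z hz => (hb z.1 z.2 hz.1 hz.2).2]
    exact (convex_box _ _ _).isPreconnected
  have hzE : (x₀, y₀) ∈ edgeUnion X Y := by
    by_contra h; exact hzi (hP.mem_interior.2 ⟨hz, h⟩)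
  rcases mem_edgeUnion.1 hzE with ⟨k, hk⟩ | ⟨k, hk⟩
  swap
  · exact hv k hk
  obtain ⟨h1, rfl⟩ := mem_hEdge.1 hk
  rcases eq_or_ne x₀ (X (k - 1)) with rfl | n1
  · exact hv (k - 1) (by simp [mem_vEdge])
  rcases eq_or_ne x₀ (X k) with rfl | n2
  · exact hv k (by simp [mem_vEdge])
  have h2 : min (X (k - 1)) (X k) < x₀ := by
    refine lt_of_le_of_ne h1.1 fun h => ?_
    rcases min_choice (X (k - 1)) (X k) with h' | h'
    · exact n1 (h.symm.trans h')
    · exact n2 (h.symm.trans h')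
  have h3 : x₀ < max (X (k - 1)) (X k) := by
    refine lt_of_le_of_ne h1.2 fun h => ?_
    rcases max_choice (X (k - 1)) (X k) with h' | h'
    · exact n1 (h.trans h')
    · exact n2 (h.trans h')
  obtain ⟨ε, hε, hbW, hbE, hside⟩ := hP.hEdge_side h2 h3 hW hzW
  refine ⟨_, isOpen_box x₀ (Y k) ε, by simpa using hε, fun z hz => hbW z.1 z.2 hz.1 hz.2, ?_⟩
  have hE : ∀ z ∈ {z : Plane | |z.1 - x₀| < ε ∧ |z.2 - Y k| < ε}, z ∈ interior P →
      z.2 ≠ Y k := fun z hz hi h => (hP.mem_interior.1 hi).2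
    (mem_edgeUnion.2 (Or.inl ⟨k, by have := hbE z.1 hz.1; rwa [← h] at this⟩))
  rcases hside with ⟨a, b⟩ | ⟨a, b⟩
  · have e : {z : Plane | |z.1 - x₀| < ε ∧ |z.2 - Y k| < ε} ∩ interior P =
        {z : Plane | |z.1 - x₀| < ε ∧ |z.2 - Y k| < ε} ∩ {z | z.2 < Y k} := by
      ext z
      refine and_congr_right fun hz => ⟨fun h => ?_, fun h => a z.1 z.2 hz.1 hz.2 h⟩
      exact lt_of_le_of_ne (not_lt.1 fun h' => b z.1 z.2 hz.1 hz.2 h' (interior_subset h))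
        (hE z hz h)
    rw [e]
    exact ((convex_box _ _ ε).inter (convex_halfSpace_lt (f := Prod.snd)
      (LinearMap.snd ℝ ℝ ℝ).isLinear (Y k))).isPreconnected
  · have e : {z : Plane | |z.1 - x₀| < ε ∧ |z.2 - Y k| < ε} ∩ interior P =
        {z : Plane | |z.1 - x₀| < ε ∧ |z.2 - Y k| < ε} ∩ {z | Y k < z.2} := by
      ext z
      refine and_congr_right fun hz => ⟨fun h => ?_, fun h => b z.1 z.2 hz.1 hz.2 h⟩
      exact lt_of_le_of_ne (not_lt.1 fun h' => a z.1 z.2 hz.1 hz.2 h' (interior_subset h))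
        (hE z hz h).symm
    rw [e]
    exact ((convex_box _ _ ε).inter (convex_halfSpace_gt (f := Prod.snd)
      (LinearMap.snd ℝ ℝ ℝ).isLinear (Y k))).isPreconnected

end IsCyclicPolygon

/-! ### Crossing parity of closed orthogonal chains -/

/-- The indicator of a proposition, modulo two. -/
noncomputable def bit (p : Prop) : ZMod 2 := open Classical in if p then 1 else 0

theorem bit_congr {p q : Prop} (h : p ↔ q) : bit p = bit q := by rw [propext h]

theorem bit_true {p : Prop} (h : p) : bit p = 1 := by simp [bit, h]

theorem bit_false {p : Prop} (h : ¬ p) : bit p = 0 := by simp [bit, h]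

theorem bit_add_bit_of_iff {p q : Prop} (h : p ↔ q) : bit p + bit q = 0 := by
  rw [bit_congr h]; exact CharTwo.add_self_eq_zero _

/-- The parity of the number of horizontal edges above `(x, y)` of the closed orthogonal chain with
`x`-coordinates `a 0, …, a s` and heights `h 1, …, h s, c`. -/
noncomputable def chainParity (a h : ℕ → ℝ) (c : ℝ) (s : ℕ) (x y : ℝ) : ZMod 2 :=
  ∑ j ∈ Finset.range s, bit (y < h (j + 1)) * (bit (a j ≤ x) + bit (a (j + 1) ≤ x)) +
    bit (y < c) * (bit (a 0 ≤ x) + bit (a s ≤ x))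

/-- The bracket vanishes unless `x` lies between the ends of the horizontal edge, and only then does
crossing its height matter. -/
theorem bit_mul_vertical {x y y' p q c : ℝ} (h : x ∈ uIcc p q → c ∉ uIcc y y') :
    bit (y < c) * (bit (p ≤ x) + bit (q ≤ x)) = bit (y' < c) * (bit (p ≤ x) + bit (q ≤ x)) := by
  by_cases hx : x ∈ uIcc p q
  · have := h hx
    rw [mem_uIcc, not_or] at this
    rw [bit_congr (p := y < c) (q := y' < c)]
    constructor
    · intro h1
      by_contra h2
      exact this.1 ⟨h1.le, by linarith⟩
    · intro h1
      by_contra h2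
      exact this.2 ⟨h1.le, by linarith⟩
  · rw [mem_uIcc, not_or] at hx
    have : p ≤ x ↔ q ≤ x := by
      constructor
      · intro h1; by_contra h2; exact hx.1 ⟨h1, by linarith⟩
      · intro h1; by_contra h2; exact hx.2 ⟨h1, by linarith⟩
    rw [bit_add_bit_of_iff this, mul_zero, mul_zero]

theorem chainParity_vertical {a h : ℕ → ℝ} {c : ℝ} {s : ℕ} {x y y' : ℝ}
    (h1 : ∀ j < s, x ∈ uIcc (a j) (a (j + 1)) → h (j + 1) ∉ uIcc y y')
    (h2 : x ∈ uIcc (a 0) (a s) → c ∉ uIcc y y') :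
    chainParity a h c s x y = chainParity a h c s x y' := by
  unfold chainParity
  rw [bit_mul_vertical h2]
  congr 1
  refine Finset.sum_congr rfl fun j hj => bit_mul_vertical (h1 j (Finset.mem_range.1 hj))

theorem sum_range_adjacent (z : ℕ → ZMod 2) (s : ℕ) :
    ∑ j ∈ Finset.range s, (z j + z (j + 1)) = z 0 + z s := by
  induction s with
  | zero => simp [CharTwo.add_self_eq_zero]
  | succ s ih =>
    rw [Finset.sum_range_succ, ih]
    have := CharTwo.add_self_eq_zero (z s)
    linear_combination this

theorem bit_mul_horizontal {x x' y a p q : ℝ} (h : a ∈ uIcc x x' → y ∉ uIcc p q) :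
    bit (y < p) * (bit (a ≤ x) + bit (a ≤ x')) = bit (y < q) * (bit (a ≤ x) + bit (a ≤ x')) := by
  by_cases ha : a ∈ uIcc x x'
  · have := h ha
    rw [mem_uIcc, not_or] at this
    rw [bit_congr (p := y < p) (q := y < q)]
    constructor
    · intro h1
      by_contra h2
      exact this.2 ⟨by linarith, h1.le⟩
    · intro h1
      by_contra h2
      exact this.1 ⟨by linarith, h1.le⟩
  · rw [mem_uIcc, not_or] at ha
    have : a ≤ x ↔ a ≤ x' := by
      constructor
      · intro h1; by_contra h2; exact ha.2 ⟨by linarith, h1⟩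
      · intro h1; by_contra h2; exact ha.1 ⟨by linarith, h1⟩
    rw [bit_add_bit_of_iff this, mul_zero, mul_zero]

/-- The change of the parity is regrouped by the vertical edges of the chain: each passed abscissa
occurs with the heights of both ends of its vertical edge. As `y` is not between these heights, the
two contributions agree and cancel modulo two. -/
theorem chainParity_horizontal {a h : ℕ → ℝ} {c : ℝ} {s : ℕ} {x x' y : ℝ}
    (h1 : ∀ j, 0 < j → j < s → a j ∈ uIcc x x' → y ∉ uIcc (h j) (h (j + 1)))
    (h0 : a 0 ∈ uIcc x x' → y ∉ uIcc c (h 1))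
    (h2 : a s ∈ uIcc x x' → y ∉ uIcc (h s) c) :
    chainParity a h c s x y = chainParity a h c s x' y := by
  rw [← sub_eq_zero, CharTwo.sub_eq_add]
  set δ : ℕ → ZMod 2 := fun j => bit (a j ≤ x) + bit (a j ≤ x') with hδ
  -- The contribution of the vertical edge at `a j`, read off at its end of height `h j`. The two
  -- extreme vertical edges have an end at the closing height `c`, which is used for them instead.
  set z : ℕ → ZMod 2 := fun j => bit (y < if j = 0 ∨ j = s then c else h j) * δ j with hz
  have z0 : z 0 = bit (y < c) * δ 0 := by simp [hz]
  have zs : z s = bit (y < c) * δ s := by simp [hz]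
  have e1 : ∀ j < s, bit (y < h (j + 1)) * δ j = z j := by
    intro j hj
    by_cases hj0 : j = 0
    · subst hj0
      rw [z0]; exact (bit_mul_horizontal h0).symm
    · simp only [hz, hj0, hj.ne, or_self, if_false]
      exact (bit_mul_horizontal (h1 j (Nat.pos_of_ne_zero hj0) hj)).symm
  have e2 : ∀ j < s, bit (y < h (j + 1)) * δ (j + 1) = z (j + 1) := by
    intro j hj
    by_cases hjs : j + 1 = s
    · rw [hjs, zs]; exact bit_mul_horizontal h2
    · simp only [hz, hjs, Nat.succ_ne_zero, or_self, if_false]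
  have e3 : ∑ j ∈ Finset.range s, bit (y < h (j + 1)) * (δ j + δ (j + 1)) = z 0 + z s := by
    rw [← sum_range_adjacent]
    refine Finset.sum_congr rfl fun j hj => ?_
    rw [mul_add, e1 j (Finset.mem_range.1 hj), e2 j (Finset.mem_range.1 hj)]
  have e4 : bit (y < c) * (δ 0 + δ s) = z 0 + z s := by rw [z0, zs, mul_add]
  have e5 : chainParity a h c s x y + chainParity a h c s x' y =
      ∑ j ∈ Finset.range s, bit (y < h (j + 1)) * (δ j + δ (j + 1)) +
        bit (y < c) * (δ 0 + δ s) := by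
    have : ∀ j, bit (y < h (j + 1)) * (δ j + δ (j + 1)) =
        bit (y < h (j + 1)) * (bit (a j ≤ x) + bit (a (j + 1) ≤ x)) +
        bit (y < h (j + 1)) * (bit (a j ≤ x') + bit (a (j + 1) ≤ x')) := fun j => by
      simp only [hδ]; ring
    simp only [this, Finset.sum_add_distrib]
    simp only [chainParity, hδ]
    ring
  rw [e5, e3, e4]
  exact CharTwo.add_self_eq_zero _

/-! ### The potential of a piece, and the rank argument -/

namespace IsCyclicPolygon

variable {m : ℕ} {X Y : ZMod m → ℝ} {P : Set Plane}

/-- A function that is locally constant in the interior of `P` away from a closed set `K` extends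
to a function that is constant on the connected subsets of `P` that avoid `K`. -/
theorem exists_extension (hP : IsCyclicPolygon X Y P) [NeZero m] {K : Set Plane} (hK : IsClosed K)
    {β : Type*} (F : Plane → β)
    (hF : ∀ z ∈ interior P \ K, ∃ U, IsOpen U ∧ z ∈ U ∧ ∀ w ∈ U, F w = F z) :
    ∃ G : Plane → β, (∀ z ∈ interior P \ K, G z = F z) ∧
      ∀ S, IsPreconnected S → S ⊆ P → Disjoint S K → ∀ z ∈ S, ∀ w ∈ S, G z = G w := by
  classical
  -- Each point of `P \ K` gets a neighbourhood whose trace on the interior is connected. `F` is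
  -- constant on this trace, and its value there serves as `G z`, also when `z` is a boundary point.
  have ex : ∀ z : Plane, ∃ U : Set Plane, z ∈ P \ K →
      IsOpen U ∧ z ∈ U ∧ U ⊆ Kᶜ ∧ IsPreconnected (U ∩ interior P) := by
    intro z
    by_cases h : z ∈ P \ K
    · obtain ⟨U, hU⟩ := hP.exists_preconnected h.1 hK.isOpen_compl h.2
      exact ⟨U, fun _ => hU⟩
    · exact ⟨∅, fun h' => absurd h' h⟩
  choose U hU using ex
  have ne : ∀ z ∈ P, ∀ V, IsOpen V → z ∈ V → (V ∩ interior P).Nonempty := by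
    intro z hz V hV hzV
    rw [← hP.closure_interior] at hz
    exact mem_closure_iff.1 hz V hV hzV
  have ex2 : ∀ z : Plane, ∃ w : Plane, z ∈ P \ K → w ∈ U z ∩ interior P := by
    intro z
    by_cases h : z ∈ P \ K
    · obtain ⟨w, hw⟩ := ne z h.1 (U z) (hU z h).1 (hU z h).2.1
      exact ⟨w, fun _ => hw⟩
    · exact ⟨z, fun h' => absurd h' h⟩
  choose p hp using ex2
  have hconst : ∀ z ∈ P \ K, ∀ w ∈ U z ∩ interior P, F w = F (p z) := by
    intro z hz w hw
    refine (hU z hz).2.2.2.eq_of_locally_eq (F := F) ?_ hw (hp z hz)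
    intro v hv
    obtain ⟨V, hV, hvV, hc⟩ := hF v ⟨hv.2, (hU z hz).2.2.1 hv.1⟩
    exact ⟨V, hV, hvV, fun u hu => hc u hu.1⟩
  refine ⟨fun z => F (p z), ?_, ?_⟩
  · intro z hz
    have hz' : z ∈ P \ K := ⟨interior_subset hz.1, hz.2⟩
    exact (hconst z hz' z ⟨(hU z hz').2.1, hz.1⟩).symm
  · intro S hS hSP hSK z hz w hw
    refine hS.eq_of_locally_eq (F := fun z => F (p z)) ?_ hz hw
    intro v hv
    have hv' : v ∈ P \ K := ⟨hSP hv, disjoint_left.1 hSK hv⟩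
    refine ⟨U v, (hU v hv').1, (hU v hv').2.1, fun u hu => ?_⟩
    have hu' : u ∈ P \ K := ⟨hSP hu.2, disjoint_left.1 hSK hu.2⟩
    -- Traces belonging to nearby points share an interior point, so their constant values agree and
    -- `G` is locally constant.
    obtain ⟨q, ⟨hq1, hq2⟩, hq3⟩ := ne u hu'.1 (U u ∩ U v) ((hU u hu').1.inter (hU v hv').1)
      ⟨(hU u hu').2.1, hu.1⟩
    exact (hconst u hu' q ⟨hq1, hq3⟩).symm.trans (hconst v hv' q ⟨hq2, hq3⟩)

theorem hExtension_subset (_ : IsCyclicPolygon X Y P) (k : ZMod m) : hExtension X Y P k ⊆ P := by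
  rintro z ⟨-, q, -, hs⟩
  exact hs (left_mem_segment ℝ z q)

theorem hEdge_subset_hExtension (hP : IsCyclicPolygon X Y P) (k : ZMod m) :
    hEdge X Y k ⊆ hExtension X Y P k := by
  rintro ⟨x, y⟩ hz
  obtain ⟨h1, h2⟩ := mem_hEdge.1 hz
  refine mem_hExtension.2 ⟨h2, x, h1, fun s hs => ?_⟩
  rw [uIcc_self, mem_singleton_iff] at hs
  exact hs ▸ hP.hEdge_subset k hz

/-- The separation of the extensions by a chord in the piece between `l`, `r`, `b` and `t`. -/
theorem exists_potential (hP : IsCyclicPolygon X Y P) [NeZero m] {l r : ZMod m} {b t : ℝ}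
    (h : IsPiece X Y P l r b t) :
    ∃ f : ZMod m → ZMod 2,
      (∀ k k', hExtension X Y P k = hExtension X Y P k' → f k = f k') ∧
      (∀ l' r' b' t', IsPiece X Y P l' r' b' t' →
        (Icc (X l) (X r) ×ˢ Icc b t : Set Plane) ≠ Icc (X l') (X r') ×ˢ Icc b' t' →
        ∀ k k', Touches X l' r' k → Y k = b' → Touches X l' r' k' → Y k' = t' → f k = f k') ∧
      (∀ k k', Touches X l r k → Y k = b → Touches X l r k' → Y k' = t → f k ≠ f k') := by
  set c := (b + t) / 2 with hc
  have hbt := h.lt_y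
  have hlr := h.lt_x
  have hbc : b < c := by rw [hc]; linarith
  have hct : c < t := by rw [hc]; linarith
  -- The chain follows the boundary from height `c` on the vertical edge `l` forward to height `c`
  -- on `r`, passing `s` horizontal edges; the chord at height `c` closes it.
  set s := (r - l).val with hs
  have hsr : l + (s : ZMod m) = r := by rw [hs, ZMod.natCast_zmod_val]; ring
  set a : ℕ → ℝ := fun j => X (l + j) with ha
  set hh : ℕ → ℝ := fun j => Y (l + j) with hhh
  have a0 : a 0 = X l := by simp [ha]
  have as : a s = X r := by simp [ha, hsr]
  have hh1 : hh 1 = Y (l + 1) := by simp [hhh]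
  have hhs : hh s = Y r := by simp [hhh, hsr]
  have hE : ∀ j : ℕ, hEdge X Y (l + (j + 1 : ℕ)) = uIcc (a j) (a (j + 1)) ×ˢ {hh (j + 1)} := by
    intro j
    have : l + ((j + 1 : ℕ) : ZMod m) - 1 = l + j := by push_cast; ring
    simp only [hEdge, ha, hhh, this]
  have vE : ∀ j : ℕ, vEdge X Y (l + j) = {a j} ×ˢ uIcc (hh j) (hh (j + 1)) := by
    intro j
    have : l + (j : ZMod m) + 1 = l + (j + 1 : ℕ) := by push_cast; ring
    simp only [vEdge, ha, hhh, this]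
  set K : Set Plane := Icc (X l) (X r) ×ˢ {c} with hK
  have hKc : IsClosed K := isClosed_Icc.prod isClosed_singleton
  set F : Plane → ZMod 2 := fun z => chainParity a hh c s z.1 z.2 with hF
  have cl : c ∈ uIcc (Y l) (Y (l + 1)) := ⟨h.lo_l.trans hbc.le, hct.le.trans h.hi_l⟩
  have cr : c ∈ uIcc (Y r) (Y (r + 1)) := ⟨h.lo_r.trans hbc.le, hct.le.trans h.hi_r⟩
  -- A vertical move inside the box crosses neither horizontal edges nor the chord. A horizontal
  -- move crosses no vertical edge; by `cl` and `cr` the extreme parts of the chain lie within the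
  -- edges `l` and `r`.
  have hFloc : ∀ z ∈ interior P \ K, ∃ U, IsOpen U ∧ z ∈ U ∧ ∀ w ∈ U, F w = F z := by
    rintro ⟨x₀, y₀⟩ ⟨hz, hzK⟩
    have hzE := (hP.mem_interior.1 hz).2
    rw [mem_edgeUnion, not_or, not_exists, not_exists] at hzE
    obtain ⟨ε, hε, hb⟩ := hP.exists_box_avoiding hKc.isOpen_compl hzK
    have nH : ∀ x y, |x - x₀| < ε → |y - y₀| < ε → ∀ k, (x, y) ∉ hEdge X Y k :=
      fun x y hx hy k hk => hzE.1 k ((hb x y hx hy).2.1 k hk)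
    have nV : ∀ x y, |x - x₀| < ε → |y - y₀| < ε → ∀ k, (x, y) ∉ vEdge X Y k :=
      fun x y hx hy k hk => hzE.2 k ((hb x y hx hy).2.2 k hk)
    have nK : ∀ x y, |x - x₀| < ε → |y - y₀| < ε → (x, y) ∉ K :=
      fun x y hx hy => (hb x y hx hy).1
    have btw : ∀ p q u : ℝ, |p - q| < ε → u ∈ uIcc p q → |u - q| < ε := by
      intro p q u h1 h2
      rw [mem_uIcc] at h2
      rw [abs_lt] at h1 ⊢
      rcases h2 with h2 | h2 <;> constructor <;> linarith
    refine ⟨_, isOpen_box x₀ y₀ ε, by simpa using hε, ?_⟩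
    rintro ⟨x, y⟩ ⟨hx, hy⟩
    simp only at hx hy
    have e1 : F (x, y) = F (x, y₀) := by
      refine chainParity_vertical ?_ ?_
      · intro j hj h1 h2
        refine nH x _ hx (btw y y₀ _ hy h2) (l + (j + 1 : ℕ)) ?_
        rw [hE]; exact ⟨h1, rfl⟩
      · intro h1 h2
        refine nK x _ hx (btw y y₀ _ hy h2) ?_
        rw [a0, as, uIcc_of_le hlr.le] at h1
        exact ⟨h1, rfl⟩
    have e2 : F (x, y₀) = F (x₀, y₀) := by
      have hy0 : |y₀ - y₀| < ε := by simpa using hε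
      refine chainParity_horizontal ?_ ?_ ?_
      · intro j _ _ h1 h2
        refine nV _ y₀ (btw x x₀ _ hx h1) hy0 (l + j) ?_
        rw [vE]; exact ⟨rfl, h2⟩
      · intro h1 h2
        refine nV _ y₀ (btw x x₀ _ hx h1) hy0 l ?_
        rw [a0, mem_vEdge]
        rw [hh1] at h2
        exact ⟨rfl, uIcc_subset_uIcc cl right_mem_uIcc h2⟩
      · intro h1 h2
        refine nV _ y₀ (btw x x₀ _ hx h1) hy0 r ?_
        rw [as, mem_vEdge]
        rw [hhs] at h2
        exact ⟨rfl, uIcc_subset_uIcc left_mem_uIcc cr h2⟩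
    exact e1.trans e2
  obtain ⟨G, hG1, hG2⟩ := hP.exists_extension hKc F hFloc
  have hextK : ∀ k, Disjoint (hExtension X Y P k) K := by
    intro k
    rw [disjoint_left]
    rintro ⟨x, y⟩ hz ⟨hx, hy⟩
    simp only [mem_singleton_iff] at hx hy
    subst hy
    exact h.not_mem_hExtension hP hx ⟨hbc, hct⟩ k hz
  have cornerE : ∀ k, (X k, Y k) ∈ hEdge X Y k := fun k => mem_hEdge.2 ⟨right_mem_uIcc, rfl⟩
  have pcE : ∀ k, IsPreconnected (hEdge X Y k) := fun k =>
    isPreconnected_horizontal isPreconnected_uIcc _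
  have hGE : ∀ k, ∀ z ∈ hEdge X Y k, ∀ w ∈ hEdge X Y k, G z = G w := fun k =>
    hG2 _ (pcE k) (hP.hEdge_subset k) ((hextK k).mono_left (hP.hEdge_subset_hExtension k))
  have hGrect : ∀ l' r' b' t', IsPiece X Y P l' r' b' t' → ∀ S : Set Plane, IsPreconnected S →
      S ⊆ Icc (X l') (X r') ×ˢ Icc b' t' → Disjoint S K → ∀ z ∈ S, ∀ w ∈ S, G z = G w :=
    fun l' r' b' t' h' S hS hsub hd => hG2 S hS (hsub.trans (h'.Icc_subset hP)) hd
  have touch : ∀ l' r' k, X l' ≤ X r' → Touches X l' r' k →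
      ∃ x ∈ Icc (X l') (X r'), (x, Y k) ∈ hEdge X Y k := by
    intro l' r' k hlr' hk
    refine ⟨max (min (X (k - 1)) (X k)) (X l'), ⟨le_max_right _ _, max_le hk.1 hlr'⟩, ?_⟩
    exact mem_hEdge.2 ⟨⟨le_max_left _ _, max_le min_le_max hk.2⟩, rfl⟩
  -- The potential of an extension is the value of `G` at a corner of any of its edges: extensions
  -- avoid the chord, so `G` does not change along them.
  refine ⟨fun k => G (X k, Y k), ?_, ?_, ?_⟩
  · intro k k' hkk
    have h1 : (X k, Y k) ∈ hExtension X Y P k' := hkk ▸ hP.hEdge_subset_hExtension k (cornerE k)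
    obtain ⟨h2, q, hq, hseg⟩ := mem_hExtension.1 h1
    have h3 : (q, Y k) ∈ hEdge X Y k' := mem_hEdge.2 ⟨hq, h2⟩
    have h4 : uIcc (X k) q ×ˢ {Y k} ⊆ hExtension X Y P k' := by
      rintro ⟨x, y⟩ ⟨hx, hy⟩
      simp only [mem_singleton_iff] at hx hy
      subst hy
      exact mem_hExtension.2 ⟨h2, q, hq, fun s hs =>
        hseg s (uIcc_subset_uIcc hx right_mem_uIcc hs)⟩
    have h5 := hG2 _ (isPreconnected_horizontal (isPreconnected_uIcc (a := X k) (b := q)) (Y k))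
      (h4.trans (hP.hExtension_subset k')) ((hextK k').mono_left h4) (X k, Y k)
      ⟨left_mem_uIcc, rfl⟩ (q, Y k) ⟨right_mem_uIcc, rfl⟩
    exact h5.trans (hGE k' _ h3 _ (cornerE k'))
  · intro l' r' b' t' h' hne k k' hk hkb hk' hkt
    -- Near a point of the chord, interior points of `P` belong to the open piece of the chord; at
    -- the ends this holds because `P` is on one side of `l` and of `r` only. A second rectangle
    -- through such a point would share interior points with that piece.
    have hd : Disjoint (Icc (X l') (X r') ×ˢ Icc b' t' : Set Plane) K := by
      rw [disjoint_left]
      rintro ⟨x, y⟩ hz ⟨hx, hy⟩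
      simp only [mem_singleton_iff] at hx hy
      subst hy
      have hnd : ∀ U, IsOpen U → (x, c) ∈ U →
          U ∩ interior P ⊆ Ioo (X l) (X r) ×ˢ Ioo b t → False := by
        intro U hU hxU hsub
        rw [← h'.closure_eq] at hz
        obtain ⟨w, hw, hw'⟩ := mem_closure_iff.1 hz U hU hxU
        exact hne (hP.isPiece_unique h h' ⟨w, hsub ⟨hw, h'.subset_interior hP hw'⟩, hw'⟩)
      rcases hx.1.lt_or_eq with h1 | h1
      · rcases hx.2.lt_or_eq with h2 | h2
        · exact hnd _ (isOpen_Ioo.prod isOpen_Ioo) ⟨⟨h1, h2⟩, hbc, hct⟩ inter_subset_left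
        · subst h2
          obtain ⟨ε, hε, hW, hv, hside⟩ := hP.vEdge_side (k := r) (y₀ := c)
            (W := Ioi (X l) ×ˢ Ioo b t)
            (h.lo_r.trans_lt hbc) (hct.trans_le h.hi_r) (isOpen_Ioi.prod isOpen_Ioo)
            ⟨hlr, hbc, hct⟩
          have hside' : ∀ x y, |x - X r| < ε → |y - c| < ε → X r < x → (x, y) ∉ P := by
            rcases hside with hs | hs
            · exact hs.2
            · exfalso
              have hpos : 0 < min (ε / 2) ((X r - X l) / 2) := lt_min (by linarith) (by linarith)
              have m1 := min_le_left (ε / 2) ((X r - X l) / 2)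
              have m2 := min_le_right (ε / 2) ((X r - X l) / 2)
              refine hs.1 (X r - min (ε / 2) ((X r - X l) / 2)) c
                (by rw [abs_lt]; constructor <;> linarith) (by simpa using hε) (by linarith)
                (interior_subset (h.subset_interior hP ⟨⟨?_, ?_⟩, hbc, hct⟩))
              all_goals simp only; linarith
          refine hnd _ (isOpen_box (X r) c ε) (by simpa using hε) ?_
          rintro ⟨x, y⟩ ⟨⟨hx, hy⟩, hi⟩
          have hWxy := hW x y hx hy
          refine ⟨⟨hWxy.1, lt_of_le_of_ne (not_lt.1 fun h3 =>
            hside' x y hx hy h3 (interior_subset hi)) ?_⟩, hWxy.2⟩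
          rintro rfl
          exact (hP.mem_interior.1 hi).2 (mem_edgeUnion.2 (Or.inr ⟨r, hv y hy⟩))
      · subst h1
        obtain ⟨ε, hε, hW, hv, hside⟩ := hP.vEdge_side (k := l) (y₀ := c)
          (W := Iio (X r) ×ˢ Ioo b t)
          (h.lo_l.trans_lt hbc) (hct.trans_le h.hi_l) (isOpen_Iio.prod isOpen_Ioo)
          ⟨hlr, hbc, hct⟩
        have hside' : ∀ x y, |x - X l| < ε → |y - c| < ε → x < X l → (x, y) ∉ P := by
          rcases hside with hs | hs
          · exfalso
            have hpos : 0 < min (ε / 2) ((X r - X l) / 2) := lt_min (by linarith) (by linarith)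
            have m1 := min_le_left (ε / 2) ((X r - X l) / 2)
            have m2 := min_le_right (ε / 2) ((X r - X l) / 2)
            refine hs.2 (X l + min (ε / 2) ((X r - X l) / 2)) c
              (by rw [abs_lt]; constructor <;> linarith) (by simpa using hε) (by linarith)
              (interior_subset (h.subset_interior hP ⟨⟨?_, ?_⟩, hbc, hct⟩))
            all_goals simp only; linarith
          · exact hs.1
        refine hnd _ (isOpen_box (X l) c ε) (by simpa using hε) ?_
        rintro ⟨x, y⟩ ⟨⟨hx, hy⟩, hi⟩
        have hWxy := hW x y hx hy
        refine ⟨⟨lt_of_le_of_ne (not_lt.1 fun h3 =>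
          hside' x y hx hy h3 (interior_subset hi)) ?_, hWxy.1⟩, hWxy.2⟩
        rintro rfl
        exact (hP.mem_interior.1 hi).2 (mem_edgeUnion.2 (Or.inr ⟨l, hv y hy⟩))
    obtain ⟨x, hx, hxE⟩ := touch l' r' k h'.lt_x.le hk
    obtain ⟨x', hx', hxE'⟩ := touch l' r' k' h'.lt_x.le hk'
    have e := hGrect l' r' b' t' h' _ (isPreconnected_Icc.prod isPreconnected_Icc) subset_rfl hd
      (x, Y k) ⟨hx, hkb.ge, hkb.le.trans h'.lt_y.le⟩ (x', Y k') ⟨hx', h'.lt_y.le.trans hkt.ge, hkt.le⟩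
    exact (hGE k _ (cornerE k) _ hxE).trans (e.trans (hGE k' _ hxE' _ (cornerE k')))
  · intro k k' hk hkb hk' hkt hcon
    obtain ⟨x, hx, hxE⟩ := touch l r k hlr.le hk
    obtain ⟨x', hx', hxE'⟩ := touch l r k' hlr.le hk'
    set xm := (X l + X r) / 2 with hxm
    have hxm1 : X l < xm := by rw [hxm]; linarith
    have hxm2 : xm < X r := by rw [hxm]; linarith
    set y1 := (b + c) / 2 with hy1
    set y2 := (c + t) / 2 with hy2
    have i1 : (xm, y1) ∈ interior P \ K := by
      refine ⟨h.subset_interior hP ⟨⟨hxm1, hxm2⟩, ?_, ?_⟩, ?_⟩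
      · simp only; linarith
      · simp only; linarith
      · rintro ⟨-, e⟩
        simp only [mem_singleton_iff] at e
        linarith
    have i2 : (xm, y2) ∈ interior P \ K := by
      refine ⟨h.subset_interior hP ⟨⟨hxm1, hxm2⟩, ?_, ?_⟩, ?_⟩
      · simp only; linarith
      · simp only; linarith
      · rintro ⟨-, e⟩
        simp only [mem_singleton_iff] at e
        linarith
    have g1 : G (x, Y k) = G (xm, y1) := by
      refine hGrect l r b t h (Icc (X l) (X r) ×ˢ Ico b c) (isPreconnected_Icc.prod isPreconnected_Ico)
        (prod_mono_right (Ico_subset_Icc_self.trans (Icc_subset_Icc_right hct.le))) ?_ _ ?_ _ ?_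
      · rw [disjoint_left]
        rintro z ⟨-, hz⟩ ⟨-, hz'⟩
        rw [mem_singleton_iff] at hz'
        exact absurd hz.2 (by rw [hz']; exact lt_irrefl _)
      · exact ⟨hx, hkb.ge, by rw [hkb]; exact hbc⟩
      · exact ⟨⟨hxm1.le, hxm2.le⟩, by simp only; linarith, by simp only; linarith⟩
    have g2 : G (x', Y k') = G (xm, y2) := by
      refine hGrect l r b t h (Icc (X l) (X r) ×ˢ Ioc c t) (isPreconnected_Icc.prod isPreconnected_Ioc)
        (prod_mono_right (Ioc_subset_Icc_self.trans (Icc_subset_Icc_left hbc.le))) ?_ _ ?_ _ ?_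
      · rw [disjoint_left]
        rintro z ⟨-, hz⟩ ⟨-, hz'⟩
        rw [mem_singleton_iff] at hz'
        exact absurd hz.1 (by rw [hz']; exact lt_irrefl _)
      · exact ⟨hx', by rw [hkt]; exact hct, hkt.le⟩
      · exact ⟨⟨hxm1.le, hxm2.le⟩, by simp only; linarith, by simp only; linarith⟩
    have e1 : F (xm, y1) = F (xm, y2) := by
      rw [← hG1 _ i1, ← hG1 _ i2, ← g1, ← g2]
      exact (hGE k _ hxE _ (cornerE k)).trans (hcon.trans (hGE k' _ (cornerE k') _ hxE'))
    -- Between the two test points no horizontal edge of the boundary is crossed, since the open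
    -- piece contains none. Only the term of the chord changes.
    have e2 : ∑ j ∈ Finset.range s, bit (y1 < hh (j + 1)) * (bit (a j ≤ xm) + bit (a (j + 1) ≤ xm))
        = ∑ j ∈ Finset.range s, bit (y2 < hh (j + 1)) * (bit (a j ≤ xm) + bit (a (j + 1) ≤ xm)) := by
      refine Finset.sum_congr rfl fun j _ => bit_mul_vertical fun h1 h2 => ?_
      rw [uIcc_of_le (by linarith)] at h2
      have m1 : (xm, hh (j + 1)) ∈ Ioo (X l) (X r) ×ˢ Ioo b t :=
        ⟨⟨hxm1, hxm2⟩, by simp only; linarith [h2.1], by simp only; linarith [h2.2]⟩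
      refine disjoint_left.1 h.disjoint_edgeUnion m1
        (mem_edgeUnion.2 (Or.inl ⟨l + (j + 1 : ℕ), ?_⟩))
      rw [hE]; exact ⟨h1, rfl⟩
    simp only [hF, chainParity, e2, add_right_inj] at e1
    rw [bit_true (by linarith : y1 < c), bit_false (by linarith : ¬ y2 < c), a0, as,
      bit_true hxm1.le, bit_false (not_le.2 hxm2)] at e1
    simp at e1

/-- The number of pieces is smaller than the number of extensions. -/
theorem ncard_pieces_lt (hP : IsCyclicPolygon X Y P) [NeZero m] :
    (pieces X Y P).ncard + 1 ≤ (range (hExtension X Y P)).ncard := by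
  classical
  have : Finite (pieces X Y P) := hP.finite_pieces
  have : Fintype (pieces X Y P) := Fintype.ofFinite _
  have : Fintype (range (hExtension X Y P)) := Fintype.ofFinite _
  have ex : ∀ K : pieces X Y P, ∃ l r b t kb kt, IsPiece X Y P l r b t ∧
      K.1 = Icc (X l) (X r) ×ˢ Icc b t ∧ Touches X l r kb ∧ Y kb = b ∧ Touches X l r kt ∧
      Y kt = t := by
    rintro ⟨K, l, r, b, t, h, rfl⟩
    obtain ⟨kb, h1, h2⟩ := h.bottom
    obtain ⟨kt, h3, h4⟩ := h.top
    exact ⟨l, r, b, t, kb, kt, h, rfl, h1, h2, h3, h4⟩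
  choose l r b t kb kt hpiece hrect hb1 hb2 ht1 ht2 using ex
  have exf := fun K : pieces X Y P => hP.exists_potential (hpiece K)
  choose f hf1 hf2 hf3 using exf
  let e : ZMod m → range (hExtension X Y P) := fun k => ⟨hExtension X Y P k, k, rfl⟩
  have exg : ∀ K : pieces X Y P, ∃ g : range (hExtension X Y P) → ZMod 2,
      ∀ k, g (e k) = f K k := by
    intro K
    refine ⟨fun S => f K S.2.choose, fun k => hf1 K _ _ ?_⟩
    exact (e k).2.choose_spec
  choose g hg using exg
  -- Difference of the values at top and bottom of each piece, written as a sum modulo two. The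
  -- potential of a piece is sent to the corresponding basis vector.
  let Φ : (range (hExtension X Y P) → ZMod 2) →ₗ[ZMod 2] (pieces X Y P → ZMod 2) :=
    { toFun := fun φ K => φ (e (kt K)) + φ (e (kb K))
      map_add' := fun φ ψ => by ext K; simp only [Pi.add_apply]; ring
      map_smul' := fun c φ => by ext K; simp only [Pi.smul_apply, smul_eq_mul, RingHom.id_apply]; ring }
  have hΦ : ∀ K, Φ (g K) = Pi.single K 1 := by
    intro K
    ext L
    change g K (e (kt L)) + g K (e (kb L)) = _
    rw [hg, hg]
    by_cases hKL : L = K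
    · subst hKL
      rw [Pi.single_eq_same]
      have := hf3 L (kb L) (kt L) (hb1 L) (hb2 L) (ht1 L) (ht2 L)
      revert this
      generalize f L (kb L) = p
      generalize f L (kt L) = q
      revert p q; decide
    · rw [Pi.single_eq_of_ne hKL]
      have hne : K.1 ≠ L.1 := fun h => hKL (Subtype.ext h).symm
      rw [hrect K, hrect L] at hne
      rw [hf2 K _ _ _ _ (hpiece L) hne _ _ (hb1 L) (hb2 L) (ht1 L) (ht2 L)]
      exact CharTwo.add_self_eq_zero _
  have hsurj : LinearMap.range Φ = ⊤ := by
    rw [eq_top_iff, ← (Pi.basisFun (ZMod 2) (pieces X Y P)).span_eq, Submodule.span_le]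
    rintro _ ⟨K, rfl⟩
    rw [Pi.basisFun_apply]
    exact ⟨g K, hΦ K⟩
  have hker : 1 ≤ Module.finrank (ZMod 2) (LinearMap.ker Φ) := by
    rw [Nat.one_le_iff_ne_zero, ← Nat.pos_iff_ne_zero, Module.finrank_pos_iff_exists_ne_zero]
    refine ⟨⟨fun _ => 1, ?_⟩, ?_⟩
    · rw [LinearMap.mem_ker]; ext K; exact CharTwo.add_self_eq_zero _
    · intro h0
      have := congrFun (congrArg Subtype.val h0) (e 0)
      exact one_ne_zero this
  have hrank := Φ.finrank_range_add_finrank_ker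
  rw [hsurj, finrank_top, Module.finrank_pi, Module.finrank_pi] at hrank
  rw [← Nat.card_coe_set_eq, ← Nat.card_coe_set_eq, Nat.card_eq_fintype_card,
    Nat.card_eq_fintype_card]
  omega

end IsCyclicPolygon

/-! ## Top and bottom edges, hidden sets, and parity along vertical lines -/

/-- The midpoint of a horizontal edge. -/
noncomputable def hMid {m : ℕ} (X Y : ZMod m → ℝ) (k : ZMod m) : Plane :=
  ((X (k - 1) + X k) / 2, Y k)

/-- The horizontal edge `k` bounds `P` from above. -/
def IsTopH {m : ℕ} (X Y : ZMod m → ℝ) (P : Set Plane) (k : ZMod m) : Prop :=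
  ∀ᶠ ε : ℝ in 𝓝[>] 0, hMid X Y k + (0, ε) ∉ P

/-- The horizontal edge `k` bounds `P` from below. -/
def IsBottomH {m : ℕ} (X Y : ZMod m → ℝ) (P : Set Plane) (k : ZMod m) : Prop :=
  ∀ᶠ ε : ℝ in 𝓝[>] 0, hMid X Y k - (0, ε) ∉ P

/-- The horizontal edge `k` covers the abscissa `x`. -/
def Covers {m : ℕ} (X : ZMod m → ℝ) (x : ℝ) (k : ZMod m) : Prop :=
  min (X (k - 1)) (X k) < x ∧ x < max (X (k - 1)) (X k)

namespace IsCyclicPolygon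

variable {m : ℕ} {X Y : ZMod m → ℝ} {P : Set Plane}

theorem covers_mid (hP : IsCyclicPolygon X Y P) (k : ZMod m) :
    Covers X ((X (k - 1) + X k) / 2) k := by
  constructor
  · rcases lt_or_gt_of_ne (hP.X_ne k) with h | h
    · exact (min_le_left _ _).trans_lt (by linarith)
    · exact (min_le_right _ _).trans_lt (by linarith)
  · rcases lt_or_gt_of_ne (hP.X_ne k) with h | h
    · exact lt_of_lt_of_le (by linarith) (le_max_right _ _)
    · exact lt_of_lt_of_le (by linarith) (le_max_left _ _)

theorem eventually_mid_side {ε : ℝ} (hε : ε > 0) : ∀ᶠ δ : ℝ in 𝓝[>] 0, 0 < δ ∧ δ < ε := by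
  filter_upwards [Ioo_mem_nhdsGT hε] with δ hδ using hδ

/-- Every horizontal edge is either a top edge or a bottom edge. -/
theorem mid_side (hP : IsCyclicPolygon X Y P) [NeZero m] (k : ZMod m) :
    ∃ ε > 0,
      (IsTopH X Y P k ∧ ¬ IsBottomH X Y P k ∧
        (∀ x y, |x - (hMid X Y k).1| < ε → |y - Y k| < ε → y < Y k → (x, y) ∈ interior P) ∧
        (∀ x y, |x - (hMid X Y k).1| < ε → |y - Y k| < ε → Y k < y → (x, y) ∉ P)) ∨
      (IsBottomH X Y P k ∧ ¬ IsTopH X Y P k ∧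
        (∀ x y, |x - (hMid X Y k).1| < ε → |y - Y k| < ε → y < Y k → (x, y) ∉ P) ∧
        (∀ x y, |x - (hMid X Y k).1| < ε → |y - Y k| < ε → Y k < y → (x, y) ∈ interior P)) := by
  have hc := hP.covers_mid k
  obtain ⟨ε, hε, -, -, hside⟩ := hP.hEdge_side (k := k) (x₀ := (hMid X Y k).1) hc.1 hc.2 isOpen_univ
    (mem_univ _)
  have up : ∀ δ, 0 < δ ∧ δ < ε → |(Y k + δ) - Y k| < ε ∧ Y k < Y k + δ := fun δ h =>
    ⟨by rw [add_sub_cancel_left, abs_of_pos h.1]; exact h.2, by linarith [h.1]⟩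
  have dn : ∀ δ, 0 < δ ∧ δ < ε → |(Y k - δ) - Y k| < ε ∧ Y k - δ < Y k := fun δ h =>
    ⟨by rw [sub_sub_cancel_left, abs_neg, abs_of_pos h.1]; exact h.2, by linarith [h.1]⟩
  have h0 : |(hMid X Y k).1 - (hMid X Y k).1| < ε := by simpa using hε
  have eu : ∀ δ, hMid X Y k + (0, δ) = ((hMid X Y k).1, Y k + δ) := fun δ => by
    ext <;> simp [hMid]
  have ed : ∀ δ, hMid X Y k - (0, δ) = ((hMid X Y k).1, Y k - δ) := fun δ => by
    ext <;> simp [hMid]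
  refine ⟨ε, hε, hside.imp ?_ ?_⟩
  · rintro ⟨a, b⟩
    refine ⟨?_, fun hb => ?_, a, b⟩
    · filter_upwards [eventually_mid_side hε] with δ hδ
      rw [eu]; exact b _ _ h0 (up δ hδ).1 (up δ hδ).2
    · obtain ⟨δ, h1, h2⟩ := (hb.and (eventually_mid_side hε)).exists
      rw [ed] at h1
      exact h1 (interior_subset (a _ _ h0 (dn δ h2).1 (dn δ h2).2))
  · rintro ⟨a, b⟩
    refine ⟨?_, fun hb => ?_, a, b⟩
    · filter_upwards [eventually_mid_side hε] with δ hδ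
      rw [ed]; exact a _ _ h0 (dn δ hδ).1 (dn δ hδ).2
    · obtain ⟨δ, h1, h2⟩ := (hb.and (eventually_mid_side hε)).exists
      rw [eu] at h1
      exact h1 (interior_subset (b _ _ h0 (up δ h2).1 (up δ h2).2))

theorem isTop_iff_not_isBottom (hP : IsCyclicPolygon X Y P) [NeZero m] (k : ZMod m) :
    IsTopH X Y P k ↔ ¬ IsBottomH X Y P k := by
  obtain ⟨ε, hε, ⟨h1, h2, -⟩ | ⟨h1, h2, -⟩⟩ := hP.mid_side k <;> tauto

/-- From a point of the extension one first reaches the edge `k`, then moves along it to `x`, and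
then to `x'` on the edge `k'`. These three intervals lie in `P` and cover the direct interval,
wherever the points are relative to each other. -/
theorem hExtension_subset_of_sees {k k' : ZMod m} {x x' y : ℝ} (h : (x, y) ∈ hEdge X Y k)
    (h' : (x', y) ∈ hEdge X Y k') (hs : ∀ s ∈ uIcc x x', (s, y) ∈ P)
    (hP : IsCyclicPolygon X Y P) : hExtension X Y P k ⊆ hExtension X Y P k' := by
  rintro ⟨z, w⟩ hz
  obtain ⟨rfl, q, hq, hzq⟩ := mem_hExtension.1 hz
  obtain ⟨hx, rfl⟩ := mem_hEdge.1 h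
  obtain ⟨hx', hy⟩ := mem_hEdge.1 h'
  refine mem_hExtension.2 ⟨hy, x', hx', fun s hs' => ?_⟩
  by_cases h1 : s ∈ uIcc z q
  · exact hzq s h1
  by_cases h2 : s ∈ uIcc x x'
  · exact hs s h2
  have h3 : s ∈ uIcc q x := by
    rw [mem_uIcc, not_or] at h1 h2
    rw [mem_uIcc] at hs' ⊢
    by_contra hc
    rw [not_or] at hc
    simp only [not_and, not_le] at h1 h2 hc
    rcases hs' with hs' | hs' <;>
      rcases le_total s q with a | a <;> rcases le_total s x with b | b <;>
      first
        | linarith [h1.1 hs'.1] | linarith [h1.2 a] | linarith [h2.1 b] | linarith [h2.2 hs'.1]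
        | linarith [hc.1 a] | linarith [hc.2 b]
  exact hP.hEdge_subset k (mem_hEdge.2 ⟨uIcc_subset_uIcc hq hx h3, rfl⟩)

theorem hExtension_eq_of_sees {k k' : ZMod m} {x x' y : ℝ} (h : (x, y) ∈ hEdge X Y k)
    (h' : (x', y) ∈ hEdge X Y k') (hs : ∀ s ∈ uIcc x x', (s, y) ∈ P)
    (hP : IsCyclicPolygon X Y P) : hExtension X Y P k = hExtension X Y P k' :=
  subset_antisymm (hExtension_subset_of_sees h h' hs hP)
    (hExtension_subset_of_sees h' h (by rwa [uIcc_comm]) hP)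

theorem hMid_mem (hP : IsCyclicPolygon X Y P) (k : ZMod m) : hMid X Y k ∈ hEdge X Y k :=
  mem_hEdge.2 ⟨⟨(hP.covers_mid k).1.le, (hP.covers_mid k).2.le⟩, rfl⟩

theorem hMid_injective (hP : IsCyclicPolygon X Y P) : Function.Injective (hMid X Y) :=
  fun k k' h => hP.eq_of_mem_hEdge (hP.hMid_mem k) (h ▸ hP.hMid_mem k')

theorem hExtension_eq_of_sees_mid (hP : IsCyclicPolygon X Y P) {k k' : ZMod m} (hy : Y k = Y k')
    (hs : Sees P (hMid X Y k) (hMid X Y k')) : hExtension X Y P k = hExtension X Y P k' := by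
  have h1 := hP.hMid_mem k
  have h2 := hP.hMid_mem k'
  unfold hMid at hs h1 h2
  rw [← hy] at hs h2
  exact hExtension_eq_of_sees h1 h2 (sees_horizontal.1 hs) hP

/-- The number `M` exceeds both components of the displacement, so a step of relative length at most
`ε / (2 * M)` moves each coordinate by less than `ε`. -/
theorem exists_mem_segment_near {p q : Plane} (ε : ℝ) (hε : 0 < ε) :
    ∃ s : ℝ, 0 < s ∧ p + s • (q - p) ∈ segment ℝ p q ∧
      |(p + s • (q - p)).1 - p.1| < ε ∧ |(p + s • (q - p)).2 - p.2| < ε := by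
  have hpos : 0 < |q.1 - p.1| + |q.2 - p.2| + 1 := by positivity
  set M := |q.1 - p.1| + |q.2 - p.2| + 1 with hM
  refine ⟨min 1 (ε / (2 * M)), by positivity, ?_, ?_, ?_⟩
  · rw [segment_eq_image']
    exact ⟨_, ⟨by positivity, min_le_left _ _⟩, rfl⟩
  all_goals
    have h1 : min 1 (ε / (2 * M)) * M ≤ ε / 2 := by
      calc _ ≤ ε / (2 * M) * M := by gcongr; exact min_le_right _ _
        _ = ε / 2 := by field_simp
    have h0 : 0 < min 1 (ε / (2 * M)) := by positivity
    set s := min 1 (ε / (2 * M))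
    simp only [Prod.fst_add, Prod.snd_add, Prod.smul_fst, Prod.smul_snd, Prod.fst_sub, Prod.snd_sub,
      smul_eq_mul, add_sub_cancel_left, abs_mul, abs_of_pos h0]
    nlinarith [abs_nonneg (q.1 - p.1), abs_nonneg (q.2 - p.2)]

/-- A segment to a higher point begins by rising from the midpoint, through a box above the edge
that contains no point of `P`. -/
theorem not_sees_of_isTop (hP : IsCyclicPolygon X Y P) [NeZero m] {k : ZMod m}
    (hk : IsTopH X Y P k) {q : Plane} (hq : Y k < q.2) : ¬ Sees P (hMid X Y k) q := by
  intro hs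
  obtain ⟨ε, hε, ⟨-, -, -, h⟩ | ⟨-, h, -⟩⟩ := hP.mid_side k
  · obtain ⟨s, h1, h2, h3, h4⟩ := exists_mem_segment_near (p := hMid X Y k) (q := q) ε hε
    refine h _ _ h3 h4 ?_ (hs h2)
    have : 0 < s * (q.2 - Y k) := mul_pos h1 (by linarith)
    simp only [Prod.snd_add, Prod.smul_snd, Prod.snd_sub, smul_eq_mul, hMid]
    linarith
  · exact h hk

theorem not_sees_of_isBottom (hP : IsCyclicPolygon X Y P) [NeZero m] {k : ZMod m}
    (hk : IsBottomH X Y P k) {q : Plane} (hq : q.2 < Y k) : ¬ Sees P (hMid X Y k) q := by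
  intro hs
  obtain ⟨ε, hε, ⟨-, h, -⟩ | ⟨-, -, h, -⟩⟩ := hP.mid_side k
  · exact h hk
  · obtain ⟨s, h1, h2, h3, h4⟩ := exists_mem_segment_near (p := hMid X Y k) (q := q) ε hε
    refine h _ _ h3 h4 ?_ (hs h2)
    have : 0 < s * (Y k - q.2) := mul_pos h1 (by linarith)
    simp only [Prod.snd_add, Prod.smul_snd, Prod.snd_sub, smul_eq_mul, hMid]
    linarith

/-- Of two midpoints at different heights the lower one cannot see the higher one. At equal heights
visibility would make the extensions coincide, against injectivity. -/
theorem isHiddenSet_of_isTop (hP : IsCyclicPolygon X Y P) [NeZero m] {T : Set (ZMod m)}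
    (hT : ∀ k ∈ T, IsTopH X Y P k) (hinj : InjOn (hExtension X Y P) T) :
    IsHiddenSet P (hMid X Y '' T) := by
  refine ⟨?_, ?_⟩
  · rintro _ ⟨k, -, rfl⟩
    exact hP.hEdge_subset k (hP.hMid_mem k)
  · rintro _ ⟨k, hk, rfl⟩ _ ⟨k', hk', rfl⟩ hne hs
    rcases lt_trichotomy (Y k) (Y k') with h | h | h
    · exact hP.not_sees_of_isTop (hT k hk) h hs
    · exact hne (congrArg _ (hinj hk hk' (hP.hExtension_eq_of_sees_mid h hs)))
    · refine hP.not_sees_of_isTop (hT k' hk') (q := hMid X Y k) h ?_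
      unfold Sees; rw [segment_symm]; exact hs

theorem isHiddenSet_of_isBottom (hP : IsCyclicPolygon X Y P) [NeZero m] {T : Set (ZMod m)}
    (hT : ∀ k ∈ T, IsBottomH X Y P k) (hinj : InjOn (hExtension X Y P) T) :
    IsHiddenSet P (hMid X Y '' T) := by
  refine ⟨?_, ?_⟩
  · rintro _ ⟨k, -, rfl⟩
    exact hP.hEdge_subset k (hP.hMid_mem k)
  · rintro _ ⟨k, hk, rfl⟩ _ ⟨k', hk', rfl⟩ hne hs
    rcases lt_trichotomy (Y k) (Y k') with h | h | h
    · refine hP.not_sees_of_isBottom (hT k' hk') (q := hMid X Y k) h ?_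
      unfold Sees; rw [segment_symm]; exact hs
    · exact hne (congrArg _ (hinj hk hk' (hP.hExtension_eq_of_sees_mid h hs)))
    · exact hP.not_sees_of_isBottom (hT k hk) h hs

theorem covers_of_mem_hEdge {x y : ℝ} (hx : ∀ k, X k ≠ x) {k : ZMod m}
    (h : (x, y) ∈ hEdge X Y k) : Covers X x k ∧ y = Y k := by
  obtain ⟨⟨h1, h2⟩, h3⟩ := mem_hEdge.1 h
  refine ⟨⟨lt_of_le_of_ne h1 fun h => ?_, lt_of_le_of_ne h2 fun h => ?_⟩, h3⟩
  · rcases min_choice (X (k - 1)) (X k) with h' | h'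
    · exact hx _ (h'.symm.trans h)
    · exact hx _ (h'.symm.trans h)
  · rcases max_choice (X (k - 1)) (X k) with h' | h'
    · exact hx _ (h'.symm.trans h.symm)
    · exact hx _ (h'.symm.trans h.symm)

theorem mem_hEdge_of_covers {x : ℝ} {k : ZMod m} (h : Covers X x k) : (x, Y k) ∈ hEdge X Y k :=
  mem_hEdge.2 ⟨⟨h.1.le, h.2.le⟩, rfl⟩

open Classical in
/-- A point off the boundary lies in `P` iff it is above an odd number of horizontal edges. -/
theorem mem_iff_odd (hP : IsCyclicPolygon X Y P) [NeZero m] {x y : ℝ} (hx : ∀ k, X k ≠ x)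
    (hy : ∀ k, Covers X x k → Y k ≠ y) :
    (x, y) ∈ P ↔ Odd (Finset.univ.filter fun k => Covers X x k ∧ Y k < y).card := by
  generalize hn : (Finset.univ.filter fun k => Covers X x k ∧ Y k < y).card = n
  induction n generalizing y with
  | zero =>
    simp only [Finset.card_eq_zero, Finset.filter_eq_empty_iff, Finset.mem_univ, true_implies,
      not_and, not_lt] at hn
    -- With no edge below, the downward ray avoids the boundary; being unbounded it is outside `P`.
    have hd : Disjoint ({x} ×ˢ Iic y : Set Plane) (edgeUnion X Y) := by
      rw [disjoint_left]
      rintro ⟨x', s⟩ ⟨hx', hs⟩ hE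
      simp only [mem_singleton_iff, mem_Iic] at hx' hs
      subst hx'
      rcases mem_edgeUnion.1 hE with ⟨k, hk⟩ | ⟨k, hk⟩
      · obtain ⟨h1, rfl⟩ := covers_of_mem_hEdge hx hk
        exact hy k h1 (le_antisymm hs (hn h1))
      · exact hx k (mem_vEdge.1 hk).1.symm
    obtain ⟨M, hM⟩ := hP.exists_bound
    simp only [Nat.not_odd_zero, iff_false]
    rcases hP.subset_interior_or_disjoint (isPreconnected_vertical isPreconnected_Iic x) hd with h | h
    · have h1 := (hM x (min y (-M)) (interior_subset (h ⟨rfl, mem_Iic.2 (min_le_left _ _)⟩))).2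
      have h2 := (abs_lt.1 h1).1
      have := min_le_right y (-M)
      exact absurd h2 (by linarith)
    · exact fun hc => disjoint_left.1 h (mk_mem_prod (mem_singleton x) (mem_Iic.2 (le_refl y))) hc
  | succ n ih =>
    set S := Finset.univ.filter fun k => Covers X x k ∧ Y k < y with hS
    -- The highest edge below the point is removed: `y₁` is chosen just below it but above all the
    -- others, and `y₂` just above it.
    obtain ⟨h₀, hh₀, hmax⟩ := S.exists_max_image Y (Finset.card_pos.1 (by omega))
    have mS : ∀ k, k ∈ S ↔ Covers X x k ∧ Y k < y := fun k => by simp [hS]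
    have inj : ∀ k k', Covers X x k → Covers X x k' → Y k = Y k' → k = k' := fun k k' h h' e =>
      hP.eq_of_mem_hEdge (mem_hEdge_of_covers h) (e ▸ mem_hEdge_of_covers h')
    obtain ⟨c0, cy⟩ := (mS h₀).1 hh₀
    obtain ⟨ε, hε, -, -, hside⟩ := hP.hEdge_side c0.1 c0.2 isOpen_univ (mem_univ _)
    have lt0 : ∀ k ∈ S.erase h₀, Y k < Y h₀ := by
      intro k hk
      obtain ⟨h1, h2⟩ := Finset.mem_erase.1 hk
      exact lt_of_le_of_ne (hmax k h2) fun e => h1 (inj k h₀ ((mS k).1 h2).1 c0 e)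
    have ev : ∀ᶠ y₁ in 𝓝[<] (Y h₀), (∀ k ∈ S.erase h₀, Y k < y₁) ∧ y₁ ∈ Ioo (Y h₀ - ε) (Y h₀) := by
      refine Eventually.and ?_ (Ioo_mem_nhdsLT (by linarith))
      rw [Finset.eventually_all]
      intro k hk
      exact Filter.mem_of_superset (Ioo_mem_nhdsLT (lt0 k hk)) fun z hz => hz.1
    obtain ⟨y₁, hy₁, hy₁'⟩ := ev.exists
    obtain ⟨y₂, hy₂⟩ := exists_between (lt_min cy (by linarith : Y h₀ < Y h₀ + ε))
    have hy₂' := lt_min_iff.1 hy₂.2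
    have e1 : (Finset.univ.filter fun k => Covers X x k ∧ Y k < y₁) = S.erase h₀ := by
      ext k
      simp only [Finset.mem_filter, Finset.mem_univ, true_and, Finset.mem_erase]
      constructor
      · rintro ⟨h1, h2⟩
        refine ⟨?_, (mS k).2 ⟨h1, by linarith [hy₁'.2]⟩⟩
        rintro rfl; linarith [hy₁'.2]
      · rintro ⟨h1, h2⟩
        exact ⟨((mS k).1 h2).1, hy₁ k (Finset.mem_erase.2 ⟨h1, h2⟩)⟩
    have h1 := ih (y := y₁) (by
      intro k hk e
      have hk' : k ∈ S.erase h₀ := by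
        rw [← e1]
        rcases eq_or_ne k h₀ with rfl | hne
        · linarith [hy₁'.2]
        · refine absurd (hy₁ k (Finset.mem_erase.2 ⟨hne, (mS k).2 ⟨hk, by linarith [hy₁'.2]⟩⟩)) ?_
          rw [e]; exact lt_irrefl _
      exact absurd (hy₁ k hk') (by rw [e]; exact lt_irrefl _))
      (by rw [e1, Finset.card_erase_of_mem hh₀]; omega)
    -- Passing a single horizontal edge exchanges inside and outside.
    have h2 : (x, y₂) ∈ P ↔ (x, y₁) ∉ P := by
      have a0 : |x - x| < ε := by simpa using hε
      have a1 : |y₁ - Y h₀| < ε := by rw [abs_lt]; constructor <;> linarith [hy₁'.1, hy₁'.2]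
      have a2 : |y₂ - Y h₀| < ε := by rw [abs_lt]; constructor <;> linarith [hy₂.1, hy₂'.2]
      rcases hside with ⟨u, v⟩ | ⟨u, v⟩
      · exact iff_of_false (v x y₂ a0 a2 hy₂.1)
          (not_not.2 (interior_subset (u x y₁ a0 a1 hy₁'.2)))
      · exact iff_of_true (interior_subset (v x y₂ a0 a2 hy₂.1)) (u x y₁ a0 a1 hy₁'.2)
    have h3 : (x, y) ∈ P ↔ (x, y₂) ∈ P := by
      have hd : Disjoint ({x} ×ˢ Icc y₂ y : Set Plane) (edgeUnion X Y) := by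
        rw [disjoint_left]
        rintro ⟨x', s⟩ ⟨hx', hs⟩ hE
        simp only [mem_singleton_iff, mem_Icc] at hx' hs
        subst hx'
        rcases mem_edgeUnion.1 hE with ⟨k, hk⟩ | ⟨k, hk⟩
        · obtain ⟨h1, rfl⟩ := covers_of_mem_hEdge hx hk
          have := hmax k ((mS k).2 ⟨h1, lt_of_le_of_ne hs.2 (hy k h1)⟩)
          linarith [hy₂.1]
        · exact hx k (mem_vEdge.1 hk).1.symm
      have m1 : (x, y) ∈ ({x} ×ˢ Icc y₂ y : Set Plane) := ⟨rfl, hy₂'.1.le, le_rfl⟩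
      have m2 : (x, y₂) ∈ ({x} ×ˢ Icc y₂ y : Set Plane) := ⟨rfl, le_rfl, hy₂'.1.le⟩
      rcases hP.subset_interior_or_disjoint (isPreconnected_vertical isPreconnected_Icc x) hd with h | h
      · exact iff_of_true (interior_subset (h m1)) (interior_subset (h m2))
      · exact iff_of_false (disjoint_left.1 h m1) (disjoint_left.1 h m2)
    rw [h3, h2, h1, Nat.not_odd_iff_even, Nat.odd_add_one, Nat.not_odd_iff_even]

end IsCyclicPolygon

/-! ## The sweep -/

/-- The horizontal edges in the order `e 0, e 1, …` of increasing height (from left to right at the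
same height), with ranks `ρ`, and the vertical edges in the order `vp 1, vp 2, …` of increasing
abscissa, with positions `pos`. -/
structure IsSweep {m : ℕ} (X Y : ZMod m → ℝ) (e : ℕ → ZMod m) (ρ : ZMod m → ℕ)
    (vp : ℕ → ZMod m) (pos : ZMod m → ℕ) : Prop where
  ρ_lt : ∀ h, ρ h < m
  e_ρ : ∀ h, e (ρ h) = h
  ρ_e : ∀ k < m, ρ (e k) = k
  ρ_sorted : ∀ h h', ρ h < ρ h' → Y h < Y h' ∨ (Y h = Y h' ∧ X h < X h')
  one_le_pos : ∀ u, 1 ≤ pos u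
  pos_le : ∀ u, pos u ≤ m
  vp_pos : ∀ u, vp (pos u) = u
  pos_vp : ∀ p, 1 ≤ p → p ≤ m → pos (vp p) = p
  pos_sorted : ∀ u w, pos u < pos w → X u ≤ X w

/-- The vertical edge `u` is active before event `k`: exactly one of its two neighbours has been
processed. -/
def Active {m : ℕ} (ρ : ZMod m → ℕ) (k : ℕ) (u : ZMod m) : Prop :=
  ¬ (ρ u < k ↔ ρ (u + 1) < k)

/-- The position `p` is occupied by an active vertical edge. -/
def ActAt {m : ℕ} (ρ : ZMod m → ℕ) (vp : ℕ → ZMod m) (k p : ℕ) : Prop :=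
  1 ≤ p ∧ p ≤ m ∧ Active ρ k (vp p)

open Classical in
/-- The number of active vertical edges up to position `l`. -/
noncomputable def activeCount {m : ℕ} [NeZero m] (ρ pos : ZMod m → ℕ) (k l : ℕ) : ℕ :=
  (Finset.univ.filter fun u => Active ρ k u ∧ pos u ≤ l).card

/-- `n` is the successor of `l` among the positions that satisfy `A`; `0` stands for none. -/
def IsNext (A : ℕ → Prop) (l n : ℕ) : Prop :=
  (n = 0 ∧ ∀ q, l < q → ¬ A q) ∨ (A n ∧ l < n ∧ ∀ q, l < q → q < n → ¬ A q)

/-- The invariant of the sweep before event `k`. -/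
structure SweepInv {m : ℕ} [NeZero m] (X Y : ZMod m → ℝ) (ρ : ZMod m → ℕ) (vp : ℕ → ZMod m)
    (pos : ZMod m → ℕ) (k : ℕ) (nxt flag : ℕ → ℕ) (bot : ℕ → ℝ) : Prop where
  next : ∀ l, (l = 0 ∨ ActAt ρ vp k l) → IsNext (ActAt ρ vp k) l (nxt l)
  flag_eq : ∀ l, (l = 0 ∨ ActAt ρ vp k l) → flag l = activeCount ρ pos k l % 2
  bot_max : ∀ l, ActAt ρ vp k l → ActAt ρ vp k (nxt l) →
    ∀ h, ρ h < k → Touches X (vp l) (vp (nxt l)) h → Y h ≤ bot l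
  bot_mem : ∀ l, ActAt ρ vp k l → ActAt ρ vp k (nxt l) →
    ∃ h, ρ h < k ∧ Touches X (vp l) (vp (nxt l)) h ∧ Y h = bot l

/-- The positions that are relevant for event `k`: `pa` and `pb` are the positions of the left and
the right neighbour of the horizontal edge, and `p` is the predecessor of `pa` (or `0`). -/
structure IsEvent {m : ℕ} (e : ℕ → ZMod m) (ρ : ZMod m → ℕ) (vp : ℕ → ZMod m) (pos : ZMod m → ℕ)
    (k p pa pb : ℕ) : Prop where
  lt : k < m
  pa_eq : pa = min (pos (e k - 1)) (pos (e k))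
  pb_eq : pb = max (pos (e k - 1)) (pos (e k))
  p_lt : p < pa
  p_act : p = 0 ∨ ActAt ρ vp k p
  p_max : ∀ q, p < q → q < pa → ¬ ActAt ρ vp k q

theorem IsNext.unique {A : ℕ → Prop} {l n n' : ℕ} (h : IsNext A l n) (hn' : A n') (h' : l < n')
    (hm : ∀ q, l < q → q < n' → ¬ A q) : n = n' := by
  rcases h with ⟨-, h⟩ | ⟨h1, h2, h3⟩
  · exact absurd hn' (h _ h')
  · rcases lt_trichotomy n n' with h4 | h4 | h4
    · exact absurd h1 (hm n h2 h4)
    · exact h4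
    · exact absurd hn' (h3 _ h' h4)

theorem touches_self {m : ℕ} {X : ZMod m → ℝ} {l r : ZMod m} (h : X l ≤ X r) :
    Touches X l r l ∧ Touches X l r (l + 1) ∧ Touches X l r r ∧ Touches X l r (r + 1) := by
  simp only [Touches, add_sub_cancel_right]
  exact ⟨⟨(min_le_right _ _).trans h, le_max_right _ _⟩, ⟨(min_le_left _ _).trans h, le_max_left _ _⟩,
    ⟨min_le_right _ _, h.trans (le_max_right _ _)⟩, ⟨min_le_left _ _, h.trans (le_max_left _ _)⟩⟩

theorem touches_of_between {m : ℕ} {X : ZMod m → ℝ} {l r u : ZMod m} (h : X l ≤ X u)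
    (h' : X u ≤ X r) : Touches X l r u ∧ Touches X l r (u + 1) := by
  simp only [Touches, add_sub_cancel_right]
  exact ⟨⟨(min_le_right _ _).trans h', h.trans (le_max_right _ _)⟩,
    ⟨(min_le_left _ _).trans h', h.trans (le_max_left _ _)⟩⟩

theorem exists_generic {m : ℕ} [NeZero m] (X : ZMod m → ℝ) {a b : ℝ} (h : a < b) :
    ∃ x, a < x ∧ x < b ∧ ∀ k, X k ≠ x := by
  obtain ⟨x, hx, hx'⟩ := ((Ioo_infinite h).sdiff (finite_range X)).nonempty
  exact ⟨x, hx.1, hx.2, fun k hk => hx' ⟨k, hk⟩⟩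

open Classical in
theorem bit_xor {p q : Prop} : bit (¬ (p ↔ q)) = bit p + bit q := by
  by_cases hp : p <;> by_cases hq : q <;> simp [bit, hp, hq]
  decide

theorem natCast_card_filter_eq_sum_bit {α : Type*} (s : Finset α) (p : α → Prop)
    [DecidablePred p] :
    (((s.filter p).card : ℕ) : ZMod 2) = ∑ a ∈ s, bit (p a) := by
  rw [Finset.card_filter, Nat.cast_sum]
  exact Finset.sum_congr rfl fun a _ => by by_cases h : p a <;> simp [bit, h]

theorem bit_and {p q : Prop} : bit (p ∧ q) = bit p * bit q := by
  by_cases hp : p <;> by_cases hq : q <;> simp [bit, hp, hq]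

theorem bit_covers {m : ℕ} {X : ZMod m → ℝ} {x : ℝ} (hx : ∀ k, X k ≠ x) (k : ZMod m) :
    bit (Covers X x k) = bit (X (k - 1) < x) + bit (X k < x) := by
  rw [← bit_xor]
  refine bit_congr ?_
  have h1 := hx k
  have h2 := hx (k - 1)
  simp only [Covers, min_lt_iff, lt_max_iff]
  rcases lt_or_gt_of_ne h1 with a | a <;> rcases lt_or_gt_of_ne h2 with b | b <;>
    simp [a, b, not_lt_of_gt a, not_lt_of_gt b]

open Classical in
/-- The parity of the number of active edges to the left of `x` is the parity of the number of
processed edges that cover `x`. -/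
theorem activeCount_parity {m : ℕ} [NeZero m] {X : ZMod m → ℝ} {ρ pos : ZMod m → ℕ} {k l : ℕ}
    {x : ℝ} (hx : ∀ k, X k ≠ x) (hl : ∀ u, Active ρ k u → (pos u ≤ l ↔ X u < x)) :
    activeCount ρ pos k l % 2 =
      (Finset.univ.filter fun h => Covers X x h ∧ ρ h < k).card % 2 := by
  change Nat.ModEq 2 _ _
  rw [← ZMod.natCast_eq_natCast_iff]
  rw [activeCount, natCast_card_filter_eq_sum_bit, natCast_card_filter_eq_sum_bit]
  -- Being active and covering `x` are both exclusive disjunctions. Modulo two, each side counts the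
  -- pairs of a processed horizontal edge and an adjacent vertical edge to the left of `x`; the sums
  -- differ by a cyclic shift of the index.
  have e1 : ∀ u, bit (Active ρ k u ∧ pos u ≤ l) =
      bit (ρ u < k) * bit (X u < x) + bit (ρ (u + 1) < k) * bit (X u < x) := by
    intro u
    rw [← add_mul, ← bit_xor, ← bit_and]
    exact bit_congr ⟨fun h => ⟨h.1, (hl u h.1).1 h.2⟩, fun h => ⟨h.1, (hl u h.1).2 h.2⟩⟩
  have e2 : ∀ h, bit (Covers X x h ∧ ρ h < k) =
      bit (ρ h < k) * bit (X h < x) + bit (ρ h < k) * bit (X (h - 1) < x) := by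
    intro h
    rw [bit_and, bit_covers hx]; ring
  simp only [e1, e2, Finset.sum_add_distrib]
  congr 1
  refine Fintype.sum_equiv (Equiv.addRight 1) _ _ fun u => ?_
  simp

/-! ### The order of the active edges, and the effect of one event on them -/

section

variable {m : ℕ} [NeZero m] {X Y : ZMod m → ℝ} {P : Set Plane} {e : ℕ → ZMod m}
  {ρ : ZMod m → ℕ} {vp : ℕ → ZMod m} {pos : ZMod m → ℕ} {k p pa pb : ℕ} {nxt flag : ℕ → ℕ}
  {bot : ℕ → ℝ}

namespace IsSweep

theorem le_of_rank_lt (hs : IsSweep X Y e ρ vp pos) {h h' : ZMod m} (hh : ρ h < ρ h') :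
    Y h ≤ Y h' := by
  rcases hs.ρ_sorted h h' hh with a | a
  · exact a.le
  · exact a.1.le

theorem le_of_rank_le (hs : IsSweep X Y e ρ vp pos) {h h' : ZMod m} (hh : ρ h ≤ ρ h') :
    Y h ≤ Y h' := by
  rcases hh.lt_or_eq with a | a
  · exact hs.le_of_rank_lt a
  · rw [← hs.e_ρ h, a, hs.e_ρ]

theorem height_le (hs : IsSweep X Y e ρ vp pos) (hk : k < m) {h : ZMod m} (hh : ρ h < k) :
    Y h ≤ Y (e k) :=
  hs.le_of_rank_lt (by rwa [hs.ρ_e k hk])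

theorem le_height (hs : IsSweep X Y e ρ vp pos) (hk : k < m) {h : ZMod m} (hh : ¬ ρ h < k) :
    Y (e k) ≤ Y h :=
  hs.le_of_rank_le (by rw [hs.ρ_e k hk]; exact not_lt.1 hh)

theorem rank_lt_of_lt (hs : IsSweep X Y e ρ vp pos) (hk : k < m) {h : ZMod m}
    (hh : Y h < Y (e k)) : ρ h < k := by
  by_contra hc
  exact absurd (hs.le_height hk hc) (not_le.2 hh)

theorem not_rank_lt_of_lt (hs : IsSweep X Y e ρ vp pos) (hk : k < m) {h : ZMod m}
    (hh : Y (e k) < Y h) : ¬ ρ h < k := by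
  intro hc
  exact absurd (hs.height_le hk hc) (not_le.2 hh)

/-- One end of an active edge has been processed and the other has not. The processing order is by
height, so the current height is between them. -/
theorem height_mem (hs : IsSweep X Y e ρ vp pos) (hk : k < m) {u : ZMod m} (hu : Active ρ k u) :
    Y (e k) ∈ uIcc (Y u) (Y (u + 1)) := by
  rw [mem_uIcc]
  by_cases h1 : ρ u < k
  · have h2 : ¬ ρ (u + 1) < k := fun h => hu (iff_of_true h1 h)
    exact Or.inl ⟨hs.height_le hk h1, hs.le_height hk h2⟩
  · have h2 : ρ (u + 1) < k := by
      by_contra h; exact hu (iff_of_false h1 h)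
    exact Or.inr ⟨hs.height_le hk h2, hs.le_height hk h1⟩

theorem pos_injective (hs : IsSweep X Y e ρ vp pos) : Function.Injective pos :=
  Function.LeftInverse.injective hs.vp_pos

theorem actAt_pos (hs : IsSweep X Y e ρ vp pos) {u : ZMod m} :
    ActAt ρ vp k (pos u) ↔ Active ρ k u := by
  unfold ActAt
  rw [hs.vp_pos]
  exact ⟨fun h => h.2.2, fun h => ⟨hs.one_le_pos u, hs.pos_le u, h⟩⟩

theorem pos_vp_of_actAt (hs : IsSweep X Y e ρ vp pos) (h : ActAt ρ vp k p) : pos (vp p) = p :=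
  hs.pos_vp p h.1 h.2.1

theorem ne_of_touch (hP : IsCyclicPolygon X Y P) {u w : ZMod m} {y : ℝ} (huw : u ≠ w)
    (hu : y ∈ uIcc (Y u) (Y (u + 1))) (hw : y ∈ uIcc (Y w) (Y (w + 1))) : X u ≠ X w := by
  intro h
  exact huw (hP.eq_of_mem_vEdge (mem_vEdge.2 ⟨rfl, hu⟩) (mem_vEdge.2 ⟨h, hw⟩))

/-- Positions respect abscissas only weakly. Distinct vertical edges that meet a common height are
disjoint and so have different abscissas; among them the order of positions is the true order from
left to right. -/
theorem lt_iff (hs : IsSweep X Y e ρ vp pos) (hP : IsCyclicPolygon X Y P) {u w : ZMod m} {y : ℝ}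
    (hu : y ∈ uIcc (Y u) (Y (u + 1))) (hw : y ∈ uIcc (Y w) (Y (w + 1))) :
    pos u < pos w ↔ X u < X w := by
  constructor
  · intro h
    exact lt_of_le_of_ne (hs.pos_sorted u w h)
      (ne_of_touch hP (fun e => by rw [e] at h; exact lt_irrefl _ h) hu hw)
  · intro h
    rcases lt_trichotomy (pos u) (pos w) with a | a | a
    · exact a
    · rw [hs.pos_injective a] at h; exact absurd h (lt_irrefl _)
    · exact absurd (hs.pos_sorted w u a) (not_le.2 h)

theorem touch_left (Y : ZMod m → ℝ) (h : ZMod m) : Y h ∈ uIcc (Y (h - 1)) (Y (h - 1 + 1)) := by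
  rw [sub_add_cancel]; exact right_mem_uIcc

theorem touch_right (Y : ZMod m → ℝ) (h : ZMod m) : Y h ∈ uIcc (Y h) (Y (h + 1)) := left_mem_uIcc

end IsSweep

theorem IsCyclicPolygon.sub_one_ne (hP : IsCyclicPolygon X Y P) (h : ZMod m) : h - 1 ≠ h := by
  intro he
  exact hP.X_ne h (by rw [he])

namespace IsEvent

/-- The neighbours of the edge of an event, from left to right. -/
theorem cases (hv : IsEvent e ρ vp pos k p pa pb) (hs : IsSweep X Y e ρ vp pos)
    (hP : IsCyclicPolygon X Y P) :
    ∃ a b, ((a = e k - 1 ∧ b = e k) ∨ (a = e k ∧ b = e k - 1)) ∧ pa = pos a ∧ pb = pos b ∧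
      pa < pb ∧ X a < X b ∧ min (X (e k - 1)) (X (e k)) = X a ∧ max (X (e k - 1)) (X (e k)) = X b ∧
      Y (e k) ∈ uIcc (Y a) (Y (a + 1)) ∧ Y (e k) ∈ uIcc (Y b) (Y (b + 1)) := by
  have t1 := IsSweep.touch_left Y (e k)
  have t2 := IsSweep.touch_right Y (e k)
  have l1 := hs.lt_iff hP t1 t2
  have l2 := hs.lt_iff hP t2 t1
  rcases lt_or_gt_of_ne (hP.X_ne (e k)) with h | h
  · have h' := l1.2 h
    have e1 := hv.pa_eq.trans (min_eq_left h'.le)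
    have e2 := hv.pb_eq.trans (max_eq_right h'.le)
    exact ⟨e k - 1, e k, Or.inl ⟨rfl, rfl⟩, e1, e2, e1.trans_lt (h'.trans_eq e2.symm), h,
      min_eq_left h.le, max_eq_right h.le, t1, t2⟩
  · have h' := l2.2 h
    have e1 := hv.pa_eq.trans (min_eq_right h'.le)
    have e2 := hv.pb_eq.trans (max_eq_left h'.le)
    exact ⟨e k, e k - 1, Or.inr ⟨rfl, rfl⟩, e1, e2, e1.trans_lt (h'.trans_eq e2.symm), h,
      min_eq_right h.le, max_eq_left h.le, t2, t1⟩

/-- No vertical edge touching the height of the event lies strictly between its neighbours. -/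
theorem not_between (hv : IsEvent e ρ vp pos k p pa pb) (hs : IsSweep X Y e ρ vp pos)
    (hP : IsCyclicPolygon X Y P) {u : ZMod m} (hu : Y (e k) ∈ uIcc (Y u) (Y (u + 1)))
    (h1 : pa < pos u) (h2 : pos u < pb) : False := by
  obtain ⟨a, b, hab, rfl, rfl, -, -, hmin, hmax, ta, tb⟩ := hv.cases hs hP
  have x1 := (hs.lt_iff hP ta hu).1 h1
  have x2 := (hs.lt_iff hP hu tb).1 h2
  have hua : u ≠ a := fun h => by rw [h] at h1; exact lt_irrefl _ h1
  have hub : u ≠ b := fun h => by rw [h] at h2; exact lt_irrefl _ h2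
  have n1 : u ≠ e k ∧ u ≠ e k - 1 := by
    rcases hab with ⟨rfl, rfl⟩ | ⟨rfl, rfl⟩
    · exact ⟨hub, hua⟩
    · exact ⟨hua, hub⟩
  have m1 : (X u, Y (e k)) ∈ hEdge X Y (e k) :=
    mem_hEdge.2 ⟨⟨hmin.le.trans x1.le, x2.le.trans hmax.ge⟩, rfl⟩
  exact disjoint_left.1 (hP.hv_disjoint (e k) u n1.1 n1.2) m1 (mem_vEdge.2 ⟨rfl, hu⟩)

theorem not_actAt_between (hv : IsEvent e ρ vp pos k p pa pb) (hs : IsSweep X Y e ρ vp pos)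
    (hP : IsCyclicPolygon X Y P) {q : ℕ} (h1 : pa < q) (h2 : q < pb) : ¬ ActAt ρ vp k q := by
  intro hq
  have := hs.pos_vp_of_actAt hq
  exact hv.not_between hs hP (hs.height_mem hv.lt hq.2.2) (by rwa [this]) (by rwa [this])

/-- Event `k` changes the status of the horizontal edge `e k` alone, and this edge adjoins only the
vertical edges `e k - 1` and `e k`. These two toggle, as they are distinct; all others keep their
status. -/
theorem active_succ (_ : IsEvent e ρ vp pos k p pa pb) (hs : IsSweep X Y e ρ vp pos)
    (u : ZMod m) (h1 : u ≠ e k) (h2 : u ≠ e k - 1) : Active ρ (k + 1) u ↔ Active ρ k u := by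
  have r : ∀ h, h ≠ e k → (ρ h < k + 1 ↔ ρ h < k) := by
    intro h hh
    have : ρ h ≠ k := fun h' => hh (by rw [← hs.e_ρ h, h'])
    omega
  unfold Active
  rw [r u h1, r (u + 1) fun h => h2 (by rw [← h, add_sub_cancel_right])]

theorem active_toggle (hv : IsEvent e ρ vp pos k p pa pb) (hs : IsSweep X Y e ρ vp pos)
    (hP : IsCyclicPolygon X Y P) (u : ZMod m) (h : u = e k ∨ u = e k - 1) :
    Active ρ (k + 1) u ↔ ¬ Active ρ k u := by
  have r : ∀ h, h ≠ e k → (ρ h < k + 1 ↔ ρ h < k) := by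
    intro h hh
    have : ρ h ≠ k := fun h' => hh (by rw [← hs.e_ρ h, h'])
    omega
  have r0 : ρ (e k) = k := hs.ρ_e k hv.lt
  unfold Active
  rcases h with rfl | rfl
  · rw [r (e k + 1) fun h => hP.sub_one_ne (e k + 1) (by rw [add_sub_cancel_right]; exact h.symm), r0]
    simp
  · rw [r (e k - 1) (hP.sub_one_ne _), sub_add_cancel, r0]
    simp

theorem actAt_succ (hv : IsEvent e ρ vp pos k p pa pb) (hs : IsSweep X Y e ρ vp pos)
    (hP : IsCyclicPolygon X Y P) {q : ℕ} (h1 : q ≠ pa) (h2 : q ≠ pb) :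
    ActAt ρ vp (k + 1) q ↔ ActAt ρ vp k q := by
  unfold ActAt
  refine and_congr_right fun h3 => and_congr_right fun h4 => ?_
  have e1 := hs.pos_vp q h3 h4
  obtain ⟨a, b, hab, rfl, rfl, -⟩ := hv.cases hs hP
  have n1 : vp q ≠ a := fun h => h1 (by rw [← h, e1])
  have n2 : vp q ≠ b := fun h => h2 (by rw [← h, e1])
  refine hv.active_succ hs _ ?_ ?_
  · rcases hab with ⟨rfl, rfl⟩ | ⟨rfl, rfl⟩ <;> assumption
  · rcases hab with ⟨rfl, rfl⟩ | ⟨rfl, rfl⟩ <;> assumption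

theorem actAt_toggle (hv : IsEvent e ρ vp pos k p pa pb) (hs : IsSweep X Y e ρ vp pos)
    (hP : IsCyclicPolygon X Y P) {q : ℕ} (h : q = pa ∨ q = pb) :
    ActAt ρ vp (k + 1) q ↔ ¬ ActAt ρ vp k q := by
  obtain ⟨a, b, hab, rfl, rfl, -⟩ := hv.cases hs hP
  rcases h with rfl | rfl
  · rw [hs.actAt_pos, hs.actAt_pos]
    exact hv.active_toggle hs hP _ (by rcases hab with ⟨rfl, rfl⟩ | ⟨rfl, rfl⟩ <;> simp)
  · rw [hs.actAt_pos, hs.actAt_pos]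
    exact hv.active_toggle hs hP _ (by rcases hab with ⟨rfl, rfl⟩ | ⟨rfl, rfl⟩ <;> simp)

end IsEvent

end

section

variable {m : ℕ} [NeZero m] {X Y : ZMod m → ℝ} {P : Set Plane} {e : ℕ → ZMod m}
  {ρ : ZMod m → ℕ} {vp : ℕ → ZMod m} {pos : ZMod m → ℕ} {k p pa pb : ℕ} {nxt flag : ℕ → ℕ}
  {bot : ℕ → ℝ}

theorem IsNext.extend {A : ℕ → Prop} {l l' n : ℕ} (hn : IsNext A l' n) (hl : l ≤ l')
    (h : ∀ q, l < q → q ≤ l' → ¬ A q) : IsNext A l n := by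
  have aux : ∀ q, l < q → (l' < q → ¬ A q) → ¬ A q := fun q h1 h2 => by
    rcases le_or_gt q l' with h3 | h3
    · exact h q h1 h3
    · exact h2 h3
  rcases hn with ⟨h1, h2⟩ | ⟨h1, h2, h3⟩
  · exact Or.inl ⟨h1, fun q hq => aux q hq (h2 q)⟩
  · exact Or.inr ⟨h1, hl.trans_lt h2, fun q hq hq' => aux q hq fun h' => h3 q h' hq'⟩

theorem IsNext.shrink {A : ℕ → Prop} {l l' n : ℕ} (hn : IsNext A l n) (hl : l ≤ l')
    (h : ∀ q, l < q → q ≤ l' → ¬ A q) : IsNext A l' n := by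
  rcases hn with ⟨h1, h2⟩ | ⟨h1, h2, h3⟩
  · exact Or.inl ⟨h1, fun q hq => h2 q (hl.trans_lt hq)⟩
  · refine Or.inr ⟨h1, ?_, fun q hq hq' => h3 q (hl.trans_lt hq) hq'⟩
    by_contra hc
    exact h n h2 (not_lt.1 hc) h1

theorem IsNext.congr {A B : ℕ → Prop} {l n : ℕ} (hn : IsNext A l n)
    (h : ∀ q, l < q → (A q ↔ B q)) : IsNext B l n := by
  rcases hn with ⟨h1, h2⟩ | ⟨h1, h2, h3⟩
  · exact Or.inl ⟨h1, fun q hq hb => h2 q hq ((h q hq).2 hb)⟩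
  · exact Or.inr ⟨(h n h2).1 h1, h2, fun q hq hq' hb => h3 q hq hq' ((h q hq).2 hb)⟩

theorem IsSweep.not_actAt_zero : ¬ ActAt ρ vp k 0 := fun h => by simpa using h.1

namespace IsSweep

theorem X_le_of_pos_le (hs : IsSweep X Y e ρ vp pos) {u w : ZMod m} (h : pos u ≤ pos w) :
    X u ≤ X w := by
  rcases h.lt_or_eq with h | h
  · exact hs.pos_sorted u w h
  · rw [hs.pos_injective h]

theorem X_vp_le (hs : IsSweep X Y e ρ vp pos) {q r : ℕ} (hq : ActAt ρ vp k q)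
    (hr : ActAt ρ vp k r) (h : q ≤ r) : X (vp q) ≤ X (vp r) :=
  hs.X_le_of_pos_le (by rwa [hs.pos_vp_of_actAt hq, hs.pos_vp_of_actAt hr])

open Classical in
theorem activeCount_zero (hs : IsSweep X Y e ρ vp pos) : activeCount ρ pos k 0 = 0 := by
  rw [activeCount, Finset.card_eq_zero, Finset.filter_eq_empty_iff]
  rintro u - ⟨-, h⟩
  have := hs.one_le_pos u
  omega

open Classical in
theorem activeCount_congr {l l' : ℕ}
    (h : ∀ u, Active ρ k u → (pos u ≤ l ↔ pos u ≤ l')) :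
    activeCount ρ pos k l = activeCount ρ pos k l' := by
  unfold activeCount
  congr 1
  ext u
  simp only [Finset.mem_filter, Finset.mem_univ, true_and]
  exact and_congr_right fun hu => h u hu

open Classical in
theorem activeCount_insert {l l' : ℕ} {a : ZMod m} (ha : Active ρ k a) (hl : l < pos a)
    (hl' : pos a ≤ l') (h : ∀ u, Active ρ k u → u ≠ a → (pos u ≤ l ↔ pos u ≤ l')) :
    activeCount ρ pos k l' = activeCount ρ pos k l + 1 := by
  unfold activeCount
  rw [← Finset.card_insert_of_notMem (a := a) (by simp [hl])]
  congr 1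
  ext u
  simp only [Finset.mem_filter, Finset.mem_univ, true_and, Finset.mem_insert]
  by_cases hu : u = a
  · subst hu; simp [ha, hl']
  · constructor
    · rintro ⟨h1, h2⟩; exact Or.inr ⟨h1, (h u h1 hu).2 h2⟩
    · rintro (h1 | ⟨h1, h2⟩)
      · exact absurd h1 hu
      · exact ⟨h1, (h u h1 hu).1 h2⟩

-- Only the parity of the count is kept: it changes by one for each of the two toggled edges whose
-- position is at most `l`, whether they become active or inactive.
open Classical in
theorem activeCount_succ (hs : IsSweep X Y e ρ vp pos) (hk : k < m) (l : ℕ) :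
    ((activeCount ρ pos (k + 1) l : ℕ) : ZMod 2) =
      activeCount ρ pos k l + (bit (pos (e k) ≤ l) + bit (pos (e k - 1) ≤ l)) := by
  unfold activeCount
  rw [natCast_card_filter_eq_sum_bit, natCast_card_filter_eq_sum_bit]
  have e1 : ∀ h, bit (ρ h < k + 1) = bit (ρ h < k) + bit (h = e k) := by
    intro h
    rw [← bit_xor]
    refine bit_congr ?_
    constructor
    · intro h1 h2
      by_cases h3 : h = e k
      · rw [h3, hs.ρ_e k hk] at h2; simp at h2
      · have : ρ h ≠ k := fun h' => h3 (by rw [← hs.e_ρ h, h'])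
        exact h3 (h2.1 (by omega))
    · intro h1
      by_contra h2
      refine h1 (iff_of_false (by omega) ?_)
      rintro rfl
      rw [hs.ρ_e k hk] at h2; omega
  have e2 : ∀ u, bit (Active ρ (k + 1) u ∧ pos u ≤ l) = bit (Active ρ k u ∧ pos u ≤ l) +
      (bit (u = e k) * bit (pos u ≤ l) + bit (u = e k - 1) * bit (pos u ≤ l)) := by
    intro u
    simp only [bit_and, Active, bit_xor, e1]
    rw [bit_congr (p := u + 1 = e k) (q := u = e k - 1) eq_sub_iff_add_eq.symm]
    ring
  have e3 : ∀ c : ZMod m, ∑ u, bit (u = c) * bit (pos u ≤ l) = bit (pos c ≤ l) := by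
    intro c
    rw [Finset.sum_eq_single c]
    · rw [bit_true rfl, one_mul]
    · intro u _ hu; rw [bit_false hu, zero_mul]
    · simp
  simp only [e2, Finset.sum_add_distrib, e3]

end IsSweep

/-! ### Preservation of the invariant; the reported rectangles are exactly the pieces -/

namespace SweepInv

/-- There is no active position strictly between `p` and `pa`, nor between `pa` and `pb`. So the
successor of `pb` is that of the last active position among the three, or of the list head `0`. -/
theorem next_event (hI : SweepInv X Y ρ vp pos k nxt flag bot) (hs : IsSweep X Y e ρ vp pos)
    (hP : IsCyclicPolygon X Y P) (hv : IsEvent e ρ vp pos k p pa pb) [Decidable (ActAt ρ vp k pa)]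
    [Decidable (ActAt ρ vp k pb)] :
    IsNext (ActAt ρ vp k) pb
      (nxt (if ActAt ρ vp k pb then pb else if ActAt ρ vp k pa then pa else p)) := by
  obtain ⟨-, -, -, -, -, hab, -⟩ := hv.cases hs hP
  have n1 := fun q h1 h2 => hv.not_actAt_between hs hP (q := q) h1 h2
  split_ifs with hb ha
  · exact hI.next pb (Or.inr hb)
  · refine (hI.next pa (Or.inr ha)).shrink hab.le fun q h1 h2 => ?_
    rcases h2.lt_or_eq with h2 | rfl
    · exact n1 q h1 h2
    · exact hb
  · refine (hI.next p hv.p_act).shrink (hv.p_lt.le.trans hab.le) fun q h1 h2 => ?_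
    rcases lt_trichotomy q pa with h3 | rfl | h3
    · exact hv.p_max q h1 h3
    · exact ha
    · rcases h2.lt_or_eq with h2 | rfl
      · exact n1 q h3 h2
      · exact hb

theorem touches_event (hs : IsSweep X Y e ρ vp pos) (hP : IsCyclicPolygon X Y P)
    (hv : IsEvent e ρ vp pos k p pa pb) {l n : ℕ} {j : ℕ} (hl : ActAt ρ vp j l)
    (hn : ActAt ρ vp j n) (h1 : l ≤ pb) (h2 : pa ≤ n) : Touches X (vp l) (vp n) (e k) := by
  obtain ⟨a, b, -, rfl, rfl, -, -, hmin, hmax, -⟩ := hv.cases hs hP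
  constructor
  · rw [hmin]; exact hs.X_le_of_pos_le (by rwa [hs.pos_vp_of_actAt hn])
  · rw [hmax]; exact hs.X_le_of_pos_le (by rwa [hs.pos_vp_of_actAt hl])

/-- The equations insert or delete `pa` and `pb` in the linked list, in all four combinations of old
states at once. The gaps at `p`, `pa` and `pb` touch the edge of the event, which has the greatest
height so far. Every other gap lies left of `pa` or right of `pb` and keeps its data. -/
theorem step (hI : SweepInv X Y ρ vp pos k nxt flag bot) (hs : IsSweep X Y e ρ vp pos)
    (hP : IsCyclicPolygon X Y P) (hv : IsEvent e ρ vp pos k p pa pb) [Decidable (ActAt ρ vp k pa)]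
    [Decidable (ActAt ρ vp k pb)] {nxt' flag' : ℕ → ℕ} {bot' : ℕ → ℝ}
    (n1 : nxt' pb = nxt (if ActAt ρ vp k pb then pb else if ActAt ρ vp k pa then pa else p))
    (n2 : nxt' pa = if ActAt ρ vp k pb then nxt' pb else pb)
    (n3 : nxt' p = if ActAt ρ vp k pa then nxt' pa else pa)
    (n4 : ∀ l, l ≠ p → l ≠ pa → l ≠ pb → nxt' l = nxt l)
    (f1 : flag' pa = 1 - flag p)
    (f2 : flag' pb = if ActAt ρ vp k pa then 1 - flag p else flag p)
    (f3 : ∀ l, l ≠ pa → l ≠ pb → flag' l = flag l)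
    (b1 : ∀ l, l = p ∨ l = pa ∨ l = pb → bot' l = Y (e k))
    (b2 : ∀ l, l ≠ p → l ≠ pa → l ≠ pb → bot' l = bot l) :
    SweepInv X Y ρ vp pos (k + 1) nxt' flag' bot' := by
  obtain ⟨a, b, hab, hpa, hpb, hlt, hXab, hmin, hmax, ta, tb⟩ := hv.cases hs hP
  have btw := fun q h1 h2 => hv.not_actAt_between hs hP (q := q) h1 h2
  have ta' := hv.actAt_toggle hs hP (Or.inl (rfl : pa = pa))
  have tb' := hv.actAt_toggle hs hP (Or.inr (rfl : pb = pb))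
  have same : ∀ q, q ≠ pa → q ≠ pb → (ActAt ρ vp (k + 1) q ↔ ActAt ρ vp k q) :=
    fun q h1 h2 => hv.actAt_succ hs hP h1 h2
  have hplt := hv.p_lt
  have N1 : IsNext (ActAt ρ vp (k + 1)) pb (nxt' pb) := by
    rw [n1]
    exact (hI.next_event hs hP hv).congr fun q hq => (same q (by omega) (by omega)).symm
  have N2 : IsNext (ActAt ρ vp (k + 1)) pa (nxt' pa) := by
    rw [n2]
    split_ifs with hb
    · refine N1.extend hlt.le fun q h1 h2 => ?_
      rcases h2.lt_or_eq with h2 | rfl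
      · rw [same q (by omega) (by omega)]; exact btw q h1 h2
      · rw [tb']; exact not_not.2 hb
    · refine Or.inr ⟨tb'.2 hb, hlt, fun q h1 h2 => ?_⟩
      rw [same q (by omega) (by omega)]; exact btw q h1 h2
  have N3 : IsNext (ActAt ρ vp (k + 1)) p (nxt' p) := by
    rw [n3]
    split_ifs with ha
    · refine N2.extend hplt.le fun q h1 h2 => ?_
      rcases h2.lt_or_eq with h2 | rfl
      · rw [same q (by omega) (by omega)]; exact hv.p_max q h1 h2
      · rw [ta']; exact not_not.2 ha
    · refine Or.inr ⟨ta'.2 ha, hplt, fun q h1 h2 => ?_⟩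
      rw [same q (by omega) (by omega)]; exact hv.p_max q h1 h2
  -- A further list position is left of an active `p`, or it is an old active position right of
  -- `pb`.
  have loc : ∀ l, l = 0 ∨ ActAt ρ vp (k + 1) l → l ≠ p → l ≠ pa → l ≠ pb →
      (l < p ∧ ActAt ρ vp k p) ∨ (pb < l ∧ ActAt ρ vp k l) := by
    intro l hl h1 h2 h3
    rcases hl with rfl | hl
    · left
      have : 0 < p := by omega
      exact ⟨this, hv.p_act.resolve_left (by omega)⟩
    · have hl' := (same l h2 h3).1 hl
      rcases lt_trichotomy l p with h4 | h4 | h4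
      · exact Or.inl ⟨h4, hv.p_act.resolve_left (by omega)⟩
      · exact absurd h4 h1
      · rcases lt_trichotomy l pa with h5 | h5 | h5
        · exact absurd hl' (hv.p_max l h4 h5)
        · exact absurd h5 h2
        · rcases lt_trichotomy l pb with h6 | h6 | h6
          · exact absurd hl' (btw l h5 h6)
          · exact absurd h6 h3
          · exact Or.inr ⟨h6, hl'⟩
  have next_le : ∀ l, l = 0 ∨ ActAt ρ vp (k + 1) l → l ≠ pa → l < p → ActAt ρ vp k p →
      ActAt ρ vp k (nxt l) ∧ l < nxt l ∧ nxt l ≤ p ∧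
        ∀ q, l < q → q < nxt l → ¬ ActAt ρ vp k q := by
    intro l hl h0 h1 h2
    have hl' : l = 0 ∨ ActAt ρ vp k l := hl.imp_right fun h => (same l h0 (by omega)).1 h
    rcases hI.next l hl' with ⟨h3, h4⟩ | ⟨h3, h4, h5⟩
    · exact absurd h2 (h4 p h1)
    · refine ⟨h3, h4, ?_, h5⟩
      by_contra hc
      exact h5 p h1 (by omega) h2
  refine ⟨?_, ?_, ?_, ?_⟩
  · intro l hl
    by_cases h1 : l = p
    · rw [h1]; exact N3
    by_cases h2 : l = pa
    · rw [h2]; exact N2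
    by_cases h3 : l = pb
    · rw [h3]; exact N1
    rw [n4 l h1 h2 h3]
    rcases loc l hl h1 h2 h3 with ⟨h4, h5⟩ | ⟨h4, h5⟩
    · obtain ⟨h6, h7, h8, h9⟩ := next_le l hl h2 h4 h5
      refine Or.inr ⟨(same _ (by omega) (by omega)).2 h6, h7, fun q h10 h11 => ?_⟩
      rw [same q (by omega) (by omega)]; exact h9 q h10 h11
    · exact (hI.next l (Or.inr h5)).congr fun q hq => (same q (by omega) (by omega)).symm
  · intro l hl
    have hc := hs.activeCount_succ hv.lt l
    have hc' : ((activeCount ρ pos (k + 1) l : ℕ) : ZMod 2) =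
        activeCount ρ pos k l + (bit (pa ≤ l) + bit (pb ≤ l)) := by
      rw [hc]
      rcases hab with ⟨rfl, rfl⟩ | ⟨rfl, rfl⟩
      · rw [← hpa, ← hpb]; ring
      · rw [← hpa, ← hpb]
    -- Away from `pa ≤ l < pb` the two toggles change the count by an even number, so an unchanged
    -- flag remains correct.
    have even : (bit (pa ≤ l) + bit (pb ≤ l) = 0) → flag' l = flag l →
        (l = 0 ∨ ActAt ρ vp k l) → flag' l = activeCount ρ pos (k + 1) l % 2 := by
      intro h1 h2 h3
      rw [h1, add_zero, ZMod.natCast_eq_natCast_iff] at hc'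
      rw [h2, hI.flag_eq l h3]; exact hc'.symm
    have ppar := hI.flag_eq p hv.p_act
    have actpos : ∀ u, Active ρ k u → ActAt ρ vp k (pos u) := fun u hu => hs.actAt_pos.2 hu
    -- If `pa` is active after the event, it was inactive before. The old count up to `pa` then
    -- equals that up to `p`, and `pa` itself adds one.
    by_cases h2 : l = pa
    · subst h2
      have hna : ¬ ActAt ρ vp k l := by
        rcases hl with h | h
        · omega
        · exact ta'.1 h
      have ec : activeCount ρ pos k l = activeCount ρ pos k p := by
        refine IsSweep.activeCount_congr fun u hu => ⟨fun h => ?_, fun h => by omega⟩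
        by_contra hcon
        rcases h.lt_or_eq with h | h
        · exact hv.p_max _ (by omega) h (actpos u hu)
        · exact hna (h ▸ actpos u hu)
      rw [bit_true (le_refl l), bit_false (not_le.2 hlt), add_zero, ec, ← Nat.cast_one (R := ZMod 2),
        ← Nat.cast_add, ZMod.natCast_eq_natCast_iff] at hc'
      rw [f1, ppar]
      unfold Nat.ModEq at hc'
      omega
    by_cases h3 : l = pb
    · subst h3
      have hnb : ¬ ActAt ρ vp k l := by
        rcases hl with h | h
        · omega
        · exact tb'.1 h
      rw [bit_true (le_refl l), bit_true hlt.le, CharTwo.add_self_eq_zero, add_zero,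
        ZMod.natCast_eq_natCast_iff] at hc'
      have hcl : ∀ u, Active ρ k u → pos u ≠ pa → (pos u ≤ p ↔ pos u ≤ l) := by
        intro u hu hupa
        refine ⟨fun h => by omega, fun h => ?_⟩
        by_contra hcon
        have hne : pos u ≠ l := fun h' => hnb (h' ▸ actpos u hu)
        rcases lt_or_gt_of_ne hupa with h4 | h4
        · exact hv.p_max _ (by omega) h4 (actpos u hu)
        · exact btw _ h4 (by omega) (actpos u hu)
      rw [f2]
      unfold Nat.ModEq at hc'
      split_ifs with ha
      · have hact : Active ρ k a := hs.actAt_pos.1 (hpa ▸ ha)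
        have := IsSweep.activeCount_insert (l := p) (l' := l) hact (by omega) (by omega)
          fun u hu hne => hcl u hu fun h => hne (hs.pos_injective (h.trans hpa))
        omega
      · have := IsSweep.activeCount_congr (l := p) (l' := l) fun u hu =>
          hcl u hu fun h => ha (h ▸ actpos u hu)
        omega
    by_cases h1 : l = p
    · subst h1
      exact even (by rw [bit_false (by omega), bit_false (by omega), add_zero]) (f3 l h2 h3) hv.p_act
    rcases loc l hl h1 h2 h3 with ⟨h4, h5⟩ | ⟨h4, h5⟩
    · exact even (by rw [bit_false (by omega), bit_false (by omega), add_zero]) (f3 l h2 h3)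
        (hl.imp_right fun h => (same l h2 h3).1 h)
    · exact even (by rw [bit_true (by omega), bit_true (by omega), CharTwo.add_self_eq_zero])
        (f3 l h2 h3) (Or.inr h5)
  · intro l hl hn h hh ht
    by_cases hlm : l = p ∨ l = pa ∨ l = pb
    · rw [b1 l hlm]
      exact hs.le_of_rank_le (by rw [hs.ρ_e k hv.lt]; omega)
    · simp only [not_or] at hlm
      obtain ⟨h1, h2, h3⟩ := hlm
      rw [n4 l h1 h2 h3] at hn ht
      rw [b2 l h1 h2 h3]
      have hlk := (same l h2 h3).1 hl
      -- The edge of the event spans from `pa` to `pb`, so a gap that ends left of `pa` or starts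
      -- right of `pb` does not touch it.
      have hnk : ActAt ρ vp k (nxt l) ∧ (h ≠ e k) := by
        rcases loc l (Or.inr hl) h1 h2 h3 with ⟨h4, h5⟩ | ⟨h4, h5⟩
        · obtain ⟨h6, h7, h8, h9⟩ := next_le l (Or.inr hl) h2 h4 h5
          refine ⟨h6, ?_⟩
          rintro rfl
          have := ht.1
          rw [hmin] at this
          refine absurd this (not_le.2 ((hs.lt_iff hP (hs.height_mem hv.lt h6.2.2) ta).1 ?_))
          rw [hs.pos_vp_of_actAt h6, ← hpa]; omega
        · have hgt : l < nxt l := by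
            rcases hI.next l (Or.inr h5) with ⟨h6, -⟩ | ⟨-, h6, -⟩
            · rw [h6] at hn; exact absurd hn IsSweep.not_actAt_zero
            · exact h6
          refine ⟨(same _ (by omega) (by omega)).1 hn, ?_⟩
          rintro rfl
          have := ht.2
          rw [hmax] at this
          refine absurd this (not_le.2 ((hs.lt_iff hP tb (hs.height_mem hv.lt h5.2.2)).1 ?_))
          rw [hs.pos_vp_of_actAt h5, ← hpb]; omega
      refine hI.bot_max l hlk hnk.1 h ?_ ht
      have : ρ h ≠ k := fun h' => hnk.2 (by rw [← hs.e_ρ h, h'])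
      omega
  · intro l hl hn
    by_cases hlm : l = p ∨ l = pa ∨ l = pb
    · refine ⟨e k, by rw [hs.ρ_e k hv.lt]; omega, ?_, (b1 l hlm).symm⟩
      refine touches_event hs hP hv hl hn (by omega) ?_
      have hnz : nxt' l ≠ 0 := fun h => IsSweep.not_actAt_zero (h ▸ hn)
      rcases hlm with rfl | rfl | rfl
      · rcases N3 with ⟨h, -⟩ | ⟨h1, h2, -⟩
        · exact absurd h hnz
        · by_contra hc
          exact hv.p_max _ h2 (by omega) ((same _ (by omega) (by omega)).1 h1)
      · rcases N2 with ⟨h, -⟩ | ⟨h1, h2, -⟩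
        · exact absurd h hnz
        · omega
      · rcases N1 with ⟨h, -⟩ | ⟨h1, h2, -⟩
        · exact absurd h hnz
        · omega
    · simp only [not_or] at hlm
      obtain ⟨h1, h2, h3⟩ := hlm
      rw [n4 l h1 h2 h3] at hn ⊢
      rw [b2 l h1 h2 h3]
      have hlk := (same l h2 h3).1 hl
      have hnk : ActAt ρ vp k (nxt l) := by
        rcases loc l (Or.inr hl) h1 h2 h3 with ⟨h4, h5⟩ | ⟨h4, h5⟩
        · exact (next_le l (Or.inr hl) h2 h4 h5).1
        · have hgt : l < nxt l := by
            rcases hI.next l (Or.inr h5) with ⟨h6, -⟩ | ⟨-, h6, -⟩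
            · rw [h6] at hn; exact absurd hn IsSweep.not_actAt_zero
            · exact h6
          exact (same _ (by omega) (by omega)).1 hn
      obtain ⟨h, hh, ht, hb⟩ := hI.bot_mem l hlk hnk
      exact ⟨h, by omega, ht, hb⟩

/-- The active edges on the two sides of a gap. -/
theorem gap_iff (hs : IsSweep X Y e ρ vp pos) {l r : ℕ} (hl : ActAt ρ vp k l)
    (hr : ActAt ρ vp k r) (hm : ∀ q, l < q → q < r → ¬ ActAt ρ vp k q) {x : ℝ}
    (h1 : X (vp l) < x) (h2 : x < X (vp r)) (u : ZMod m) (hu : Active ρ k u) :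
    pos u ≤ l ↔ X u < x := by
  constructor
  · intro h
    exact (hs.X_le_of_pos_le (by rwa [hs.pos_vp_of_actAt hl])).trans_lt h1
  · intro h
    by_contra hc
    have h3 : r ≤ pos u := by
      by_contra h4
      exact hm _ (by omega) (by omega) (hs.actAt_pos.2 hu)
    have := hs.X_le_of_pos_le (u := vp r) (w := u) (by rwa [hs.pos_vp_of_actAt hr])
    linarith

/-- A reported rectangle is a piece. -/
theorem isPiece (hI : SweepInv X Y ρ vp pos k nxt flag bot) (hs : IsSweep X Y e ρ vp pos)
    (hP : IsCyclicPolygon X Y P) (hv : IsEvent e ρ vp pos k p pa pb) {l : ℕ}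
    (hlp : l = p ∨ l = pa ∨ l = pb) (hl : l = 0 ∨ ActAt ρ vp k l) (hf : flag l = 1)
    (hb : bot l < Y (e k)) :
    IsPiece X Y P (vp l) (vp (nxt l)) (bot l) (Y (e k)) := by
  obtain ⟨-, -, -, -, -, hlt, -⟩ := hv.cases hs hP
  have hplt := hv.p_lt
  -- At the list head the count of active edges is zero, so its flag cannot be one.
  have hl' : ActAt ρ vp k l := by
    refine hl.resolve_left ?_
    rintro rfl
    rw [hI.flag_eq 0 (Or.inl rfl), hs.activeCount_zero] at hf
    simp at hf
  have hlpos := hs.pos_vp_of_actAt hl'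
  -- Without a successor, the flag counts all active edges. Its parity is that of the processed
  -- edges covering an abscissa beyond the whole polygon, of which there are none.
  rcases hI.next l hl with ⟨-, hnone⟩ | ⟨hr, hlr, hbtw⟩
  · exfalso
    obtain ⟨M, hM⟩ := (finite_range X).bddAbove
    have hM' : ∀ u, X u < M + 1 := fun u => by
      have := hM ⟨u, rfl⟩
      linarith
    rw [hI.flag_eq l hl, activeCount_parity (x := M + 1) (fun u => (hM' u).ne)
      (fun u hu => iff_of_true (not_lt.1 fun h => hnone _ h (hs.actAt_pos.2 hu)) (hM' u))] at hf
    have h0 : ∀ h, ¬ Covers X (M + 1) h := fun h hc => by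
      have := hc.2
      rcases lt_max_iff.1 this with h' | h' <;> linarith [hM' h, hM' (h - 1)]
    simp [h0] at hf
  set r := nxt l with hrdef
  have tl := hs.height_mem hv.lt hl'.2.2
  have tr := hs.height_mem hv.lt hr.2.2
  have hrpos := hs.pos_vp_of_actAt hr
  have hX : X (vp l) < X (vp r) := (hs.lt_iff hP tl tr).1 (by rwa [hlpos, hrpos])
  have hlpb : l ≤ pb := by omega
  have hpar : pa ≤ r := by
    rcases hlp with rfl | rfl | rfl
    · by_contra hc
      exact hv.p_max r hlr (by omega) hr
    · omega
    · omega
  have rk : ∀ h, Touches X (vp l) (vp r) h → ρ h < k → Y h ≤ bot l := fun h ht hh =>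
    hI.bot_max l hl' hr h hh ht
  have rk' : ∀ h, ¬ ρ h < k → Y (e k) ≤ Y h := fun h hh => hs.le_height hv.lt hh
  have tself := touches_self hX.le
  have lohi : ∀ u, Active ρ k u → Touches X (vp l) (vp r) u → Touches X (vp l) (vp r) (u + 1) →
      min (Y u) (Y (u + 1)) ≤ bot l ∧ Y (e k) ≤ max (Y u) (Y (u + 1)) := by
    intro u hu h1 h2
    by_cases h3 : ρ u < k
    · have h4 : ¬ ρ (u + 1) < k := fun h => hu (iff_of_true h3 h)
      exact ⟨(min_le_left _ _).trans (rk u h1 h3), (rk' _ h4).trans (le_max_right _ _)⟩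
    · have h4 : ρ (u + 1) < k := by
        by_contra h; exact hu (iff_of_false h3 h)
      exact ⟨(min_le_right _ _).trans (rk _ h2 h4), (rk' _ h3).trans (le_max_left _ _)⟩
  obtain ⟨hb0, hb1, hb2, hb3⟩ := hI.bot_mem l hl' hr
  have L := lohi (vp l) hl'.2.2 tself.1 tself.2.1
  have R := lohi (vp r) hr.2.2 tself.2.2.1 tself.2.2.2
  refine ⟨hX, hb, L.1, L.2, R.1, R.2, ?_, ?_, ⟨hb0, hb2, hb3⟩,
    ⟨e k, touches_event hs hP hv hl' hr hlpb hpar, rfl⟩, ?_⟩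
  · intro u h1 h2 h3
    have ht := touches_of_between h1.le h2.le
    by_contra hc
    -- An inactive edge inside the gap has both ends processed, and is below `bot l`, or neither,
    -- and is above the event.
    have hu : ¬ Active ρ k u := by
      intro hu
      have tu := hs.height_mem hv.lt hu
      refine hbtw (pos u) ?_ ?_ (hs.actAt_pos.2 hu)
      · rw [← hlpos]; exact (hs.lt_iff hP tl tu).2 h1
      · rw [← hrpos]; exact (hs.lt_iff hP tu tr).2 h2
    have hiff : ρ u < k ↔ ρ (u + 1) < k := not_not.1 hu
    by_cases h4 : ρ u < k
    · exact hc (max_le (rk u ht.1 h4) (rk _ ht.2 (hiff.1 h4)))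
    · have h5 := rk' u h4
      have h6 := rk' (u + 1) fun h => h4 (hiff.2 h)
      exact absurd h3 (not_lt.2 (le_min h5 h6))
  · intro h ht
    by_cases h1 : ρ h < k
    · exact Or.inl (rk h ht h1)
    · exact Or.inr (rk' h h1)
  -- On a generic vertical line through the gap, the processed edges are those below the test point.
  -- So the flag is the parity that decides membership in `P`.
  · obtain ⟨x, hx1, hx2, hx⟩ := exists_generic X hX
    set y := (bot l + Y (e k)) / 2 with hy
    have y1 : bot l < y := by rw [hy]; linarith
    have y2 : y < Y (e k) := by rw [hy]; linarith
    have hcov : ∀ h, Covers X x h → (ρ h < k ↔ Y h < y) ∧ Y h ≠ y := by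
      intro h hc
      have ht : Touches X (vp l) (vp r) h := ⟨(hc.1.trans hx2).le, (hx1.trans hc.2).le⟩
      by_cases h1 : ρ h < k
      · have := rk h ht h1
        exact ⟨iff_of_true h1 (by linarith), by linarith⟩
      · have := rk' h h1
        exact ⟨iff_of_false h1 (by linarith), fun h => by linarith⟩
    refine ⟨(x, y), ⟨⟨hx1, hx2⟩, y1, y2⟩, ?_⟩
    rw [hP.mem_iff_odd hx fun h hc => (hcov h hc).2, Nat.odd_iff]
    rw [hI.flag_eq l hl, activeCount_parity hx (gap_iff hs hl' hr hbtw hx1 hx2)] at hf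
    rw [← hf]
    congr 2
    ext h
    simp only [Finset.mem_filter, Finset.mem_univ, true_and]
    exact and_congr_right fun hc => (hcov h hc).1.symm

/-- Every piece is reported at the first event that touches it from above. -/
theorem reports (hI : SweepInv X Y ρ vp pos k nxt flag bot) (hs : IsSweep X Y e ρ vp pos)
    (hP : IsCyclicPolygon X Y P) (hv : IsEvent e ρ vp pos k p pa pb) {l r : ZMod m} {b : ℝ}
    (hp : IsPiece X Y P l r b (Y (e k))) (ht : Touches X l r (e k))
    (hfirst : ∀ h, ρ h < k → Touches X l r h → Y h ≠ Y (e k)) :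
    ActAt ρ vp k (pos l) ∧ nxt (pos l) = pos r ∧ bot (pos l) = b ∧ flag (pos l) = 1 ∧
      (pos l = p ∨ pos l = pa ∨ pos l = pb) := by
  have hX := hp.lt_x
  have hby := hp.lt_y
  have tself := touches_self hX.le
  -- By `hfirst`, edges on the top side of the piece are still unprocessed. Hence a vertical edge
  -- along the whole side has exactly one processed end.
  have act : ∀ u, Touches X l r u → Touches X l r (u + 1) → min (Y u) (Y (u + 1)) ≤ b →
      Y (e k) ≤ max (Y u) (Y (u + 1)) → Active ρ k u := by
    intro u h1 h2 h3 h4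
    have hi : ∀ h, Touches X l r h → Y (e k) ≤ Y h → ¬ ρ h < k := fun h ht hy hlt =>
      hfirst h hlt ht (le_antisymm (hs.height_le hv.lt hlt) hy)
    have lo : ∀ h, Y h ≤ b → ρ h < k := fun h hy => hs.rank_lt_of_lt hv.lt (by linarith)
    rcases min_le_iff.1 h3 with h5 | h5 <;> rcases le_max_iff.1 h4 with h6 | h6
    · linarith
    · exact fun h => hi _ h2 h6 (h.1 (lo _ h5))
    · exact fun h => hi _ h1 h6 (h.2 (lo _ h5))
    · linarith
  have al : Active ρ k l := act l tself.1 tself.2.1 hp.lo_l hp.hi_l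
  have ar : Active ρ k r := act r tself.2.2.1 tself.2.2.2 hp.lo_r hp.hi_r
  have Al : ActAt ρ vp k (pos l) := hs.actAt_pos.2 al
  have Ar : ActAt ρ vp k (pos r) := hs.actAt_pos.2 ar
  have tl := hs.height_mem hv.lt al
  have tr := hs.height_mem hv.lt ar
  have hpos : pos l < pos r := (hs.lt_iff hP tl tr).2 hX
  have rk : ∀ h, Touches X l r h → ρ h < k → Y h ≤ b := fun h ht hlt =>
    (hp.h_between h ht).resolve_right fun hy =>
      hfirst h hlt ht (le_antisymm (hs.height_le hv.lt hlt) hy)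
  -- An active edge inside the strip would reach from at most `b` to at least the height of the
  -- event, against `v_between`.
  have hbtw : ∀ q, pos l < q → q < pos r → ¬ ActAt ρ vp k q := by
    intro q h1 h2 hq
    have tq := hs.height_mem hv.lt hq.2.2
    have eq := hs.pos_vp_of_actAt hq
    have x1 : X l < X (vp q) := (hs.lt_iff hP tl tq).1 (by rwa [eq])
    have x2 : X (vp q) < X r := (hs.lt_iff hP tq tr).1 (by rwa [eq])
    have tt := touches_of_between x1.le x2.le
    by_cases h3 : ρ (vp q) < k
    · have h4 : ¬ ρ (vp q + 1) < k := fun h => hq.2.2 (iff_of_true h3 h)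
      have h5 := hs.le_height hv.lt h4
      have h6 := rk _ tt.1 h3
      have := hp.v_between _ x1 x2 ((min_le_left _ _).trans_lt (by linarith))
      have := (le_max_right _ _).trans this
      linarith
    · have h4 : ρ (vp q + 1) < k := by
        by_contra h; exact hq.2.2 (iff_of_false h3 h)
      have h5 := hs.le_height hv.lt h3
      have h6 := rk _ tt.2 h4
      have := hp.v_between _ x1 x2 ((min_le_right _ _).trans_lt (by linarith))
      have := (le_max_left _ _).trans this
      linarith
  have hnxt : nxt (pos l) = pos r := (hI.next (pos l) (Or.inr Al)).unique Ar hpos hbtw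
  have Ar' : ActAt ρ vp k (nxt (pos l)) := by rw [hnxt]; exact Ar
  have hbot : bot (pos l) = b := by
    refine le_antisymm ?_ ?_
    · obtain ⟨h, h1, h2, h3⟩ := hI.bot_mem (pos l) Al Ar'
      rw [hnxt, hs.vp_pos, hs.vp_pos] at h2
      rw [← h3]; exact rk h h2 h1
    · obtain ⟨h, h1, h2⟩ := hp.bottom
      rw [← h2]
      refine hI.bot_max (pos l) Al Ar' h (hs.rank_lt_of_lt hv.lt (by linarith)) ?_
      rw [hnxt, hs.vp_pos, hs.vp_pos]; exact h1
  refine ⟨Al, hnxt, hbot, ?_, ?_⟩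
  · obtain ⟨x, hx1, hx2, hx⟩ := exists_generic X hX
    set y := (b + Y (e k)) / 2 with hy
    have y1 : b < y := by rw [hy]; linarith
    have y2 : y < Y (e k) := by rw [hy]; linarith
    have hcov : ∀ h, Covers X x h → (ρ h < k ↔ Y h < y) ∧ Y h ≠ y := by
      intro h hc
      have ht : Touches X l r h := ⟨(hc.1.trans hx2).le, (hx1.trans hc.2).le⟩
      by_cases h1 : ρ h < k
      · have := rk h ht h1
        exact ⟨iff_of_true h1 (by linarith), by linarith⟩
      · have := hs.le_height hv.lt h1
        exact ⟨iff_of_false h1 (by linarith), fun h => by linarith⟩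
    have hin : (x, y) ∈ P := interior_subset (hp.subset_interior hP ⟨⟨hx1, hx2⟩, y1, y2⟩)
    rw [hP.mem_iff_odd hx fun h hc => (hcov h hc).2, Nat.odd_iff] at hin
    rw [hI.flag_eq _ (Or.inr Al), activeCount_parity hx
      (gap_iff hs Al Ar hbtw (by rwa [hs.vp_pos]) (by rwa [hs.vp_pos])), ← hin]
    congr 2
    ext h
    simp only [Finset.mem_filter, Finset.mem_univ, true_and]
    exact and_congr_right fun hc => (hcov h hc).1
  -- The edge touches the strip, which gives `pa ≤ pos r` and `pos l ≤ pb`. Since `pos l` and `pos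
  -- r` are consecutive active positions, only the three stated values of `pos l` are possible.
  · obtain ⟨a, c, hac, hpa, hpb, hlt, hXac, hmin, hmax, ta, tc⟩ := hv.cases hs hP
    have x1 := ht.1
    have x2 := ht.2
    rw [hmin] at x1
    rw [hmax] at x2
    have p1 : pa ≤ pos r := by
      by_contra h
      exact absurd x1 (not_le.2 ((hs.lt_iff hP tr ta).1 (by omega)))
    have p2 : pos l ≤ pb := by
      by_contra h
      exact absurd x2 (not_le.2 ((hs.lt_iff hP tc tl).1 (by omega)))
    rcases lt_trichotomy (pos l) pa with h1 | h1 | h1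
    · left
      rcases lt_trichotomy (pos l) p with h2 | h2 | h2
      · have := hv.p_lt
        exact absurd (hv.p_act.resolve_left (by omega)) (hbtw p h2 (by omega))
      · exact h2
      · exact absurd Al (hv.p_max _ h2 h1)
    · exact Or.inr (Or.inl h1)
    · right; right
      rcases p2.lt_or_eq with h2 | h2
      · exact absurd Al (hv.not_actAt_between hs hP h1 h2)
      · exact h2

end SweepInv

end

/-! ### Recognizing top edges and shared extensions during the sweep -/

section

variable {m : ℕ} [NeZero m] {X Y : ZMod m → ℝ} {P : Set Plane} {e : ℕ → ZMod m}
  {ρ : ZMod m → ℕ} {vp : ℕ → ZMod m} {pos : ZMod m → ℕ} {k p pa pb : ℕ} {nxt flag : ℕ → ℕ}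
  {bot : ℕ → ℝ}

theorem card_mod_congr {α : Type*} {s t : Finset α} (h : s = t) :
    s.card % 2 = 1 ↔ t.card % 2 = 1 := by
  rw [h]

namespace SweepInv

/-- The edge is a top edge exactly if points just below it are in `P`, tested at a generic abscissa
close to the right of its midpoint. There the edges below the point are the processed ones, and the
active edges to its left end with `pa` if that is active and with `p` otherwise. -/
theorem isTopH_iff (hI : SweepInv X Y ρ vp pos k nxt flag bot) (hs : IsSweep X Y e ρ vp pos)
    (hP : IsCyclicPolygon X Y P) (hv : IsEvent e ρ vp pos k p pa pb)
    [Decidable (ActAt ρ vp k pa)] :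
    IsTopH X Y P (e k) ↔ flag (if ActAt ρ vp k pa then pa else p) = 1 := by
  obtain ⟨a, b, hab, hpa, hpb, hlt, hXab, hmin, hmax, ta, tb⟩ := hv.cases hs hP
  obtain ⟨ε, hε, hside⟩ := hP.mid_side (e k)
  have hc := hP.covers_mid (e k)
  have hmid2 : (hMid X Y (e k)).1 < X b := by rw [← hmax]; exact hc.2
  have hmid1 : X a < (hMid X Y (e k)).1 := by rw [← hmin]; exact hc.1
  obtain ⟨x, hx1, hx2, hx⟩ := exists_generic X
    (lt_min (by linarith : (hMid X Y (e k)).1 < (hMid X Y (e k)).1 + ε) hmid2)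
  have hx3 := (lt_min_iff.1 hx2).1
  have hx4 := (lt_min_iff.1 hx2).2
  have hcov : Covers X x (e k) := ⟨hmin.trans_lt (hmid1.trans hx1), hx4.trans_eq hmax.symm⟩
  set y := Y (e k) with hy
  have ev : ∀ᶠ y₁ in 𝓝[<] y, (∀ h ∈ (Finset.univ : Finset (ZMod m)), Y h < y → Y h < y₁) ∧
      y₁ ∈ Ioo (y - ε) y := by
    refine Eventually.and ?_ (Ioo_mem_nhdsLT (by linarith))
    rw [Finset.eventually_all]
    intro h _
    by_cases h1 : Y h < y
    · filter_upwards [Ioo_mem_nhdsLT h1] with z hz _ using hz.1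
    · exact Eventually.of_forall fun z h2 => absurd h2 h1
  obtain ⟨y₁, hy₁, hy₂, hy₃⟩ := ev.exists
  have a1 : |x - (hMid X Y (e k)).1| < ε := by rw [abs_lt]; constructor <;> linarith
  have a2 : |y₁ - Y (e k)| < ε := by rw [abs_lt]; constructor <;> linarith
  have h1 : IsTopH X Y P (e k) ↔ (x, y₁) ∈ P := by
    rcases hside with ⟨t, -, hin, -⟩ | ⟨-, t, hout, -⟩
    · exact iff_of_true t (interior_subset (hin x y₁ a1 a2 hy₃))
    · exact iff_of_false t (hout x y₁ a1 a2 hy₃)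
  have hcv : ∀ h, Covers X x h → (ρ h < k ↔ Y h < y₁) ∧ Y h ≠ y₁ := by
    intro h hch
    by_cases h2 : ρ h < k
    -- A processed edge of the same height covering `x` would meet the edge of the event.
    · have h3 : Y h < y := by
        refine lt_of_le_of_ne (hs.height_le hv.lt h2) fun h4 => ?_
        have h5 := IsCyclicPolygon.mem_hEdge_of_covers (Y := Y) hch
        rw [h4] at h5
        have := hP.eq_of_mem_hEdge h5 (IsCyclicPolygon.mem_hEdge_of_covers hcov)
        rw [this, hs.ρ_e k hv.lt] at h2
        exact lt_irrefl _ h2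
      have h4 := hy₁ h (Finset.mem_univ _) h3
      exact ⟨iff_of_true h2 h4, h4.ne⟩
    · have h3 := hs.le_height hv.lt h2
      exact ⟨iff_of_false h2 (by linarith), fun h => by linarith⟩
  rw [h1, hP.mem_iff_odd hx fun h hch => (hcv h hch).2, Nat.odd_iff]
  have hl : (if ActAt ρ vp k pa then pa else p) = 0 ∨
      ActAt ρ vp k (if ActAt ρ vp k pa then pa else p) := by
    split_ifs with ha
    · exact Or.inr ha
    · exact hv.p_act
  have hplt := hv.p_lt
  rw [hI.flag_eq _ hl, activeCount_parity (x := x) hx]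
  · refine card_mod_congr ?_
    ext h
    simp only [Finset.mem_filter, Finset.mem_univ, true_and]
    exact and_congr_right fun hch => (hcv h hch).1.symm
  · intro u hu
    have Au : ActAt ρ vp k (pos u) := hs.actAt_pos.2 hu
    have h2 : (pos u ≤ if ActAt ρ vp k pa then pa else p) ↔ pos u ≤ pa := by
      split_ifs with ha
      · rfl
      · constructor
        · intro h; omega
        · intro h
          by_contra hc
          rcases h.lt_or_eq with h | h
          · exact hv.p_max _ (by omega) h Au
          · exact ha (h ▸ Au)
    rw [h2]
    constructor
    · intro h
      have := hs.X_le_of_pos_le (u := u) (w := a) (by omega)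
      linarith
    · intro h
      by_contra hc
      have h3 : pb ≤ pos u := by
        by_contra h4
        exact hv.not_actAt_between hs hP (by omega) (by omega) Au
      have := hs.X_le_of_pos_le (u := b) (w := u) (by omega)
      linarith

end SweepInv

namespace IsSweep

/-- Disjoint intervals at one height are ordered as a whole by any choice of a point in each, here
the abscissas `X h` and `X h'`. -/
theorem left_of (hs : IsSweep X Y e ρ vp pos) (hP : IsCyclicPolygon X Y P) {h h' : ZMod m}
    (hlt : ρ h < ρ h') (hy : Y h = Y h') :
    max (X (h - 1)) (X h) < min (X (h' - 1)) (X h') := by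
  have hX : X h < X h' := by
    rcases hs.ρ_sorted h h' hlt with a | a
    · exact absurd hy a.ne
    · exact a.2
  have hne : h ≠ h' := by rintro rfl; exact lt_irrefl _ hlt
  by_contra hc
  rw [not_lt] at hc
  have h1 : min (X (h - 1)) (X h) ≤ X h := min_le_right _ _
  have h2 : X h' ≤ max (X (h' - 1)) (X h') := le_max_right _ _
  have m1 : (max (min (X (h - 1)) (X h)) (min (X (h' - 1)) (X h')), Y h) ∈ hEdge X Y h :=
    mem_hEdge.2 ⟨⟨le_max_left _ _, max_le min_le_max hc⟩, rfl⟩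
  have m2 : (max (min (X (h - 1)) (X h)) (min (X (h' - 1)) (X h')), Y h) ∈ hEdge X Y h' :=
    mem_hEdge.2 ⟨⟨le_max_right _ _, max_le (by linarith) min_le_max⟩, hy⟩
  exact disjoint_left.1 (hP.h_disjoint h h' hne) m1 m2

theorem _root_.IsCyclicPolygon.between_subset (hP : IsCyclicPolygon X Y P) {h h' : ZMod m}
    (hext : hExtension X Y P h = hExtension X Y P h') :
    Y h = Y h' ∧ ∀ x, max (X (h - 1)) (X h) ≤ x → x ≤ min (X (h' - 1)) (X h') →
      (x, Y h) ∈ P := by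
  have m1 : (X h, Y h) ∈ hExtension X Y P h' := by
    rw [← hext]
    exact hP.hEdge_subset_hExtension h (mem_hEdge.2 ⟨right_mem_uIcc, rfl⟩)
  obtain ⟨hy, q, hq, hseg⟩ := mem_hExtension.1 m1
  refine ⟨hy, fun x h1 h2 => hseg x ?_⟩
  rw [mem_uIcc]
  exact Or.inl ⟨(le_max_right _ _).trans h1, h2.trans hq.1⟩

/-- Edges with the same extension are consecutive in the order of the sweep. -/
theorem hExtension_eq_of_between (hs : IsSweep X Y e ρ vp pos) (hP : IsCyclicPolygon X Y P)
    {h i h' : ZMod m} (h1 : ρ h < ρ i) (h2 : ρ i < ρ h')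
    (hext : hExtension X Y P h = hExtension X Y P h') :
    hExtension X Y P i = hExtension X Y P h' := by
  obtain ⟨hy, hseg⟩ := hP.between_subset hext
  have y1 : Y h = Y i := le_antisymm (hs.le_of_rank_lt h1) (hy ▸ hs.le_of_rank_lt h2)
  have y2 : Y i = Y h' := y1.symm.trans hy
  have l1 := hs.left_of hP h1 y1
  have l2 := hs.left_of hP h2 y2
  have c1 : min (X (i - 1)) (X i) ≤ X i := min_le_right _ _
  have c2 : X i ≤ max (X (i - 1)) (X i) := le_max_right _ _
  refine IsCyclicPolygon.hExtension_eq_of_sees (x := X i) (x' := min (X (h' - 1)) (X h')) (y := Y i)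
    (mem_hEdge.2 ⟨right_mem_uIcc, rfl⟩) (mem_hEdge.2 ⟨⟨le_rfl, min_le_max⟩, y2⟩) ?_ hP
  intro s hs'
  rw [uIcc_of_le (by linarith)] at hs'
  rw [← y1]
  exact hseg s (by linarith [hs'.1]) hs'.2

end IsSweep

namespace SweepInv

/-- The test whether an edge has the same extension as the preceding edge. -/
theorem linked_iff (hI : SweepInv X Y ρ vp pos k nxt flag bot) (hs : IsSweep X Y e ρ vp pos)
    (hP : IsCyclicPolygon X Y P) (hv : IsEvent e ρ vp pos k p pa pb) :
    (flag p = 1 ∧ bot p = Y (e k)) ↔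
      0 < k ∧ hExtension X Y P (e (k - 1)) = hExtension X Y P (e k) := by
  obtain ⟨a, b, hab, hpa, hpb, hlt, hXab, hmin, hmax, ta, tb⟩ := hv.cases hs hP
  have hplt := hv.p_lt
  have rk : ρ (e k) = k := hs.ρ_e k hv.lt
  set y := Y (e k) with hy
  -- a vertical edge at height `y` strictly between two consecutive edges at height `y`
  have cross : ∀ u, y ∈ uIcc (Y u) (Y (u + 1)) → 0 < k → Y (e (k - 1)) = y →
      max (X (e (k - 1) - 1)) (X (e (k - 1))) < X u → X u < X a →
      Active ρ k u ∧ min (Y u) (Y (u + 1)) < y ∧ y < max (Y u) (Y (u + 1)) := by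
    intro u hu hk hyk h1 h2
    have rk1 : ρ (e (k - 1)) = k - 1 := hs.ρ_e _ (by have := hv.lt; omega)
    have key : ∀ h, Y h = y → X u ∈ uIcc (X (h - 1)) (X h) → False := by
      intro h h3 h4
      rcases lt_trichotomy (ρ h) k with h5 | h5 | h5
      · rcases lt_or_eq_of_le (show ρ h ≤ k - 1 by omega) with h6 | h6
        · have := hs.left_of hP (h := h) (h' := e (k - 1)) (by omega) (by rw [h3, hyk])
          have h7 := h4.2
          have : min (X (e (k - 1) - 1)) (X (e (k - 1))) ≤ max (X (e (k - 1) - 1)) (X (e (k - 1))) :=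
            min_le_max
          linarith [show X u ≤ max (X (h - 1)) (X h) from h7]
        · have : h = e (k - 1) := by rw [← hs.e_ρ h, h6]
          rw [this] at h4
          exact absurd h4.2 (not_le.2 h1)
      · have : h = e k := by rw [← hs.e_ρ h, h5]
        rw [this] at h4
        exact absurd h4.1 (not_le.2 (h2.trans_eq hmin.symm))
      · have := hs.left_of hP (h := e k) (h' := h) (by omega) (by rw [h3])
        have h7 : min (X (h - 1)) (X h) ≤ X u := h4.1
        linarith [hmax]
    have n1 : Y u ≠ y := fun h => key u h right_mem_uIcc
    have n2 : Y (u + 1) ≠ y := fun h => key (u + 1) h (by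
      rw [add_sub_cancel_right]; exact left_mem_uIcc)
    rw [mem_uIcc] at hu
    rcases hu with hu | hu
    · have l1 := lt_of_le_of_ne hu.1 n1
      have l2 := lt_of_le_of_ne hu.2 n2.symm
      exact ⟨fun h => hs.not_rank_lt_of_lt hv.lt l2 (h.1 (hs.rank_lt_of_lt hv.lt l1)),
        (min_le_left _ _).trans_lt l1, l2.trans_le (le_max_right _ _)⟩
    · have l1 := lt_of_le_of_ne hu.1 n2
      have l2 := lt_of_le_of_ne hu.2 n1.symm
      exact ⟨fun h => hs.not_rank_lt_of_lt hv.lt l2 (h.2 (hs.rank_lt_of_lt hv.lt l1)),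
        (min_le_right _ _).trans_lt l1, l2.trans_le (le_max_left _ _)⟩
  -- the points between the two edges are in `P` iff `flag p = 1`
  have inside : 0 < k → Y (e (k - 1)) = y → ∀ x₁, max (X (e (k - 1) - 1)) (X (e (k - 1))) ≤ x₁ →
      x₁ < X a → (ActAt ρ vp k p → X (vp p) ≤ x₁) →
      (flag p = 1 ↔ ∀ x, x₁ < x → x < X a → (x, y) ∈ P) := by
    intro hk hyk x₁ hx₁ hx₁a hpx
    have rk1 : ρ (e (k - 1)) = k - 1 := hs.ρ_e _ (by have := hv.lt; omega)
    have noH : ∀ h x, x₁ < x → x < X a → (x, y) ∉ hEdge X Y h := by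
      intro h x h1 h2 h3
      obtain ⟨h4, h5⟩ := mem_hEdge.1 h3
      rcases lt_trichotomy (ρ h) k with h6 | h6 | h6
      · rcases lt_or_eq_of_le (show ρ h ≤ k - 1 by omega) with h7 | h7
        · have := hs.left_of hP (h := h) (h' := e (k - 1)) (by omega) (by rw [← h5, hyk])
          have h8 : x ≤ max (X (h - 1)) (X h) := h4.2
          have : min (X (e (k - 1) - 1)) (X (e (k - 1))) ≤ max (X (e (k - 1) - 1)) (X (e (k - 1))) :=
            min_le_max
          linarith
        · have : h = e (k - 1) := by rw [← hs.e_ρ h, h7]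
          rw [this] at h4
          have h8 : x ≤ max (X (e (k - 1) - 1)) (X (e (k - 1))) := h4.2
          linarith
      · have : h = e k := by rw [← hs.e_ρ h, h6]
        rw [this] at h4
        have h8 : min (X (e k - 1)) (X (e k)) ≤ x := h4.1
        linarith
      · have := hs.left_of hP (h := e k) (h' := h) (by omega) (by rw [← h5])
        have h8 : min (X (h - 1)) (X h) ≤ x := h4.1
        linarith
    have noA : ∀ u, Active ρ k u → pos u < pa → X u ≤ x₁ := by
      intro u hu h1
      have Au : ActAt ρ vp k (pos u) := hs.actAt_pos.2 hu
      have h2 : pos u ≤ p := by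
        by_contra hc
        exact hv.p_max _ (by omega) h1 Au
      have Ap := hv.p_act.resolve_left (by have := hs.one_le_pos u; omega)
      have := hs.X_vp_le Au Ap h2
      rw [hs.vp_pos] at this
      exact this.trans (hpx Ap)
    have noV : ∀ u x, x₁ < x → x < X a → (x, y) ∉ vEdge X Y u := by
      intro u x h1 h2 h3
      obtain ⟨rfl, h4⟩ := mem_vEdge.1 h3
      obtain ⟨h5, -⟩ := cross u h4 hk hyk (hx₁.trans_lt h1) h2
      have := noA u h5 (by rw [hpa]; exact (hs.lt_iff hP h4 ta).2 h2)
      linarith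
    have hd : Disjoint (Ioo x₁ (X a) ×ˢ {y} : Set Plane) (edgeUnion X Y) := by
      rw [disjoint_left]
      rintro ⟨s, y'⟩ ⟨hs', hy'⟩ hE
      simp only [mem_singleton_iff, mem_Ioo] at hs' hy'
      subst hy'
      rcases mem_edgeUnion.1 hE with ⟨h, hh⟩ | ⟨h, hh⟩
      · exact noH h s hs'.1 hs'.2 hh
      · exact noV h s hs'.1 hs'.2 hh
    obtain ⟨x, hx1, hx2, hx⟩ := exists_generic X hx₁a
    have hcv : ∀ h, Covers X x h → (ρ h < k ↔ Y h < y) ∧ Y h ≠ y := by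
      intro h hc
      have h1 : Y h ≠ y := fun h' => noH h x hx1 hx2 (by
        rw [← h']; exact IsCyclicPolygon.mem_hEdge_of_covers hc)
      refine ⟨⟨fun h2 => lt_of_le_of_ne (hs.height_le hv.lt h2) h1,
        fun h2 => hs.rank_lt_of_lt hv.lt h2⟩, h1⟩
    have e1 : flag p = 1 ↔ (x, y) ∈ P := by
      rw [hP.mem_iff_odd hx fun h hc => (hcv h hc).2, Nat.odd_iff, hI.flag_eq p hv.p_act,
        activeCount_parity hx]
      · refine card_mod_congr ?_
        ext h
        simp only [Finset.mem_filter, Finset.mem_univ, true_and]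
        exact and_congr_right fun hch => (hcv h hch).1
      · intro u hu
        have Au : ActAt ρ vp k (pos u) := hs.actAt_pos.2 hu
        constructor
        · intro h
          exact (noA u hu (by omega)).trans_lt hx1
        · intro h
          by_contra hc
          have h3 : pa ≤ pos u := by
            by_contra h4
            exact hv.p_max _ (by omega) (by omega) Au
          have := hs.X_le_of_pos_le (u := a) (w := u) (by omega)
          linarith
    rw [e1]
    constructor
    · intro hin
      rcases hP.subset_interior_or_disjoint (isPreconnected_horizontal isPreconnected_Ioo y) hd
        with h | h
      · exact fun s h1 h2 => interior_subset (h ⟨⟨h1, h2⟩, rfl⟩)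
      · exact absurd hin (disjoint_left.1 h ⟨⟨hx1, hx2⟩, rfl⟩)
    · intro h
      exact h x hx1 hx2
  constructor
  · rintro ⟨hf, hb⟩
    have Ap : ActAt ρ vp k p := by
      refine hv.p_act.resolve_left ?_
      rintro rfl
      rw [hI.flag_eq 0 (Or.inl rfl), hs.activeCount_zero] at hf
      simp at hf
    have tp := hs.height_mem hv.lt Ap.2.2
    have epos := hs.pos_vp_of_actAt Ap
    have hXp : X (vp p) < X a := (hs.lt_iff hP tp ta).1 (by omega)
    rcases hI.next p (Or.inr Ap) with ⟨-, hnone⟩ | ⟨hr, hpr, hbtw⟩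
    · exfalso
      obtain ⟨M, hM⟩ := (finite_range X).bddAbove
      have hM' : ∀ u, X u < M + 1 := fun u => by
        have := hM ⟨u, rfl⟩
        linarith
      rw [hI.flag_eq p (Or.inr Ap), activeCount_parity (x := M + 1) (fun u => (hM' u).ne)
        (fun u hu => iff_of_true (not_lt.1 fun h => hnone _ h (hs.actAt_pos.2 hu)) (hM' u))] at hf
      have h0 : ∀ h, ¬ Covers X (M + 1) h := fun h hc => by
        rcases lt_max_iff.1 hc.2 with h' | h' <;> linarith [hM' h, hM' (h - 1)]
      simp [h0] at hf
    · obtain ⟨h, h1, h2, h3⟩ := hI.bot_mem p Ap hr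
      rw [hb] at h3
      -- The edge that realizes `bot p` has smaller rank and the height of the event. The sorted
      -- order forces the preceding edge to this height too.
      have hk : 0 < k := by omega
      have rk1 : ρ (e (k - 1)) = k - 1 := hs.ρ_e _ (by have := hv.lt; omega)
      have hyk : Y (e (k - 1)) = y := by
        refine le_antisymm (hs.le_of_rank_lt (by omega)) ?_
        rw [← h3]; exact hs.le_of_rank_le (by omega)
      have hleft := hs.left_of hP (h := e (k - 1)) (h' := e k) (by omega) hyk
      rw [hmin] at hleft
      -- The edge realizing `bot p` reaches the right side of `vp p`, and it is the preceding edge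
      -- or lies to the left of it. So no active edge interrupts the row between the two edges.
      have hge : X (vp p) ≤ max (X (e (k - 1) - 1)) (X (e (k - 1))) := by
        rcases lt_or_eq_of_le (show ρ h ≤ k - 1 by omega) with h4 | h4
        · have := hs.left_of hP (h := h) (h' := e (k - 1)) (by omega) (by rw [h3, hyk])
          have := h2.2
          have : min (X (e (k - 1) - 1)) (X (e (k - 1))) ≤ max (X (e (k - 1) - 1)) (X (e (k - 1))) :=
            min_le_max
          linarith
        · have : h = e (k - 1) := by rw [← hs.e_ρ h, h4]
          rw [← this]; exact h2.2
      have hin := (inside hk hyk _ le_rfl hleft fun _ => hge).1 hf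
      refine ⟨hk, IsCyclicPolygon.hExtension_eq_of_sees (y := y)
        (x := max (X (e (k - 1) - 1)) (X (e (k - 1)))) (x' := X a)
        (mem_hEdge.2 ⟨⟨min_le_max, le_rfl⟩, hyk.symm⟩)
        (mem_hEdge.2 ⟨⟨hmin.le, hXab.le.trans hmax.ge⟩, rfl⟩) ?_ hP⟩
      intro s hs'
      rw [uIcc_of_le hleft.le] at hs'
      rcases hs'.1.lt_or_eq with h4 | h4
      · rcases hs'.2.lt_or_eq with h5 | h5
        · exact hin s h4 h5
        · rw [h5]
          exact hP.hEdge_subset (e k) (mem_hEdge.2 ⟨⟨hmin.le, hXab.le.trans hmax.ge⟩, rfl⟩)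
      · rw [← h4]
        exact hP.hEdge_subset (e (k - 1)) (mem_hEdge.2 ⟨⟨min_le_max, le_rfl⟩, hyk.symm⟩)
  · rintro ⟨hk, hext⟩
    have rk1 : ρ (e (k - 1)) = k - 1 := hs.ρ_e _ (by have := hv.lt; omega)
    obtain ⟨hyk, hseg⟩ := hP.between_subset hext
    have hleft := hs.left_of hP (h := e (k - 1)) (h' := e k) (by omega) hyk
    rw [hmin] at hleft hseg
    rw [hyk] at hseg
    -- An active edge strictly between the two horizontal edges would be crossed by their connecting
    -- segment, so `P` would lie on both of its sides.
    have hpx : ActAt ρ vp k p → X (vp p) ≤ max (X (e (k - 1) - 1)) (X (e (k - 1))) := by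
      intro Ap
      by_contra hc
      have tp := hs.height_mem hv.lt Ap.2.2
      have epos := hs.pos_vp_of_actAt Ap
      have hXp : X (vp p) < X a := (hs.lt_iff hP tp ta).1 (by omega)
      obtain ⟨-, h1, h2⟩ := cross (vp p) tp hk hyk (not_le.1 hc) hXp
      obtain ⟨ε, hε, -, -, hside⟩ := hP.vEdge_side h1 h2 isOpen_univ (mem_univ _)
      have c1 := not_le.1 hc
      have hpos : 0 < min (ε / 2) (min (X a - X (vp p))
        (X (vp p) - max (X (e (k - 1) - 1)) (X (e (k - 1))))) :=
        lt_min (by linarith) (lt_min (by linarith) (by linarith))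
      set δ := min (ε / 2) (min (X a - X (vp p))
        (X (vp p) - max (X (e (k - 1) - 1)) (X (e (k - 1))))) with hδ
      have d1 : δ ≤ ε / 2 := min_le_left _ _
      have d2 : δ ≤ X a - X (vp p) := (min_le_right _ _).trans (min_le_left _ _)
      have d3 : δ ≤ X (vp p) - max (X (e (k - 1) - 1)) (X (e (k - 1))) :=
        (min_le_right _ _).trans (min_le_right _ _)
      rcases hside with hside | hside
      · exact hside.2 (X (vp p) + δ) y (by rw [abs_lt]; constructor <;> linarith)
          (by simpa using hε) (by linarith) (hseg _ (by linarith) (by linarith))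
      · exact hside.1 (X (vp p) - δ) y (by rw [abs_lt]; constructor <;> linarith)
          (by simpa using hε) (by linarith) (hseg _ (by linarith) (by linarith))
    have hf : flag p = 1 := (inside hk hyk _ le_rfl hleft hpx).2
      fun x h1 h2 => hseg x h1.le h2.le
    refine ⟨hf, ?_⟩
    have Ap : ActAt ρ vp k p := by
      refine hv.p_act.resolve_left ?_
      rintro rfl
      rw [hI.flag_eq 0 (Or.inl rfl), hs.activeCount_zero] at hf
      simp at hf
    rcases hI.next p (Or.inr Ap) with ⟨-, hnone⟩ | ⟨hr, hpr, hbtw⟩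
    · exfalso
      obtain ⟨M, hM⟩ := (finite_range X).bddAbove
      have hM' : ∀ u, X u < M + 1 := fun u => by
        have := hM ⟨u, rfl⟩
        linarith
      rw [hI.flag_eq p (Or.inr Ap), activeCount_parity (x := M + 1) (fun u => (hM' u).ne)
        (fun u hu => iff_of_true (not_lt.1 fun h => hnone _ h (hs.actAt_pos.2 hu)) (hM' u))] at hf
      have h0 : ∀ h, ¬ Covers X (M + 1) h := fun h hc => by
        rcases lt_max_iff.1 hc.2 with h' | h' <;> linarith [hM' h, hM' (h - 1)]
      simp [h0] at hf
    · refine le_antisymm ?_ ?_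
      · obtain ⟨h, h1, -, h3⟩ := hI.bot_mem p Ap hr
        rw [← h3]; exact hs.height_le hv.lt h1
      -- The preceding edge has the same height and touches the gap of `p`, so the stored maximum is
      -- at least this height.
      · change Y (e k) ≤ bot p
        rw [show Y (e k) = Y (e (k - 1)) from hyk.symm]
        refine hI.bot_max p Ap hr _ (by omega) ⟨?_, hpx Ap⟩
        have hge : pa ≤ nxt p := by
          by_contra hc
          exact hv.p_max _ hpr (by omega) hr
        have := hs.X_le_of_pos_le (u := a) (w := vp (nxt p)) (by
          rw [hs.pos_vp_of_actAt hr]; omega)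
        have : min (X (e (k - 1) - 1)) (X (e (k - 1))) ≤ max (X (e (k - 1) - 1)) (X (e (k - 1))) :=
          min_le_max
        linarith

end SweepInv

end

/-! ## The bounds -/

/-- A convex polygon in a cover contains at most one point of a hidden set. -/
theorem hiddenSetNumber_le_convexCoverNumber (P : Set Plane) :
    hiddenSetNumber P ≤ convexCoverNumber P := by
  refine iSup₂_le fun H hH => le_iInf₂ fun C hC => ?_
  have h1 : ∀ x ∈ H, ∃ K ∈ C, x ∈ K := fun x hx => by
    have := hH.1 hx
    rwa [← hC.2] at this
  choose! f hf hxf using h1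
  refine encard_le_encard_of_injOn (f := f) hf fun x hx y hy hxy => ?_
  by_contra hne
  refine hH.2 hx hy hne fun z hz => ?_
  rw [← hC.2]
  obtain ⟨⟨S, -, hS⟩, -⟩ := hC.1 _ (hf x hx)
  have hconv : Convex ℝ (f x) := by rw [hS]; exact convex_convexHull ℝ S
  exact ⟨f x, hf x hx, hconv.segment_subset (hxf x hx) (hxy ▸ hxf y hy) hz⟩

theorem IsAxisRectangle.isConvexPolygon {K : Set Plane} (h : IsAxisRectangle K) :
    IsConvexPolygon K := by
  obtain ⟨x₁, x₂, y₁, y₂, hx, hy, rfl⟩ := h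
  refine ⟨⟨{x₁, x₂} ×ˢ {y₁, y₂}, (toFinite _).prod (toFinite _), ?_⟩, ?_⟩
  · rw [convexHull_prod, convexHull_pair, convexHull_pair, segment_eq_Icc hx.le,
      segment_eq_Icc hy.le]
  · rw [interior_prod_eq, interior_Icc, interior_Icc]
    exact (nonempty_Ioo.2 hx).prod (nonempty_Ioo.2 hy)

theorem IsRectanglePartition.isConvexCover {P : Set Plane} {C : Set (Set Plane)}
    (h : IsRectanglePartition P C) : IsConvexCover P C :=
  ⟨fun K hK => (h.1 K hK).isConvexPolygon, h.2.1⟩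

theorem IsHiddenSet.encard_le {P H : Set Plane} (h : IsHiddenSet P H) :
    H.encard ≤ hiddenSetNumber P :=
  le_iSup₂ (f := fun (H : Set Plane) (_ : IsHiddenSet P H) => H.encard) H h

theorem IsConvexCover.le_encard {P : Set Plane} {C : Set (Set Plane)} (h : IsConvexCover P C) :
    convexCoverNumber P ≤ C.encard :=
  iInf₂_le (f := fun (C : Set (Set Plane)) (_ : IsConvexCover P C) => C.encard) C h

namespace IsCyclicPolygon

variable {m : ℕ} [NeZero m] {X Y : ZMod m → ℝ} {P : Set Plane}

theorem range_hExtension (hP : IsCyclicPolygon X Y P) : range (hExtension X Y P) =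
    hExtension X Y P '' {k | IsTopH X Y P k} ∪ hExtension X Y P '' {k | IsBottomH X Y P k} := by
  rw [← image_union, ← image_univ]
  congr 1
  refine (eq_univ_of_forall fun k => ?_).symm
  by_cases h : IsBottomH X Y P k
  · exact Or.inr h
  · exact Or.inl ((hP.isTop_iff_not_isBottom k).2 h)

theorem ncard_pieces_lt_add (hP : IsCyclicPolygon X Y P) :
    (pieces X Y P).ncard + 1 ≤ (hExtension X Y P '' {k | IsTopH X Y P k}).ncard +
      (hExtension X Y P '' {k | IsBottomH X Y P k}).ncard := by
  refine hP.ncard_pieces_lt.trans ?_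
  rw [hP.range_hExtension]
  exact ncard_union_le _ _

theorem encard_hMid (hP : IsCyclicPolygon X Y P) {E T : Set (ZMod m)}
    (hi : InjOn (hExtension X Y P) T) (he : hExtension X Y P '' T = hExtension X Y P '' E) :
    (hMid X Y '' T).encard = (hExtension X Y P '' E).ncard := by
  rw [(hP.hMid_injective.injOn).encard_image, ← he, (toFinite _).cast_ncard_eq, hi.encard_image]

/-- Choosing one top edge for each extension makes the midpoints a hidden set. -/
theorem ncard_isTopH_le (hP : IsCyclicPolygon X Y P) :
    ((hExtension X Y P '' {k | IsTopH X Y P k}).ncard : ℕ∞) ≤ hiddenSetNumber P := by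
  obtain ⟨T, hT, hb⟩ := exists_subset_bijOn {k | IsTopH X Y P k} (hExtension X Y P)
  rw [← hP.encard_hMid hb.injOn hb.image_eq]
  exact (hP.isHiddenSet_of_isTop hT hb.injOn).encard_le

theorem ncard_isBottomH_le (hP : IsCyclicPolygon X Y P) :
    ((hExtension X Y P '' {k | IsBottomH X Y P k}).ncard : ℕ∞) ≤ hiddenSetNumber P := by
  obtain ⟨T, hT, hb⟩ := exists_subset_bijOn {k | IsBottomH X Y P k} (hExtension X Y P)
  rw [← hP.encard_hMid hb.injOn hb.image_eq]
  exact (hP.isHiddenSet_of_isBottom hT hb.injOn).encard_le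

theorem encard_pieces_lt (hP : IsCyclicPolygon X Y P) :
    (pieces X Y P).encard + 1 ≤ 2 * hiddenSetNumber P := by
  rw [← hP.finite_pieces.cast_ncard_eq, two_mul]
  refine le_trans ?_ (add_le_add hP.ncard_isTopH_le hP.ncard_isBottomH_le)
  exact_mod_cast hP.ncard_pieces_lt_add

theorem isTwoApproxConvexCover_pieces (hP : IsCyclicPolygon X Y P) :
    IsTwoApproxConvexCover P (pieces X Y P) :=
  ⟨hP.isRectanglePartition_pieces.isConvexCover,
    le_self_add.trans (hP.encard_pieces_lt.trans
      (mul_le_mul_right (hiddenSetNumber_le_convexCoverNumber P) 2))⟩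

/-- The pieces are themselves a convex cover, so they bound the size of every hidden set from above.
This is what makes the larger family of midpoints a half-approximation. -/
theorem hiddenSetNumber_le_add (hP : IsCyclicPolygon X Y P) : hiddenSetNumber P ≤
    ((hExtension X Y P '' {k | IsTopH X Y P k}).ncard : ℕ∞) +
      (hExtension X Y P '' {k | IsBottomH X Y P k}).ncard := by
  refine (hiddenSetNumber_le_convexCoverNumber P).trans
    (hP.isRectanglePartition_pieces.isConvexCover.le_encard.trans ?_)
  rw [← hP.finite_pieces.cast_ncard_eq]
  exact_mod_cast (Nat.le_succ _).trans hP.ncard_pieces_lt_add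

/-- The larger one of the two sets of midpoints is a half-approximate hidden set. -/
theorem isHalfApproxHiddenSet (hP : IsCyclicPolygon X Y P) {T B : Set (ZMod m)}
    (hT : T ⊆ {k | IsTopH X Y P k}) (hTi : InjOn (hExtension X Y P) T)
    (hTe : hExtension X Y P '' T = hExtension X Y P '' {k | IsTopH X Y P k})
    (hB : B ⊆ {k | IsBottomH X Y P k}) (hBi : InjOn (hExtension X Y P) B)
    (hBe : hExtension X Y P '' B = hExtension X Y P '' {k | IsBottomH X Y P k}) :
    (B.ncard ≤ T.ncard → IsHalfApproxHiddenSet P (hMid X Y '' T)) ∧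
      (T.ncard ≤ B.ncard → IsHalfApproxHiddenSet P (hMid X Y '' B)) := by
  have h := hP.hiddenSetNumber_le_add
  rw [← hTe, ← hBe, hTi.ncard_image, hBi.ncard_image] at h
  have e : ∀ S : Set (ZMod m), (hMid X Y '' S).encard = S.ncard := fun S => by
    rw [(hP.hMid_injective.injOn).encard_image, (toFinite _).cast_ncard_eq]
  constructor <;> intro hle
  · refine ⟨hP.isHiddenSet_of_isTop hT hTi, h.trans ?_⟩
    rw [e]
    exact_mod_cast (by omega : T.ncard + B.ncard ≤ 2 * T.ncard)
  · refine ⟨hP.isHiddenSet_of_isBottom hB hBi, h.trans ?_⟩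
    rw [e]
    exact_mod_cast (by omega : T.ncard + B.ncard ≤ 2 * B.ncard)

end IsCyclicPolygon

/-! ## From vertex lists to cyclic sequences of coordinates -/

theorem segment_horizontal (x₁ x₂ y : ℝ) :
    segment ℝ ((x₁, y) : Plane) (x₂, y) = uIcc x₁ x₂ ×ˢ {y} := by
  rw [← Prod.image_mk_segment_left, segment_eq_uIcc, prod_singleton]

theorem segment_vertical (x y₁ y₂ : ℝ) :
    segment ℝ ((x, y₁) : Plane) (x, y₂) = {x} ×ˢ uIcc y₁ y₂ := by
  rw [← Prod.image_mk_segment_right, segment_eq_uIcc, singleton_prod]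

/-- The horizontal edges of the polygon `v` are the edges `σ k` from `(X (k - 1), Y k)` to
`(X k, Y k)`. -/
structure IsCyclicForm {n m : ℕ} (v : Polygon Plane n) (X Y : ZMod m → ℝ)
    (σ : ZMod m → Fin n) : Prop where
  start : ∀ k, v (σ k) = (X (k - 1), Y k)
  finish : ∀ k, v (finRotate n (σ k)) = (X k, Y k)
  succ : ∀ k, finRotate n (finRotate n (σ k)) = σ (k + 1)
  injective : Function.Injective σ
  ne : ∀ k l, σ k ≠ finRotate n (σ l)
  cover : ∀ i, ∃ k, i = σ k ∨ i = finRotate n (σ k)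

/-- The number `j`, taken modulo `n`. -/
def cyc {n : ℕ} (hn : 0 < n) (j : ℕ) : Fin n := ⟨j % n, Nat.mod_lt _ hn⟩

theorem cyc_eq_iff {n : ℕ} (hn : 0 < n) {i j : ℕ} : cyc hn i = cyc hn j ↔ i ≡ j [MOD n] := by
  simp [cyc, Nat.ModEq]

theorem finRotate_cyc {n : ℕ} (hn : 0 < n) (j : ℕ) : finRotate n (cyc hn j) = cyc hn (j + 1) := by
  have : NeZero n := ⟨hn.ne'⟩
  rw [finRotate_apply]
  apply Fin.ext
  simp [cyc, Fin.val_add]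

namespace IsSimpleOrthogonalPolygon

variable {n : ℕ} {v : Polygon Plane n} {P : Set Plane}

theorem not_vertical (hv : IsSimpleOrthogonalPolygon v P) {i : Fin n} (h : IsHorizontalEdge v i) :
    ¬ IsVerticalEdge v i := by
  intro h'
  have h1 := hv.simple.injective (Prod.ext h' h : v.vertices i = v.vertices (finRotate n i))
  have h3 := hv.simple.three_le
  have : NeZero n := ⟨by omega⟩
  rw [finRotate_apply, left_eq_add, Fin.ext_iff, Fin.val_one', Fin.val_zero,
    Nat.mod_eq_of_lt (by omega)] at h1
  exact one_ne_zero h1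

/-- Horizontal and vertical edges alternate, so the type of an edge depends on the parity `d` of its
index. Returning to the first edge after `n` steps forces `n` to be even. -/
theorem exists_parity (hv : IsSimpleOrthogonalPolygon v P) (hn : 0 < n) :
    ∃ d < 2, n % 2 = 0 ∧ ∀ j, (j % 2 = d → IsHorizontalEdge v (cyc hn j)) ∧
      (j % 2 ≠ d → IsVerticalEdge v (cyc hn j)) := by
  have alt := fun j => hv.orthogonal (cyc hn j)
  simp only [finRotate_cyc] at alt
  have hor : ∀ j, IsVerticalEdge v (cyc hn j) ↔ ¬ IsHorizontalEdge v (cyc hn j) := fun j =>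
    ⟨fun h h' => hv.not_vertical h' h, fun h => by
      rcases alt j with h' | h'
      · exact absurd h'.1 h
      · exact h'.1⟩
  have succ : ∀ j, IsHorizontalEdge v (cyc hn (j + 1)) ↔ ¬ IsHorizontalEdge v (cyc hn j) := by
    intro j
    have := alt j
    rw [hor, hor] at this
    tauto
  have key : ∀ j, IsHorizontalEdge v (cyc hn j) ↔
      (j % 2 = 0 ↔ IsHorizontalEdge v (cyc hn 0)) := by
    intro j
    induction j with
    | zero => simp
    | succ j ih =>
      rw [succ, ih]
      have : (j + 1) % 2 = 0 ↔ ¬ j % 2 = 0 := by omega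
      rw [this]
      tauto
  have hnn := key n
  rw [(cyc_eq_iff hn).2 (show n ≡ 0 [MOD n] by simp [Nat.ModEq])] at hnn
  have hn2 : n % 2 = 0 := by tauto
  by_cases h0 : IsHorizontalEdge v (cyc hn 0)
  · refine ⟨0, by omega, hn2, fun j => ?_⟩
    rw [hor, key]
    tauto
  · refine ⟨1, by omega, hn2, fun j => ?_⟩
    rw [hor, key]
    constructor <;> intro h
    · exact iff_of_false (by omega) h0
    · have : j % 2 = 0 := by omega
      tauto

/-- Abscissas are read at the odd vertices and heights at the even ones, whether the list starts
with a horizontal or with a vertical edge. So the program needs no case distinction; only the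
labelling `σ` of the edges depends on `d`. -/
theorem exists_cyclicForm (hv : IsSimpleOrthogonalPolygon v P) :
    ∃ (m : ℕ) (X Y : ZMod m → ℝ) (σ : ZMod m → Fin n), n = 2 * m ∧ 2 ≤ m ∧
      (∀ (a : ℕ) (h : 2 * a + 1 < n), X (a : ZMod m) = (v ⟨2 * a + 1, h⟩).1 ∧
        Y (a : ZMod m) = (v ⟨2 * a, by omega⟩).2) ∧ IsCyclicForm v X Y σ := by
  have h3 := hv.simple.three_le
  have hn : 0 < n := by omega
  obtain ⟨d, hd, hn2, hpar⟩ := hv.exists_parity hn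
  obtain ⟨m, rfl⟩ : ∃ m, n = 2 * m := ⟨n / 2, by omega⟩
  have : NeZero m := ⟨by omega⟩
  have two : ∀ a b : ℕ, a ≡ b [MOD m] → ∀ c, cyc hn (2 * a + c) = cyc hn (2 * b + c) :=
    fun a b h c => (cyc_eq_iff hn).2 ((h.mul_left' 2).add_right c)
  have hval : ∀ a : ℕ, (a : ZMod m).val ≡ a [MOD m] := fun a => by
    rw [ZMod.val_natCast]; exact Nat.mod_modEq a m
  have hsurj : ∀ k : ZMod m, ∃ a : ℕ, k = ((a + 1 : ℕ) : ZMod m) := fun k =>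
    ⟨(k - 1).val, by push_cast; rw [ZMod.natCast_zmod_val]; ring⟩
  set X : ZMod m → ℝ := fun k => (v (cyc hn (2 * k.val + 1))).1 with hX
  set Y : ZMod m → ℝ := fun k => (v (cyc hn (2 * k.val + 0))).2 with hY
  -- The offset is `-d`; a full turn is added to avoid truncated subtraction.
  set σ : ZMod m → Fin (2 * m) := fun k => cyc hn (2 * k.val + (2 * m - d)) with hσ
  have eX : ∀ a : ℕ, X a = (v (cyc hn (2 * a + 1))).1 := fun a => by
    simp only [hX]; rw [two _ _ (hval a)]
  have eY : ∀ a : ℕ, Y a = (v (cyc hn (2 * a))).2 := fun a => by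
    simp only [hY]; rw [two _ _ (hval a), add_zero]
  have eσ : ∀ a : ℕ, σ ((a + 1 : ℕ) : ZMod m) = cyc hn (2 * a + 2 - d) := fun a => by
    simp only [hσ]
    rw [two _ _ (hval _), cyc_eq_iff, show 2 * (a + 1) + (2 * m - d) = 2 * a + 2 - d + 2 * m by omega]
    simp [Nat.ModEq]
  have epred : ∀ a : ℕ, ((a + 1 : ℕ) : ZMod m) - 1 = a := fun a => by push_cast; ring
  have hver : ∀ j, j % 2 ≠ d → (v (cyc hn j)).1 = (v (cyc hn (j + 1))).1 := fun j h => by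
    have := (hpar j).2 h
    rwa [IsVerticalEdge, finRotate_cyc] at this
  have hhor : ∀ j, j % 2 = d → (v (cyc hn j)).2 = (v (cyc hn (j + 1))).2 := fun j h => by
    have := (hpar j).1 h
    rwa [IsHorizontalEdge, finRotate_cyc] at this
  have hodd : ∀ i j, i % 2 ≠ j % 2 → cyc hn i ≠ cyc hn j := fun i j h h' => by
    have := ((cyc_eq_iff hn).1 h').of_dvd (Dvd.intro m rfl : 2 ∣ 2 * m)
    exact h this
  refine ⟨m, X, Y, σ, rfl, by omega, fun a h => ⟨?_, ?_⟩, ?_⟩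
  · rw [eX]; congr 2; exact Fin.ext (Nat.mod_eq_of_lt h)
  · rw [eY]; congr 2; exact Fin.ext (Nat.mod_eq_of_lt (by omega))
  have hd' : d = 0 ∨ d = 1 := by omega
  refine ⟨fun k => ?_, fun k => ?_, fun k => ?_, fun k l h => ?_, fun k l => ?_, fun i => ?_⟩
  · obtain ⟨a, rfl⟩ := hsurj k
    rw [epred, eσ, eX, eY]
    rcases hd' with rfl | rfl
    · exact Prod.ext (hver (2 * a + 1) (by omega)).symm rfl
    · exact Prod.ext rfl (hhor (2 * a + 1) (by omega))
  · obtain ⟨a, rfl⟩ := hsurj k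
    rw [eσ, eX, eY, finRotate_cyc]
    rcases hd' with rfl | rfl
    · exact Prod.ext rfl (hhor (2 * a + 2) (by omega)).symm
    · exact Prod.ext (hver (2 * a + 2) (by omega)) rfl
  · obtain ⟨a, rfl⟩ := hsurj k
    rw [show ((a + 1 : ℕ) : ZMod m) + 1 = ((a + 1 + 1 : ℕ) : ZMod m) by push_cast; ring, eσ, eσ,
      finRotate_cyc, finRotate_cyc]
    congr 1; omega
  · obtain ⟨a, rfl⟩ := hsurj k
    obtain ⟨b, rfl⟩ := hsurj l
    rw [eσ, eσ, cyc_eq_iff] at h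
    have h1 := h.add_right d
    rw [show 2 * a + 2 - d + d = 2 * (a + 1) by omega,
      show 2 * b + 2 - d + d = 2 * (b + 1) by omega] at h1
    exact (ZMod.natCast_eq_natCast_iff _ _ _).2 (Nat.ModEq.mul_left_cancel' two_ne_zero h1)
  · obtain ⟨a, rfl⟩ := hsurj k
    obtain ⟨b, rfl⟩ := hsurj l
    rw [eσ, eσ, finRotate_cyc]
    exact hodd _ _ (by omega)
  -- Again a full turn is added before subtracting, so that the halves below are exact.
  · have hi : cyc hn (i + 2 * m) = i := Fin.ext (by simp [cyc, Nat.mod_eq_of_lt i.2])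
    rcases eq_or_ne ((i : ℕ) % 2) d with h | h
    · refine ⟨(((i + 2 * m + d - 2) / 2 + 1 : ℕ) : ZMod m), Or.inl ?_⟩
      rw [eσ, ← hi]
      congr 1; omega
    · refine ⟨(((i + 2 * m + d - 3) / 2 + 1 : ℕ) : ZMod m), Or.inr ?_⟩
      rw [eσ, finRotate_cyc, ← hi]
      congr 1; omega

end IsSimpleOrthogonalPolygon

/-! ### Translation of edges, midpoints, pieces and counts into cyclic form -/

namespace IsCyclicForm

variable {n m : ℕ} {v : Polygon Plane n} {P : Set Plane} {X Y : ZMod m → ℝ} {σ : ZMod m → Fin n}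

theorem edgeSet_eq (hf : IsCyclicForm v X Y σ) (k : ZMod m) :
    v.edgeSet ℝ (σ k) = hEdge X Y k := by
  rw [hEdge, ← segment_horizontal, ← hf.start, ← hf.finish, ← affineSegment_eq_segment]
  rfl

theorem edgeSet_finRotate_eq (hf : IsCyclicForm v X Y σ) (k : ZMod m) :
    v.edgeSet ℝ (finRotate n (σ k)) = vEdge X Y k := by
  have h := hf.start (k + 1)
  rw [add_sub_cancel_right, ← hf.succ] at h
  rw [vEdge, ← segment_vertical, ← hf.finish, ← h, ← affineSegment_eq_segment]
  rfl

theorem isCyclicPolygon (hf : IsCyclicForm v X Y σ) (hm : 2 ≤ m)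
    (hv : IsSimpleOrthogonalPolygon v P) : IsCyclicPolygon X Y P where
  two_le := hm
  X_ne k h := hf.ne k k (hv.simple.injective (by
    rw [hf.start, hf.finish, h]))
  Y_ne k h := hf.ne (k + 1) k (hv.simple.injective (by
    rw [hf.start, hf.finish, add_sub_cancel_right, h]))
  h_disjoint k l h := by
    rw [← hf.edgeSet_eq, ← hf.edgeSet_eq]
    exact hv.simple.disjoint _ _ (fun h' => h (hf.injective h')) (hf.ne _ _) (hf.ne _ _)
  v_disjoint k l h := by
    rw [← hf.edgeSet_finRotate_eq, ← hf.edgeSet_finRotate_eq]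
    refine hv.simple.disjoint _ _ (fun h' => h (hf.injective ((finRotate n).injective h'))) ?_ ?_
    · rw [hf.succ]; exact (hf.ne _ _).symm
    · rw [hf.succ]; exact (hf.ne _ _).symm
  hv_disjoint k l h h' := by
    rw [← hf.edgeSet_eq, ← hf.edgeSet_finRotate_eq]
    refine hv.simple.disjoint _ _ (hf.ne _ _)
      (fun h1 => h (hf.injective ((finRotate n).injective h1))) ?_
    rw [hf.succ]
    exact fun h1 => h' (by rw [hf.injective h1, add_sub_cancel_right])
  isCompact := hv.isCompact
  closure_interior := hv.closure_interior
  frontier_eq := by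
    rw [hv.frontier_eq]
    ext z
    rw [mem_edgeUnion, Polygon.boundary, mem_iUnion]
    constructor
    · rintro ⟨i, hi⟩
      obtain ⟨k, rfl | rfl⟩ := hf.cover i
      · exact Or.inl ⟨k, by rwa [← hf.edgeSet_eq]⟩
      · exact Or.inr ⟨k, by rwa [← hf.edgeSet_finRotate_eq]⟩
    · rintro (⟨k, hk⟩ | ⟨k, hk⟩)
      · exact ⟨_, by rwa [hf.edgeSet_eq k]⟩
      · exact ⟨_, by rwa [hf.edgeSet_finRotate_eq k]⟩

theorem range_eq (hf : IsCyclicForm v X Y σ) (hP : IsCyclicPolygon X Y P) :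
    range σ = {i | IsHorizontalEdge v i} := by
  ext i
  constructor
  · rintro ⟨k, rfl⟩
    change (v (σ k)).2 = (v (finRotate n (σ k))).2
    rw [hf.start, hf.finish]
  · intro h
    obtain ⟨k, rfl | rfl⟩ := hf.cover i
    · exact ⟨k, rfl⟩
    · change (v (finRotate n (σ k))).2 = (v (finRotate n (finRotate n (σ k)))).2 at h
      rw [hf.succ, hf.finish, hf.start] at h
      exact absurd h (hP.Y_ne k)

theorem edgeExtension_eq (hf : IsCyclicForm v X Y σ) (k : ZMod m) :
    edgeExtension v P (σ k) = hExtension X Y P k := by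
  rw [edgeExtension, hExtension, hf.start, hf.edgeSet_eq]

theorem edgeMidpoint_eq (hf : IsCyclicForm v X Y σ) (k : ZMod m) :
    edgeMidpoint v (σ k) = hMid X Y k := by
  rw [edgeMidpoint, hf.start, hf.finish, midpoint_eq_smul_add, hMid]
  ext
  · simp; ring
  · simp; ring

theorem cutInterior_eq (hf : IsCyclicForm v X Y σ) (hP : IsCyclicPolygon X Y P) :
    cutInterior v P = hCut X Y P := by
  rw [cutInterior, hCut, ← hf.range_eq hP, biUnion_range]
  simp only [hf.edgeExtension_eq]

theorem horizontalPieces_eq [NeZero m] (hf : IsCyclicForm v X Y σ) (hP : IsCyclicPolygon X Y P) :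
    horizontalPieces v P = pieces X Y P := by
  rw [hP.pieces_eq, horizontalPieces, hf.cutInterior_eq hP]

theorem isTopEdge_iff (hf : IsCyclicForm v X Y σ) (hP : IsCyclicPolygon X Y P) (k : ZMod m) :
    IsTopEdge v P (σ k) ↔ IsTopH X Y P k := by
  rw [IsTopEdge, IsTopH, hf.edgeMidpoint_eq]
  refine and_iff_right ?_
  have : σ k ∈ {i | IsHorizontalEdge v i} := hf.range_eq hP ▸ mem_range_self k
  exact this

theorem isBottomEdge_iff (hf : IsCyclicForm v X Y σ) (hP : IsCyclicPolygon X Y P) (k : ZMod m) :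
    IsBottomEdge v P (σ k) ↔ IsBottomH X Y P k := by
  rw [IsBottomEdge, IsBottomH, hf.edgeMidpoint_eq]
  refine and_iff_right ?_
  have : σ k ∈ {i | IsHorizontalEdge v i} := hf.range_eq hP ▸ mem_range_self k
  exact this

theorem noncollinearCount_eq (hf : IsCyclicForm v X Y σ) {E : Set (Fin n)} (hE : E ⊆ range σ) :
    noncollinearCount v P E = (hExtension X Y P '' (σ ⁻¹' E)).ncard := by
  rw [noncollinearCount]
  congr 1
  rw [← image_preimage_eq_of_subset hE, image_image]
  simp only [hf.edgeExtension_eq, preimage_image_eq _ hf.injective]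

theorem isHiddenSet_image (hf : IsCyclicForm v X Y σ) {T : Set (Fin n)} (hT : T ⊆ range σ)
    (h : InjOn (hExtension X Y P) (σ ⁻¹' T) → IsHiddenSet P (hMid X Y '' (σ ⁻¹' T)))
    (hi : InjOn (edgeExtension v P) T) : IsHiddenSet P (edgeMidpoint v '' T) := by
  have e : edgeMidpoint v '' T = hMid X Y '' (σ ⁻¹' T) := by
    rw [← image_preimage_eq_of_subset hT, image_image]
    simp only [hf.edgeMidpoint_eq, preimage_image_eq _ hf.injective]
  rw [e]
  refine h fun k hk l hl hkl => hf.injective (hi hk hl ?_)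
  rw [hf.edgeExtension_eq, hf.edgeExtension_eq, hkl]

/-- The bounds for the partition, and the hidden sets of edge midpoints. -/
theorem partition_bounds [NeZero m] (hf : IsCyclicForm v X Y σ) (hP : IsCyclicPolygon X Y P) :
    IsRectanglePartition P (horizontalPieces v P) ∧
      (horizontalPieces v P).encard + 1 ≤ noncollinearCount v P {i | IsHorizontalEdge v i} ∧
      (horizontalPieces v P).encard + 1 ≤
        noncollinearCount v P {i | IsTopEdge v P i} +
          noncollinearCount v P {i | IsBottomEdge v P i} ∧
      (horizontalPieces v P).encard + 1 ≤ 2 * hiddenSetNumber P ∧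
      (∀ T : Set (Fin n), (∀ i ∈ T, IsTopEdge v P i) → InjOn (edgeExtension v P) T →
        IsHiddenSet P (edgeMidpoint v '' T)) ∧
      (∀ B : Set (Fin n), (∀ i ∈ B, IsBottomEdge v P i) → InjOn (edgeExtension v P) B →
        IsHiddenSet P (edgeMidpoint v '' B)) := by
  have eT : σ ⁻¹' {i | IsTopEdge v P i} = {k | IsTopH X Y P k} :=
    Set.ext fun k => hf.isTopEdge_iff hP k
  have eB : σ ⁻¹' {i | IsBottomEdge v P i} = {k | IsBottomH X Y P k} :=
    Set.ext fun k => hf.isBottomEdge_iff hP k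
  have sub : ∀ {E : Set (Fin n)}, (∀ i ∈ E, IsHorizontalEdge v i) → E ⊆ range σ := fun h => by
    rw [hf.range_eq hP]; exact h
  rw [hf.horizontalPieces_eq hP, hf.noncollinearCount_eq (E := {i | IsHorizontalEdge v i}) (sub fun i hi => hi),
    hf.noncollinearCount_eq (E := {i | IsTopEdge v P i}) (sub fun i hi => hi.1),
    hf.noncollinearCount_eq (E := {i | IsBottomEdge v P i}) (sub fun i hi => hi.1), eT, eB,
    ← hf.range_eq hP, preimage_range, image_univ, ← hP.finite_pieces.cast_ncard_eq]
  refine ⟨hP.isRectanglePartition_pieces, by exact_mod_cast hP.ncard_pieces_lt,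
    by exact_mod_cast hP.ncard_pieces_lt_add, ?_, fun T hT hi => ?_, fun B hB hi => ?_⟩
  · rw [hP.finite_pieces.cast_ncard_eq]
    exact hP.encard_pieces_lt
  · exact hf.isHiddenSet_image (sub fun i h => (hT i h).1) (hP.isHiddenSet_of_isTop fun k hk =>
      (hf.isTopEdge_iff hP k).1 (hT _ hk)) hi
  · exact hf.isHiddenSet_image (sub fun i h => (hB i h).1) (hP.isHiddenSet_of_isBottom fun k hk =>
      (hf.isBottomEdge_iff hP k).1 (hB _ hk)) hi

end IsCyclicForm

/-! ## Reasoning about programs of the real RAM -/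

namespace RealRAM

namespace Store

@[simp] theorem setNat_nat (s : Store) (a i k b j : ℕ) :
    (s.setNat a i k).nat b j = if b = a ∧ j = i then k else s.nat b j := by
  by_cases h : b = a
  · subst h
    simp [setNat, Function.update_apply]
  · simp [setNat, h]

@[simp] theorem setNat_real (s : Store) (a i k : ℕ) : (s.setNat a i k).real = s.real := rfl

@[simp] theorem setReal_real (s : Store) (a i : ℕ) (x : ℝ) (b j : ℕ) :
    (s.setReal a i x).real b j = if b = a ∧ j = i then x else s.real b j := by
  by_cases h : b = a
  · subst h
    simp [setReal, Function.update_apply]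
  · simp [setReal, h]

@[simp] theorem setReal_nat (s : Store) (a i : ℕ) (x : ℝ) : (s.setReal a i x).nat = s.nat := rfl

end Store

namespace Program

/-- A bound for the running time of a program without loops. -/
def bound : Program → ℕ
  | skip => 1
  | writeNat _ i e => i.cost + e.cost + 1
  | writeReal _ i e => i.cost + e.cost + 1
  | seq p q => p.bound + q.bound
  | ite b p q => b.cost + (p.bound + q.bound) + 1
  | .while _ _ => 0

/-- A sufficient condition for `Q` after the execution of a program without loops. -/
def wp : Program → (Store → Prop) → Store → Prop
  | skip, Q, s => Q s
  | writeNat a i e, Q, s => ∀ s', s' = s.setNat a (i.eval s) (e.eval s) → Q s'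
  | writeReal a i e, Q, s => ∀ s', s' = s.setReal a (i.eval s) (e.eval s) → Q s'
  | seq p q, Q, s => p.wp (q.wp Q) s
  | ite b p q, Q, s => (b.Holds s → p.wp Q s) ∧ (¬ b.Holds s → q.wp Q s)
  | .while _ _, _, _ => False

/-- The program contains an assignment to the array `a` of natural numbers. -/
def WritesNat (a : ℕ) : Program → Prop
  | skip => False
  | writeNat b _ _ => a = b
  | writeReal _ _ _ => False
  | seq p q => p.WritesNat a ∨ q.WritesNat a
  | ite _ p q => p.WritesNat a ∨ q.WritesNat a
  | .while _ p => p.WritesNat a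

/-- The program contains an assignment to the array `a` of real numbers. -/
def WritesReal (a : ℕ) : Program → Prop
  | skip => False
  | writeNat _ _ _ => False
  | writeReal b _ _ => a = b
  | seq p q => p.WritesReal a ∨ q.WritesReal a
  | ite _ p q => p.WritesReal a ∨ q.WritesReal a
  | .while _ p => p.WritesReal a

end Program

open Program

theorem Runs.nat_eq {p : Program} {s s' : Store} {t a : ℕ} (h : Runs p s t s')
    (ha : ¬ p.WritesNat a) : s'.nat a = s.nat a := by
  induction h with
  | skip s => rfl
  | writeNat s b i e => exact Function.update_of_ne ha _ _
  | writeReal s b i e => rfl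
  | seq _ _ ih ih' =>
    simp only [WritesNat, not_or] at ha
    exact (ih' ha.2).trans (ih ha.1)
  | iteTrue q _ _ ih =>
    simp only [WritesNat, not_or] at ha
    exact ih ha.1
  | iteFalse p _ _ ih =>
    simp only [WritesNat, not_or] at ha
    exact ih ha.2
  | whileTrue _ _ _ ih ih' => exact (ih' ha).trans (ih ha)
  | whileFalse p _ => rfl

theorem Runs.real_eq {p : Program} {s s' : Store} {t a : ℕ} (h : Runs p s t s')
    (ha : ¬ p.WritesReal a) : s'.real a = s.real a := by
  induction h with
  | skip s => rfl
  | writeNat s b i e => rfl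
  | writeReal s b i e => exact Function.update_of_ne ha _ _
  | seq _ _ ih ih' =>
    simp only [WritesReal, not_or] at ha
    exact (ih' ha.2).trans (ih ha.1)
  | iteTrue q _ _ ih =>
    simp only [WritesReal, not_or] at ha
    exact ih ha.1
  | iteFalse p _ _ ih =>
    simp only [WritesReal, not_or] at ha
    exact ih ha.2
  | whileTrue _ _ _ ih ih' => exact (ih' ha).trans (ih ha)
  | whileFalse p _ => rfl

/-- Started with memory `s`, the program halts after at most `T` time units
with memory that satisfies `Q`. -/
def Halts (p : Program) (s : Store) (T : ℕ) (Q : Store → Prop) : Prop :=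
  ∃ t s', Runs p s t s' ∧ t ≤ T ∧ Q s'

namespace Halts

variable {p q : Program} {s : Store} {T U : ℕ} {Q R : Store → Prop}

theorem mono (h : Halts p s T R) (hT : T ≤ U) (hQ : ∀ s', R s' → Q s') : Halts p s U Q := by
  obtain ⟨t, s', h1, h2, h3⟩ := h
  exact ⟨t, s', h1, h2.trans hT, hQ s' h3⟩

/-- Array names are fixed in the program text, so a syntactic check shows which arrays survive. The
correctness proofs of the subprograms need to mention only what they change. -/
theorem frame (h : Halts p s T Q) : Halts p s T fun s' => Q s' ∧
    (∀ a, ¬ p.WritesNat a → s'.nat a = s.nat a) ∧ ∀ a, ¬ p.WritesReal a → s'.real a = s.real a := by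
  obtain ⟨t, s', h1, h2, h3⟩ := h
  exact ⟨t, s', h1, h2, h3, fun a ha => h1.nat_eq ha, fun a ha => h1.real_eq ha⟩

theorem seq (hp : Halts p s T R) (hq : ∀ s', R s' → Halts q s' U Q) :
    Halts (.seq p q) s (T + U) Q := by
  obtain ⟨t, s', h1, h2, h3⟩ := hp
  obtain ⟨u, s'', h4, h5, h6⟩ := hq s' h3
  exact ⟨t + u, s'', .seq h1 h4, add_le_add h2 h5, h6⟩

theorem ite {b : Test} (h : b.Holds s → Halts p s T Q) (h' : ¬ b.Holds s → Halts q s T Q) :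
    Halts (.ite b p q) s (b.cost + T + 1) Q := by
  by_cases hb : b.Holds s
  · obtain ⟨t, s', h1, h2, h3⟩ := h hb
    exact ⟨_, s', .iteTrue q hb h1, by omega, h3⟩
  · obtain ⟨t, s', h1, h2, h3⟩ := h' hb
    exact ⟨_, s', .iteFalse p hb h1, by omega, h3⟩

/-- The value zero of `bound` for loops does no harm because `wp` is false for them. Since `wp`
names each new memory by an equation, long assignments can be unfolded one at a time. -/
theorem of_wp : ∀ (p : Program) (s : Store) (Q : Store → Prop), p.wp Q s → Halts p s p.bound Q
  | .skip, s, _, h => ⟨1, s, .skip s, le_rfl, h⟩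
  | .writeNat a i e, s, _, h => ⟨_, _, .writeNat s a i e, le_rfl, h _ rfl⟩
  | .writeReal a i e, s, _, h => ⟨_, _, .writeReal s a i e, le_rfl, h _ rfl⟩
  | .seq p q, s, Q, h => (of_wp p s _ h).seq fun s' h' => of_wp q s' Q h'
  | .ite b p q, s, Q, h => by
    refine (ite (T := p.bound + q.bound) (fun hb => (of_wp p s Q (h.1 hb)).mono ?_ fun _ h => h)
      fun hb => (of_wp q s Q (h.2 hb)).mono ?_ fun _ h => h).mono le_rfl fun _ h => h
    · exact Nat.le_add_right _ _
    · exact Nat.le_add_left _ _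
  | .while _ _, _, _, h => h.elim

/-- A loop with an invariant `I r` that limits the number of the remaining iterations to `r`. -/
theorem loop {b : Test} {I : ℕ → Store → Prop}
    (step : ∀ r s, I r s → b.Holds s → ∃ r', r = r' + 1 ∧ Halts p s T (I r')) :
    ∀ (r : ℕ) (s : Store), I r s →
      Halts (.while b p) s (r * (T + b.cost + 1) + (b.cost + 1)) fun s' =>
        ∃ r', I r' s' ∧ ¬ b.Holds s' := by
  intro r
  induction r with
  | zero =>
    intro s hI
    by_cases hb : b.Holds s
    · obtain ⟨r', h, -⟩ := step 0 s hI hb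
      omega
    · exact ⟨_, s, .whileFalse p hb, by omega, 0, hI, hb⟩
  | succ r ih =>
    intro s hI
    by_cases hb : b.Holds s
    · obtain ⟨r', h, t, s', h1, h2, h3⟩ := step _ s hI hb
      obtain rfl : r = r' := by omega
      obtain ⟨u, s'', h4, h5, h6⟩ := ih s' h3
      refine ⟨_, s'', .whileTrue hb h1 h4, ?_, h6⟩
      rw [Nat.succ_mul]
      omega
    · exact ⟨_, s, .whileFalse p hb, by omega, _, hI, hb⟩

end Halts

/-- The variable with name `a`. -/
abbrev var (a : ℕ) : NatExpr := .read a (.const 0)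

/-- Assignment to the variable with name `a`. -/
abbrev assign (a : ℕ) (e : NatExpr) : Program := .writeNat a (.const 0) e

/-- Increment of the variable with name `a`. -/
abbrev increment (a : ℕ) : Program := assign a (.add (var a) (.const 1))

infixr:60 " ;; " => Program.seq

/-- The loop for the variable `i` below the value of the variable `k`. -/
def forLoop (i k : ℕ) (p : Program) : Program :=
  assign i (.const 0) ;; .while (.natLt (var i) (var k)) (p ;; increment i)

/-- The time for a loop of `m` iterations of duration `T`. -/
def forTime (m T : ℕ) : ℕ := 3 + (m * (T + 6 + 6) + 6)

/-- `I j` is the invariant before iteration `j`, and the increment is applied to the memory in the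
conclusion of a step. In `forTime`, the initial assignment costs `3`, and the increment and each
evaluation of the test with its overhead cost `6`. -/
theorem Halts.forLoop {p : Program} {i k m T : ℕ} {s : Store} {I : ℕ → Store → Prop} (hik : i ≠ k)
    (hi : ¬ p.WritesNat i) (hk : ¬ p.WritesNat k) (hm : s.nat k 0 = m)
    (start : I 0 (s.setNat i 0 0))
    (step : ∀ j s, j < m → s.nat i 0 = j → s.nat k 0 = m → I j s →
      Halts p s T fun s' => I (j + 1) (s'.setNat i 0 (j + 1))) :
    Halts (forLoop i k p) s (forTime m T) (I m) := by
  refine Halts.seq (R := fun s' => s' = s.setNat i 0 0) (T := 3) (U := m * (T + 6 + 6) + 6)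
    (of_wp _ _ _ fun _ h => h) ?_
  rintro _ rfl
  refine (Halts.loop (T := T + 6) (I := fun r s => ∃ j, j + r = m ∧ s.nat i 0 = j ∧ s.nat k 0 = m ∧ I j s)
    ?_ m _ ⟨0, by omega, by simp, by simp [hik.symm, hm], start⟩).mono le_rfl ?_
  · rintro r s ⟨j, h1, h2, h3, h4⟩ hb
    simp only [Test.Holds, NatExpr.eval, h2, h3] at hb
    refine ⟨r - 1, by omega, ?_⟩
    refine Halts.seq (U := 6) (step j s hb h2 h3 h4).frame ?_
    rintro s' ⟨h5, h6, -⟩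
    refine of_wp _ _ _ ?_
    rintro _ rfl
    have e : s'.nat i 0 = j := by rw [h6 i hi, h2]
    refine ⟨j + 1, by omega, ?_, ?_, ?_⟩
    · simp [NatExpr.eval, e]
    · simp [NatExpr.eval, hik.symm, h6 k hk, h3]
    · simpa [NatExpr.eval, e] using h5
  · rintro s' ⟨r, ⟨j, h1, h2, h3, h4⟩, hb⟩
    simp only [Test.Holds, NatExpr.eval, h2, h3] at hb
    obtain rfl : j = m := by omega
    exact h4

end RealRAM

/-! ## Tournament trees -/

/-- Every inner node `j` of the complete binary tree with `N` leaves holds the value that `ch`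
selects from its children `2j` and `2j + 1`, except for the nodes that satisfy `exc`. -/
def TreeValid (ch : ℕ → ℕ → ℕ) (N : ℕ) (exc : ℕ → Prop) (t : ℕ → ℕ) : Prop :=
  ∀ j, 1 ≤ j → j < N → ¬ exc j → t j = ch (t (2 * j)) (t (2 * j + 1))

/-- A node of height `h` holds the best one of the values of the leaves below it. -/
theorem TreeValid.best {ch : ℕ → ℕ → ℕ} {le : ℕ → ℕ → Prop} {t : ℕ → ℕ} {D : ℕ}
    (ht : TreeValid ch (2 ^ D) (fun _ => False) t) (refl : ∀ a, le a a)
    (trans : ∀ a b c, le a b → le b c → le a c) (sel : ∀ a b, ch a b = a ∨ ch a b = b)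
    (left : ∀ a b, le (ch a b) a) (right : ∀ a b, le (ch a b) b) :
    ∀ (h g j : ℕ), h + g = D → 2 ^ g ≤ j → j < 2 ^ (g + 1) →
      (∃ l, j * 2 ^ h ≤ l ∧ l < (j + 1) * 2 ^ h ∧ t j = t l) ∧
        ∀ l, j * 2 ^ h ≤ l → l < (j + 1) * 2 ^ h → le (t j) (t l) := by
  -- Induction on the height; `g` is the depth of the node, and the leaves below node `j` are those
  -- from `j * 2 ^ h` to before `(j + 1) * 2 ^ h`.
  intro h
  induction h with
  | zero =>
    intro g j _ _ _
    refine ⟨⟨j, by simp, by simp, rfl⟩, fun l h1 h2 => ?_⟩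
    obtain rfl : l = j := by rw [pow_zero] at h1 h2; omega
    exact refl _
  | succ h ih =>
    intro g j hD h1 h2
    have hg : 2 ^ (g + 1) = 2 * 2 ^ g := pow_succ' _ _
    have hg' : 2 ^ (g + 1 + 1) = 2 * 2 ^ (g + 1) := pow_succ' _ _
    have hle : 2 ^ (g + 1) ≤ 2 ^ D := Nat.pow_le_pow_right (by norm_num) (by omega)
    have hj : t j = ch (t (2 * j)) (t (2 * j + 1)) :=
      ht j (Nat.one_le_two_pow.trans h1) (h2.trans_le hle) not_false
    obtain ⟨⟨l₁, a1, a2, a3⟩, a4⟩ := ih (g + 1) (2 * j) (by omega) (by omega) (by omega)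
    obtain ⟨⟨l₂, b1, b2, b3⟩, b4⟩ := ih (g + 1) (2 * j + 1) (by omega) (by omega) (by omega)
    have e1 : j * 2 ^ (h + 1) = 2 * j * 2 ^ h := by ring
    have e2 : (j + 1) * 2 ^ (h + 1) = (2 * j + 1 + 1) * 2 ^ h := by ring
    have e3 : 2 * j * 2 ^ h ≤ (2 * j + 1) * 2 ^ h := Nat.mul_le_mul_right _ (by omega)
    have e4 : (2 * j + 1) * 2 ^ h ≤ (2 * j + 1 + 1) * 2 ^ h := Nat.mul_le_mul_right _ (by omega)
    rw [e1, e2, hj]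
    constructor
    · rcases sel (t (2 * j)) (t (2 * j + 1)) with h | h
      · exact ⟨l₁, a1, by omega, by rw [h, a3]⟩
      · exact ⟨l₂, by omega, b2, by rw [h, b3]⟩
    · intro l h3 h4
      rcases lt_or_ge l ((2 * j + 1) * 2 ^ h) with h5 | h5
      · exact trans _ _ _ (left _ _) (a4 l h3 h5)
      · exact trans _ _ _ (right _ _) (b4 l h5 h4)

namespace RealRAM

open Program

/-- Recompute the nodes on the path from the node `var 13` to the root; `τ` tests whether the
left value `var 14` wins over the right value `var 15`. -/
def climbBody (tr : ℕ) (τ : Test) : Program :=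
  assign 13 (.half (var 13)) ;;
  assign 14 (.read tr (.add (var 13) (var 13))) ;;
  assign 15 (.read tr (.add (.add (var 13) (var 13)) (.const 1))) ;;
  .ite τ (.writeNat tr (var 13) (var 14)) (.writeNat tr (var 13) (var 15))

/-- Recompute the nodes on the path from the node `var 13` to the root. -/
def climb (tr : ℕ) (τ : Test) : Program := .while (.natLt (.const 1) (var 13)) (climbBody tr τ)

/-- Write `var 41` to the leaf `var 40` of the tree `tr` with `var 11` leaves. -/
def updateLeaf (tr : ℕ) (τ : Test) : Program :=
  (assign 13 (.add (var 11) (var 40)) ;; .writeNat tr (var 13) (var 41)) ;; climb tr τ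

open Classical in
/-- The winner of two values. -/
noncomputable def winner (win : ℕ → ℕ → Prop) (a b : ℕ) : ℕ := if win a b then a else b

theorem halts_climbBody {tr : ℕ} {τ : Test} {win : ℕ → ℕ → Prop} {s : Store}
    (hτ : ∀ s', s'.real = s.real → (τ.Holds s' ↔ win (s'.nat 14 0) (s'.nat 15 0)))
    (htr : tr ≠ 13 ∧ tr ≠ 14 ∧ tr ≠ 15) :
    Halts (climbBody tr τ) s (climbBody tr τ).bound fun s' => s'.real = s.real ∧
      s'.nat 13 0 = s.nat 13 0 / 2 ∧ ∀ j, s'.nat tr j = if j = s.nat 13 0 / 2 then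
        winner win (s.nat tr (2 * j)) (s.nat tr (2 * j + 1)) else s.nat tr j := by
  obtain ⟨h13, h14, h15⟩ := htr
  refine Halts.of_wp _ _ _ ?_
  intro s₁ e₁ s₂ e₂ s₃ e₃
  have hw := hτ s₃ (by simp [e₁, e₂, e₃])
  have h₁₃ : s₃.nat 13 0 = s.nat 13 0 / 2 := by simp [e₁, e₂, e₃, NatExpr.eval]
  have h₁₄ : s₃.nat 14 0 = s.nat tr (2 * (s.nat 13 0 / 2)) := by
    simp [e₁, e₂, e₃, NatExpr.eval, h13, two_mul]
  have h₁₅ : s₃.nat 15 0 = s.nat tr (2 * (s.nat 13 0 / 2) + 1) := by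
    simp [e₁, e₂, e₃, NatExpr.eval, h13, h14, two_mul]
  have htr : ∀ j, s₃.nat tr j = s.nat tr j := by simp [e₁, e₂, e₃, h13, h14, h15]
  have hreal : s₃.real = s.real := by simp [e₁, e₂, e₃]
  rw [h₁₄, h₁₅] at hw
  constructor
  · rintro h _ rfl
    rw [hw] at h
    refine ⟨hreal, by simp [h13.symm, h₁₃], fun j => ?_⟩
    by_cases hj : j = s.nat 13 0 / 2 <;> simp [NatExpr.eval, h₁₃, h₁₄, hj, htr, winner, h]
  · rintro h _ rfl
    rw [hw] at h
    refine ⟨hreal, by simp [h13.symm, h₁₃], fun j => ?_⟩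
    by_cases hj : j = s.nat 13 0 / 2 <;> simp [NatExpr.eval, h₁₃, h₁₅, hj, htr, winner, h]

/-- The time for `climb` in a tree of depth `D`. -/
def climbTime (tr : ℕ) (τ : Test) (D : ℕ) : ℕ := D * ((climbBody tr τ).bound + 5) + 5

/-- Only the proper ancestors `s.nat 13 0 / 2 ^ q` of the current node may be invalid. Recomputing
the parent repairs it and can disturb only nodes further up, which remain exempt. The bound `2 ^ (r
+ 1)` limits the number of steps to `r`. -/
theorem halts_climb {tr : ℕ} {τ : Test} {win : ℕ → ℕ → Prop} {s : Store} {r N : ℕ}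
    (hτ : ∀ s', s'.real = s.real → (τ.Holds s' ↔ win (s'.nat 14 0) (s'.nat 15 0)))
    (htr : tr ≠ 13 ∧ tr ≠ 14 ∧ tr ≠ 15) (h1 : 1 ≤ s.nat 13 0) (hr : s.nat 13 0 < 2 ^ (r + 1))
    (hN : s.nat 13 0 < 2 * N)
    (hv : TreeValid (winner win) N (fun j => ∃ q, 1 ≤ q ∧ j = s.nat 13 0 / 2 ^ q) (s.nat tr)) :
    Halts (climb tr τ) s (climbTime tr τ r) fun s' =>
      TreeValid (winner win) N (fun _ => False) (s'.nat tr) ∧ ∀ j, N ≤ j → s'.nat tr j = s.nat tr j := by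
  refine (Halts.loop (T := (climbBody tr τ).bound) (I := fun r s' => s'.real = s.real ∧ 1 ≤ s'.nat 13 0 ∧
    s'.nat 13 0 < 2 ^ (r + 1) ∧ s'.nat 13 0 < 2 * N ∧
    TreeValid (winner win) N (fun j => ∃ q, 1 ≤ q ∧ j = s'.nat 13 0 / 2 ^ q) (s'.nat tr) ∧
    ∀ j, N ≤ j → s'.nat tr j = s.nat tr j) ?_ r s ⟨rfl, h1, hr, hN, hv, fun _ _ => rfl⟩).mono
    ?_ ?_
  · rintro r s₁ ⟨e1, e2, e3, e4, e5, e6⟩ hb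
    simp only [Test.Holds, NatExpr.eval] at hb
    have hr : 1 ≤ r := by
      by_contra h
      obtain rfl : r = 0 := by omega
      norm_num at e3
      omega
    obtain ⟨r, rfl⟩ : ∃ r', r = r' + 1 := ⟨r - 1, by omega⟩
    refine ⟨r, rfl, (halts_climbBody (fun s' h => hτ s' (h.trans e1)) htr).mono le_rfl ?_⟩
    rintro s' ⟨f1, f2, f3⟩
    set J := s₁.nat 13 0 with hJ
    have hpow : ∀ q, s'.nat 13 0 / 2 ^ q = J / 2 ^ (q + 1) := fun q => by
      rw [f2, Nat.div_div_eq_div_mul, pow_succ']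
    refine ⟨f1.trans e1, by omega, ?_, by omega, ?_, ?_⟩
    · rw [f2]
      rw [pow_succ'] at e3
      omega
    · intro j j1 j2 j3
      have hne : ∀ c, c / 2 = j → c ≠ J / 2 := fun c hc hc' =>
        j3 ⟨1, le_rfl, by
          rw [hpow, ← hc, hc', Nat.div_div_eq_div_mul]; norm_num⟩
      rw [f3 (2 * j), f3 (2 * j + 1), if_neg (hne _ (by omega)), if_neg (hne _ (by omega)), f3]
      split_ifs with h
      · rfl
      · refine e5 j j1 j2 ?_
        rintro ⟨q, q1, q2⟩
        rcases q1.lt_or_eq with h3 | rfl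
        · exact j3 ⟨q - 1, by omega, by rw [hpow, q2]; congr 2; omega⟩
        · exact h (by rw [q2, pow_one])
    · intro j hj
      rw [f3, if_neg (by omega), e6 j hj]
  · simp [climbTime, Test.cost, NatExpr.cost]
  · rintro s' ⟨r', ⟨-, e2, -, -, e5, e6⟩, hb⟩
    simp only [Test.Holds, NatExpr.eval] at hb
    refine ⟨fun j j1 j2 _ => e5 j j1 j2 ?_, e6⟩
    rintro ⟨q, q1, q2⟩
    have : s'.nat 13 0 / 2 ^ q = 0 := by
      rw [show s'.nat 13 0 = 1 by omega]
      exact Nat.div_eq_of_lt (Nat.one_lt_two_pow (by omega))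
    omega

/-- The time for `updateLeaf` in a tree of depth `D`. -/
def updateTime (tr : ℕ) (τ : Test) (D : ℕ) : ℕ := 12 + climbTime tr τ D

/-- Overwriting a leaf invalidates at most its ancestors, and these are recomputed on the way to the
root. -/
theorem halts_updateLeaf {tr : ℕ} {τ : Test} {win : ℕ → ℕ → Prop} {s : Store} {D a x : ℕ}
    (hτ : ∀ s', s'.real = s.real → (τ.Holds s' ↔ win (s'.nat 14 0) (s'.nat 15 0)))
    (htr : tr ≠ 13 ∧ tr ≠ 14 ∧ tr ≠ 15 ∧ tr ≠ 40 ∧ tr ≠ 41) (hD : s.nat 11 0 = 2 ^ D)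
    (ha : s.nat 40 0 = a) (hx : s.nat 41 0 = x)
    (haD : a < 2 ^ D) (hv : TreeValid (winner win) (2 ^ D) (fun _ => False) (s.nat tr)) :
    Halts (updateLeaf tr τ) s (updateTime tr τ D) fun s' =>
      (TreeValid (winner win) (2 ^ D) (fun _ => False) (s'.nat tr) ∧
        ∀ b, s'.nat tr (2 ^ D + b) = if b = a then x else s.nat tr (2 ^ D + b)) ∧
      (∀ b, b ≠ tr → b ≠ 13 → b ≠ 14 → b ≠ 15 → s'.nat b = s.nat b) ∧ s'.real = s.real := by
  have key : Halts (updateLeaf tr τ) s (updateTime tr τ D) fun s' =>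
      TreeValid (winner win) (2 ^ D) (fun _ => False) (s'.nat tr) ∧
        ∀ b, s'.nat tr (2 ^ D + b) = if b = a then x else s.nat tr (2 ^ D + b) := by
    refine Halts.seq (R := fun s' => s'.real = s.real ∧ s'.nat 13 0 = 2 ^ D + a ∧
      ∀ j, s'.nat tr j = if j = 2 ^ D + a then x else s.nat tr j)
      (T := 12) (Halts.of_wp _ _ _ ?_) ?_
    · rintro s₁ e₁ s₂ e₂
      refine ⟨by simp [e₁, e₂], ?_, fun j => ?_⟩
      · simp [NatExpr.eval, e₁, e₂, htr.1.symm, hD, ha]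
      · simp [NatExpr.eval, e₁, e₂, htr.1, hx, ha, hD]
    · rintro s₁ ⟨h1, h2, h3⟩
      have hpos : 1 ≤ 2 ^ D := Nat.one_le_two_pow
      refine (halts_climb (N := 2 ^ D) (fun s' h => hτ s' (h.trans h1)) ⟨htr.1, htr.2.1, htr.2.2.1⟩
        (by omega) (by rw [h2, pow_succ]; omega) (by omega) ?_).mono le_rfl ?_
      · intro j j1 j2 j3
        have hne : ∀ c, c / 2 = j → c ≠ 2 ^ D + a := fun c hc hc' =>
          j3 ⟨1, le_rfl, by rw [h2, ← hc', pow_one, hc]⟩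
        rw [h3, h3, h3, if_neg (by omega), if_neg (hne _ (by omega)), if_neg (hne _ (by omega))]
        exact hv j j1 j2 not_false
      · rintro s' ⟨f1, f2⟩
        refine ⟨f1, fun b => ?_⟩
        rw [f2 _ (by omega), h3]
        simp
  refine key.frame.mono le_rfl ?_
  rintro s' ⟨h1, h2, h3⟩
  refine ⟨h1, fun b b1 b2 b3 b4 => h2 b ?_, funext fun b => h3 b ?_⟩
  · simp [updateLeaf, climb, climbBody, WritesNat, b1, b2, b3, b4]
  · simp [updateLeaf, climb, climbBody, WritesReal]

end RealRAM

/-! ## Sorting -/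

/-- The key of a tree value: the value `a + 1` stands for the item `a`, and `0` for none. -/
def itemKey {α : Type*} (κ : ℕ → α) : ℕ → WithTop α
  | 0 => ⊤
  | a + 1 => κ a

/-- The item values `0, …, m - 1` are listed by `out` in the order of increasing keys. -/
structure IsSorting {α : Type*} [LinearOrder α] (κ : ℕ → α) (m : ℕ) (out : ℕ → ℕ) : Prop where
  lt : ∀ a < m, out a < m
  ne : ∀ a b, a < b → b < m → out a ≠ out b
  le : ∀ a b, a < b → b < m → κ (out a) ≤ κ (out b)

namespace RealRAM

open Program

/-- Sort the items `0, …, var 10 - 1` by means of a tournament tree. -/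
def sort (out tr : ℕ) (τ : Test) : Program :=
  forLoop 12 10 ((assign 40 (var 12) ;; assign 41 (.add (var 12) (.const 1))) ;;
    updateLeaf tr τ) ;;
  forLoop 12 10 ((assign 40 (.sub (.read tr (.const 1)) (.const 1)) ;;
    .writeNat out (var 12) (var 40) ;; assign 41 (.const 0)) ;; updateLeaf tr τ)

/-- The time for sorting `m` items with a tree of depth `D`. -/
def sortTime (tr : ℕ) (τ : Test) (m D : ℕ) : ℕ :=
  forTime m (20 + updateTime tr τ D) + forTime m (20 + updateTime tr τ D)

theorem not_writesNat_updateLeaf {tr a : ℕ} {τ : Test} (h : a ≠ tr) (h13 : a ≠ 13) (h14 : a ≠ 14)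
    (h15 : a ≠ 15) : ¬ (updateLeaf tr τ).WritesNat a := by
  simp [updateLeaf, climb, climbBody, WritesNat, h, h13, h14, h15]

/-- The first loop enters the items as leaves. In the second, the root names a minimal remaining
item, which is output and then removed by the value `0` of infinite key. The invariant says that
each output item is at most every item not output before it. -/
theorem halts_sort {α : Type*} [LinearOrder α] {κ : ℕ → α} {out tr D m : ℕ} {τ : Test} {s : Store}
    (hτ : ∀ s', s'.real = s.real → (τ.Holds s' ↔
      itemKey κ (s'.nat 14 0) < itemKey κ (s'.nat 15 0)))
    (htr : 15 < tr ∧ tr ≠ 40 ∧ tr ≠ 41) (hout : 15 < out ∧ out ≠ 40 ∧ out ≠ 41) (hto : out ≠ tr)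
    (hm : s.nat 10 0 = m) (hN : s.nat 11 0 = 2 ^ D) (hmD : m ≤ 2 ^ D) (h0 : ∀ j, s.nat tr j = 0) :
    Halts (sort out tr τ) s (sortTime tr τ m D) fun s' => IsSorting κ m (s'.nat out) ∧
      s'.real = s.real ∧ ∀ j, m ≤ j → s'.nat out j = s.nat out j := by
  obtain ⟨t1, t2, t3⟩ := htr
  obtain ⟨o1, o2, o3⟩ := hout
  set win : ℕ → ℕ → Prop := fun a b => itemKey κ a < itemKey κ b with hwin
  have htr' : tr ≠ 13 ∧ tr ≠ 14 ∧ tr ≠ 15 ∧ tr ≠ 40 ∧ tr ≠ 41 := by omega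
  have upd : ∀ s' : Store, ∀ a x, s'.real = s.real → s'.nat 11 0 = 2 ^ D → s'.nat 40 0 = a →
      s'.nat 41 0 = x → a < 2 ^ D → TreeValid (winner win) (2 ^ D) (fun _ => False) (s'.nat tr) → _ :=
    fun s' a x e1 e2 e3 e4 e5 e6 => halts_updateLeaf (win := win)
      (fun s'' h => hτ s'' (h.trans e1)) htr' e2 e3 e4 e5 e6
  have writes : ∀ a, a < 15 → a ≠ 13 → a ≠ 14 → ¬ (updateLeaf tr τ).WritesNat a := fun a h1 h2 h3 =>
    not_writesNat_updateLeaf (by omega) h2 h3 (by omega)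
  refine Halts.seq (R := fun s' => s'.real = s.real ∧ s'.nat 10 0 = m ∧ s'.nat 11 0 = 2 ^ D ∧
    TreeValid (winner win) (2 ^ D) (fun _ => False) (s'.nat tr) ∧
    (∀ b < 2 ^ D, s'.nat tr (2 ^ D + b) = if b < m then b + 1 else 0) ∧ s'.nat out = s.nat out) ?_ ?_
  · refine (Halts.forLoop (m := m) (I := fun j s' => s'.real = s.real ∧ s'.nat 11 0 = 2 ^ D ∧
      TreeValid (winner win) (2 ^ D) (fun _ => False) (s'.nat tr) ∧
      ∀ b < 2 ^ D, s'.nat tr (2 ^ D + b) = if b < j then b + 1 else 0) (by norm_num) ?_ ?_ hm ?_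
      ?_).frame.mono le_rfl ?_
    · simp [WritesNat, writes]
    · simp [WritesNat, writes]
    · have e : (s.setNat 12 0 0).nat tr = s.nat tr := funext fun j => by
        simp [show tr ≠ 12 by omega]
      refine ⟨rfl, by simp [hN], ?_, ?_⟩
      · rw [e]
        intro j _ _ _
        simp [h0, winner]
      · rw [e]
        simp [h0]
    · rintro j s₁ hj h12 h10 ⟨e1, e2, e3, e4⟩
      refine (Halts.seq (T := 20) (R := fun s' => s'.real = s.real ∧ s'.nat 11 0 = 2 ^ D ∧
        s'.nat 40 0 = j ∧ s'.nat 41 0 = j + 1 ∧ s'.nat tr = s₁.nat tr)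
        ((Halts.of_wp _ _ _ ?_).mono (by simp [bound, NatExpr.cost]) fun _ h => h) ?_)
      · rintro s₂ f2 s₃ f3
        have : s₃.nat tr = s₁.nat tr := funext fun j => by simp [f2, f3, t2, t3]
        refine ⟨by simp [f2, f3, e1], by simp [f2, f3, e2], by simp [f2, f3, NatExpr.eval, h12],
          by simp [f2, f3, NatExpr.eval, h12], this⟩
      · rintro s₂ ⟨f1, f2, f3, f4, f5⟩
        refine (upd s₂ j (j + 1) f1 f2 f3 f4 (by omega) (f5 ▸ e3)).mono le_rfl ?_
        rintro s₃ ⟨⟨g1, g2⟩, g3, g4⟩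
        have e : (s₃.setNat 12 0 (j + 1)).nat tr = s₃.nat tr := funext fun j => by
          simp [show tr ≠ 12 by omega]
        refine ⟨g4.trans f1, ?_, e ▸ g1, fun b hb => ?_⟩
        · simp [g3 11 (by omega), f2]
        · rw [e, g2, f5, e4 b hb]
          rcases lt_trichotomy b j with h | h | h
          · rw [if_neg (by omega), if_pos h, if_pos (by omega)]
          · subst h; simp
          · rw [if_neg (by omega), if_neg (by omega), if_neg (by omega)]
    · rintro s' ⟨⟨e1, e2, e3, e4⟩, e5, -⟩
      refine ⟨e1, ?_, e2, e3, e4, ?_⟩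
      · rw [e5 10 (by simp [forLoop, WritesNat, writes]), hm]
      · refine e5 out ?_
        simp only [forLoop, WritesNat, not_or]
        refine ⟨by omega, ⟨⟨by omega, by omega⟩, ?_⟩, by omega⟩
        exact not_writesNat_updateLeaf hto (by omega) (by omega) (by omega)
  · rintro s₀ ⟨a1, a2, a3, a4, a5, a6⟩
    refine (Halts.forLoop (m := m) (I := fun j s' => s'.real = s.real ∧ s'.nat 11 0 = 2 ^ D ∧
      TreeValid (winner win) (2 ^ D) (fun _ => False) (s'.nat tr) ∧
      (∀ b < 2 ^ D, s'.nat tr (2 ^ D + b) =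
        if b < m ∧ ∀ a < j, s'.nat out a ≠ b then b + 1 else 0) ∧
      (∀ a < j, s'.nat out a < m) ∧ (∀ a b, a < b → b < j → s'.nat out a ≠ s'.nat out b) ∧
      (∀ a < j, ∀ b < m, (∀ c < a, s'.nat out c ≠ b) → κ (s'.nat out a) ≤ κ b) ∧
      ∀ a, m ≤ a → s'.nat out a = s.nat out a)
      (by norm_num) ?_ ?_ a2 ?_ ?_).mono le_rfl ?_
    · simp [WritesNat, writes]; omega
    · simp [WritesNat, writes]; omega
    · have e : (s₀.setNat 12 0 0).nat tr = s₀.nat tr := funext fun j => by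
        simp [show tr ≠ 12 by omega]
      refine ⟨a1, by simp [a3], e ▸ a4, ?_, by simp, by simp, by simp, ?_⟩
      · rw [e]; simpa using a5
      · simp [show out ≠ 12 by omega, a6]
    · rintro j s₁ hj h12 h10 ⟨e1, e2, e3, e4, e5, e6, e7, e8⟩
      have best := e3.best (le := fun a b => itemKey κ a ≤ itemKey κ b) (fun _ => le_rfl)
        (fun _ _ _ => le_trans) (fun a b => by unfold winner; split_ifs <;> simp)
        (fun a b => by
          simp only [winner, hwin]; split_ifs with h
          · exact le_rfl
          · exact not_lt.1 h)
        (fun a b => by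
          simp only [winner, hwin]; split_ifs with h
          · exact h.le
          · exact le_rfl) D 0 1 (by omega) (by simp) (by simp)
      rw [one_mul] at best
      obtain ⟨⟨l, l1, l2, l3⟩, hbest⟩ := best
      have leaf : ∀ b < m, (∀ a < j, s₁.nat out a ≠ b) →
          itemKey κ (s₁.nat tr 1) ≤ κ b := fun b hb hf => by
        have := hbest (2 ^ D + b) (by omega) (by omega)
        rwa [e4 b (by omega), if_pos ⟨hb, hf⟩] at this
      -- Fewer than `m` items have been output, so one remains and the root is not empty.
      obtain ⟨b₀, hb₀, hf₀⟩ : ∃ b ∈ Finset.range m, b ∉ (Finset.range j).image (s₁.nat out) := by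
        refine Finset.exists_mem_notMem_of_card_lt_card ?_
        refine Finset.card_image_le.trans_lt ?_
        simpa using hj
      have hroot : s₁.nat tr 1 ≠ 0 := by
        intro h
        have := leaf b₀ (by simpa using hb₀) (by simpa using hf₀)
        rw [h] at this
        exact absurd this (by simp [itemKey])
      obtain ⟨b, rfl⟩ : ∃ b, l = 2 ^ D + b := ⟨l - 2 ^ D, by omega⟩
      have hbD : b < 2 ^ D := by omega
      have hb : (b < m ∧ ∀ a < j, s₁.nat out a ≠ b) ∧ s₁.nat tr 1 = b + 1 := by
        rw [e4 b hbD] at l3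
        split_ifs at l3 with h
        · exact ⟨h, l3⟩
        · exact absurd l3 hroot
      obtain ⟨⟨hbm, hbf⟩, hbr⟩ := hb
      refine (Halts.seq (T := 20) (R := fun s' => s'.real = s.real ∧ s'.nat 11 0 = 2 ^ D ∧
        s'.nat 40 0 = b ∧ s'.nat 41 0 = 0 ∧ s'.nat tr = s₁.nat tr ∧
        ∀ a, s'.nat out a = if a = j then b else s₁.nat out a)
        ((Halts.of_wp _ _ _ ?_).mono (by simp [bound, NatExpr.cost]) fun _ h => h) ?_)
      · rintro s₂ f2 s₃ f3 s₄ f4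
        have h40 : s₂.nat 40 0 = b := by simp [f2, NatExpr.eval, hbr]
        refine ⟨by simp [f2, f3, f4, e1], ?_, ?_, by simp [f4, NatExpr.eval], ?_, fun a => ?_⟩
        · simp [f2, f3, f4, e2, NatExpr.eval, show 11 ≠ out by omega]
        · simp [f3, f4, NatExpr.eval, o2.symm, h40]
        · funext i
          simp [f2, f3, f4, NatExpr.eval, t2, t3, hto.symm]
        · have h12' : s₂.nat 12 0 = j := by simp [f2, h12]
          simp only [f4, f3, NatExpr.eval, Store.setNat_nat, o3, false_and, if_false, h12', h40,
            true_and]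
          simp [f2, o2]
      · rintro s₂ ⟨f1, f2, f3, f4, f5, f6⟩
        refine (upd s₂ b 0 f1 f2 f3 f4 hbD (f5 ▸ e3)).mono le_rfl ?_
        rintro s₃ ⟨⟨g1, g2⟩, g3, g4⟩
        have e : (s₃.setNat 12 0 (j + 1)).nat tr = s₃.nat tr := funext fun j => by
          simp [show tr ≠ 12 by omega]
        have e' : ∀ a, (s₃.setNat 12 0 (j + 1)).nat out a = if a = j then b else s₁.nat out a := by
          intro a
          rw [← f6, ← g3 out hto (by omega) (by omega) (by omega)]
          simp [show out ≠ 12 by omega]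
        have hne : ∀ a < j, (if a = j then b else s₁.nat out a) = s₁.nat out a := fun a ha =>
          if_neg ha.ne
        simp only [e', e]
        refine ⟨g4.trans f1, ?_, g1, fun c hc => ?_, fun a ha => ?_, fun a c hac hcj => ?_,
          fun a ha c hc hf => ?_, fun a ha => ?_⟩
        · simp [g3 11 (by omega), f2]
        · rw [g2, f5, e4 c hc]
          by_cases hcb : c = b
          · rw [if_pos hcb, if_neg]
            rintro ⟨-, h⟩
            exact h j (by omega) (by rw [if_pos rfl, hcb])
          · rw [if_neg hcb]
            refine if_congr (and_congr_right fun _ => ⟨fun h a ha => ?_, fun h a ha => ?_⟩) rfl rfl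
            · rcases eq_or_ne a j with h' | h'
              · rw [if_pos h']; exact Ne.symm hcb
              · rw [if_neg h']; exact h a (by omega)
            · rw [← hne a ha]; exact h a (by omega)
        · rcases eq_or_ne a j with h | h
          · rwa [if_pos h]
          · rw [if_neg h]; exact e5 a (by omega)
        · rw [hne a (by omega)]
          rcases eq_or_ne c j with h | h
          · rw [if_pos h]; exact hbf a (by omega)
          · rw [if_neg h]; exact e6 a c hac (by omega)
        · have hf' : ∀ i < a, s₁.nat out i ≠ c := fun i hi => by
            rw [← hne i (by omega)]; exact hf i hi
          rcases eq_or_ne a j with h | h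
          · rw [if_pos h]
            have := leaf c hc (fun i hi => hf' i (by omega))
            rw [hbr] at this
            exact WithTop.coe_le_coe.1 this
          · rw [if_neg h]; exact e7 a (by omega) c hc hf'
        · rw [if_neg (by omega)]; exact e8 a ha
    · rintro s' ⟨e1, -, -, -, e5, e6, e7, e8⟩
      exact ⟨⟨e5, e6, fun a b hab hb => e7 a (by omega) _ (e5 b hb) fun c hc =>
        e6 c b (by omega) hb⟩, e1, e8⟩

end RealRAM

/-! ## The order of the sweep, and predecessors -/

theorem IsSorting.exists_inverse {α : Type*} [LinearOrder α] {κ : ℕ → α} {m : ℕ} {out : ℕ → ℕ}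
    (h : IsSorting κ m out) : ∃ inv : ℕ → ℕ, (∀ a < m, inv a < m ∧ out (inv a) = a) ∧
      ∀ k < m, inv (out k) = k := by
  have inj : ∀ a < m, ∀ b < m, out a = out b → a = b := fun a ha b hb hab => by
    rcases lt_trichotomy a b with h' | h' | h'
    · exact absurd hab (h.ne a b h' hb)
    · exact h'
    · exact absurd hab.symm (h.ne b a h' ha)
  have surj : ∀ a < m, ∃ k < m, out k = a := fun a ha => by
    have h1 : (Finset.range m).image out = Finset.range m := by
      refine Finset.eq_of_subset_of_card_le (fun b hb => ?_) ?_
      · obtain ⟨c, hc, rfl⟩ := Finset.mem_image.1 hb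
        exact Finset.mem_range.2 (h.lt c (Finset.mem_range.1 hc))
      · rw [Finset.card_image_of_injOn]
        intro b hb c hc
        simp only [Finset.coe_range, mem_Iio] at hb hc
        exact inj b hb c hc
    have h2 := Finset.mem_range.2 ha
    rw [← h1] at h2
    obtain ⟨k, hk, h3⟩ := Finset.mem_image.1 h2
    exact ⟨k, Finset.mem_range.1 hk, h3⟩
  choose! inv hlt hinv using surj
  exact ⟨inv, fun a ha => ⟨hlt a ha, hinv a ha⟩, fun k hk =>
    inj _ (hlt _ (h.lt k hk)) k hk (hinv _ (h.lt k hk))⟩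

/-- The two sorted lists of edges determine the order of the sweep. -/
theorem IsCyclicPolygon.exists_isSweep {m : ℕ} [NeZero m] {X Y : ZMod m → ℝ} {P : Set Plane}
    (hP : IsCyclicPolygon X Y P) {κ κ' : ℕ → ℝ ×ₗ ℝ} {hs vs : ℕ → ℕ}
    (hκ : ∀ a < m, κ a = toLex (Y a, X a)) (hκ' : ∀ a < m, κ' a = toLex (X a, Y a))
    (h : IsSorting κ m hs) (h' : IsSorting κ' m vs) :
    ∃ ρ pos, IsSweep X Y (fun k => (hs k : ZMod m)) ρ (fun p => (vs (p - 1) : ZMod m)) pos := by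
  obtain ⟨ι, a1, a2⟩ := h.exists_inverse
  obtain ⟨ι', b1, b2⟩ := h'.exists_inverse
  have hval : ∀ u : ZMod m, u.val < m := fun u => u.val_lt
  have cast : ∀ u : ZMod m, ((u.val : ℕ) : ZMod m) = u := fun u => ZMod.natCast_zmod_val u
  -- Positions are ranks plus one, because position `0` is reserved for the list head and for
  -- "none".
  refine ⟨fun u => ι u.val, fun u => ι' u.val + 1, fun u => (a1 _ (hval u)).1, fun u => ?_,
    fun k hk => ?_, fun u w huw => ?_, fun u => by omega, fun u => (b1 _ (hval u)).1, fun u => ?_,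
    fun p hp hpm => ?_, fun u w huw => ?_⟩
  · simp only [(a1 _ (hval u)).2, cast]
  · simp only [ZMod.val_cast_of_lt (h.lt k hk), a2 k hk]
  · have h1 := h.le _ _ huw (a1 _ (hval w)).1
    rw [(a1 _ (hval u)).2, (a1 _ (hval w)).2, hκ _ (hval u), hκ _ (hval w), cast, cast,
      Prod.Lex.le_iff] at h1
    rcases h1 with h1 | ⟨h1, h2⟩
    · exact Or.inl h1
    · refine Or.inr ⟨h1, lt_of_le_of_ne h2 fun h3 => ?_⟩
      -- Equal keys would mean a common corner; so horizontal edges have no ties.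
      have : u = w := hP.eq_of_mem_hEdge (z := (X u, Y u))
        (mem_hEdge.2 ⟨right_mem_uIcc, rfl⟩)
        (mem_hEdge.2 ⟨by change X u = X w at h3; rw [h3]; exact right_mem_uIcc, h1⟩)
      rw [this] at huw
      exact lt_irrefl _ huw
  · simp only [Nat.add_sub_cancel, (b1 _ (hval u)).2, cast]
  · simp only [ZMod.val_cast_of_lt (h'.lt (p - 1) (by omega)), b2 (p - 1) (by omega)]
    omega
  · have h1 := h'.le _ _ (by omega : ι' u.val < ι' w.val) (b1 _ (hval w)).1
    rw [(b1 _ (hval u)).2, (b1 _ (hval w)).2, hκ' _ (hval u), hκ' _ (hval w), cast, cast,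
      Prod.Lex.le_iff] at h1
    rcases h1 with h1 | ⟨h1, -⟩
    · exact le_of_lt h1
    · exact le_of_eq h1

namespace RealRAM

open Program

/-- The item `var 14 - 1` precedes the item `var 15 - 1` in the lexicographic order
of the keys `k`, `k'`; the value `0` stands for no item. -/
def precedes (k k' : NatExpr → RealExpr) : Test :=
  .and (.not (.natEq (var 14) (.const 0))) (.not (.and (.not (.natEq (var 15) (.const 0)))
    (.and (.not (.realLt (k (.sub (var 14) (.const 1))) (k (.sub (var 15) (.const 1)))))
      (.not (.and (.realEq (k (.sub (var 14) (.const 1))) (k (.sub (var 15) (.const 1))))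
        (.realLt (k' (.sub (var 14) (.const 1))) (k' (.sub (var 15) (.const 1)))))))))

/-- Tests offer no disjunction, so the lexicographic comparison and the treatment of the value `0`
are written with negations and conjunctions. -/
theorem precedes_holds {k k' : NatExpr → RealExpr} {f f' : ℕ → ℝ} {s : Store}
    (hk : ∀ e, (k e).eval s = f (e.eval s)) (hk' : ∀ e, (k' e).eval s = f' (e.eval s)) :
    (precedes k k').Holds s ↔ itemKey (fun a => toLex (f a, f' a)) (s.nat 14 0) <
      itemKey (fun a => toLex (f a, f' a)) (s.nat 15 0) := by
  simp only [precedes, Test.Holds, hk, hk', NatExpr.eval]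
  rcases s.nat 14 0 with _ | a
  · simp [itemKey]
  · rcases s.nat 15 0 with _ | b
    · simp [itemKey]
    · simp [itemKey, Prod.Lex.lt_iff, -not_and, -not_or, not_and_or, or_iff_not_imp_left]

/-! ### Trees of maxima and the search for predecessors -/

/-- Among two values the larger one wins. -/
def larger : Test := .natLt (var 15) (var 14)

/-- `t` is the tree of maxima for the set `A`. -/
structure IsMaxTree (D : ℕ) (A : ℕ → Prop) (t : ℕ → ℕ) : Prop where
  valid : TreeValid (winner fun a b => b < a) (2 ^ D) (fun _ => False) t
  leaf : ∀ b < 2 ^ D, A b → t (2 ^ D + b) = b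
  leaf' : ∀ b < 2 ^ D, ¬ A b → t (2 ^ D + b) = 0

theorem IsMaxTree.best {D : ℕ} {A : ℕ → Prop} {t : ℕ → ℕ} (ht : IsMaxTree D A t) :
    ∀ (h g j : ℕ), h + g = D → 2 ^ g ≤ j → j < 2 ^ (g + 1) →
      (∃ l, j * 2 ^ h ≤ l ∧ l < (j + 1) * 2 ^ h ∧ t j = t l) ∧
        ∀ l, j * 2 ^ h ≤ l → l < (j + 1) * 2 ^ h → t l ≤ t j :=
  ht.valid.best (le := fun a b => b ≤ a) (fun _ => le_rfl) (fun _ _ _ h h' => h'.trans h)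
    (fun a b => by unfold winner; split_ifs <;> simp)
    (fun a b => by unfold winner; split_ifs <;> omega)
    (fun a b => by unfold winner; split_ifs <;> omega)

/-- One step of the search for the predecessor. -/
def predecessorBody : Program :=
  .ite (.and (.not (.natEq (var 13) (.add (.half (var 13)) (.half (var 13)))))
    (.natEq (var 17) (.const 0))) (assign 17 (.read 32 (.sub (var 13) (.const 1)))) .skip ;;
  assign 13 (.half (var 13))

/-- Find the largest element below `var 18` by means of the tree of maxima `32`. -/
def predecessor : Program :=
  (assign 13 (.add (var 11) (var 18)) ;; assign 17 (.const 0)) ;;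
    .while (.natLt (.const 1) (var 13)) predecessorBody

/-- The time for the search for the predecessor in a tree of depth `D`. -/
def predecessorTime (D : ℕ) : ℕ := 12 + (D * (predecessorBody.bound + 5) + 5)

/-- On the way from the leaf `a` to the root, whenever the node is a right child its left sibling
covers the next block of smaller numbers. The first nonzero maximum found there is the predecessor.
While nothing is found, no element lies between the left border of the current subtree and `a`. -/
theorem halts_predecessor {s : Store} {D a : ℕ} {A : ℕ → Prop} (ht : IsMaxTree D A (s.nat 32))
    (hN : s.nat 11 0 = 2 ^ D) (ha : s.nat 18 0 = a) (haD : a < 2 ^ D) (hpos : 0 < a) :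
    Halts predecessor s (predecessorTime D) fun s' => s'.nat 17 0 < a ∧
      (s'.nat 17 0 = 0 ∨ A (s'.nat 17 0)) ∧ ∀ q, s'.nat 17 0 < q → q < a → ¬ A q := by
  refine Halts.seq (R := fun s' => s'.nat 32 = s.nat 32 ∧ s'.nat 13 0 = 2 ^ D + a ∧
    s'.nat 17 0 = 0) (T := 12) ((Halts.of_wp _ _ _ ?_).mono (by simp [bound, NatExpr.cost])
      fun _ h => h) ?_
  · rintro s₁ e₁ s₂ e₂
    refine ⟨funext fun j => by simp [e₁, e₂], by simp [e₁, e₂, NatExpr.eval, hN, ha],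
      by simp [e₂, NatExpr.eval]⟩
  rintro s₀ ⟨a1, a2, a3⟩
  refine (Halts.loop (T := predecessorBody.bound) (I := fun r s' => s'.nat 32 = s.nat 32 ∧
    2 ^ r ≤ s'.nat 13 0 ∧ s'.nat 13 0 < 2 ^ (r + 1) ∧ ∃ h, h + r = D ∧
    s'.nat 13 0 * 2 ^ h ≤ 2 ^ D + a ∧ s'.nat 17 0 < a ∧ (s'.nat 17 0 = 0 ∨ A (s'.nat 17 0)) ∧
    ∀ q, s'.nat 17 0 < q → q < a → (s'.nat 17 0 = 0 → s'.nat 13 0 * 2 ^ h ≤ 2 ^ D + q) → ¬ A q)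
    ?_ D s₀ ⟨a1, by omega, by rw [pow_succ]; omega, 0, by omega, by omega, by omega, Or.inl a3,
      fun q h1 h2 h3 => by have := h3 a3; omega⟩).mono ?_ ?_
  · rintro r s₁ ⟨e1, e2, e3, h, e4, e5, e6, e7, e8⟩ hb
    simp only [Test.Holds, NatExpr.eval] at hb
    set J := s₁.nat 13 0 with hJ
    obtain ⟨r, rfl⟩ : ∃ r', r = r' + 1 := ⟨r - 1, by
      rcases r with _ | r
      · norm_num at e3; omega
      · rfl⟩
    refine ⟨r, rfl, Halts.of_wp _ _ _ ?_⟩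
    have hr : 2 ^ (r + 1) = 2 * 2 ^ r := pow_succ' _ _
    have hr' : 2 ^ (r + 1 + 1) = 2 * 2 ^ (r + 1) := pow_succ' _ _
    have hD : 2 ^ (r + 1) * 2 ^ h = 2 ^ D := by rw [← pow_add, ← e4, add_comm]
    have hh : J / 2 * 2 ^ (h + 1) = 2 * (J / 2) * 2 ^ h := by ring
    constructor
    · rintro ⟨hodd, hz⟩ s₂ e₂ s₃ e₃
      simp only [Test.Holds, NatExpr.eval] at hodd hz
      have h13 : s₃.nat 13 0 = J / 2 := by simp [e₃, e₂, NatExpr.eval, hJ]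
      have h17 : s₃.nat 17 0 = s.nat 32 (2 * (J / 2)) := by
        simp only [e₃, e₂, NatExpr.eval, Store.setNat_nat, ← e1]
        simp only [Nat.reduceEqDiff, false_and, if_false, and_self, if_true]
        congr 1; omega
      have h32 : s₃.nat 32 = s₁.nat 32 := funext fun j => by simp [e₃, e₂]
      rw [h13, h17]
      obtain ⟨⟨l, l1, l2, l3⟩, hbest⟩ := ht.best h (r + 1) (2 * (J / 2)) e4 (by omega) (by omega)
      have hJ1 : 2 * (J / 2) + 1 = J := by omega
      rw [hJ1] at l2 hbest
      have hle : 2 ^ (r + 1) * 2 ^ h ≤ 2 * (J / 2) * 2 ^ h := Nat.mul_le_mul_right _ (by omega)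
      obtain ⟨b, rfl⟩ : ∃ b, l = 2 ^ D + b := ⟨l - 2 ^ D, by omega⟩
      have hval : s.nat 32 (2 * (J / 2)) < a ∧ (s.nat 32 (2 * (J / 2)) = 0 ∨
          (A (s.nat 32 (2 * (J / 2))) ∧ s.nat 32 (2 * (J / 2)) = b)) := by
        rw [l3]
        by_cases hAb : A b
        · rw [ht.leaf b (by omega) hAb]
          exact ⟨by omega, Or.inr ⟨hAb, rfl⟩⟩
        · rw [ht.leaf' b (by omega) hAb]
          exact ⟨by omega, Or.inl rfl⟩
      refine ⟨h32.trans e1, by omega, by omega, h + 1, by omega, ?_, hval.1,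
        hval.2.imp_right And.left, fun q h1 h2 h3 hq => ?_⟩
      · rw [hh]
        exact (Nat.mul_le_mul_right _ (by omega)).trans e5
      · rw [hh] at h3
        rcases le_or_gt (J * 2 ^ h) (2 ^ D + q) with h4 | h4
        · exact e8 q (by omega) h2 (fun _ => h4) hq
        · have := hbest (2 ^ D + q) (by
            rcases hval.2 with h5 | h5
            · exact h3 h5
            · omega) h4
          rw [ht.leaf q (by omega) hq] at this
          omega
    · intro hb' s₃ e₃
      simp only [Test.Holds, NatExpr.eval] at hb'
      have h13 : s₃.nat 13 0 = J / 2 := by simp [e₃, NatExpr.eval, hJ]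
      have h17 : s₃.nat 17 0 = s₁.nat 17 0 := by simp [e₃]
      have h32 : s₃.nat 32 = s₁.nat 32 := funext fun j => by simp [e₃]
      have hle : 2 * (J / 2) * 2 ^ h ≤ J * 2 ^ h := Nat.mul_le_mul_right _ (by omega)
      rw [h13, h17, h32]
      refine ⟨e1, by omega, by omega, h + 1, by omega, by omega, e6, e7,
        fun q h1 h2 h3 => e8 q h1 h2 fun hz => ?_⟩
      have h4 := h3 hz
      have h5 : 2 * (J / 2) = J := by
        by_contra hc
        exact hb' ⟨by rw [← hJ]; omega, hz⟩
      rwa [hh, h5] at h4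
  · simp [Test.cost, NatExpr.cost]
  · rintro s' ⟨r, ⟨-, e2, e3, h, e4, e5, e6, e7, e8⟩, hb⟩
    simp only [Test.Holds, NatExpr.eval] at hb
    refine ⟨e6, e7, fun q h1 h2 => e8 q h1 h2 fun _ => ?_⟩
    have h1 : 1 ≤ 2 ^ r := Nat.one_le_two_pow
    obtain rfl : r = 0 := by
      rcases r with _ | r
      · rfl
      · have := Nat.one_le_two_pow (n := r)
        rw [pow_succ] at e2; omega
    obtain rfl : h = D := by omega
    rw [show s'.nat 13 0 = 1 by omega]
    omega

end RealRAM

/-! ## What the sweep has found -/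

section

variable {m : ℕ} [NeZero m] {X Y : ZMod m → ℝ} {P : Set Plane} {e : ℕ → ZMod m}
  {ρ : ZMod m → ℕ} {vp : ℕ → ZMod m} {pos : ZMod m → ℕ} {k p pa pb : ℕ} {nxt flag : ℕ → ℕ}
  {bot : ℕ → ℝ}

/-- Before event `k`, the set `S` consists of the midpoints of `cnt` edges of the kind `good`, one
for each extension; `tag` tells whether the extension of the last edge is among them. -/
def PointInv (X Y : ZMod m → ℝ) (P : Set Plane) (e : ℕ → ZMod m) (ρ : ZMod m → ℕ)
    (good : ZMod m → Prop) (k tag cnt : ℕ) (S : Set Plane) : Prop :=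
  ∃ T : Set (ZMod m), (∀ h ∈ T, good h ∧ ρ h < k) ∧ InjOn (hExtension X Y P) T ∧
    (∀ h, good h → ρ h < k → ∃ h' ∈ T, hExtension X Y P h' = hExtension X Y P h) ∧
    T.ncard = cnt ∧ S = hMid X Y '' T ∧
    (tag ≠ 0 ↔ 0 < k ∧ ∃ h ∈ T, hExtension X Y P h = hExtension X Y P (e (k - 1)))

/-- Before event `k`, the quadruples `(x₁, x₂, y₁, y₂)` in `Q` describe the pieces with a top edge
that has been processed. -/
structure RectInv (X Y : ZMod m → ℝ) (P : Set Plane) (ρ : ZMod m → ℕ) (k : ℕ)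
    (Q : Set (ℝ × ℝ × ℝ × ℝ)) : Prop where
  sound : ∀ q ∈ Q, ∃ l r b t, IsPiece X Y P l r b t ∧ q = (X l, X r, b, t)
  complete : ∀ l r b t h, IsPiece X Y P l r b t → ρ h < k → Touches X l r h → Y h = t →
    (X l, X r, b, t) ∈ Q

theorem PointInv.zero {good : ZMod m → Prop} : PointInv X Y P e ρ good 0 0 0 ∅ :=
  ⟨∅, by simp, by simp, by simp, by simp, by simp, by simp⟩

/-- Edges with a common extension are consecutive in the sweep. So one bit per list, reset when the
extension changes, tells whether the current extension is already represented. -/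
theorem PointInv.step {good : ZMod m → Prop} {tag cnt tag₁ : ℕ} {S : Set Plane}
    (hI : PointInv X Y P e ρ good k tag cnt S) (hs : IsSweep X Y e ρ vp pos)
    (hP : IsCyclicPolygon X Y P) (hk : k < m)
    (h1 : (0 < k ∧ hExtension X Y P (e (k - 1)) = hExtension X Y P (e k)) → tag₁ = tag)
    (h2 : ¬ (0 < k ∧ hExtension X Y P (e (k - 1)) = hExtension X Y P (e k)) → tag₁ = 0) :
    (good (e k) → tag₁ = 0 →
      PointInv X Y P e ρ good (k + 1) 1 (cnt + 1) (insert (hMid X Y (e k)) S)) ∧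
    (good (e k) → tag₁ ≠ 0 → PointInv X Y P e ρ good (k + 1) tag₁ cnt S) ∧
    (¬ good (e k) → PointInv X Y P e ρ good (k + 1) tag₁ cnt S) := by
  obtain ⟨T, a1, a2, a3, a4, a5, a6⟩ := hI
  -- A representative processed earlier with the same extension would make the immediately preceding
  -- edge share it, by `hExtension_eq_of_between`.
  have tag_iff : tag₁ ≠ 0 ↔ ∃ h ∈ T, hExtension X Y P h = hExtension X Y P (e k) := by
    by_cases hl : 0 < k ∧ hExtension X Y P (e (k - 1)) = hExtension X Y P (e k)
    · rw [h1 hl, a6, ← hl.2]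
      exact and_iff_right hl.1
    · refine iff_of_false (not_not.2 (h2 hl)) ?_
      rintro ⟨h, hT, hext⟩
      have h3 := (a1 h hT).2
      have rk : ρ (e k) = k := hs.ρ_e k hk
      have rk' : ρ (e (k - 1)) = k - 1 := hs.ρ_e _ (by omega)
      refine hl ⟨by omega, ?_⟩
      rcases eq_or_ne (ρ h) (k - 1) with h4 | h4
      · rw [← h4, hs.e_ρ, hext]
      · exact hs.hExtension_eq_of_between hP (by omega) (by omega) hext
  have rank : ∀ h, ρ h < k + 1 → ρ h < k ∨ h = e k := fun h hh => by
    rcases (Nat.lt_succ_iff.1 hh).lt_or_eq with h' | h'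
    · exact Or.inl h'
    · exact Or.inr (by rw [← h', hs.e_ρ])
  have keep : (good (e k) → tag₁ ≠ 0) → PointInv X Y P e ρ good (k + 1) tag₁ cnt S := by
    intro hg
    refine ⟨T, fun h hT => ⟨(a1 h hT).1, (a1 h hT).2.trans (Nat.lt_succ_self k)⟩, a2,
      fun h hh hr => ?_, a4, a5, ?_⟩
    · rcases rank h hr with h' | rfl
      · exact a3 h hh h'
      · exact tag_iff.1 (hg hh)
    · rw [tag_iff, Nat.add_sub_cancel]
      exact (and_iff_right (Nat.succ_pos k)).symm
  refine ⟨fun hg ht => ?_, fun _ ht => keep fun _ => ht, fun hg => keep fun h => absurd h hg⟩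
  have fresh : ∀ h ∈ T, hExtension X Y P h ≠ hExtension X Y P (e k) := fun h hT hext =>
    tag_iff.2 ⟨h, hT, hext⟩ ht
  refine ⟨insert (e k) T, ?_, ?_, fun h hh hr => ?_, ?_, ?_, ?_⟩
  · rintro h (rfl | hT)
    · exact ⟨hg, by rw [hs.ρ_e k hk]; exact Nat.lt_succ_self k⟩
    · exact ⟨(a1 h hT).1, (a1 h hT).2.trans (Nat.lt_succ_self k)⟩
  · rw [injOn_insert fun h => fresh _ h rfl]
    refine ⟨a2, ?_⟩
    rintro ⟨h, hT, hext⟩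
    exact fresh h hT hext
  · rcases rank h hr with h' | rfl
    · obtain ⟨h', h3, h4⟩ := a3 h hh h'
      exact ⟨h', Or.inr h3, h4⟩
    · exact ⟨_, Or.inl rfl, rfl⟩
  · rw [ncard_insert_of_notMem fun h => fresh _ h rfl, a4]
  · rw [image_insert_eq, a5]
  · exact iff_of_true one_ne_zero ⟨Nat.succ_pos k, e k, Or.inl rfl, by rw [Nat.add_sub_cancel]⟩

theorem RectInv.zero : RectInv X Y P ρ 0 ∅ :=
  ⟨by simp, fun _ _ _ _ _ _ h => absurd h (Nat.not_lt_zero _)⟩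

/-- New entries are pieces by `isPiece`. A piece whose top side was touched earlier is already
listed; otherwise this is the first such event, and `reports` applies. -/
theorem RectInv.step {Q Q' : Set (ℝ × ℝ × ℝ × ℝ)} (hR : RectInv X Y P ρ k Q)
    (hI : SweepInv X Y ρ vp pos k nxt flag bot) (hs : IsSweep X Y e ρ vp pos)
    (hP : IsCyclicPolygon X Y P) (hv : IsEvent e ρ vp pos k p pa pb)
    (hQ : ∀ q, q ∈ Q' ↔ q ∈ Q ∨ ∃ c, (c = p ∨ (c = pa ∧ ActAt ρ vp k pa) ∨
      (c = pb ∧ ActAt ρ vp k pb)) ∧ flag c = 1 ∧ bot c < Y (e k) ∧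
      q = (X (vp c), X (vp (nxt c)), bot c, Y (e k))) :
    RectInv X Y P ρ (k + 1) Q' := by
  refine ⟨fun q hq => ?_, fun l r b t h hp hr ht hy => ?_⟩
  · rcases (hQ q).1 hq with h | ⟨c, h1, h2, h3, rfl⟩
    · exact hR.sound q h
    · refine ⟨_, _, _, _, hI.isPiece hs hP hv ?_ ?_ h2 h3, rfl⟩
      · rcases h1 with rfl | ⟨rfl, -⟩ | ⟨rfl, -⟩ <;> simp
      · rcases h1 with rfl | ⟨rfl, h⟩ | ⟨rfl, h⟩
        · exact hv.p_act
        · exact Or.inr h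
        · exact Or.inr h
  · by_cases hex : ∃ h', ρ h' < k ∧ Touches X l r h' ∧ Y h' = t
    · obtain ⟨h', h1, h2, h3⟩ := hex
      exact (hQ _).2 (Or.inl (hR.complete l r b t h' hp h1 h2 h3))
    · have hk : ρ h = k := by
        rcases (Nat.lt_succ_iff.1 hr).lt_or_eq with h' | h'
        · exact absurd ⟨h, h', ht, hy⟩ hex
        · exact h'
      obtain rfl : h = e k := by rw [← hk, hs.e_ρ]
      subst hy
      obtain ⟨b1, b2, b3, b4, b5⟩ := hI.reports hs hP hv hp ht fun h' h1 h2 h3 => hex ⟨h', h1, h2, h3⟩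
      refine (hQ _).2 (Or.inr ⟨pos l, ?_, b4, ?_, ?_⟩)
      · rcases b5 with h | h | h
        · exact Or.inl h
        · exact Or.inr (Or.inl ⟨h, h ▸ b1⟩)
        · exact Or.inr (Or.inr ⟨h, h ▸ b1⟩)
      · rw [b3]; exact hp.lt_y
      · rw [b2, b3, hs.vp_pos, hs.vp_pos]

end

set_option linter.unusedSimpArgs false

/-! ## The program for one event of the sweep -/

namespace RealRAM

open Program

/-- The abscissa of the vertical edge `a`. -/
def absc (a : NatExpr) : RealExpr := .read 0 (.add (.add a a) (.const 1))

/-- The height of the horizontal edge `a`. -/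
def height (a : NatExpr) : RealExpr := .read 1 (.add a a)

/-- Find the horizontal edge `var 20` of event `var 12`, the preceding edge `var 21`, and the
positions `var 18 < var 19` of the neighbours. -/
def loadEvent : Program :=
  assign 20 (.read 33 (var 12)) ;;
  .ite (.natEq (var 20) (.const 0)) (assign 21 (.sub (var 10) (.const 1)))
    (assign 21 (.sub (var 20) (.const 1))) ;;
  .ite (.natLt (.read 35 (var 21)) (.read 35 (var 20)))
    (assign 18 (.read 35 (var 21)) ;; assign 19 (.read 35 (var 20)))
    (assign 18 (.read 35 (var 20)) ;; assign 19 (.read 35 (var 21)))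

theorem halts_loadEvent (s : Store) {a b : ℕ} (ha : s.nat 33 (s.nat 12 0) = a)
    (hb : b = if a = 0 then s.nat 10 0 - 1 else a - 1) :
    Halts loadEvent s loadEvent.bound fun s' => s'.nat 20 0 = a ∧ s'.nat 21 0 = b ∧
      s'.nat 18 0 = min (s.nat 35 b) (s.nat 35 a) ∧ s'.nat 19 0 = max (s.nat 35 b) (s.nat 35 a) := by
  refine Halts.of_wp _ _ _ ?_
  intro s₁ e₁
  have key : ∀ s₂ : Store, s₂.nat 20 0 = a → s₂.nat 21 0 = b → s₂.nat 35 = s.nat 35 →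
      Program.wp (.ite (.natLt (.read 35 (var 21)) (.read 35 (var 20)))
        (assign 18 (.read 35 (var 21)) ;; assign 19 (.read 35 (var 20)))
        (assign 18 (.read 35 (var 20)) ;; assign 19 (.read 35 (var 21))))
        (fun s' => s'.nat 20 0 = a ∧ s'.nat 21 0 = b ∧
      s'.nat 18 0 = min (s.nat 35 b) (s.nat 35 a) ∧ s'.nat 19 0 = max (s.nat 35 b) (s.nat 35 a))
        s₂ := by
    intro s₂ h20 h21 h35
    constructor
    · intro hlt s₃ e₃ s₄ e₄
      simp only [Test.Holds, NatExpr.eval, h20, h21, h35] at hlt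
      rw [min_eq_left hlt.le, max_eq_right hlt.le]
      simp [e₃, e₄, h20, h21, h35, NatExpr.eval]
    · intro hlt s₃ e₃ s₄ e₄
      simp only [Test.Holds, NatExpr.eval, h20, h21, h35, not_lt] at hlt
      rw [min_eq_right hlt, max_eq_left hlt]
      simp [e₃, e₄, h20, h21, h35, NatExpr.eval]
  have h20 : s₁.nat 20 0 = a := by simp [e₁, NatExpr.eval, ha]
  constructor
  · intro h0 s₂ e₂
    simp only [Test.Holds, NatExpr.eval, h20] at h0
    refine key s₂ (by simp [e₂, h20]) ?_ (funext fun j => by simp [e₁, e₂])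
    rw [hb, if_pos h0]
    simp [e₁, e₂, NatExpr.eval]
  · intro h0 s₂ e₂
    simp only [Test.Holds, NatExpr.eval, h20] at h0
    refine key s₂ (by simp [e₂, h20]) ?_ (funext fun j => by simp [e₁, e₂])
    rw [hb, if_neg h0]
    simp [e₂, NatExpr.eval, h20]

/-- Find out whether the positions `var 18` and `var 19` are active. -/
def loadActive : Program :=
  assign 38 (.read 32 (.add (var 11) (var 18))) ;; assign 39 (.read 32 (.add (var 11) (var 19)))

theorem halts_loadActive (s : Store) : Halts loadActive s loadActive.bound fun s' =>
    s'.nat 38 0 = s.nat 32 (s.nat 11 0 + s.nat 18 0) ∧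
    s'.nat 39 0 = s.nat 32 (s.nat 11 0 + s.nat 19 0) := by
  refine Halts.of_wp _ _ _ ?_
  intro s₁ e₁ s₂ e₂
  simp [e₁, e₂, NatExpr.eval]

/-- The points listed in two arrays. -/
def listed (x y : ℕ → ℝ) (cnt : ℕ) : Set Plane := (fun j => (x j, y j)) '' Iio cnt

/-- Add the midpoint of the edge `var 20` to a list unless it is tagged. -/
def addPoint (tag cnt x y : ℕ) : Program :=
  .ite (.natEq (var tag) (.const 0))
    (.writeReal x (var cnt) (.div (.add (absc (var 21)) (absc (var 20))) (.const 2)) ;;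
      .writeReal y (var cnt) (height (var 20)) ;; increment cnt ;; assign tag (.const 1))
    .skip

theorem image_Iio_succ {α : Type*} {f g : ℕ → α} {n : ℕ} {a : α} (h : ∀ j < n, g j = f j)
    (hn : g n = a) : g '' Iio (n + 1) = insert a (f '' Iio n) := by
  ext x
  simp only [mem_image, mem_Iio, mem_insert_iff]
  constructor
  · rintro ⟨j, hj, rfl⟩
    rcases (Nat.lt_succ_iff.1 hj).lt_or_eq with h' | rfl
    · exact Or.inr ⟨j, h', (h j h').symm⟩
    · exact Or.inl hn
  · rintro (rfl | ⟨j, hj, rfl⟩)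
    · exact ⟨n, Nat.lt_succ_self n, hn⟩
    · exact ⟨j, hj.trans (Nat.lt_succ_self n), h j hj⟩

theorem halts_addPoint (s : Store) {tag cnt x y : ℕ} (ht : tag ≠ cnt) (hx : 1 < x)
    (hxy : x ≠ y) : Halts (addPoint tag cnt x y) s (addPoint tag cnt x y).bound fun s' =>
      (s.nat tag 0 ≠ 0 → s' = s) ∧ (s.nat tag 0 = 0 → s'.nat tag 0 = 1 ∧
        s'.nat cnt 0 = s.nat cnt 0 + 1 ∧
        listed (s'.real x) (s'.real y) (s'.nat cnt 0) =
          insert (((absc (var 21)).eval s + (absc (var 20)).eval s) / 2, (height (var 20)).eval s)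
            (listed (s.real x) (s.real y) (s.nat cnt 0))) := by
  have x0 : (0 : ℕ) ≠ x := by omega
  have x1 : (1 : ℕ) ≠ x := by omega
  refine Halts.of_wp _ _ _ ⟨?_, ?_⟩
  · intro h s₁ e₁ s₂ e₂ s₃ e₃ s₄ e₄
    simp only [Test.Holds, NatExpr.eval] at h
    have hc : s₃.nat cnt 0 = s.nat cnt 0 + 1 := by simp [e₁, e₂, e₃, NatExpr.eval]
    have hc' : s₄.nat cnt 0 = s.nat cnt 0 + 1 := by rw [e₄]; simp [NatExpr.eval, ht.symm, hc]
    refine ⟨fun h' => absurd h h', fun _ => ⟨by simp [e₄, NatExpr.eval], hc', ?_⟩⟩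
    rw [hc', listed, listed]
    refine image_Iio_succ (fun j hj => ?_) ?_
    · simp [e₁, e₂, e₃, e₄, NatExpr.eval, hj.ne]
    · simp [e₁, e₂, e₃, e₄, NatExpr.eval, RealExpr.eval, absc, height, hxy, x1]
  · intro h
    simp only [Test.Holds, NatExpr.eval] at h
    exact ⟨fun _ => rfl, fun h' => absurd h' h⟩

/-- Reset the tags if the edge does not have the same extension as the preceding one. -/
def resetTags : Program :=
  .ite (.and (.natEq (.read 37 (var 17)) (.const 1)) (.realEq (.read 10 (var 17)) (height (var 20))))
    .skip (assign 24 (.const 0) ;; assign 25 (.const 0))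

theorem halts_resetTags (s : Store) : Halts resetTags s resetTags.bound fun s' =>
    ((s.nat 37 (s.nat 17 0) = 1 ∧ s.real 10 (s.nat 17 0) = (height (var 20)).eval s) → s' = s) ∧
    (¬ (s.nat 37 (s.nat 17 0) = 1 ∧ s.real 10 (s.nat 17 0) = (height (var 20)).eval s) →
      s'.nat 24 0 = 0 ∧ s'.nat 25 0 = 0) := by
  refine Halts.of_wp _ _ _ ⟨fun h => ⟨fun _ => rfl, fun h' => absurd h h'⟩, fun h => ?_⟩
  intro s₁ e₁ s₂ e₂
  refine ⟨fun h' => absurd h' h, fun _ => ?_⟩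
  simp [e₁, e₂, NatExpr.eval]

/-- Add the midpoint to the list of top edges or to the list of bottom edges. -/
def addPoints : Program :=
  .ite (.natEq (var 38) (.const 0)) (assign 22 (var 17)) (assign 22 (var 18)) ;;
  .ite (.natEq (.read 37 (var 22)) (.const 1)) (addPoint 24 26 6 7) (addPoint 25 27 12 13)

/-- Report the rectangle above position `c`. -/
def report (c : ℕ) : Program :=
  .ite (.and (.natEq (.read 37 (var c)) (.const 1)) (.realLt (.read 10 (var c)) (height (var 20))))
    (.writeReal 2 (var 1) (absc (.read 34 (.sub (var c) (.const 1)))) ;;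
      .writeReal 3 (var 1) (absc (.read 34 (.sub (.read 36 (var c)) (.const 1)))) ;;
      .writeReal 4 (var 1) (.read 10 (var c)) ;;
      .writeReal 5 (var 1) (height (var 20)) ;; increment 1) .skip

/-- The rectangles that have been reported. -/
def reported (s : Store) : Set (ℝ × ℝ × ℝ × ℝ) :=
  (fun j => (s.real 2 j, s.real 3 j, s.real 4 j, s.real 5 j)) '' Iio (s.nat 1 0)

/-- The rectangle that is to be reported at position `c`. -/
def IsReport (s : Store) (y : ℝ) (c : ℕ) (q : ℝ × ℝ × ℝ × ℝ) : Prop :=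
  s.nat 37 c = 1 ∧ s.real 10 c < y ∧ q = (s.real 0 (s.nat 34 (c - 1) + s.nat 34 (c - 1) + 1),
    s.real 0 (s.nat 34 (s.nat 36 c - 1) + s.nat 34 (s.nat 36 c - 1) + 1), s.real 10 c, y)

theorem halts_report (s : Store) (c : ℕ) : Halts (report c) s (report c).bound fun s' =>
    ∀ q, q ∈ reported s' ↔ q ∈ reported s ∨
      IsReport s ((height (var 20)).eval s) (s.nat c 0) q := by
  refine Halts.of_wp _ _ _ ⟨?_, ?_⟩
  · intro h s₁ e₁ s₂ e₂ s₃ e₃ s₄ e₄ s₅ e₅ q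
    simp only [Test.Holds, NatExpr.eval, RealExpr.eval] at h
    have hcnt : s₅.nat 1 0 = s.nat 1 0 + 1 := by simp [e₁, e₂, e₃, e₄, e₅, NatExpr.eval]
    rw [reported, reported, hcnt, image_Iio_succ (f := fun j => (s.real 2 j, s.real 3 j, s.real 4 j,
      s.real 5 j)) (fun j hj => by simp [e₁, e₂, e₃, e₄, e₅, NatExpr.eval, hj.ne]) rfl,
      mem_insert_iff, or_comm]
    refine or_congr_right ?_
    have : IsReport s ((height (var 20)).eval s) (s.nat c 0) q ↔ q = _ :=
      ⟨fun h => h.2.2, fun h' => ⟨h.1, h.2, h'⟩⟩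
    rw [this]
    simp [e₁, e₂, e₃, e₄, e₅, NatExpr.eval, RealExpr.eval, absc, height]
  · rintro h q
    simp only [Test.Holds, NatExpr.eval, RealExpr.eval] at h
    exact ⟨Or.inl, fun h' => h'.resolve_right fun h'' => h ⟨h''.1, h''.2.1⟩⟩

/-- Report the rectangles below the edge `var 20`. -/
def reports : Program :=
  report 17 ;; .ite (.natEq (var 38) (.const 0)) .skip (report 18) ;;
    .ite (.natEq (var 39) (.const 0)) .skip (report 19)

theorem IsReport.congr {s s' : Store} {y : ℝ} {c : ℕ} {q : ℝ × ℝ × ℝ × ℝ}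
    (h34 : s'.nat 34 = s.nat 34) (h36 : s'.nat 36 = s.nat 36) (h37 : s'.nat 37 = s.nat 37)
    (h0 : s'.real 0 = s.real 0) (h10 : s'.real 10 = s.real 10) :
    IsReport s' y c q ↔ IsReport s y c q := by
  simp [IsReport, h34, h36, h37, h0, h10]

/-- A report writes only the output arrays and their counter, so the later reports still read the
data from before the event. The positions `pa` and `pb` own a gap only if they are active. -/
theorem halts_reports (s : Store) : Halts reports s reports.bound fun s' =>
    ∀ q, q ∈ reported s' ↔ q ∈ reported s ∨ ∃ c, (c = s.nat 17 0 ∨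
      (c = s.nat 18 0 ∧ s.nat 38 0 ≠ 0) ∨ (c = s.nat 19 0 ∧ s.nat 39 0 ≠ 0)) ∧
      IsReport s ((height (var 20)).eval s) c q := by
  have fr : ∀ {c : ℕ} {s₁ s₂ : Store}, (∀ a, ¬ (report c).WritesNat a → s₂.nat a = s₁.nat a) →
      (∀ a, ¬ (report c).WritesReal a → s₂.real a = s₁.real a) →
      (∀ a, a ≠ 1 → s₂.nat a = s₁.nat a) ∧ s₂.real 0 = s₁.real 0 ∧ s₂.real 1 = s₁.real 1 ∧
      s₂.real 10 = s₁.real 10 := fun h h' => by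
    refine ⟨fun a ha => h a ?_, h' 0 ?_, h' 1 ?_, h' 10 ?_⟩ <;>
      simp [report, WritesNat, WritesReal]
    exact ha
  refine Halts.seq (halts_report s 17).frame ?_
  rintro s₁ ⟨h1, h2, h3⟩
  obtain ⟨f1, f2, f3, f4⟩ := fr h2 h3
  have y₁ : (height (var 20)).eval s₁ = (height (var 20)).eval s := by
    simp [height, RealExpr.eval, NatExpr.eval, f1, f3]
  refine Halts.seq (R := fun s' => (∀ q, q ∈ reported s' ↔ q ∈ reported s₁ ∨
    (s.nat 38 0 ≠ 0 ∧ IsReport s ((height (var 20)).eval s) (s.nat 18 0) q)) ∧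
    (∀ a, a ≠ 1 → s'.nat a = s.nat a) ∧ s'.real 0 = s.real 0 ∧ s'.real 1 = s.real 1 ∧
      s'.real 10 = s.real 10) ((Halts.ite (T := (report 18).bound) (fun hb => ?_) fun hb => ?_).mono
        (by simp [bound, report]) fun _ h => h) ?_
  · simp only [Test.Holds, NatExpr.eval, f1 38 (by norm_num)] at hb
    refine (Halts.of_wp .skip s₁ _ ?_).mono (by simp [bound, report, NatExpr.cost]) fun _ h => h
    exact ⟨fun q => by simp [hb], f1, f2, f3, f4⟩
  · simp only [Test.Holds, NatExpr.eval, f1 38 (by norm_num)] at hb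
    refine (halts_report s₁ 18).frame.mono le_rfl ?_
    rintro s₂ ⟨g1, g2, g3⟩
    obtain ⟨k1, k2, k3, k4⟩ := fr g2 g3
    refine ⟨fun q => ?_, fun a ha => (k1 a ha).trans (f1 a ha), k2.trans f2, k3.trans f3,
      k4.trans f4⟩
    rw [g1, y₁, IsReport.congr (f1 34 (by norm_num)) (f1 36 (by norm_num)) (f1 37 (by norm_num)) f2
      f4, f1 18 (by norm_num)]
    simp [hb]
  · rintro s₂ ⟨g1, k1, k2, k3, k4⟩
    have y₂ : (height (var 20)).eval s₂ = (height (var 20)).eval s := by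
      simp [height, RealExpr.eval, NatExpr.eval, k1, k3]
    refine (Halts.ite (T := (report 19).bound) (fun hb => ?_) fun hb => ?_).mono
        (by simp [bound, report]) fun _ h => h
    · simp only [Test.Holds, NatExpr.eval, k1 39 (by norm_num)] at hb
      refine (Halts.of_wp .skip s₂ _ ?_).mono (by simp [bound, report, NatExpr.cost]) fun _ h => h
      intro q
      rw [g1, h1]
      simp only [hb, ne_eq, not_true, and_false, or_false, or_and_right, exists_or, and_assoc,
        exists_eq_left, or_assoc]
    · simp only [Test.Holds, NatExpr.eval, k1 39 (by norm_num)] at hb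
      refine (halts_report s₂ 19).mono le_rfl ?_
      intro s₃ g5 q
      rw [g5, g1, h1, y₂, IsReport.congr (k1 34 (by norm_num)) (k1 36 (by norm_num))
        (k1 37 (by norm_num)) k2 k4, k1 19 (by norm_num)]
      simp only [hb, ne_eq, not_false_eq_true, and_true, or_and_right, exists_or, and_assoc,
        exists_eq_left, or_assoc]

/-- Update the links, the flags and the heights at the positions `var 17`, `var 18`, `var 19`. -/
def relink : Program :=
  .ite (.natEq (var 39) (.const 0))
    (.ite (.natEq (var 38) (.const 0)) (assign 22 (.read 36 (var 17)))
      (assign 22 (.read 36 (var 18)))) (assign 22 (.read 36 (var 19))) ;;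
  .writeNat 36 (var 19) (var 22) ;;
  .ite (.natEq (var 39) (.const 0)) (.writeNat 36 (var 18) (var 19))
    (.writeNat 36 (var 18) (var 22)) ;;
  .ite (.natEq (var 38) (.const 0)) (.writeNat 36 (var 17) (var 18))
    (.writeNat 36 (var 17) (.read 36 (var 18)))

/-- Update the flags and the heights at the positions `var 17`, `var 18`, `var 19`. -/
def reflag : Program :=
  .ite (.natEq (var 38) (.const 0)) (.writeNat 37 (var 19) (.read 37 (var 17)))
    (.writeNat 37 (var 19) (.sub (.const 1) (.read 37 (var 17)))) ;;
  .writeNat 37 (var 18) (.sub (.const 1) (.read 37 (var 17))) ;;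
  .writeReal 10 (var 17) (height (var 20)) ;;
  .writeReal 10 (var 18) (height (var 20)) ;;
  .writeReal 10 (var 19) (height (var 20))

/-- The links are written from right to left, because the new link of each position may be a copy of
the new link of the next one. -/
theorem halts_relink (s : Store) {p a b : ℕ} (hp : s.nat 17 0 = p) (ha : s.nat 18 0 = a)
    (hb : s.nat 19 0 = b) (hpa : p < a) (hab : a < b) : Halts relink s relink.bound fun s' =>
      s'.nat 36 b = s.nat 36 (if s.nat 39 0 ≠ 0 then b else if s.nat 38 0 ≠ 0 then a else p) ∧
      s'.nat 36 a = (if s.nat 39 0 ≠ 0 then s'.nat 36 b else b) ∧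
      s'.nat 36 p = (if s.nat 38 0 ≠ 0 then s'.nat 36 a else a) ∧
      ∀ l, l ≠ p → l ≠ a → l ≠ b → s'.nat 36 l = s.nat 36 l := by
  refine Halts.of_wp _ _ _ ?_
  have hpb := hpa.trans hab
  have key : ∀ s₁ : Store, ∀ q, s₁.nat 22 0 = q → s₁.nat 17 0 = p → s₁.nat 18 0 = a →
      s₁.nat 19 0 = b → s₁.nat 38 0 = s.nat 38 0 → s₁.nat 39 0 = s.nat 39 0 →
      s₁.nat 36 = s.nat 36 →
      q = s.nat 36 (if s.nat 39 0 ≠ 0 then b else if s.nat 38 0 ≠ 0 then a else p) →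
      Program.wp (.writeNat 36 (var 19) (var 22) ;;
        .ite (.natEq (var 39) (.const 0)) (.writeNat 36 (var 18) (var 19))
          (.writeNat 36 (var 18) (var 22)) ;;
        .ite (.natEq (var 38) (.const 0)) (.writeNat 36 (var 17) (var 18))
          (.writeNat 36 (var 17) (.read 36 (var 18)))) (fun s' =>
      s'.nat 36 b = s.nat 36 (if s.nat 39 0 ≠ 0 then b else if s.nat 38 0 ≠ 0 then a else p) ∧
      s'.nat 36 a = (if s.nat 39 0 ≠ 0 then s'.nat 36 b else b) ∧
      s'.nat 36 p = (if s.nat 38 0 ≠ 0 then s'.nat 36 a else a) ∧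
      ∀ l, l ≠ p → l ≠ a → l ≠ b → s'.nat 36 l = s.nat 36 l) s₁ := by
    intro s₁ q h22 h17 h18 h19 h38 h39 h36 hq
    rw [← hq]
    intro s₂ e₂
    constructor <;> intro b39 s₃ e₃ <;> constructor <;> intro b38 s₄ e₄ <;>
      simp only [Test.Holds, NatExpr.eval, e₂, e₃, Store.setNat_nat, h38, h39] at b38 b39 <;>
      simp only [Nat.reduceEqDiff, false_and, if_false] at b38 b39 <;>
      simp [e₂, e₃, e₄, NatExpr.eval, b38, b39, h22, h17, h18, h19, h36, hpa.ne, hpa.ne', hab.ne,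
        hab.ne', hpb.ne, hpb.ne'] <;>
      intro l h1 h2 h3 <;> simp [h1, h2, h3]
  constructor
  · intro b39
    simp only [Test.Holds, NatExpr.eval] at b39
    constructor
    · intro b38 s₁ e₁
      simp only [Test.Holds, NatExpr.eval] at b38
      refine key s₁ _ rfl ?_ ?_ ?_ ?_ ?_ (funext fun j => ?_) ?_ <;>
        simp [e₁, NatExpr.eval, hp, ha, hb, b38, b39]
    · intro b38 s₁ e₁
      simp only [Test.Holds, NatExpr.eval] at b38
      refine key s₁ _ rfl ?_ ?_ ?_ ?_ ?_ (funext fun j => ?_) ?_ <;>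
        simp [e₁, NatExpr.eval, hp, ha, hb, b38, b39]
  · intro b39 s₁ e₁
    simp only [Test.Holds, NatExpr.eval] at b39
    refine key s₁ _ rfl ?_ ?_ ?_ ?_ ?_ (funext fun j => ?_) ?_ <;>
      simp [e₁, NatExpr.eval, hp, ha, hb, b39]

theorem halts_reflag (s : Store) {p a b : ℕ} {y : ℝ} (hp : s.nat 17 0 = p) (ha : s.nat 18 0 = a)
    (hb : s.nat 19 0 = b) (hy : (height (var 20)).eval s = y) (hpa : p < a) (hab : a < b) :
    Halts reflag s reflag.bound fun s' =>
      s'.nat 37 a = 1 - s.nat 37 p ∧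
      s'.nat 37 b = (if s.nat 38 0 ≠ 0 then 1 - s.nat 37 p else s.nat 37 p) ∧
      (∀ l, l ≠ a → l ≠ b → s'.nat 37 l = s.nat 37 l) ∧
      (∀ l, l = p ∨ l = a ∨ l = b → s'.real 10 l = y) ∧
      ∀ l, l ≠ p → l ≠ a → l ≠ b → s'.real 10 l = s.real 10 l := by
  refine Halts.of_wp _ _ _ ?_
  have hpb := hpa.trans hab
  simp only [height, RealExpr.eval, NatExpr.eval] at hy
  constructor <;> intro b38 s₁ e₁ s₂ e₂ s₃ e₃ s₄ e₄ s₅ e₅ <;>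
    simp only [Test.Holds, NatExpr.eval] at b38 <;>
    refine ⟨?_, ?_, fun l h1 h2 => ?_, fun l hl => ?_, fun l h1 h2 h3 => ?_⟩
  any_goals
    simp [e₁, e₂, e₃, e₄, e₅, NatExpr.eval, b38, hp, ha, hb, hpa.ne, hab.ne, hab.ne', hpb.ne]
    try simp [*]
  all_goals
    rcases hl with rfl | rfl | rfl <;>
    simp [e₁, e₂, e₃, e₄, e₅, NatExpr.eval, RealExpr.eval, b38, hp, ha, hb, hpa.ne, hab.ne, hpb.ne,
      height, hy]

/-- Toggle the leaf `var a` of the tree of maxima; `var c` tells whether it is present. -/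
def toggle (a c : ℕ) : Program :=
  (assign 40 (var a) ;; .ite (.natEq (var c) (.const 0)) (assign 41 (var a))
    (assign 41 (.const 0))) ;; updateLeaf 32 larger

/-- The time for `toggle` in a tree of depth `D`. -/
def toggleTime (D : ℕ) : ℕ := 40 + updateTime 32 larger D

theorem larger_holds (s : Store) : larger.Holds s ↔ s.nat 15 0 < s.nat 14 0 := by
  simp [larger, Test.Holds, NatExpr.eval]

theorem halts_toggle (s : Store) {a c x D : ℕ} {A A' : ℕ → Prop} (hax : s.nat a 0 = x)
    (ha : a ≠ 40 ∧ a ≠ 41) (hc : c ≠ 40) (hcA : s.nat c 0 ≠ 0 ↔ A x)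
    (hN : s.nat 11 0 = 2 ^ D) (hxD : x < 2 ^ D) (ht : IsMaxTree D A (s.nat 32))
    (hA' : A' x ↔ ¬ A x) (hsame : ∀ q, q ≠ x → (A' q ↔ A q)) :
    Halts (toggle a c) s (toggleTime D) fun s' => IsMaxTree D A' (s'.nat 32) ∧
      (∀ b, b ≠ 32 → b ≠ 13 → b ≠ 14 → b ≠ 15 → b ≠ 40 → b ≠ 41 → s'.nat b = s.nat b) ∧
      s'.real = s.real := by
  classical
  refine Halts.seq (T := 40) (R := fun s' => s'.nat 40 0 = x ∧
    s'.nat 41 0 = (if A x then 0 else x) ∧ (∀ b, b ≠ 40 → b ≠ 41 → s'.nat b = s.nat b) ∧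
    s'.real = s.real)
    ((Halts.of_wp _ _ _ ?_).mono (by simp [bound, NatExpr.cost, Test.cost]) fun _ h => h) ?_
  · rintro s₁ e₁
    constructor <;> intro b s₂ e₂ <;>
      simp [Test.Holds, NatExpr.eval, e₁, hc] at b
    · have : ¬ A x := fun h => hcA.2 h b
      rw [if_neg this]
      refine ⟨by simp [e₁, e₂, NatExpr.eval, hax], by simp [e₁, e₂, NatExpr.eval, hax, ha.1],
        fun i h1 h2 => funext fun j => by simp [e₁, e₂, h1, h2], by simp [e₁, e₂]⟩
    · rw [if_pos (hcA.1 b)]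
      refine ⟨by simp [e₁, e₂, NatExpr.eval, hax], by simp [e₂, NatExpr.eval],
        fun i h1 h2 => funext fun j => by simp [e₁, e₂, h1, h2], by simp [e₁, e₂]⟩
  · rintro s₁ ⟨h40, h41, hf, hr⟩
    refine (halts_updateLeaf (win := fun a b => b < a) (fun s' _ => larger_holds s') (by norm_num)
      (by rw [hf 11 (by norm_num) (by norm_num), hN]) h40 h41 hxD
      (by rw [hf 32 (by norm_num) (by norm_num)]; exact ht.valid)).mono le_rfl ?_
    rintro s₂ ⟨⟨g1, g2⟩, g3, g4⟩
    rw [hf 32 (by norm_num) (by norm_num)] at g2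
    refine ⟨⟨g1, fun b hb hA => ?_, fun b hb hA => ?_⟩, fun b h1 h2 h3 h4 h5 h6 =>
      (g3 b h1 h2 h3 h4).trans (hf b h5 h6), g4.trans hr⟩
    · rw [g2]
      split_ifs with h h'
      · subst h; exact absurd h' (hA'.1 hA)
      · exact h.symm
      · exact ht.leaf b hb ((hsame b h).1 hA)
    · rw [g2]
      split_ifs with h h'
      · rfl
      · subst h; exact absurd (hA'.2 h') hA
      · exact ht.leaf' b hb fun h' => hA ((hsame b h).2 h')

end RealRAM

/-! ## The sweep as a program -/

namespace RealRAM

open Program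

/-- The order of the sweep is given by the lists `H` and `V` of edges; the trees have depth `D`. -/
structure Setting {m : ℕ} (X Y : ZMod m → ℝ) (P : Set Plane) (e : ℕ → ZMod m) (ρ : ZMod m → ℕ)
    (vp : ℕ → ZMod m) (pos : ZMod m → ℕ) (H V : ℕ → ℕ) (D : ℕ) : Prop where
  poly : IsCyclicPolygon X Y P
  sweep : IsSweep X Y e ρ vp pos
  e_eq : ∀ k, e k = (H k : ZMod m)
  H_lt : ∀ k < m, H k < m
  vp_eq : ∀ p, vp p = (V (p - 1) : ZMod m)
  V_lt : ∀ j, V j < m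
  lt_D : m < 2 ^ D

/-- The memory contains the input of the sweep. -/
structure Ready {m : ℕ} (X Y : ZMod m → ℝ) (pos : ZMod m → ℕ) (H V : ℕ → ℕ) (D : ℕ)
    (s : Store) : Prop where
  size : s.nat 10 0 = m
  leaves : s.nat 11 0 = 2 ^ D
  hor : s.nat 33 = H
  ver : s.nat 34 = V
  pos_eq : ∀ a < m, s.nat 35 a = pos a
  X_eq : ∀ a < m, s.real 0 (a + a + 1) = X a
  Y_eq : ∀ a < m, s.real 1 (a + a) = Y a

/-- The memory contains the data of event `k`. -/
structure Loaded {m : ℕ} (e : ℕ → ZMod m) (ρ : ZMod m → ℕ) (vp : ℕ → ZMod m) (pos : ZMod m → ℕ)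
    (k : ℕ) (s : Store) : Prop where
  event : IsEvent e ρ vp pos k (s.nat 17 0) (s.nat 18 0) (s.nat 19 0)
  lt : s.nat 20 0 < m
  pred_lt : s.nat 21 0 < m
  edge : e k = (s.nat 20 0 : ZMod m)
  pred : e k - 1 = (s.nat 21 0 : ZMod m)
  left : s.nat 38 0 ≠ 0 ↔ ActAt ρ vp k (s.nat 18 0)
  right : s.nat 39 0 ≠ 0 ↔ ActAt ρ vp k (s.nat 19 0)

variable {m : ℕ} [NeZero m] {X Y : ZMod m → ℝ} {P : Set Plane} {e : ℕ → ZMod m} {ρ : ZMod m → ℕ}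
  {vp : ℕ → ZMod m} {pos : ZMod m → ℕ} {H V : ℕ → ℕ} {D k : ℕ} {s s' : Store}

theorem Ready.congr (h : Ready X Y pos H V D s)
    (hn : ∀ a ∈ [10, 11, 33, 34, 35], s'.nat a = s.nat a)
    (hr : ∀ a ∈ [0, 1], s'.real a = s.real a) : Ready X Y pos H V D s' := by
  simp only [List.forall_mem_cons] at hn hr
  obtain ⟨h10, h11, h33, h34, h35, -⟩ := hn
  obtain ⟨h0, h1, -⟩ := hr
  refine ⟨?_, ?_, ?_, ?_, ?_, ?_, ?_⟩
  · rw [h10]; exact h.size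
  · rw [h11]; exact h.leaves
  · rw [h33]; exact h.hor
  · rw [h34]; exact h.ver
  · rw [h35]; exact h.pos_eq
  · rw [h0]; exact h.X_eq
  · rw [h1]; exact h.Y_eq

theorem Loaded.congr (h : Loaded e ρ vp pos k s)
    (hn : ∀ a ∈ [17, 18, 19, 20, 21, 38, 39], s'.nat a = s.nat a) : Loaded e ρ vp pos k s' := by
  simp only [List.forall_mem_cons] at hn
  obtain ⟨h17, h18, h19, h20, h21, h38, h39, -⟩ := hn
  constructor <;> simp only [h17, h18, h19, h20, h21, h38, h39]
  exacts [h.event, h.lt, h.pred_lt, h.edge, h.pred, h.left, h.right]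

theorem Loaded.eval_height (h : Loaded e ρ vp pos k s) (hr : Ready X Y pos H V D s) :
    (height (var 20)).eval s = Y (e k) := by
  simp only [height, RealExpr.eval, NatExpr.eval]
  rw [hr.Y_eq _ h.lt, h.edge]

theorem Loaded.eval_mid (h : Loaded e ρ vp pos k s) (hr : Ready X Y pos H V D s) :
    (((absc (var 21)).eval s + (absc (var 20)).eval s) / 2, (height (var 20)).eval s) =
      hMid X Y (e k) := by
  rw [h.eval_height hr, hMid, h.pred, h.edge]
  simp only [absc, RealExpr.eval, NatExpr.eval]
  rw [hr.X_eq _ h.lt, hr.X_eq _ h.pred_lt]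

/-- The tree of maxima holds the active positions. -/
def TreeMem (ρ : ZMod m → ℕ) (vp : ℕ → ZMod m) (D k : ℕ) (s : Store) : Prop :=
  IsMaxTree D (ActAt ρ vp k) (s.nat 32)

/-- The memory satisfies the invariant of the sweep. -/
def SweepMem (X Y : ZMod m → ℝ) (ρ : ZMod m → ℕ) (vp : ℕ → ZMod m) (pos : ZMod m → ℕ) (k : ℕ)
    (s : Store) : Prop :=
  SweepInv X Y ρ vp pos k (s.nat 36) (s.nat 37) (s.real 10)

/-- The memory contains the lists of midpoints of top edges and of bottom edges. -/
def PointMem (X Y : ZMod m → ℝ) (P : Set Plane) (e : ℕ → ZMod m) (ρ : ZMod m → ℕ) (k : ℕ)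
    (s : Store) : Prop :=
  PointInv X Y P e ρ (IsTopH X Y P) k (s.nat 24 0) (s.nat 26 0)
    (listed (s.real 6) (s.real 7) (s.nat 26 0)) ∧
  PointInv X Y P e ρ (IsBottomH X Y P) k (s.nat 25 0) (s.nat 27 0)
    (listed (s.real 12) (s.real 13) (s.nat 27 0))

theorem PointMem.congr (h : PointMem X Y P e ρ k s)
    (hn : ∀ a ∈ [24, 25, 26, 27], s'.nat a = s.nat a)
    (hr : ∀ a ∈ [6, 7, 12, 13], s'.real a = s.real a) : PointMem X Y P e ρ k s' := by
  simp only [List.forall_mem_cons] at hn hr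
  obtain ⟨h24, h25, h26, h27, -⟩ := hn
  obtain ⟨h6, h7, h12, h13, -⟩ := hr
  rw [PointMem, h24, h25, h26, h27, h6, h7, h12, h13]
  exact h

/-- Load the data of event `var 12`. -/
def load : Program := loadEvent ;; predecessor ;; loadActive

/-- The time for loading the data of an event. -/
def loadTime (D : ℕ) : ℕ := loadEvent.bound + (predecessorTime D + loadActive.bound)

theorem halts_load (hS : Setting X Y P e ρ vp pos H V D) (hr : Ready X Y pos H V D s)
    (hk : k < m) (h12 : s.nat 12 0 = k) (ht : TreeMem ρ vp D k s) :
    Halts load s (loadTime D) fun s' => Loaded e ρ vp pos k s' := by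
  have hHk := hS.H_lt k hk
  -- The representative below `m` of the cyclic predecessor.
  set b := if H k = 0 then m - 1 else H k - 1 with hb
  have hbm : b < m := by rw [hb]; split_ifs <;> omega
  have hpred : e k - 1 = (b : ZMod m) := by
    rw [hS.e_eq, hb]
    split_ifs with h
    · rw [h, Nat.cast_sub (by omega)]; simp
    · rw [Nat.cast_sub (by omega)]; simp
  have pos_b : s.nat 35 b = pos (e k - 1) := by rw [hr.pos_eq b hbm, hpred]
  have pos_a : s.nat 35 (H k) = pos (e k) := by rw [hr.pos_eq _ hHk, hS.e_eq]
  have one := hS.sweep.one_le_pos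
  have lem := hS.sweep.pos_le
  refine Halts.seq (halts_loadEvent s (a := H k) (b := b) (by rw [h12, hr.hor])
    (by rw [hr.size])).frame ?_
  rintro s₁ ⟨⟨h20, h21, h18, h19⟩, f, -⟩
  have f' : ∀ a ∈ [11, 32], s₁.nat a = s.nat a := fun a ha => f a (by
    revert a; simp [loadEvent, WritesNat])
  have t₁ : IsMaxTree D (ActAt ρ vp k) (s₁.nat 32) := by
    rw [f' 32 (by simp)]; exact ht
  rw [pos_b, pos_a] at h18 h19
  have l18 : 1 ≤ s₁.nat 18 0 ∧ s₁.nat 18 0 ≤ m := by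
    rw [h18]; exact ⟨le_min (one _) (one _), (min_le_left _ _).trans (lem _)⟩
  have l19 : s₁.nat 19 0 ≤ m := by rw [h19]; exact max_le (lem _) (lem _)
  have hlt := hS.lt_D
  refine Halts.seq (halts_predecessor t₁ ((congrFun (f' 11 (by simp)) 0).trans hr.leaves) rfl
    (by omega) (by omega)).frame ?_
  rintro s₂ ⟨⟨p1, p2, p3⟩, g, -⟩
  have g' : ∀ a ∈ [11, 18, 19, 20, 21, 32], s₂.nat a = s₁.nat a := fun a ha => g a (by
    revert a; simp [predecessor, predecessorBody, WritesNat])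
  refine (halts_loadActive s₂).frame.mono le_rfl ?_
  rintro s₃ ⟨⟨q1, q2⟩, k1, -⟩
  have k' : ∀ a ∈ [17, 18, 19, 20, 21], s₃.nat a = s₂.nat a := fun a ha => k1 a (by
    revert a; simp [loadActive, WritesNat])
  simp only [List.forall_mem_cons] at g' k' f'
  obtain ⟨g11, g18, g19, g20, g21, g32, -⟩ := g'
  obtain ⟨k17, k18, k19, k20, k21, -⟩ := k'
  rw [g11, g32, f'.1, hr.leaves] at q1 q2
  rw [g18] at q1
  rw [g19] at q2
  -- A present leaf holds its own index. Positions start at `1`, so a nonzero leaf means an active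
  -- position.
  have act : ∀ q, 1 ≤ q → q ≤ m → (s₁.nat 32 (2 ^ D + q) ≠ 0 ↔ ActAt ρ vp k q) := by
    intro q h1 h2
    by_cases hq : ActAt ρ vp k q
    · rw [t₁.leaf q (by omega) hq]
      exact iff_of_true (by omega) hq
    · rw [t₁.leaf' q (by omega) hq]
      exact iff_of_false (by simp) hq
  have l19' : 1 ≤ s₁.nat 19 0 := by rw [h19]; exact (one _).trans (le_max_left _ _)
  constructor <;> simp only [k17, k18, k19, k20, k21, g18, g19, g20, g21, q1, q2]
  · exact ⟨hk, h18, h19, p1, p2, p3⟩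
  · rwa [h20]
  · rwa [h21]
  · rw [h20, hS.e_eq]
  · rw [h21, hpred]
  · exact act _ l18.1 l18.2
  · exact act _ l19' l19

/-- Extend the lists of midpoints. -/
def collect : Program := resetTags ;; addPoints

/-- Both tests, for a shared extension and for a top edge, refer to the flags and heights before the
event. -/
theorem halts_collect (hS : Setting X Y P e ρ vp pos H V D) (hr : Ready X Y pos H V D s)
    (hl : Loaded e ρ vp pos k s) (hw : SweepMem X Y ρ vp pos k s) (hp : PointMem X Y P e ρ k s) :
    Halts collect s collect.bound fun s' => PointMem X Y P e ρ (k + 1) s' := by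
  classical
  obtain ⟨ht, hb⟩ := hp
  have hlink := SweepInv.linked_iff hw hS.sweep hS.poly hl.event
  have htop := SweepInv.isTopH_iff hw hS.sweep hS.poly hl.event
  rw [← hl.eval_height hr] at hlink
  refine Halts.seq (halts_resetTags s).frame ?_
  rintro s₁ ⟨⟨r1, r2⟩, f, fr⟩
  rw [hlink] at r1 r2
  have f' : ∀ a, a ≠ 24 → a ≠ 25 → s₁.nat a = s.nat a := fun a h h' => f a (by
    simp [resetTags, WritesNat, h, h'])
  have fr' : s₁.real = s.real := funext fun a => fr a (by simp [resetTags, WritesReal])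
  have T := ht.step (tag₁ := s₁.nat 24 0) hS.sweep hS.poly hl.event.lt (fun h => by rw [r1 h])
    (fun h => (r2 h).1)
  have B := hb.step (tag₁ := s₁.nat 25 0) hS.sweep hS.poly hl.event.lt (fun h => by rw [r1 h])
    (fun h => (r2 h).2)
  have hr₁ : Ready X Y pos H V D s₁ := hr.congr (fun a ha => f' a (by revert a; simp)
    (by revert a; simp)) fun a _ => by rw [fr']
  have hl₁ : Loaded e ρ vp pos k s₁ := hl.congr (fun a ha => f' a (by revert a; simp)
    (by revert a; simp))
  have hmid := hl₁.eval_mid hr₁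
  refine Halts.seq (R := fun s' => s'.nat 22 0 = (if ActAt ρ vp k (s.nat 18 0) then s.nat 18 0
    else s.nat 17 0) ∧ (∀ a, a ≠ 22 → s'.nat a = s₁.nat a) ∧ s'.real = s₁.real)
    (Halts.of_wp _ _ _ ?_) ?_
  · constructor <;> intro b38 s₂ e₂ <;>
      simp only [Test.Holds, NatExpr.eval, f' 38 (by norm_num) (by norm_num)] at b38
    · rw [if_neg (hl.left.not.1 (not_not.2 b38))]
      refine ⟨by simp [e₂, NatExpr.eval, f'], fun a ha => funext fun j => by simp [e₂, ha],
        by simp [e₂]⟩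
    · rw [if_pos (hl.left.1 b38)]
      refine ⟨by simp [e₂, NatExpr.eval, f'], fun a ha => funext fun j => by simp [e₂, ha],
        by simp [e₂]⟩
  rintro s₂ ⟨h22, g, gr⟩
  have hr₂ : Ready X Y pos H V D s₂ := hr₁.congr (fun a ha => g a (by revert a; simp))
    fun a _ => by rw [gr]
  have hl₂ : Loaded e ρ vp pos k s₂ := hl₁.congr (fun a ha => g a (by revert a; simp))
  have hmid := hl₂.eval_mid hr₂
  have hflag : s₂.nat 37 (s₂.nat 22 0) = 1 ↔ IsTopH X Y P (e k) := by
    rw [htop, h22, g 37 (by norm_num), f' 37 (by norm_num) (by norm_num)]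
  have hnot := hS.poly.isTop_iff_not_isBottom (e k)
  have n24 : s₂.nat 24 0 = s₁.nat 24 0 := by rw [g 24 (by norm_num)]
  have n25 : s₂.nat 25 0 = s₁.nat 25 0 := by rw [g 25 (by norm_num)]
  have n26 : s₂.nat 26 0 = s.nat 26 0 := by
    rw [g 26 (by norm_num), f' 26 (by norm_num) (by norm_num)]
  have n27 : s₂.nat 27 0 = s.nat 27 0 := by
    rw [g 27 (by norm_num), f' 27 (by norm_num) (by norm_num)]
  have hreal : s₂.real = s.real := gr.trans fr'
  refine (Halts.ite (T := (addPoint 24 26 6 7).bound) (fun hb => ?_) fun hb => ?_).mono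
    (by simp [bound, addPoint]) fun _ h => h
  · simp only [Test.Holds, NatExpr.eval] at hb
    have hgood := hflag.1 hb
    refine (halts_addPoint s₂ (by norm_num) (by norm_num) (by norm_num)).frame.mono le_rfl ?_
    rintro s₃ ⟨⟨a1, a2⟩, k1, k2⟩
    have k1' : ∀ a ∈ [25, 27], s₃.nat a = s₂.nat a := fun a ha => k1 a (by
      revert a; simp [addPoint, WritesNat])
    have k2' : ∀ a ∈ [12, 13], s₃.real a = s₂.real a := fun a ha => k2 a (by
      revert a; simp [addPoint, WritesReal])
    simp only [List.forall_mem_cons] at k1' k2'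
    refine ⟨?_, ?_⟩
    · by_cases h24 : s₂.nat 24 0 = 0
      · obtain ⟨c1, c2, c3⟩ := a2 h24
        rw [hmid] at c3
        rw [c3, c1, c2, n26, hreal]
        exact T.1 hgood (n24 ▸ h24)
      · rw [a1 h24, n24, n26, hreal]
        exact T.2.1 hgood (n24 ▸ h24)
    · rw [k1'.1, k1'.2.1, k2'.1, k2'.2.1, n25, n27, hreal]
      exact B.2.2 (hnot.1 hgood)
  · simp only [Test.Holds, NatExpr.eval] at hb
    have hgood : IsBottomH X Y P (e k) := by
      by_contra h
      exact hb (hflag.2 (hnot.2 h))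
    refine (halts_addPoint s₂ (by norm_num) (by norm_num) (by norm_num)).frame.mono le_rfl ?_
    rintro s₃ ⟨⟨a1, a2⟩, k1, k2⟩
    have k1' : ∀ a ∈ [24, 26], s₃.nat a = s₂.nat a := fun a ha => k1 a (by
      revert a; simp [addPoint, WritesNat])
    have k2' : ∀ a ∈ [6, 7], s₃.real a = s₂.real a := fun a ha => k2 a (by
      revert a; simp [addPoint, WritesReal])
    simp only [List.forall_mem_cons] at k1' k2'
    refine ⟨?_, ?_⟩
    · rw [k1'.1, k1'.2.1, k2'.1, k2'.2.1, n24, n26, hreal]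
      exact T.2.2 fun h => hnot.1 h hgood
    · by_cases h25 : s₂.nat 25 0 = 0
      · obtain ⟨c1, c2, c3⟩ := a2 h25
        rw [hmid] at c3
        rw [c3, c1, c2, n27, hreal]
        exact B.1 hgood (n25 ▸ h25)
      · rw [a1 h25, n25, n27, hreal]
        exact B.2.1 hgood (n25 ▸ h25)

theorem halts_reports_rectInv (hS : Setting X Y P e ρ vp pos H V D) (hr : Ready X Y pos H V D s)
    (hl : Loaded e ρ vp pos k s) (hw : SweepMem X Y ρ vp pos k s)
    (hR : RectInv X Y P ρ k (reported s)) :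
    Halts reports s reports.bound fun s' => RectInv X Y P ρ (k + 1) (reported s') := by
  refine (halts_reports s).mono le_rfl fun s' h => ?_
  refine hR.step hw hS.sweep hS.poly hl.event fun q => ?_
  rw [h]
  refine or_congr_right (exists_congr fun c => and_congr ?_ ?_)
  · rw [hl.left, hl.right]
  · rw [IsReport, hl.eval_height hr, hr.ver, hr.X_eq _ (hS.V_lt _), hr.X_eq _ (hS.V_lt _),
      ← hS.vp_eq, ← hS.vp_eq]

/-- Update the arrays of the sweep. -/
def advance : Program := relink ;; reflag

theorem halts_advance (hS : Setting X Y P e ρ vp pos H V D) (hr : Ready X Y pos H V D s)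
    (hl : Loaded e ρ vp pos k s) (hw : SweepMem X Y ρ vp pos k s) :
    Halts advance s advance.bound fun s' => SweepMem X Y ρ vp pos (k + 1) s' := by
  classical
  obtain ⟨-, -, -, -, -, hlt, -⟩ := hl.event.cases hS.sweep hS.poly
  have hpa := hl.event.p_lt
  have hab : s.nat 18 0 < s.nat 19 0 := by
    rw [hl.event.pa_eq, hl.event.pb_eq]
    rw [min_lt_max]
    exact fun h => hS.poly.sub_one_ne _ (hS.sweep.pos_injective h)
  refine Halts.seq (halts_relink s rfl rfl rfl hpa hab).frame ?_
  rintro s₁ ⟨⟨n1, n2, n3, n4⟩, f, fr⟩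
  have f' : ∀ a ∈ [10, 11, 33, 34, 35, 17, 18, 19, 20, 21, 38, 39, 37], s₁.nat a = s.nat a :=
    fun a ha => f a (by revert a; simp [relink, WritesNat])
  have fr' : s₁.real = s.real := funext fun a => fr a (by simp [relink, WritesReal])
  have hr₁ : Ready X Y pos H V D s₁ := hr.congr (fun a ha => f' a (by revert a; simp))
    fun a _ => by rw [fr']
  have hl₁ : Loaded e ρ vp pos k s₁ := hl.congr (fun a ha => f' a (by revert a; simp))
  simp only [List.forall_mem_cons] at f'
  obtain ⟨-, -, -, -, -, f17, f18, f19, -, -, f38, -, f37, -⟩ := f'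
  refine (halts_reflag s₁ (by rw [f17]) (by rw [f18]) (by rw [f19]) (hl₁.eval_height hr₁) hpa
    hab).frame.mono le_rfl ?_
  rintro s₂ ⟨⟨c1, c2, c3, c4, c5⟩, g, -⟩
  have h36 : s₂.nat 36 = s₁.nat 36 := g 36 (by simp [reflag, WritesNat])
  rw [f37] at c1 c2 c3
  rw [f38] at c2
  rw [fr'] at c5
  simp only [hl.left, hl.right] at n1 n2 n3 c2
  rw [SweepMem, h36]
  exact SweepInv.step hw hS.sweep hS.poly hl.event n1 n2 n3 n4 c1 c2 c3 c4 c5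

/-- Update the tree of maxima. -/
def toggleBoth : Program := toggle 18 38 ;; toggle 19 39

theorem halts_toggleBoth (hS : Setting X Y P e ρ vp pos H V D) (hr : Ready X Y pos H V D s)
    (hl : Loaded e ρ vp pos k s) (ht : TreeMem ρ vp D k s) :
    Halts toggleBoth s (toggleTime D + toggleTime D) fun s' => TreeMem ρ vp D (k + 1) s' := by
  have hD := hS.lt_D
  have hab : s.nat 18 0 < s.nat 19 0 := by
    rw [hl.event.pa_eq, hl.event.pb_eq]
    rw [min_lt_max]
    exact fun h => hS.poly.sub_one_ne _ (hS.sweep.pos_injective h)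
  have l19 : s.nat 19 0 ≤ m := by
    rw [hl.event.pb_eq]; exact max_le (hS.sweep.pos_le _) (hS.sweep.pos_le _)
  -- The intermediate set, in which only the left neighbour has been toggled.
  obtain ⟨A', A1, A2⟩ : ∃ A' : ℕ → Prop, (A' (s.nat 18 0) ↔ ¬ ActAt ρ vp k (s.nat 18 0)) ∧
      ∀ q, q ≠ s.nat 18 0 → (A' q ↔ ActAt ρ vp k q) :=
    ⟨fun q => if q = s.nat 18 0 then ¬ ActAt ρ vp k q else ActAt ρ vp k q, by simp,
      fun q hq => by simp [hq]⟩
  refine Halts.seq (halts_toggle s rfl (by norm_num) (by norm_num) hl.left hr.leaves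
    (by omega) ht A1 A2) ?_
  rintro s₁ ⟨g1, g2, g3⟩
  have e19 : s₁.nat 19 0 = s.nat 19 0 := by rw [g2 19] <;> norm_num
  have e39 : s₁.nat 39 0 = s.nat 39 0 := by rw [g2 39] <;> norm_num
  have e11 : s₁.nat 11 0 = 2 ^ D := by rw [g2 11, hr.leaves] <;> norm_num
  refine (halts_toggle s₁ (A' := ActAt ρ vp (k + 1)) e19 (by norm_num) (by norm_num)
    ?_ e11 (by omega) g1 ?_ fun q hq => ?_).mono le_rfl fun s' h => h.1
  · rw [e39, hl.right, A2 _ hab.ne']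
  · rw [A2 _ hab.ne']
    exact hl.event.actAt_toggle hS.sweep hS.poly (Or.inr rfl)
  · by_cases h : q = s.nat 18 0
    · rw [h, A1]
      exact hl.event.actAt_toggle hS.sweep hS.poly (Or.inl rfl)
    · rw [A2 q h]
      exact hl.event.actAt_succ hS.sweep hS.poly h hq

/-- Process event `var 12`. -/
def event : Program := load ;; collect ;; reports ;; advance ;; toggleBoth

/-- The time for an event. -/
def eventTime (D : ℕ) : ℕ :=
  loadTime D + (collect.bound + (reports.bound + (advance.bound + (toggleTime D + toggleTime D))))

/-- The memory before event `k`. -/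
structure EventInv (X Y : ZMod m → ℝ) (P : Set Plane) (e : ℕ → ZMod m) (ρ : ZMod m → ℕ)
    (vp : ℕ → ZMod m) (pos : ZMod m → ℕ) (H V : ℕ → ℕ) (D k : ℕ) (s : Store) : Prop where
  ready : Ready X Y pos H V D s
  sweep : SweepMem X Y ρ vp pos k s
  tree : TreeMem ρ vp D k s
  points : PointMem X Y P e ρ k s
  rect : RectInv X Y P ρ k (reported s)

theorem reported_congr (h1 : s'.nat 1 = s.nat 1) (hr : ∀ a ∈ [2, 3, 4, 5], s'.real a = s.real a) :
    reported s' = reported s := by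
  simp only [List.forall_mem_cons] at hr
  obtain ⟨h2, h3, h4, h5, -⟩ := hr
  rw [reported, reported, h1, h2, h3, h4, h5]

theorem EventInv.congr (h : EventInv X Y P e ρ vp pos H V D k s)
    (hn : ∀ a ∈ [10, 11, 33, 34, 35, 1, 24, 25, 26, 27, 32, 36, 37], s'.nat a = s.nat a)
    (hr : s'.real = s.real) : EventInv X Y P e ρ vp pos H V D k s' := by
  refine ⟨h.ready.congr (fun a ha => hn a (by revert a; simp)) fun a _ => by rw [hr], ?_, ?_,
    h.points.congr (fun a ha => hn a (by revert a; simp)) fun a _ => by rw [hr], ?_⟩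
  · rw [SweepMem, hn 36 (by simp), hn 37 (by simp), hr]; exact h.sweep
  · rw [TreeMem, hn 32 (by simp)]; exact h.tree
  · rw [reported_congr (hn 1 (by simp)) fun a _ => by rw [hr]]; exact h.rect

/-- Points and rectangles are determined from the old links, flags and heights, so those are updated
only afterwards. The old activity of the two neighbours was copied to variables at loading, and it
governs the relinking and the toggling of the tree. -/
theorem halts_event (hS : Setting X Y P e ρ vp pos H V D) (hk : k < m) (h12 : s.nat 12 0 = k)
    (h : EventInv X Y P e ρ vp pos H V D k s) :
    Halts event s (eventTime D) (EventInv X Y P e ρ vp pos H V D (k + 1)) := by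
  refine Halts.seq (halts_load hS h.ready hk h12 h.tree).frame ?_
  rintro s₁ ⟨l₁, f₁, g₁⟩
  have i₁ : EventInv X Y P e ρ vp pos H V D k s₁ := h.congr (fun a ha => f₁ a (by
    revert a; simp [load, loadEvent, predecessor, predecessorBody, loadActive, WritesNat]))
    (funext fun a => g₁ a (by
      simp [load, loadEvent, predecessor, predecessorBody, loadActive, WritesReal]))
  refine Halts.seq (halts_collect hS i₁.ready l₁ i₁.sweep i₁.points).frame ?_
  rintro s₂ ⟨p₂, f₂, g₂⟩
  have f₂' : ∀ a ∈ [10, 11, 33, 34, 35, 17, 18, 19, 20, 21, 38, 39, 36, 37, 32, 1],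
    s₂.nat a = s₁.nat a := fun a ha => f₂ a (by
      revert a; simp [collect, resetTags, addPoints, addPoint, WritesNat])
  have g₂' : ∀ a ∈ [0, 1, 2, 3, 4, 5, 10], s₂.real a = s₁.real a := fun a ha => g₂ a (by
      revert a; simp [collect, resetTags, addPoints, addPoint, WritesReal])
  have r₂ := i₁.ready.congr (fun a ha => f₂' a (by revert a; simp))
    (fun a ha => g₂' a (by revert a; simp))
  have l₂ := l₁.congr (fun a ha => f₂' a (by revert a; simp))
  have w₂ : SweepMem X Y ρ vp pos k s₂ := by
    rw [SweepMem, f₂' 36 (by simp), f₂' 37 (by simp), g₂' 10 (by simp)]; exact i₁.sweep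
  have t₂ : TreeMem ρ vp D k s₂ := by rw [TreeMem, f₂' 32 (by simp)]; exact i₁.tree
  have R₂ : RectInv X Y P ρ k (reported s₂) := by
    rw [reported_congr (f₂' 1 (by simp)) fun a ha => g₂' a (by revert a; simp)]; exact i₁.rect
  refine Halts.seq (halts_reports_rectInv hS r₂ l₂ w₂ R₂).frame ?_
  rintro s₃ ⟨R₃, f₃, g₃⟩
  have f₃' : ∀ a, a ≠ 1 → s₃.nat a = s₂.nat a := fun a ha => f₃ a (by
      simp [reports, report, WritesNat, ha])
  have g₃' : ∀ a ∈ [0, 1, 6, 7, 10, 12, 13], s₃.real a = s₂.real a := fun a ha => g₃ a (by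
      revert a; simp [reports, report, WritesReal])
  have r₃ := r₂.congr (fun a ha => f₃' a (by revert a; simp))
    (fun a ha => g₃' a (by revert a; simp))
  have l₃ := l₂.congr (fun a ha => f₃' a (by revert a; simp))
  have p₃ := p₂.congr (fun a ha => f₃' a (by revert a; simp))
    (fun a ha => g₃' a (by revert a; simp))
  have w₃ : SweepMem X Y ρ vp pos k s₃ := by
    rw [SweepMem, f₃' 36 (by simp), f₃' 37 (by simp), g₃' 10 (by simp)]; exact w₂
  have t₃ : TreeMem ρ vp D k s₃ := by rw [TreeMem, f₃' 32 (by simp)]; exact t₂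
  refine Halts.seq (halts_advance hS r₃ l₃ w₃).frame ?_
  rintro s₄ ⟨w₄, f₄, g₄⟩
  have f₄' : ∀ a, a ≠ 22 → a ≠ 36 → a ≠ 37 → s₄.nat a = s₃.nat a := fun a h h' h'' => f₄ a (by
      simp [advance, relink, reflag, WritesNat, h, h', h''])
  have g₄' : ∀ a, a ≠ 10 → s₄.real a = s₃.real a := fun a ha => g₄ a (by
      simp [advance, relink, reflag, WritesReal, ha])
  have r₄ := r₃.congr (s' := s₄) (fun a ha => f₄' a (by revert a; simp) (by revert a; simp)
    (by revert a; simp)) (fun a ha => g₄' a (by revert a; simp))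
  have l₄ := l₃.congr (s' := s₄) (fun a ha => f₄' a (by revert a; simp) (by revert a; simp)
    (by revert a; simp))
  have p₄ := p₃.congr (s' := s₄) (fun a ha => f₄' a (by revert a; simp) (by revert a; simp)
    (by revert a; simp)) (fun a ha => g₄' a (by revert a; simp))
  have t₄ : TreeMem ρ vp D k s₄ := by
    rw [TreeMem, f₄' 32 (by simp) (by simp) (by simp)]; exact t₃
  have R₄ : RectInv X Y P ρ (k + 1) (reported s₄) := by
    rw [reported_congr (f₄' 1 (by simp) (by simp) (by simp)) fun a ha => g₄' a (by
      revert a; simp)]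
    exact R₃
  refine (halts_toggleBoth hS r₄ l₄ t₄).frame.mono le_rfl ?_
  rintro s₅ ⟨t₅, f₅, g₅⟩
  have f₅' : ∀ a ∈ [10, 11, 33, 34, 35, 1, 24, 25, 26, 27, 36, 37], s₅.nat a = s₄.nat a :=
    fun a ha => f₅ a (by
      revert a; simp [toggleBoth, toggle, updateLeaf, climb, climbBody, WritesNat])
  have g₅' : s₅.real = s₄.real := funext fun a => g₅ a (by
      simp [toggleBoth, toggle, updateLeaf, climb, climbBody, WritesReal])
  refine ⟨r₄.congr (fun a ha => f₅' a (by revert a; simp)) fun a _ => by rw [g₅'], ?_, t₅,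
    p₄.congr (fun a ha => f₅' a (by revert a; simp)) fun a _ => by rw [g₅'], ?_⟩
  · rw [SweepMem, f₅' 36 (by simp), f₅' 37 (by simp), g₅']; exact w₄
  · rw [reported_congr (f₅' 1 (by simp)) fun a _ => by rw [g₅']]; exact R₄

end RealRAM

/-! ## The program -/

namespace RealRAM

open Program

variable {m : ℕ} [NeZero m] {X Y : ZMod m → ℝ} {P : Set Plane} {e : ℕ → ZMod m} {ρ : ZMod m → ℕ}
  {vp : ℕ → ZMod m} {pos : ZMod m → ℕ} {H V : ℕ → ℕ} {D k : ℕ} {s s' : Store}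

/-- Compute the number `var 10` of horizontal edges and the number `var 11` of leaves. -/
def measure : Program :=
  (assign 10 (.half (.read 0 (.const 0))) ;; assign 11 (.const 1)) ;;
    .while (.natLt (var 11) (.add (var 10) (.const 1))) (assign 11 (.add (var 11) (var 11)))

/-- The time for `measure`. -/
def measureTime (D : ℕ) : ℕ := 20 + (D * 20 + 20)

/-- Doubling stops at the least power of two that is at least `m + 1`. There must be more than `m`
leaves, as the positions `1, …, m` serve as leaf indices. -/
theorem halts_measure (h : s.nat 0 0 = 2 * m) :
    Halts measure s (measureTime (Nat.clog 2 (m + 1))) fun s' => s'.nat 10 0 = m ∧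
      s'.nat 11 0 = 2 ^ Nat.clog 2 (m + 1) := by
  set D := Nat.clog 2 (m + 1) with hD
  refine Halts.seq (R := fun s' => s'.nat 10 0 = m ∧ s'.nat 11 0 = 1) ((Halts.of_wp _ _ _ ?_).mono
    (by simp [bound, NatExpr.cost]) fun _ h => h) ?_
  · rintro s₁ e₁ s₂ e₂
    simp [e₁, e₂, NatExpr.eval, h]
  rintro s₁ ⟨h10, h11⟩
  refine (Halts.loop (T := 12) (I := fun r s' => s'.nat 10 0 = m ∧ ∃ j, j + r = D ∧
    s'.nat 11 0 = 2 ^ j) ?_ D s₁ ⟨h10, 0, by omega, by simp [h11]⟩).mono ?_ ?_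
  · rintro r s₂ ⟨f10, j, hj, f11⟩ hb
    simp only [Test.Holds, NatExpr.eval, f10, f11] at hb
    have hjD : j < D := by
      by_contra hc
      have h1 := Nat.le_pow_clog (b := 2) (by norm_num) (m + 1)
      rw [← hD] at h1
      have := Nat.pow_le_pow_right (n := 2) (by norm_num) (not_lt.1 hc)
      omega
    refine ⟨r - 1, by omega, (Halts.of_wp _ _ _ ?_).mono (by simp [bound, NatExpr.cost])
      fun _ h => h⟩
    rintro s₃ e₃
    refine ⟨by simp [e₃, f10], j + 1, by omega, ?_⟩
    simp [e₃, NatExpr.eval, f11, pow_succ, mul_two]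
  · simp only [Test.cost, NatExpr.cost]
    omega
  · rintro s₂ ⟨r, ⟨f10, j, hj, f11⟩, hb⟩
    simp only [Test.Holds, NatExpr.eval, f10, f11, not_lt] at hb
    have := Nat.clog_le_of_le_pow hb
    obtain rfl : j = D := by omega
    exact ⟨f10, f11⟩

/-- Compute the positions of the vertical edges. -/
def positions : Program :=
  forLoop 12 10 (.writeNat 35 (.read 34 (var 12)) (.add (var 12) (.const 1)))

theorem halts_positions {κ : ℕ → ℝ ×ₗ ℝ} (h10 : s.nat 10 0 = m) (hV : IsSorting κ m (s.nat 34)) :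
    Halts positions s (forTime m 12) fun s' => ∀ i < m, s'.nat 35 (s.nat 34 i) = i + 1 := by
  refine (Halts.forLoop (m := m) (I := fun j s' => s'.nat 34 = s.nat 34 ∧
    ∀ i < j, s'.nat 35 (s.nat 34 i) = i + 1) (by norm_num) (by simp [WritesNat])
    (by simp [WritesNat]) h10 ⟨funext fun j => by simp, by simp⟩ ?_).mono le_rfl fun _ h => h.2
  rintro j s₁ hj h12 - ⟨h34, hI⟩
  refine (Halts.of_wp _ _ _ ?_).mono (by simp [bound, NatExpr.cost]) fun _ h => h
  rintro s₂ e₂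
  refine ⟨funext fun i => by simp [e₂, h34], fun i hi => ?_⟩
  rcases (Nat.lt_succ_iff.1 hi).lt_or_eq with h | h
  · have : s.nat 34 i ≠ s.nat 34 j := hV.ne i j h hj
    simp [e₂, NatExpr.eval, h12, h34, this, hI i h]
  · simp [e₂, NatExpr.eval, h12, h34, h]

/-- Before the first event no edge is active, so cleared memory is correct: every link is "none",
every count is even, and all lists and the tree are empty. -/
theorem EventInv.zero (hr : Ready X Y pos H V D s) (hz : ∀ a ∈ [1, 24, 25, 26, 27, 32, 36, 37],
    ∀ j, s.nat a j = 0) : EventInv X Y P e ρ vp pos H V D 0 s := by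
  classical
  simp only [List.forall_mem_cons] at hz
  obtain ⟨h1, h24, h25, h26, h27, h32, h36, h37, -⟩ := hz
  have act : ∀ u, ¬ Active ρ 0 u := fun u h => h (by simp)
  have actAt : ∀ q, ¬ ActAt ρ vp 0 q := fun q h => act _ h.2.2
  refine ⟨hr, ⟨?_, ?_, fun l h => absurd h (actAt l), fun l h => absurd h (actAt l)⟩,
    ⟨fun j _ _ _ => by simp [h32, winner], fun b _ h => absurd h (actAt b), fun b _ _ => h32 _⟩,
    ⟨?_, ?_⟩, ?_⟩
  · exact fun l _ => Or.inl ⟨h36 l, fun q _ => actAt q⟩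
  · intro l _
    simp [h37, activeCount, act]
  · rw [h24, h26, listed]
    simpa using PointInv.zero
  · rw [h25, h27, listed]
    simpa using PointInv.zero
  · rw [reported, h1]
    simpa using RectInv.zero

/-- Sort the horizontal and the vertical edges. -/
def sortEdges : Program := sort 33 30 (precedes height absc) ;; sort 34 31 (precedes absc height)

/-- The time for `sortEdges`. -/
def sortEdgesTime (m D : ℕ) : ℕ :=
  sortTime 30 (precedes height absc) m D + sortTime 31 (precedes absc height) m D

theorem writesNat_sort {out tr a : ℕ} {τ : Test} (h : a ≠ out) (h' : a ≠ tr)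
    (h'' : a ∉ [12, 13, 14, 15, 40, 41]) : ¬ (sort out tr τ).WritesNat a := by
  simp only [List.mem_cons, not_or] at h''
  simp [sort, forLoop, updateLeaf, climb, climbBody, WritesNat, h, h', h'']

theorem halts_sortEdges (h10 : s.nat 10 0 = m) (h11 : s.nat 11 0 = 2 ^ D) (hmD : m ≤ 2 ^ D)
    (hz : ∀ a ∈ [30, 31, 33, 34], ∀ j, s.nat a j = 0) :
    Halts sortEdges s (sortEdgesTime m D) fun s' =>
      IsSorting (fun a => toLex (s.real 1 (a + a), s.real 0 (a + a + 1))) m (s'.nat 33) ∧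
      IsSorting (fun a => toLex (s.real 0 (a + a + 1), s.real 1 (a + a))) m (s'.nat 34) ∧
      s'.real = s.real ∧ ∀ j, m ≤ j → s'.nat 34 j = 0 := by
  simp only [List.forall_mem_cons] at hz
  obtain ⟨z30, z31, z33, z34, -⟩ := hz
  refine Halts.seq (halts_sort (κ := fun a => toLex (s.real 1 (a + a), s.real 0 (a + a + 1)))
    (fun s' h => precedes_holds (f := fun a => s.real 1 (a + a))
      (f' := fun a => s.real 0 (a + a + 1)) (fun e => by simp [height, RealExpr.eval, NatExpr.eval, h])
      fun e => by simp [absc, RealExpr.eval, NatExpr.eval, h])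
    (by norm_num) (by norm_num) (by norm_num) h10 h11 hmD z30).frame ?_
  rintro s₁ ⟨⟨a1, a2, -⟩, f, -⟩
  have f' : ∀ a ∈ [10, 11, 31, 34], s₁.nat a = s.nat a := fun a ha => f a
    (writesNat_sort (by revert a; simp) (by revert a; simp) (by revert a; simp))
  simp only [List.forall_mem_cons] at f'
  obtain ⟨f10, f11, f31, f34, -⟩ := f'
  refine (halts_sort (κ := fun a => toLex (s.real 0 (a + a + 1), s.real 1 (a + a)))
    (fun s' h => precedes_holds (f := fun a => s.real 0 (a + a + 1))
      (f' := fun a => s.real 1 (a + a)) (fun e => by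
        simp [absc, RealExpr.eval, NatExpr.eval, h, a2])
      fun e => by simp [height, RealExpr.eval, NatExpr.eval, h, a2])
    (by norm_num) (by norm_num) (by norm_num) (by rw [f10, h10]) (by rw [f11, h11]) hmD
    (by rw [f31]; exact z31)).frame.mono le_rfl ?_
  rintro s₂ ⟨⟨b1, b2, b3⟩, g, -⟩
  refine ⟨?_, b1, b2.trans a2, fun j hj => ?_⟩
  · rw [g 33 (writesNat_sort (by norm_num) (by norm_num) (by simp))]
    exact a1
  · rw [b3 j hj, f34, z34]

/-- Prepare the sweep. -/
def prepare : Program := measure ;; sortEdges ;; positions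

/-- The time for preparing the sweep. -/
def prepareTime (m D : ℕ) : ℕ := measureTime D + (sortEdgesTime m D + forTime m 12)

theorem halts_prepare (hP : IsCyclicPolygon X Y P) (h0 : s.nat 0 0 = 2 * m)
    (hX : ∀ a < m, s.real 0 (a + a + 1) = X a) (hY : ∀ a < m, s.real 1 (a + a) = Y a)
    (hz : ∀ a, a ≠ 0 → ∀ j, s.nat a j = 0) (hD : D = Nat.clog 2 (m + 1)) :
    Halts prepare s (prepareTime m D) fun s' => ∃ e ρ vp pos H V,
      Setting X Y P e ρ vp pos H V D ∧ EventInv X Y P e ρ vp pos H V D 0 s' := by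
  subst hD
  have hmpos := NeZero.pos m
  have hlt : m < 2 ^ Nat.clog 2 (m + 1) := Nat.le_pow_clog (by norm_num) (m + 1)
  refine Halts.seq (halts_measure h0).frame ?_
  rintro s₁ ⟨⟨a10, a11⟩, f, fr⟩
  have f' : ∀ a, a ≠ 10 → a ≠ 11 → s₁.nat a = s.nat a := fun a h h' => f a (by
    simp [measure, WritesNat, h, h'])
  have fr' : s₁.real = s.real := funext fun a => fr a (by simp [measure, WritesReal])
  refine Halts.seq (halts_sortEdges a10 a11 hlt.le fun a ha j => by
    rw [f' a (by revert a; simp) (by revert a; simp), hz a (by revert a; simp)]).frame ?_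
  rintro s₂ ⟨⟨b1, b2, b3, b4⟩, g, -⟩
  rw [fr'] at b1 b2 b3
  have g' : ∀ a ∈ [1, 10, 11, 24, 25, 26, 27, 32, 36, 37], s₂.nat a = s₁.nat a := fun a ha =>
    g a (not_or.2 ⟨writesNat_sort (by revert a; simp) (by revert a; simp) (by revert a; simp),
      writesNat_sort (by revert a; simp) (by revert a; simp) (by revert a; simp)⟩)
  obtain ⟨ρ, pos, hsw⟩ := hP.exists_isSweep (fun a ha => by rw [hX a ha, hY a ha])
    (fun a ha => by rw [hX a ha, hY a ha]) b1 b2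
  -- The description of a report reads this array at arbitrary link values, so the bound is needed
  -- beyond `m` too, where the entries are still `0`.
  have V_lt : ∀ j, s₂.nat 34 j < m := fun j => by
    rcases lt_or_ge j m with h | h
    · exact b2.lt j h
    · rw [b4 j h]; exact hmpos
  refine (halts_positions (by rw [g' 10 (by simp), a10]) b2).frame.mono le_rfl ?_
  rintro s₃ ⟨c1, k, kr⟩
  have k' : ∀ a, a ≠ 12 → a ≠ 35 → s₃.nat a = s₂.nat a := fun a h h' => k a (by
    simp [positions, forLoop, WritesNat, h, h'])
  have kr' : s₃.real = s.real := (funext fun a => kr a (by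
    simp [positions, forLoop, WritesReal])).trans b3
  refine ⟨_, ρ, _, pos, s₂.nat 33, s₂.nat 34, ⟨hP, hsw, fun _ => rfl, b1.lt, fun _ => rfl, V_lt,
    hlt⟩, EventInv.zero ⟨?_, ?_, ?_, ?_, fun a ha => ?_, ?_, ?_⟩ fun a ha j => ?_⟩
  · rw [k' 10 (by norm_num) (by norm_num), g' 10 (by simp), a10]
  · rw [k' 11 (by norm_num) (by norm_num), g' 11 (by simp), a11]
  · exact k' 33 (by norm_num) (by norm_num)
  · exact k' 34 (by norm_num) (by norm_num)
  · have h1 := hsw.one_le_pos (a : ZMod m)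
    have h2 := hsw.pos_le (a : ZMod m)
    have h3 := congrArg ZMod.val (hsw.vp_pos (a : ZMod m))
    simp only [ZMod.val_cast_of_lt ha, ZMod.val_cast_of_lt (V_lt _)] at h3
    have := c1 (pos (a : ZMod m) - 1) (by omega)
    rw [h3] at this
    omega
  · rw [kr']; exact hX
  · rw [kr']; exact hY
  · rw [k' a (by revert a; simp) (by revert a; simp), g' a (by revert a; simp),
      f' a (by revert a; simp) (by revert a; simp), hz a (by revert a; simp)]

/-- Select the larger one of the two lists of points. -/
def select : Program :=
  .ite (.natLt (var 26) (var 27))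
    (forLoop 12 27 (.writeReal 6 (var 12) (.read 12 (var 12)) ;;
      .writeReal 7 (var 12) (.read 13 (var 12))) ;; .writeNat 1 (.const 1) (var 27))
    (.writeNat 1 (.const 1) (var 26))

/-- The time for `select`. -/
def selectTime (m : ℕ) : ℕ := 10 + (forTime m 20 + 10)

theorem halts_select (h27 : s.nat 27 0 ≤ m) : Halts select s (selectTime m) fun s' =>
    (s.nat 26 0 < s.nat 27 0 → outputPoints s' = listed (s.real 12) (s.real 13) (s.nat 27 0)) ∧
    (s.nat 27 0 ≤ s.nat 26 0 → outputPoints s' = listed (s.real 6) (s.real 7) (s.nat 26 0)) ∧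
    s'.nat 1 0 = s.nat 1 0 ∧ ∀ a ∈ [2, 3, 4, 5], s'.real a = s.real a := by
  have hmono : forTime (s.nat 27 0) 20 ≤ forTime m 20 := by
    unfold forTime
    gcongr
  refine (Halts.ite (T := forTime m 20 + 10) (fun hb => ?_) fun hb => ?_).mono (by
    simp only [selectTime, Test.cost, NatExpr.cost]; omega) fun _ h => h
  · simp only [Test.Holds, NatExpr.eval] at hb
    refine Halts.seq (R := fun s' => (∀ i < s.nat 27 0, s'.real 6 i = s.real 12 i ∧
      s'.real 7 i = s.real 13 i) ∧ s'.nat 27 = s.nat 27 ∧ s'.nat 1 = s.nat 1 ∧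
      ∀ a ∈ [2, 3, 4, 5], s'.real a = s.real a) ?_ ?_
    · refine (Halts.forLoop (m := s.nat 27 0) (T := 20) (I := fun j s' =>
        (∀ i < j, s'.real 6 i = s.real 12 i ∧ s'.real 7 i = s.real 13 i) ∧
        s'.real 12 = s.real 12 ∧ s'.real 13 = s.real 13)
        (by norm_num) (by simp [WritesNat]) (by simp [WritesNat]) rfl ⟨by simp, rfl, rfl⟩
        ?_).frame.mono hmono ?_
      · rintro j s₁ hj h12 - ⟨h1, h2, h3⟩
        refine (Halts.of_wp _ _ _ ?_).mono (by simp [bound, NatExpr.cost, RealExpr.cost])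
          fun _ h => h
        rintro s₂ e₂ s₃ e₃
        refine ⟨fun i hi => ?_, funext fun i => by simp [e₂, e₃, h2],
          funext fun i => by simp [e₂, e₃, h3]⟩
        rcases (Nat.lt_succ_iff.1 hi).lt_or_eq with h | h
        · simp [e₂, e₃, NatExpr.eval, h12, h.ne, h1 i h]
        · simp [e₂, e₃, NatExpr.eval, RealExpr.eval, h12, h, h2, h3]
      · rintro s₁ ⟨⟨h1, -⟩, f, fr⟩
        refine ⟨h1, f 27 (by simp [forLoop, WritesNat]), f 1 (by simp [forLoop, WritesNat]),
          fun a ha => fr a (by revert a; simp [forLoop, WritesReal])⟩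
    · rintro s₁ ⟨h1, f27, f1, fr⟩
      refine (Halts.of_wp _ _ _ ?_).mono (by simp [bound, NatExpr.cost]) fun _ h => h
      rintro s₂ e₂
      refine ⟨fun _ => ?_, fun h => absurd h (not_le.2 hb), by simp [e₂, NatExpr.eval, f1],
        fun a ha => by rw [e₂]; exact fr a ha⟩
      have hc : s₂.nat 1 1 = s.nat 27 0 := by simp [e₂, NatExpr.eval, f27]
      rw [outputPoints, hc, listed]
      refine image_congr fun i hi => ?_
      rw [e₂]
      simp [h1 i hi]
  · simp only [Test.Holds, NatExpr.eval] at hb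
    refine (Halts.of_wp _ _ _ ?_).mono (by simp only [bound, NatExpr.cost]; omega) fun _ h => h
    rintro s₂ e₂
    refine ⟨fun h => absurd h hb, fun _ => ?_, by simp [e₂, NatExpr.eval],
        fun a ha => by rw [e₂]; rfl⟩
    have hc : s₂.nat 1 1 = s.nat 26 0 := by simp [e₂, NatExpr.eval]
    rw [outputPoints, hc, listed, e₂]
    rfl

/-- The program that finds the convex cover and the hidden set. -/
def mainProgram : Program := prepare ;; forLoop 12 10 event ;; select

/-- The running time of the program. -/
def mainTime (m D : ℕ) : ℕ := prepareTime m D + (forTime m (eventTime D) + selectTime m)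

theorem not_writesNat_event {a : ℕ} (h : a = 10 ∨ a = 12) : ¬ event.WritesNat a := by
  rcases h with rfl | rfl <;>
  simp [event, load, loadEvent, predecessor, predecessorBody, loadActive, collect, resetTags,
    addPoints, addPoint, reports, report, advance, relink, reflag, toggleBoth, toggle, updateLeaf,
    climb, climbBody, WritesNat]

/-- After all events every edge has been processed, so the edge on the top side of any piece has
caused it to be listed. -/
theorem _root_.RectInv.image_eq (hs : IsSweep X Y e ρ vp pos) {Q : Set (ℝ × ℝ × ℝ × ℝ)}
    (h : RectInv X Y P ρ m Q) :
    (fun q : ℝ × ℝ × ℝ × ℝ => Icc q.1 q.2.1 ×ˢ Icc q.2.2.1 q.2.2.2) '' Q = pieces X Y P := by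
  ext K
  constructor
  · rintro ⟨q, hq, rfl⟩
    obtain ⟨l, r, b, t, hp, rfl⟩ := h.sound q hq
    exact ⟨l, r, b, t, hp, rfl⟩
  · rintro ⟨l, r, b, t, hp, rfl⟩
    obtain ⟨i, h1, h2⟩ := hp.top
    exact ⟨_, h.complete l r b t i hp (hs.ρ_lt i) h1 h2, rfl⟩

theorem _root_.PointInv.exists_final (hs : IsSweep X Y e ρ vp pos) {good : ZMod m → Prop} {tag cnt : ℕ}
    {S : Set Plane} (h : PointInv X Y P e ρ good m tag cnt S) : ∃ T : Set (ZMod m),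
      T ⊆ {k | good k} ∧ InjOn (hExtension X Y P) T ∧
      hExtension X Y P '' T = hExtension X Y P '' {k | good k} ∧ T.ncard = cnt ∧
      S = hMid X Y '' T := by
  obtain ⟨T, h1, h2, h3, h4, h5, -⟩ := h
  refine ⟨T, fun k hk => (h1 k hk).1, h2, subset_antisymm (image_mono fun k hk => (h1 k hk).1) ?_,
    h4, h5⟩
  rintro _ ⟨k, hk, rfl⟩
  obtain ⟨k', hk', he⟩ := h3 k hk (hs.ρ_lt k)
  exact ⟨k', hk', he⟩

theorem halts_mainProgram (hP : IsCyclicPolygon X Y P) (h0 : s.nat 0 0 = 2 * m)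
    (hX : ∀ a < m, s.real 0 (a + a + 1) = X a) (hY : ∀ a < m, s.real 1 (a + a) = Y a)
    (hz : ∀ a, a ≠ 0 → ∀ j, s.nat a j = 0) :
    Halts mainProgram s (mainTime m (Nat.clog 2 (m + 1))) fun s' =>
      outputRectangles s' = pieces X Y P ∧ IsHalfApproxHiddenSet P (outputPoints s') := by
  refine Halts.seq (halts_prepare hP h0 hX hY hz rfl) ?_
  rintro s₁ ⟨e, ρ, vp, pos, H, V, hS, hI⟩
  set D := Nat.clog 2 (m + 1) with hD
  refine Halts.seq (Halts.forLoop (m := m) (T := eventTime D)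
    (I := fun j => EventInv X Y P e ρ vp pos H V D j)
    (by norm_num) (not_writesNat_event (Or.inr rfl)) (not_writesNat_event (Or.inl rfl))
    hI.ready.size ?_ ?_) ?_
  · exact hI.congr (fun a ha => funext fun j => by
      have : a ≠ 12 := by revert a; simp
      simp [this]) rfl
  · rintro j s₂ hj h12 - h
    refine (halts_event hS hj h12 h).mono le_rfl fun s₃ h' => ?_
    exact h'.congr (fun a ha => funext fun j => by
      have : a ≠ 12 := by revert a; simp
      simp [this]) rfl
  rintro s₂ h
  obtain ⟨hT, hB⟩ := h.points
  obtain ⟨T, t1, t2, t3, t4, t5⟩ := PointInv.exists_final hS.sweep hT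
  obtain ⟨B, b1, b2, b3, b4, b5⟩ := PointInv.exists_final hS.sweep hB
  have hcard : s₂.nat 27 0 ≤ m := by
    rw [← b4]
    refine (ncard_le_card B).trans_eq ?_
    simp
  have happrox := hP.isHalfApproxHiddenSet t1 t2 t3 b1 b2 b3
  refine (halts_select hcard).mono le_rfl ?_
  rintro s₃ ⟨c1, c2, c3, c4⟩
  simp only [List.forall_mem_cons] at c4
  obtain ⟨k2, k3, k4, k5, -⟩ := c4
  constructor
  · rw [← h.rect.image_eq hS.sweep, outputRectangles, reported, image_image, c3, k2, k3, k4, k5]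
  · rcases lt_or_ge (s₂.nat 26 0) (s₂.nat 27 0) with hlt | hle
    · rw [c1 hlt, b5]
      exact happrox.2 (by omega)
    · rw [c2 hle, t5]
      exact happrox.1 (by omega)

end RealRAM

/-! ## The running time -/

namespace RealRAM

open Program

/-- The bound `O((m + 1) (D + 1))`. -/
def IsQuasilinear (f : ℕ → ℕ → ℕ) : Prop := ∃ C, ∀ m D, f m D ≤ C * ((m + 1) * (D + 1))

theorem IsQuasilinear.add {f g : ℕ → ℕ → ℕ} (hf : IsQuasilinear f) (hg : IsQuasilinear g) :
    IsQuasilinear fun m D => f m D + g m D := by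
  obtain ⟨C, hC⟩ := hf
  obtain ⟨C', hC'⟩ := hg
  exact ⟨C + C', fun m D => by rw [add_mul]; exact add_le_add (hC m D) (hC' m D)⟩

theorem IsQuasilinear.of_linear {g : ℕ → ℕ} (hg : ∃ C, ∀ D, g D ≤ C * (D + 1)) :
    IsQuasilinear fun _ D => g D := by
  obtain ⟨C, hC⟩ := hg
  refine ⟨C, fun m D => (hC D).trans (Nat.mul_le_mul_left _ ?_)⟩
  exact Nat.le_mul_of_pos_left _ (Nat.succ_pos m)

theorem IsQuasilinear.forTime {g : ℕ → ℕ} (hg : ∃ C, ∀ D, g D ≤ C * (D + 1)) :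
    IsQuasilinear fun m D => forTime m (g D) := by
  obtain ⟨C, hC⟩ := hg
  refine ⟨C + 30, fun m D => ?_⟩
  have h1 := Nat.mul_le_mul_left m (hC D)
  have h2 : (C + 30) * ((m + 1) * (D + 1)) =
      m * (C * (D + 1)) + C * (D + 1) + 30 * (m * D) + 30 * m + 30 * D + 30 := by ring
  have h3 : RealRAM.forTime m (g D) = m * g D + 12 * m + 9 := by unfold RealRAM.forTime; ring
  have h4 := Nat.zero_le (C * (D + 1))
  change RealRAM.forTime m (g D) ≤ _
  rw [h2, h3]
  omega

theorem linear_const (c : ℕ) : ∃ C, ∀ D : ℕ, c ≤ C * (D + 1) :=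
  ⟨c, fun D => Nat.le_mul_of_pos_right _ (Nat.succ_pos D)⟩

theorem linear_add {f g : ℕ → ℕ} (hf : ∃ C, ∀ D, f D ≤ C * (D + 1))
    (hg : ∃ C, ∀ D, g D ≤ C * (D + 1)) : ∃ C, ∀ D, f D + g D ≤ C * (D + 1) := by
  obtain ⟨C, hC⟩ := hf
  obtain ⟨C', hC'⟩ := hg
  exact ⟨C + C', fun D => by rw [add_mul]; exact add_le_add (hC D) (hC' D)⟩

theorem linear_mul (c : ℕ) : ∃ C, ∀ D : ℕ, D * c ≤ C * (D + 1) :=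
  ⟨c, fun D => by rw [mul_comm]; exact Nat.mul_le_mul_left _ (Nat.le_succ D)⟩

theorem linear_updateTime (tr : ℕ) (τ : Test) : ∃ C, ∀ D, updateTime tr τ D ≤ C * (D + 1) :=
  linear_add (linear_const _) (linear_add (linear_mul _) (linear_const _))

theorem isQuasilinear_sortTime (tr : ℕ) (τ : Test) : IsQuasilinear (sortTime tr τ) :=
  (IsQuasilinear.forTime (linear_add (linear_const _) (linear_updateTime tr τ))).add
    (IsQuasilinear.forTime (linear_add (linear_const _) (linear_updateTime tr τ)))

theorem linear_eventTime : ∃ C, ∀ D, eventTime D ≤ C * (D + 1) := by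
  have ht := linear_add (linear_const 40) (linear_updateTime 32 larger)
  have hl := linear_add (linear_const loadEvent.bound) (linear_add (linear_add (linear_const 12)
    (linear_add (linear_mul (predecessorBody.bound + 5)) (linear_const 5)))
    (linear_const loadActive.bound))
  exact linear_add hl (linear_add (linear_const _) (linear_add (linear_const _)
    (linear_add (linear_const _) (linear_add ht ht))))

theorem isQuasilinear_mainTime : IsQuasilinear mainTime := by
  have h1 : IsQuasilinear fun _ D => measureTime D :=
    .of_linear (linear_add (linear_const _) (linear_add (linear_mul _) (linear_const _)))
  have h2 : IsQuasilinear fun m D => sortEdgesTime m D :=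
    (isQuasilinear_sortTime _ _).add (isQuasilinear_sortTime _ _)
  have h3 : IsQuasilinear fun m _ => selectTime m :=
    .add (.of_linear (linear_const 10)) (.add (.forTime (linear_const 20))
      (.of_linear (linear_const 10)))
  have h4 : IsQuasilinear prepareTime := h1.add (h2.add (.forTime (linear_const 12)))
  exact h4.add (.add (.forTime linear_eventTime) h3)

/-- The depth is `d + 1` with `2 ^ d ≤ 2 * m`, so `d / 2` is at most `log (2 * m)`. As `m ≥ 2`, this
logarithm also exceeds `1`, which absorbs the additive constant. -/
theorem le_mul_log {m : ℕ} (hm : 2 ≤ m) :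
    (((m + 1) * (Nat.clog 2 (m + 1) + 1) : ℕ) : ℝ) ≤
      4 * (((2 * m : ℕ) : ℝ) * Real.log ((2 * m : ℕ) : ℝ)) := by
  have hlog2 : (1 / 2 : ℝ) < Real.log 2 := by linarith [Real.log_two_gt_d9]
  have hpos : 0 < Nat.clog 2 (m + 1) := Nat.clog_pos (by norm_num) (by omega)
  have hlt : 2 ^ (Nat.clog 2 (m + 1)).pred < m + 1 :=
    Nat.pow_pred_clog_lt_self (by norm_num) (by omega)
  obtain ⟨d, hd⟩ : ∃ d, Nat.clog 2 (m + 1) = d + 1 := ⟨_, (Nat.succ_pred_eq_of_pos hpos).symm⟩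
  rw [hd, Nat.pred_succ] at hlt
  have h1 : (d : ℝ) * Real.log 2 ≤ Real.log ((2 * m : ℕ) : ℝ) := by
    rw [← Real.log_pow]
    refine Real.log_le_log (by positivity) ?_
    exact_mod_cast (by omega : 2 ^ d ≤ 2 * m)
  have h2 : 2 * Real.log 2 ≤ Real.log ((2 * m : ℕ) : ℝ) := by
    have : (2 : ℝ) * Real.log 2 = Real.log (2 ^ 2) := by rw [Real.log_pow]; norm_num
    rw [this]
    refine Real.log_le_log (by positivity) ?_
    exact_mod_cast (by omega : 2 ^ 2 ≤ 2 * m)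
  have h3 : ((d + 2 : ℕ) : ℝ) ≤ 4 * Real.log ((2 * m : ℕ) : ℝ) := by
    push_cast at h1 h2 ⊢
    have : (d : ℝ) * (1 / 2) ≤ d * Real.log 2 :=
      mul_le_mul_of_nonneg_left hlog2.le (Nat.cast_nonneg d)
    linarith
  have h4 : ((m + 1 : ℕ) : ℝ) ≤ ((2 * m : ℕ) : ℝ) := by exact_mod_cast (by omega : m + 1 ≤ 2 * m)
  rw [hd, Nat.cast_mul]
  calc ((m + 1 : ℕ) : ℝ) * ((d + 1 + 1 : ℕ) : ℝ)
      ≤ ((2 * m : ℕ) : ℝ) * (4 * Real.log ((2 * m : ℕ) : ℝ)) :=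
        mul_le_mul h4 h3 (Nat.cast_nonneg _) (Nat.cast_nonneg _)
    _ = _ := by ring

end RealRAM

theorem mainTheorem10 :
    -- one real RAM program finds both objects in time `O(n log n)`
    (∃ (prog : RealRAM.Program) (c : ℝ),
      ∀ (n : ℕ) (v : Polygon Plane n) (P : Set Plane), IsSimpleOrthogonalPolygon v P →
        ∃ (t : ℕ) (s : RealRAM.Store),
          RealRAM.Runs prog (RealRAM.input v) t s ∧
          (t : ℝ) ≤ c * (n * Real.log n) ∧
          (∀ K ∈ RealRAM.outputRectangles s, IsAxisRectangle K) ∧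
          IsTwoApproxConvexCover P (RealRAM.outputRectangles s) ∧
          IsHalfApproxHiddenSet P (RealRAM.outputPoints s)) ∧
    -- the partition by horizontal edge extensions, and the hidden sets of edge midpoints
    (∀ (n : ℕ) (v : Polygon Plane n) (P : Set Plane), IsSimpleOrthogonalPolygon v P →
      IsRectanglePartition P (horizontalPieces v P) ∧
      (horizontalPieces v P).encard + 1 ≤ noncollinearCount v P {i | IsHorizontalEdge v i} ∧
      (horizontalPieces v P).encard + 1 ≤
        noncollinearCount v P {i | IsTopEdge v P i} +
          noncollinearCount v P {i | IsBottomEdge v P i} ∧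
      (horizontalPieces v P).encard + 1 ≤ 2 * hiddenSetNumber P ∧
      (∀ T : Set (Fin n), (∀ i ∈ T, IsTopEdge v P i) → InjOn (edgeExtension v P) T →
        IsHiddenSet P (edgeMidpoint v '' T)) ∧
      (∀ B : Set (Fin n), (∀ i ∈ B, IsBottomEdge v P i) → InjOn (edgeExtension v P) B →
        IsHiddenSet P (edgeMidpoint v '' B))) := by
  have form : ∀ (n : ℕ) (v : Polygon Plane n) (P : Set Plane), IsSimpleOrthogonalPolygon v P →
      ∃ (m : ℕ) (_ : NeZero m) (X Y : ZMod m → ℝ) (σ : ZMod m → Fin n), n = 2 * m ∧ 2 ≤ m ∧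
        (∀ (a : ℕ) (h : 2 * a + 1 < n), X (a : ZMod m) = (v ⟨2 * a + 1, h⟩).1 ∧
          Y (a : ZMod m) = (v ⟨2 * a, by omega⟩).2) ∧ IsCyclicForm v X Y σ ∧
        IsCyclicPolygon X Y P := by
    intro n v P hv
    obtain ⟨m, X, Y, σ, h1, h2, h3, h4⟩ := hv.exists_cyclicForm
    exact ⟨m, ⟨by omega⟩, X, Y, σ, h1, h2, h3, h4, h4.isCyclicPolygon h2 hv⟩
  constructor
  · obtain ⟨C, hC⟩ := RealRAM.isQuasilinear_mainTime
    -- The factor `4` converts the bound in terms of the tree depth into one with `n * log n`.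
    refine ⟨RealRAM.mainProgram, C * 4, fun n v P hv => ?_⟩
    obtain ⟨m, _, X, Y, σ, rfl, hm, hXY, -, hP⟩ := form n v P hv
    obtain ⟨t, s, hrun, ht, hrect, hpts⟩ := RealRAM.halts_mainProgram (s := RealRAM.input v) hP
      (by simp [RealRAM.input])
      (fun a ha => by
        have h : a + a + 1 < 2 * m := by omega
        simp only [RealRAM.input, dif_pos h, if_true]
        rw [(hXY a (by omega)).1]
        congr 3
        omega)
      (fun a ha => by
        have h : a + a < 2 * m := by omega
        simp only [RealRAM.input, dif_pos h, one_ne_zero, if_true, if_false]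
        rw [(hXY a (by omega)).2]
        congr 3
        omega)
      (fun a ha j => by simp [RealRAM.input, ha])
    refine ⟨t, s, hrun, ?_, ?_, ?_, hpts⟩
    · have h1 : (t : ℝ) ≤ C * (((m + 1) * (Nat.clog 2 (m + 1) + 1) : ℕ) : ℝ) := by
        exact_mod_cast ht.trans (hC _ _)
      rw [mul_assoc]
      exact h1.trans (mul_le_mul_of_nonneg_left (RealRAM.le_mul_log hm) (Nat.cast_nonneg C))
    · rw [hrect]
      exact hP.isRectanglePartition_pieces.1
    · rw [hrect]
      exact hP.isTwoApproxConvexCover_pieces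
  · intro n v P hv
    obtain ⟨m, _, X, Y, σ, -, -, -, hf, hP⟩ := form n v P hv
    exact hf.partition_bounds hP
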